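/- **The system.** NM-DEKL$^3_\infty$ is a dependent type theory with three layers. *Universes*: computational universes $\mathsf{Uc}_i : \mathsf{Uc}_{i+1}$, knowledge universes $\mathsf{Type}_{\ell,i} : \mathsf{Type}_{\ell,i+1}$ ($i \in \mathbb N$), and $\mathsf{Prop} : \mathsf{Type}_{\ell,0}$ with $\mathsf{Prop} \subseteq \mathsf{Type}_{\ell,0}$. Contexts are lists of computational variables $x : A$ ($A : \mathsf{Uc}_i$), propositional variables $X : \mathsf{Prop}$ and assumptions $h : P$ ($P : \mathsf{Prop}$). The judgements are $\vdash \Gamma$, $\Gamma \vdash t : A$, $\Gamma \vdash t \equiv t' : A$ and the corresponding ones for substitutions $\Delta \vdash \sigma : \Gamma$, with the usual rules of substitution, equivalence, congruence and conversion. * *Computational layer* (in each $\mathsf{Uc}_i$): $\Pi$, $\Sigma$ with $\beta\eta$; identity types with $\mathsf{refl}$ and $J$; basic types $\mathsf{State}, \mathsf{Event}, \mathsf{Nat} : \mathsf{Uc}_0$ and $\mathsf{Step}(s,e,s') : \mathsf{Uc}_0$; finite traces $\mathsf{FinTrace} : \mathsf{Uc}_0$ with $\mathsf{nil}(s)$ and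 $\mathsf{step}(\tau,e,s)$; infinite traces $\mathsf{InfTrace} : \mathsf{Uc}_0$ with $\mathsf{head}(\pi) : \mathsf{State}$, $\mathsf{tail}(\pi) : \mathsf{Event} \times \mathsf{InfTrace}$ and guarded corecursion; trace extensions $\mathsf{Ext}_f(\tau,\tau') : \mathsf{Uc}_0$ with identities and composition satisfying the laws of a category. * *Knowledge layer*: $K_f(\tau), K_\infty(\pi) : \mathsf{Type}_{\ell,0}$ and $\mathsf{restrict}_\varepsilon : K_f(\tau') \to K_f(\tau)$ for $\varepsilon : \mathsf{Ext}_f(\tau,\tau')$, functorial in $\varepsilon$. * *Propositional layer*: $\top, \bot, \wedge, \vee, \to$, and $\forall, \exists$ over computational types, with the rules of intuitionistic logic and proof irrelevance; $\mu X.\varphi$ and $\nu X.\varphi$ for $\Gamma, X : \mathsf{Prop} \vdash \varphi : \mathsf{Prop}$ that is monotone (from $X \to Y$ one derives $\varphi(X) \to \varphi(Y)$), with fold/unfold and out/in. The system is *consistent* if there is no closed derivation $\vdash p : \bot$. **Models.** A model is a category with families that interprets all of this, strictly compatibly with substitution: it has a terminal object (the empty context), types and terms over each object with substitution, a type for each universe,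 the type of each element of a universe (depending only on that element), comprehension for the three kinds of context entries, $\Pi$-, $\Sigma$- and identity types, the basic types, traces and trace extensions, $K_f$, $K_\infty$ and restriction, a proof-irrelevant fibre of propositions with the operations of intuitionistic first-order logic, and fixed points of monotone formulas. In a model $\mathcal M$, $\llbracket\bot\rrbracket_{\mathcal M}$ is *uninhabited* if the type $\llbracket\bot\rrbracket_{\mathcal M}$ over the terminal object has no term (no global section). The *syntactic model* $\mathcal S$ consists of contexts, substitutions, types and terms modulo derivable equality. A model is a *model in sets* if contexts are sets, types over $\Gamma$ are interpreted as families of sets indexed by $\Gamma$, terms are exactly the sections of these families, context extension is the total space, propositions over $\Gamma$ correspond naturally to subsets of $\Gamma$ (that is, to maps $\Gamma \to \Omega$), a proposition being inhabited exactly over the points of its subset, and $\bot$ corresponds to $\varnothing$. (Nothing further is asked of the interpretation of the universes and the basic types.) **Theorem.** 1. If there is a model $\mathcal M$ (over any category) such that $\llbracket\bot\rrbracket_{\mathcal M}$ is uninhabited, then the system is consistent. 2. In particular, if $\llbracket\bot\rrbracket_{\mathcal S}$ is uninhabited in the syntactic model $\mathcal S$, then the system is consistent. 3. There is a model in sets,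 and in it $\llbracket\bot\rrbracket$ is uninhabited. 4. The system is consistent: there is no closed derivation $\vdash p : \bot$. 5. For every context $\Gamma$ of computational variables, if $\Gamma \vdash t : \bot$ for some $t$, then the system is inconsistent. -/

import Mathlib

open CategoryTheory

universe u v w

namespace NMDEKL

/-! ## Raw terms

De Bruijn terms with explicit substitutions.  `Tm.q` is the most recent variable, `Tm.sub t σ` is
`t[σ]`, `Sb.p` is the projection that forgets the most recent variable and `Sb.ext σ t` is the
substitution `⟨σ, t⟩`.  Types are terms of the universes `uc i`, `tyL i` and `prop`. -/

mutual

/-- Raw terms (including types, propositions and proofs). -/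
inductive Tm : Type
  | sub (t : Tm) (σ : Sb)
  | q
  -- universes of the three layers
  | uc (i : ℕ)
  | tyL (i : ℕ)
  | prop
  -- dependent products, dependent sums, identity types
  | pi (i : ℕ) (A B : Tm)
  | lam (i : ℕ) (A B t : Tm)
  | app (i : ℕ) (A B f a : Tm)
  | sig (i : ℕ) (A B : Tm)
  | pair (i : ℕ) (A B a b : Tm)
  | fst (i : ℕ) (A B c : Tm)
  | snd (i : ℕ) (A B c : Tm)
  | idt (i : ℕ) (A a b : Tm)
  | refl (i : ℕ) (A a : Tm)
  | J (i j : ℕ) (A C d a b r : Tm)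
  -- states, events, numbers, transitions, finite and infinite traces, trace extensions
  | state
  | event
  | nat
  | trans (s e s' : Tm)
  | fin
  | nil (s : Tm)
  | step (τ e s : Tm)
  | inf
  | head (π : Tm)
  | tail (π : Tm)
  | corec (i : ℕ) (X h e n x : Tm)
  | extn (τ τ' : Tm)
  | idE (τ : Tm)
  | compE (τ τ' τ'' ε₁ ε₂ : Tm)
  -- knowledge fibres
  | K (τ : Tm)
  | Kinf (π : Tm)
  | restrict (τ τ' ε k : Tm)
  -- propositions
  | top
  | bot
  | and (P Q : Tm)
  | or (P Q : Tm)
  | imp (P Q : Tm)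
  | all (i : ℕ) (A P : Tm)
  | ex (i : ℕ) (A P : Tm)
  | mu (φ : Tm)
  | nu (φ : Tm)
  -- proofs
  | topI
  | botE (P r : Tm)
  | andI (P Q r s : Tm)
  | andE₁ (P Q r : Tm)
  | andE₂ (P Q r : Tm)
  | orI₁ (P Q r : Tm)
  | orI₂ (P Q r : Tm)
  | orE (P Q R r s t : Tm)
  | impI (P Q r : Tm)
  | impE (P Q r s : Tm)
  | allI (i : ℕ) (A P r : Tm)
  | allE (i : ℕ) (A P r a : Tm)
  | exI (i : ℕ) (A P a r : Tm)
  | exE (i : ℕ) (A P R r s : Tm)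
  | fold (φ : Tm)
  | unfold (φ : Tm)
  | out (φ : Tm)
  | into (φ : Tm)

/-- Raw substitutions; `comp σ δ` acts by `t[comp σ δ] = t[σ][δ]`. -/
inductive Sb : Type
  | id
  | comp (σ δ : Sb)
  | p
  | ext (σ : Sb) (t : Tm)
  | bang

end

/-- Raw contexts; the head of the list is the type of the most recent variable. -/
abbrev Ctx := List Tm

/-- The universes of the three layers. -/
inductive Srt : Type
  | uc (i : ℕ)
  | tyL (i : ℕ)
  | prop

/-- The universe as a term. -/
def Srt.tm : Srt → Tm
  | uc i => .uc i
  | tyL i => .tyL i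
  | prop => .prop

/-- The universe that a universe belongs to. -/
def Srt.next : Srt → Srt
  | uc i => uc (i + 1)
  | tyL i => tyL (i + 1)
  | prop => tyL 0

/-- `⟨σ ∘ p, q⟩`: the substitution `σ` under a binder. -/
def Sb.lift (σ : Sb) : Sb := .ext (.comp σ .p) .q

/-- `⟨id, a⟩`: so `t[inst a]` is `t[a/x]` for the most recent variable `x`. -/
def Sb.inst (a : Tm) : Sb := .ext .id a

/-- Weakening by one variable. -/
def Tm.wk (t : Tm) : Tm := .sub t .p

/-- Given a context `Γ` and `Γ ⊢ A`, the identity type of the two variables in `Γ, x : A, y : A`. -/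
def Tm.idVars (A : Tm) (i : ℕ) : Tm := .idt i A.wk.wk Tm.q.wk .q

/-- `⟨⟨⟨id, a⟩, b⟩, r⟩`: instantiation of the three variables of a motive of `J`. -/
def Sb.inst₃ (a b r : Tm) : Sb := .ext (.ext (.ext .id a) b) r

/-- `⟨⟨⟨p, x⟩, x⟩, refl x⟩`: from `Γ, x : A` to `Γ, x : A, y : A, r : Id x y`. -/
def Sb.diag (A : Tm) (i : ℕ) : Sb := .ext (.ext (.ext .p .q) .q) (.refl i A.wk .q)

/-- One step of pushing a substitution through a term former. -/
def Tm.push : Tm → Sb → Tm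
  | .sub t δ, σ => .sub t (.comp δ σ)
  | .uc i, _ => .uc i
  | .tyL i, _ => .tyL i
  | .prop, _ => .prop
  | .pi i A B, σ => .pi i (.sub A σ) (.sub B σ.lift)
  | .lam i A B t, σ => .lam i (.sub A σ) (.sub B σ.lift) (.sub t σ.lift)
  | .app i A B f a, σ => .app i (.sub A σ) (.sub B σ.lift) (.sub f σ) (.sub a σ)
  | .sig i A B, σ => .sig i (.sub A σ) (.sub B σ.lift)
  | .pair i A B a b, σ => .pair i (.sub A σ) (.sub B σ.lift) (.sub a σ) (.sub b σ)
  | .fst i A B c, σ => .fst i (.sub A σ) (.sub B σ.lift) (.sub c σ)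
  | .snd i A B c, σ => .snd i (.sub A σ) (.sub B σ.lift) (.sub c σ)
  | .idt i A a b, σ => .idt i (.sub A σ) (.sub a σ) (.sub b σ)
  | .refl i A a, σ => .refl i (.sub A σ) (.sub a σ)
  | .J i j A C d a b r, σ =>
      .J i j (.sub A σ) (.sub C σ.lift.lift.lift) (.sub d σ.lift) (.sub a σ) (.sub b σ) (.sub r σ)
  | .state, _ => .state
  | .event, _ => .event
  | .nat, _ => .nat
  | .trans s e s', σ => .trans (.sub s σ) (.sub e σ) (.sub s' σ)
  | .fin, _ => .fin
  | .nil s, σ => .nil (.sub s σ)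
  | .step τ e s, σ => .step (.sub τ σ) (.sub e σ) (.sub s σ)
  | .inf, _ => .inf
  | .head π, σ => .head (.sub π σ)
  | .tail π, σ => .tail (.sub π σ)
  | .corec i X h e n x, σ =>
      .corec i (.sub X σ) (.sub h σ.lift) (.sub e σ.lift) (.sub n σ.lift) (.sub x σ)
  | .extn τ τ', σ => .extn (.sub τ σ) (.sub τ' σ)
  | .idE τ, σ => .idE (.sub τ σ)
  | .compE τ τ' τ'' ε₁ ε₂, σ =>
      .compE (.sub τ σ) (.sub τ' σ) (.sub τ'' σ) (.sub ε₁ σ) (.sub ε₂ σ)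
  | .K τ, σ => .K (.sub τ σ)
  | .Kinf π, σ => .Kinf (.sub π σ)
  | .restrict τ τ' ε k, σ => .restrict (.sub τ σ) (.sub τ' σ) (.sub ε σ) (.sub k σ)
  | .top, _ => .top
  | .bot, _ => .bot
  | .and P Q, σ => .and (.sub P σ) (.sub Q σ)
  | .or P Q, σ => .or (.sub P σ) (.sub Q σ)
  | .imp P Q, σ => .imp (.sub P σ) (.sub Q σ)
  | .all i A P, σ => .all i (.sub A σ) (.sub P σ.lift)
  | .ex i A P, σ => .ex i (.sub A σ) (.sub P σ.lift)
  | .mu φ, σ => .mu (.sub φ σ.lift)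
  | .nu φ, σ => .nu (.sub φ σ.lift)
  -- variables and proofs: nothing to push (any two proofs of a proposition are equal)
  | t, σ => .sub t σ

/-! ## Derivations -/

/-- The judgement forms. -/
inductive Judg : Type
  /-- `⊢ Γ ctx` -/
  | ctx (Γ : Ctx)
  /-- `Γ ⊢ t : A` (with `A` a universe: `t` is a type of that layer) -/
  | tm (Γ : Ctx) (t A : Tm)
  /-- `Γ ⊢ t ≡ t' : A` -/
  | eq (Γ : Ctx) (t t' A : Tm)
  /-- `Δ ⊢ σ : Γ` -/
  | sb (Δ : Ctx) (σ : Sb) (Γ : Ctx)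
  /-- `Δ ⊢ σ ≡ σ' : Γ` -/
  | sbEq (Δ : Ctx) (σ σ' : Sb) (Γ : Ctx)

/-- The context `Γ, X : Prop, Y : Prop, h : X → Y`. -/
def monoCtx (Γ : Ctx) : Ctx := .imp Tm.q.wk .q :: .prop :: .prop :: Γ

/-- In `monoCtx Γ`: the implication `φ(X) → φ(Y)`, for `Γ, X : Prop ⊢ φ`. -/
def monoGoal (φ : Tm) : Tm :=
  .imp (.sub φ (.ext (.comp .p (.comp .p .p)) Tm.q.wk.wk))
    (.sub φ (.ext (.comp .p (.comp .p .p)) Tm.q.wk))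

/-- Derivability of judgements. -/
inductive Der : Judg → Prop
  -- contexts: computational variables, propositional variables and assumptions
  | ctx_nil : Der (.ctx [])
  | ctx_comp {Γ A i} : Der (.ctx Γ) → Der (.tm Γ A (.uc i)) → Der (.ctx (A :: Γ))
  | ctx_pvar {Γ} : Der (.ctx Γ) → Der (.ctx (.prop :: Γ))
  | ctx_hyp {Γ P} : Der (.ctx Γ) → Der (.tm Γ P .prop) → Der (.ctx (P :: Γ))
  -- substitutions
  | sb_id {Γ} : Der (.ctx Γ) → Der (.sb Γ .id Γ)
  | sb_comp {Γ Δ Θ σ δ} : Der (.sb Δ σ Γ) → Der (.sb Θ δ Δ) → Der (.sb Θ (.comp σ δ) Γ)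
  | sb_p {Γ A} : Der (.ctx (A :: Γ)) → Der (.sb (A :: Γ) .p Γ)
  | sb_ext {Γ Δ σ A t} : Der (.sb Δ σ Γ) → Der (.ctx (A :: Γ)) → Der (.tm Δ t (.sub A σ)) →
      Der (.sb Δ (.ext σ t) (A :: Γ))
  | sb_bang {Γ} : Der (.ctx Γ) → Der (.sb Γ .bang [])
  -- equality of substitutions
  | sbEq_refl {Γ Δ σ} : Der (.sb Δ σ Γ) → Der (.sbEq Δ σ σ Γ)
  | sbEq_symm {Γ Δ σ σ'} : Der (.sbEq Δ σ σ' Γ) → Der (.sbEq Δ σ' σ Γ)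
  | sbEq_trans {Γ Δ σ σ' σ''} : Der (.sbEq Δ σ σ' Γ) → Der (.sbEq Δ σ' σ'' Γ) →
      Der (.sbEq Δ σ σ'' Γ)
  | sbEq_comp {Γ Δ Θ σ σ' δ δ'} : Der (.sbEq Δ σ σ' Γ) → Der (.sbEq Θ δ δ' Δ) →
      Der (.sbEq Θ (.comp σ δ) (.comp σ' δ') Γ)
  | sbEq_ext {Γ Δ σ σ' A t t'} : Der (.sbEq Δ σ σ' Γ) → Der (.ctx (A :: Γ)) →
      Der (.eq Δ t t' (.sub A σ)) → Der (.sbEq Δ (.ext σ t) (.ext σ' t') (A :: Γ))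
  | sbEq_id_comp {Γ Δ σ} : Der (.sb Δ σ Γ) → Der (.sbEq Δ (.comp .id σ) σ Γ)
  | sbEq_comp_id {Γ Δ σ} : Der (.sb Δ σ Γ) → Der (.sbEq Δ (.comp σ .id) σ Γ)
  | sbEq_assoc {Γ Δ Θ Ξ σ δ γ} : Der (.sb Δ σ Γ) → Der (.sb Θ δ Δ) → Der (.sb Ξ γ Θ) →
      Der (.sbEq Ξ (.comp (.comp σ δ) γ) (.comp σ (.comp δ γ)) Γ)
  | sbEq_bang {Δ σ} : Der (.sb Δ σ []) → Der (.sbEq Δ σ .bang [])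
  | sbEq_p {Γ Δ σ A t} : Der (.sb Δ σ Γ) → Der (.ctx (A :: Γ)) → Der (.tm Δ t (.sub A σ)) →
      Der (.sbEq Δ (.comp .p (.ext σ t)) σ Γ)
  | sbEq_eta {Γ Δ σ A} : Der (.ctx (A :: Γ)) → Der (.sb Δ σ (A :: Γ)) →
      Der (.sbEq Δ (.ext (.comp .p σ) (.sub .q σ)) σ (A :: Γ))
  -- variables, substitution and conversion
  | q {Γ A} : Der (.ctx (A :: Γ)) → Der (.tm (A :: Γ) .q A.wk)
  | sub {Γ Δ σ t A} : Der (.tm Γ t A) → Der (.sb Δ σ Γ) → Der (.tm Δ (.sub t σ) (.sub A σ))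
  | conv {Γ t A B} {s : Srt} : Der (.tm Γ t A) → Der (.eq Γ A B s.tm) → Der (.tm Γ t B)
  -- equality of terms: equivalence, conversion, substitution
  | eq_refl {Γ t A} : Der (.tm Γ t A) → Der (.eq Γ t t A)
  | eq_symm {Γ t t' A} : Der (.eq Γ t t' A) → Der (.eq Γ t' t A)
  | eq_trans {Γ t t' t'' A} : Der (.eq Γ t t' A) → Der (.eq Γ t' t'' A) → Der (.eq Γ t t'' A)
  | eq_conv {Γ t t' A B} {s : Srt} : Der (.eq Γ t t' A) → Der (.eq Γ A B s.tm) →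
      Der (.eq Γ t t' B)
  | eq_sub {Γ Δ σ σ' t t' A} : Der (.eq Γ t t' A) → Der (.sbEq Δ σ σ' Γ) →
      Der (.eq Δ (.sub t σ) (.sub t' σ') (.sub A σ))
  | eq_sub_id {Γ t A} : Der (.tm Γ t A) → Der (.eq Γ (.sub t .id) t A)
  | eq_q {Γ Δ σ A t} : Der (.sb Δ σ Γ) → Der (.ctx (A :: Γ)) → Der (.tm Δ t (.sub A σ)) →
      Der (.eq Δ (.sub .q (.ext σ t)) t (.sub A σ))
  | eq_sort {Γ Δ σ} {s : Srt} : Der (.sb Δ σ Γ) → Der (.eq Δ (.sub s.tm σ) s.tm s.next.tm)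
  | eq_push {Γ Δ σ t A} : Der (.tm Γ t A) → Der (.sb Δ σ Γ) →
      Der (.eq Δ (.sub t σ) (t.push σ) (.sub A σ))
  -- universes
  | uc {Γ i} : Der (.ctx Γ) → Der (.tm Γ (.uc i) (.uc (i + 1)))
  | tyL {Γ i} : Der (.ctx Γ) → Der (.tm Γ (.tyL i) (.tyL (i + 1)))
  | prop {Γ} : Der (.ctx Γ) → Der (.tm Γ .prop (.tyL 0))
  | incl {Γ P} : Der (.tm Γ P .prop) → Der (.tm Γ P (.tyL 0))
  | eq_incl {Γ P P'} : Der (.eq Γ P P' .prop) → Der (.eq Γ P P' (.tyL 0))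
  -- dependent products
  | pi {Γ A B i} : Der (.tm Γ A (.uc i)) → Der (.tm (A :: Γ) B (.uc i)) →
      Der (.tm Γ (.pi i A B) (.uc i))
  | lam {Γ A B t i} : Der (.tm Γ A (.uc i)) → Der (.tm (A :: Γ) B (.uc i)) →
      Der (.tm (A :: Γ) t B) → Der (.tm Γ (.lam i A B t) (.pi i A B))
  | app {Γ A B f a i} : Der (.tm Γ A (.uc i)) → Der (.tm (A :: Γ) B (.uc i)) →
      Der (.tm Γ f (.pi i A B)) → Der (.tm Γ a A) → Der (.tm Γ (.app i A B f a) (.sub B (.inst a)))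
  | eq_pi {Γ A A' B B' i} : Der (.eq Γ A A' (.uc i)) → Der (.eq (A :: Γ) B B' (.uc i)) →
      Der (.eq Γ (.pi i A B) (.pi i A' B') (.uc i))
  | eq_lam {Γ A A' B B' t t' i} : Der (.eq Γ A A' (.uc i)) → Der (.eq (A :: Γ) B B' (.uc i)) →
      Der (.eq (A :: Γ) t t' B) → Der (.eq Γ (.lam i A B t) (.lam i A' B' t') (.pi i A B))
  | eq_app {Γ A A' B B' f f' a a' i} : Der (.eq Γ A A' (.uc i)) →
      Der (.eq (A :: Γ) B B' (.uc i)) → Der (.eq Γ f f' (.pi i A B)) → Der (.eq Γ a a' A) →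
      Der (.eq Γ (.app i A B f a) (.app i A' B' f' a') (.sub B (.inst a)))
  | pi_beta {Γ A B t a i} : Der (.tm Γ A (.uc i)) → Der (.tm (A :: Γ) B (.uc i)) →
      Der (.tm (A :: Γ) t B) → Der (.tm Γ a A) →
      Der (.eq Γ (.app i A B (.lam i A B t) a) (.sub t (.inst a)) (.sub B (.inst a)))
  | pi_eta {Γ A B f i} : Der (.tm Γ A (.uc i)) → Der (.tm (A :: Γ) B (.uc i)) →
      Der (.tm Γ f (.pi i A B)) →
      Der (.eq Γ (.lam i A B (.app i A.wk (.sub B (Sb.lift .p)) f.wk .q)) f (.pi i A B))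
  -- dependent sums
  | sig {Γ A B i} : Der (.tm Γ A (.uc i)) → Der (.tm (A :: Γ) B (.uc i)) →
      Der (.tm Γ (.sig i A B) (.uc i))
  | pair {Γ A B a b i} : Der (.tm Γ A (.uc i)) → Der (.tm (A :: Γ) B (.uc i)) →
      Der (.tm Γ a A) → Der (.tm Γ b (.sub B (.inst a))) → Der (.tm Γ (.pair i A B a b) (.sig i A B))
  | fst {Γ A B c i} : Der (.tm Γ A (.uc i)) → Der (.tm (A :: Γ) B (.uc i)) →
      Der (.tm Γ c (.sig i A B)) → Der (.tm Γ (.fst i A B c) A)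
  | snd {Γ A B c i} : Der (.tm Γ A (.uc i)) → Der (.tm (A :: Γ) B (.uc i)) →
      Der (.tm Γ c (.sig i A B)) → Der (.tm Γ (.snd i A B c) (.sub B (.inst (.fst i A B c))))
  | eq_sig {Γ A A' B B' i} : Der (.eq Γ A A' (.uc i)) → Der (.eq (A :: Γ) B B' (.uc i)) →
      Der (.eq Γ (.sig i A B) (.sig i A' B') (.uc i))
  | eq_pair {Γ A A' B B' a a' b b' i} : Der (.eq Γ A A' (.uc i)) →
      Der (.eq (A :: Γ) B B' (.uc i)) → Der (.eq Γ a a' A) →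
      Der (.eq Γ b b' (.sub B (.inst a))) →
      Der (.eq Γ (.pair i A B a b) (.pair i A' B' a' b') (.sig i A B))
  | eq_fst {Γ A A' B B' c c' i} : Der (.eq Γ A A' (.uc i)) → Der (.eq (A :: Γ) B B' (.uc i)) →
      Der (.eq Γ c c' (.sig i A B)) → Der (.eq Γ (.fst i A B c) (.fst i A' B' c') A)
  | eq_snd {Γ A A' B B' c c' i} : Der (.eq Γ A A' (.uc i)) → Der (.eq (A :: Γ) B B' (.uc i)) →
      Der (.eq Γ c c' (.sig i A B)) →
      Der (.eq Γ (.snd i A B c) (.snd i A' B' c') (.sub B (.inst (.fst i A B c))))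
  | fst_beta {Γ A B a b i} : Der (.tm Γ A (.uc i)) → Der (.tm (A :: Γ) B (.uc i)) →
      Der (.tm Γ a A) → Der (.tm Γ b (.sub B (.inst a))) →
      Der (.eq Γ (.fst i A B (.pair i A B a b)) a A)
  | snd_beta {Γ A B a b i} : Der (.tm Γ A (.uc i)) → Der (.tm (A :: Γ) B (.uc i)) →
      Der (.tm Γ a A) → Der (.tm Γ b (.sub B (.inst a))) →
      Der (.eq Γ (.snd i A B (.pair i A B a b)) b (.sub B (.inst a)))
  | sig_eta {Γ A B c i} : Der (.tm Γ A (.uc i)) → Der (.tm (A :: Γ) B (.uc i)) →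
      Der (.tm Γ c (.sig i A B)) → Der (.eq Γ (.pair i A B (.fst i A B c) (.snd i A B c)) c (.sig i A B))
  -- identity types
  | idt {Γ A a b i} : Der (.tm Γ A (.uc i)) → Der (.tm Γ a A) → Der (.tm Γ b A) →
      Der (.tm Γ (.idt i A a b) (.uc i))
  | refl {Γ A a i} : Der (.tm Γ A (.uc i)) → Der (.tm Γ a A) →
      Der (.tm Γ (.refl i A a) (.idt i A a a))
  | J {Γ A C d a b r i j} : Der (.tm Γ A (.uc i)) →
      Der (.tm (A.idVars i :: A.wk :: A :: Γ) C (.uc j)) →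
      Der (.tm (A :: Γ) d (.sub C (.diag A i))) →
      Der (.tm Γ a A) → Der (.tm Γ b A) → Der (.tm Γ r (.idt i A a b)) →
      Der (.tm Γ (.J i j A C d a b r) (.sub C (.inst₃ a b r)))
  | eq_idt {Γ A A' a a' b b' i} : Der (.eq Γ A A' (.uc i)) → Der (.eq Γ a a' A) →
      Der (.eq Γ b b' A) → Der (.eq Γ (.idt i A a b) (.idt i A' a' b') (.uc i))
  | eq_refl_tm {Γ A A' a a' i} : Der (.eq Γ A A' (.uc i)) → Der (.eq Γ a a' A) →
      Der (.eq Γ (.refl i A a) (.refl i A' a') (.idt i A a a))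
  | eq_J {Γ A A' C C' d d' a a' b b' r r' i j} : Der (.eq Γ A A' (.uc i)) →
      Der (.eq (A.idVars i :: A.wk :: A :: Γ) C C' (.uc j)) →
      Der (.eq (A :: Γ) d d' (.sub C (.diag A i))) →
      Der (.eq Γ a a' A) → Der (.eq Γ b b' A) → Der (.eq Γ r r' (.idt i A a b)) →
      Der (.eq Γ (.J i j A C d a b r) (.J i j A' C' d' a' b' r') (.sub C (.inst₃ a b r)))
  | J_beta {Γ A C d a i j} : Der (.tm Γ A (.uc i)) →
      Der (.tm (A.idVars i :: A.wk :: A :: Γ) C (.uc j)) →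
      Der (.tm (A :: Γ) d (.sub C (.diag A i))) → Der (.tm Γ a A) →
      Der (.eq Γ (.J i j A C d a a (.refl i A a)) (.sub d (.inst a)) (.sub C (.inst₃ a a (.refl i A a))))
  -- basic types and transitions
  | state {Γ} : Der (.ctx Γ) → Der (.tm Γ .state (.uc 0))
  | event {Γ} : Der (.ctx Γ) → Der (.tm Γ .event (.uc 0))
  | nat {Γ} : Der (.ctx Γ) → Der (.tm Γ .nat (.uc 0))
  | trans {Γ s e s'} : Der (.tm Γ s .state) → Der (.tm Γ e .event) → Der (.tm Γ s' .state) →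
      Der (.tm Γ (.trans s e s') (.uc 0))
  | eq_trans_tm {Γ s₁ s₂ e₁ e₂ s₁' s₂'} : Der (.eq Γ s₁ s₂ .state) → Der (.eq Γ e₁ e₂ .event) →
      Der (.eq Γ s₁' s₂' .state) → Der (.eq Γ (.trans s₁ e₁ s₁') (.trans s₂ e₂ s₂') (.uc 0))
  -- finite traces
  | fin {Γ} : Der (.ctx Γ) → Der (.tm Γ .fin (.uc 0))
  | nil {Γ s} : Der (.tm Γ s .state) → Der (.tm Γ (.nil s) .fin)
  | step {Γ τ e s} : Der (.tm Γ τ .fin) → Der (.tm Γ e .event) → Der (.tm Γ s .state) →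
      Der (.tm Γ (.step τ e s) .fin)
  | eq_nil {Γ s s'} : Der (.eq Γ s s' .state) → Der (.eq Γ (.nil s) (.nil s') .fin)
  | eq_step {Γ τ τ' e e' s s'} : Der (.eq Γ τ τ' .fin) → Der (.eq Γ e e' .event) →
      Der (.eq Γ s s' .state) → Der (.eq Γ (.step τ e s) (.step τ' e' s') .fin)
  -- infinite traces: observations and guarded corecursion
  | inf {Γ} : Der (.ctx Γ) → Der (.tm Γ .inf (.uc 0))
  | head {Γ π} : Der (.tm Γ π .inf) → Der (.tm Γ (.head π) .state)
  | tail {Γ π} : Der (.tm Γ π .inf) → Der (.tm Γ (.tail π) (.sig 0 .event .inf))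
  | corec {Γ X h e n x i} : Der (.tm Γ X (.uc i)) → Der (.tm (X :: Γ) h .state) →
      Der (.tm (X :: Γ) e .event) → Der (.tm (X :: Γ) n X.wk) → Der (.tm Γ x X) →
      Der (.tm Γ (.corec i X h e n x) .inf)
  | eq_head {Γ π π'} : Der (.eq Γ π π' .inf) → Der (.eq Γ (.head π) (.head π') .state)
  | eq_tail {Γ π π'} : Der (.eq Γ π π' .inf) →
      Der (.eq Γ (.tail π) (.tail π') (.sig 0 .event .inf))
  | eq_corec {Γ X X' h h' e e' n n' x x' i} : Der (.eq Γ X X' (.uc i)) →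
      Der (.eq (X :: Γ) h h' .state) → Der (.eq (X :: Γ) e e' .event) →
      Der (.eq (X :: Γ) n n' X.wk) → Der (.eq Γ x x' X) →
      Der (.eq Γ (.corec i X h e n x) (.corec i X' h' e' n' x') .inf)
  | head_corec {Γ X h e n x i} : Der (.tm Γ X (.uc i)) → Der (.tm (X :: Γ) h .state) →
      Der (.tm (X :: Γ) e .event) → Der (.tm (X :: Γ) n X.wk) → Der (.tm Γ x X) →
      Der (.eq Γ (.head (.corec i X h e n x)) (.sub h (.inst x)) .state)
  | tail_corec {Γ X h e n x i} : Der (.tm Γ X (.uc i)) → Der (.tm (X :: Γ) h .state) →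
      Der (.tm (X :: Γ) e .event) → Der (.tm (X :: Γ) n X.wk) → Der (.tm Γ x X) →
      Der (.eq Γ (.tail (.corec i X h e n x))
        (.pair 0 .event .inf (.sub e (.inst x)) (.corec i X h e n (.sub n (.inst x))))
        (.sig 0 .event .inf))
  -- trace extensions: identities and composition `ε₂ ∘ ε₁`, with the laws of a category
  | extn {Γ τ τ'} : Der (.tm Γ τ .fin) → Der (.tm Γ τ' .fin) → Der (.tm Γ (.extn τ τ') (.uc 0))
  | idE {Γ τ} : Der (.tm Γ τ .fin) → Der (.tm Γ (.idE τ) (.extn τ τ))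
  | compE {Γ τ τ' τ'' ε₁ ε₂} : Der (.tm Γ τ .fin) → Der (.tm Γ τ' .fin) → Der (.tm Γ τ'' .fin) →
      Der (.tm Γ ε₁ (.extn τ τ')) → Der (.tm Γ ε₂ (.extn τ' τ'')) →
      Der (.tm Γ (.compE τ τ' τ'' ε₁ ε₂) (.extn τ τ''))
  | eq_extn {Γ τ₁ τ₂ τ₁' τ₂'} : Der (.eq Γ τ₁ τ₂ .fin) → Der (.eq Γ τ₁' τ₂' .fin) →
      Der (.eq Γ (.extn τ₁ τ₁') (.extn τ₂ τ₂') (.uc 0))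
  | eq_idE {Γ τ τ'} : Der (.eq Γ τ τ' .fin) → Der (.eq Γ (.idE τ) (.idE τ') (.extn τ τ))
  | eq_compE {Γ τ₁ τ₂ τ₁' τ₂' τ₁'' τ₂'' ε₁ ε₂ δ₁ δ₂} : Der (.eq Γ τ₁ τ₂ .fin) →
      Der (.eq Γ τ₁' τ₂' .fin) → Der (.eq Γ τ₁'' τ₂'' .fin) →
      Der (.eq Γ ε₁ ε₂ (.extn τ₁ τ₁')) → Der (.eq Γ δ₁ δ₂ (.extn τ₁' τ₁'')) →
      Der (.eq Γ (.compE τ₁ τ₁' τ₁'' ε₁ δ₁) (.compE τ₂ τ₂' τ₂'' ε₂ δ₂) (.extn τ₁ τ₁''))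
  | compE_id_left {Γ τ τ' ε} : Der (.tm Γ τ .fin) → Der (.tm Γ τ' .fin) →
      Der (.tm Γ ε (.extn τ τ')) → Der (.eq Γ (.compE τ τ τ' (.idE τ) ε) ε (.extn τ τ'))
  | compE_id_right {Γ τ τ' ε} : Der (.tm Γ τ .fin) → Der (.tm Γ τ' .fin) →
      Der (.tm Γ ε (.extn τ τ')) → Der (.eq Γ (.compE τ τ' τ' ε (.idE τ')) ε (.extn τ τ'))
  | compE_assoc {Γ τ₀ τ₁ τ₂ τ₃ ε₁ ε₂ ε₃} : Der (.tm Γ τ₀ .fin) → Der (.tm Γ τ₁ .fin) →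
      Der (.tm Γ τ₂ .fin) → Der (.tm Γ τ₃ .fin) → Der (.tm Γ ε₁ (.extn τ₀ τ₁)) →
      Der (.tm Γ ε₂ (.extn τ₁ τ₂)) → Der (.tm Γ ε₃ (.extn τ₂ τ₃)) →
      Der (.eq Γ (.compE τ₀ τ₂ τ₃ (.compE τ₀ τ₁ τ₂ ε₁ ε₂) ε₃)
        (.compE τ₀ τ₁ τ₃ ε₁ (.compE τ₁ τ₂ τ₃ ε₂ ε₃)) (.extn τ₀ τ₃))
  -- knowledge fibres and restriction
  | K {Γ τ} : Der (.tm Γ τ .fin) → Der (.tm Γ (.K τ) (.tyL 0))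
  | Kinf {Γ π} : Der (.tm Γ π .inf) → Der (.tm Γ (.Kinf π) (.tyL 0))
  | restrict {Γ τ τ' ε k} : Der (.tm Γ τ .fin) → Der (.tm Γ τ' .fin) →
      Der (.tm Γ ε (.extn τ τ')) → Der (.tm Γ k (.K τ')) →
      Der (.tm Γ (.restrict τ τ' ε k) (.K τ))
  | eq_K {Γ τ τ'} : Der (.eq Γ τ τ' .fin) → Der (.eq Γ (.K τ) (.K τ') (.tyL 0))
  | eq_Kinf {Γ π π'} : Der (.eq Γ π π' .inf) → Der (.eq Γ (.Kinf π) (.Kinf π') (.tyL 0))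
  | eq_restrict {Γ τ₁ τ₂ τ₁' τ₂' ε₁ ε₂ k₁ k₂} : Der (.eq Γ τ₁ τ₂ .fin) →
      Der (.eq Γ τ₁' τ₂' .fin) → Der (.eq Γ ε₁ ε₂ (.extn τ₁ τ₁')) →
      Der (.eq Γ k₁ k₂ (.K τ₁')) →
      Der (.eq Γ (.restrict τ₁ τ₁' ε₁ k₁) (.restrict τ₂ τ₂' ε₂ k₂) (.K τ₁))
  | restrict_id {Γ τ k} : Der (.tm Γ τ .fin) → Der (.tm Γ k (.K τ)) →
      Der (.eq Γ (.restrict τ τ (.idE τ) k) k (.K τ))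
  | restrict_comp {Γ τ τ' τ'' ε₁ ε₂ k} : Der (.tm Γ τ .fin) → Der (.tm Γ τ' .fin) →
      Der (.tm Γ τ'' .fin) → Der (.tm Γ ε₁ (.extn τ τ')) → Der (.tm Γ ε₂ (.extn τ' τ'')) →
      Der (.tm Γ k (.K τ'')) →
      Der (.eq Γ (.restrict τ τ' ε₁ (.restrict τ' τ'' ε₂ k))
        (.restrict τ τ'' (.compE τ τ' τ'' ε₁ ε₂) k) (.K τ))
  -- propositions
  | top {Γ} : Der (.ctx Γ) → Der (.tm Γ .top .prop)
  | bot {Γ} : Der (.ctx Γ) → Der (.tm Γ .bot .prop)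
  | and {Γ P Q} : Der (.tm Γ P .prop) → Der (.tm Γ Q .prop) → Der (.tm Γ (.and P Q) .prop)
  | or {Γ P Q} : Der (.tm Γ P .prop) → Der (.tm Γ Q .prop) → Der (.tm Γ (.or P Q) .prop)
  | imp {Γ P Q} : Der (.tm Γ P .prop) → Der (.tm Γ Q .prop) → Der (.tm Γ (.imp P Q) .prop)
  | all {Γ A P i} : Der (.tm Γ A (.uc i)) → Der (.tm (A :: Γ) P .prop) →
      Der (.tm Γ (.all i A P) .prop)
  | ex {Γ A P i} : Der (.tm Γ A (.uc i)) → Der (.tm (A :: Γ) P .prop) →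
      Der (.tm Γ (.ex i A P) .prop)
  -- fixed points of monotone formulas, monotonicity being a derivable `φ(X) → φ(Y)`
  | mu {Γ φ m} : Der (.ctx Γ) → Der (.tm (.prop :: Γ) φ .prop) →
      Der (.tm (monoCtx Γ) m (monoGoal φ)) → Der (.tm Γ (.mu φ) .prop)
  | nu {Γ φ m} : Der (.ctx Γ) → Der (.tm (.prop :: Γ) φ .prop) →
      Der (.tm (monoCtx Γ) m (monoGoal φ)) → Der (.tm Γ (.nu φ) .prop)
  | eq_and {Γ P P' Q Q'} : Der (.eq Γ P P' .prop) → Der (.eq Γ Q Q' .prop) →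
      Der (.eq Γ (.and P Q) (.and P' Q') .prop)
  | eq_or {Γ P P' Q Q'} : Der (.eq Γ P P' .prop) → Der (.eq Γ Q Q' .prop) →
      Der (.eq Γ (.or P Q) (.or P' Q') .prop)
  | eq_imp {Γ P P' Q Q'} : Der (.eq Γ P P' .prop) → Der (.eq Γ Q Q' .prop) →
      Der (.eq Γ (.imp P Q) (.imp P' Q') .prop)
  | eq_all {Γ A A' P P' i} : Der (.eq Γ A A' (.uc i)) → Der (.eq (A :: Γ) P P' .prop) →
      Der (.eq Γ (.all i A P) (.all i A' P') .prop)
  | eq_ex {Γ A A' P P' i} : Der (.eq Γ A A' (.uc i)) → Der (.eq (A :: Γ) P P' .prop) →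
      Der (.eq Γ (.ex i A P) (.ex i A' P') .prop)
  | eq_mu {Γ φ φ' m} : Der (.eq (.prop :: Γ) φ φ' .prop) →
      Der (.tm (monoCtx Γ) m (monoGoal φ)) → Der (.eq Γ (.mu φ) (.mu φ') .prop)
  | eq_nu {Γ φ φ' m} : Der (.eq (.prop :: Γ) φ φ' .prop) →
      Der (.tm (monoCtx Γ) m (monoGoal φ)) → Der (.eq Γ (.nu φ) (.nu φ') .prop)
  -- proofs: irrelevance and the rules of intuitionistic logic
  | irrel {Γ P r s} : Der (.tm Γ P .prop) → Der (.tm Γ r P) → Der (.tm Γ s P) →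
      Der (.eq Γ r s P)
  | topI {Γ} : Der (.ctx Γ) → Der (.tm Γ .topI .top)
  | botE {Γ P r} : Der (.tm Γ P .prop) → Der (.tm Γ r .bot) → Der (.tm Γ (.botE P r) P)
  | andI {Γ P Q r s} : Der (.tm Γ P .prop) → Der (.tm Γ Q .prop) → Der (.tm Γ r P) →
      Der (.tm Γ s Q) → Der (.tm Γ (.andI P Q r s) (.and P Q))
  | andE₁ {Γ P Q r} : Der (.tm Γ P .prop) → Der (.tm Γ Q .prop) → Der (.tm Γ r (.and P Q)) →
      Der (.tm Γ (.andE₁ P Q r) P)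
  | andE₂ {Γ P Q r} : Der (.tm Γ P .prop) → Der (.tm Γ Q .prop) → Der (.tm Γ r (.and P Q)) →
      Der (.tm Γ (.andE₂ P Q r) Q)
  | orI₁ {Γ P Q r} : Der (.tm Γ P .prop) → Der (.tm Γ Q .prop) → Der (.tm Γ r P) →
      Der (.tm Γ (.orI₁ P Q r) (.or P Q))
  | orI₂ {Γ P Q r} : Der (.tm Γ P .prop) → Der (.tm Γ Q .prop) → Der (.tm Γ r Q) →
      Der (.tm Γ (.orI₂ P Q r) (.or P Q))
  | orE {Γ P Q R r s t} : Der (.tm Γ P .prop) → Der (.tm Γ Q .prop) → Der (.tm Γ R .prop) →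
      Der (.tm Γ r (.or P Q)) → Der (.tm (P :: Γ) s R.wk) → Der (.tm (Q :: Γ) t R.wk) →
      Der (.tm Γ (.orE P Q R r s t) R)
  | impI {Γ P Q r} : Der (.tm Γ P .prop) → Der (.tm Γ Q .prop) → Der (.tm (P :: Γ) r Q.wk) →
      Der (.tm Γ (.impI P Q r) (.imp P Q))
  | impE {Γ P Q r s} : Der (.tm Γ P .prop) → Der (.tm Γ Q .prop) → Der (.tm Γ r (.imp P Q)) →
      Der (.tm Γ s P) → Der (.tm Γ (.impE P Q r s) Q)
  | allI {Γ A P r i} : Der (.tm Γ A (.uc i)) → Der (.tm (A :: Γ) P .prop) →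
      Der (.tm (A :: Γ) r P) → Der (.tm Γ (.allI i A P r) (.all i A P))
  | allE {Γ A P r a i} : Der (.tm Γ A (.uc i)) → Der (.tm (A :: Γ) P .prop) →
      Der (.tm Γ r (.all i A P)) → Der (.tm Γ a A) → Der (.tm Γ (.allE i A P r a) (.sub P (.inst a)))
  | exI {Γ A P a r i} : Der (.tm Γ A (.uc i)) → Der (.tm (A :: Γ) P .prop) →
      Der (.tm Γ a A) → Der (.tm Γ r (.sub P (.inst a))) → Der (.tm Γ (.exI i A P a r) (.ex i A P))
  | exE {Γ A P R r s i} : Der (.tm Γ A (.uc i)) → Der (.tm (A :: Γ) P .prop) →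
      Der (.tm Γ R .prop) → Der (.tm Γ r (.ex i A P)) → Der (.tm (P :: A :: Γ) s R.wk.wk) →
      Der (.tm Γ (.exE i A P R r s) R)
  | fold {Γ φ m} : Der (.ctx Γ) → Der (.tm (.prop :: Γ) φ .prop) →
      Der (.tm (monoCtx Γ) m (monoGoal φ)) →
      Der (.tm Γ (.fold φ) (.imp (.sub φ (.inst (.mu φ))) (.mu φ)))
  | unfold {Γ φ m} : Der (.ctx Γ) → Der (.tm (.prop :: Γ) φ .prop) →
      Der (.tm (monoCtx Γ) m (monoGoal φ)) →
      Der (.tm Γ (.unfold φ) (.imp (.mu φ) (.sub φ (.inst (.mu φ)))))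
  | out {Γ φ m} : Der (.ctx Γ) → Der (.tm (.prop :: Γ) φ .prop) →
      Der (.tm (monoCtx Γ) m (monoGoal φ)) →
      Der (.tm Γ (.out φ) (.imp (.nu φ) (.sub φ (.inst (.nu φ)))))
  | into {Γ φ m} : Der (.ctx Γ) → Der (.tm (.prop :: Γ) φ .prop) →
      Der (.tm (monoCtx Γ) m (monoGoal φ)) →
      Der (.tm Γ (.into φ) (.imp (.sub φ (.inst (.nu φ))) (.nu φ)))

/-- Consistency: no closed derivation of `⊥`. -/
def Consistent : Prop := ¬ ∃ r : Tm, Der (.tm [] r .bot)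

/-- Contexts all of whose variables are computational. -/
inductive CompCtx : Ctx → Prop
  | nil : CompCtx []
  | cons {Γ A i} : CompCtx Γ → Der (.tm Γ A (.uc i)) → CompCtx (A :: Γ)


/-! ## Models

A model is a category with families (presented through the total families of types and of terms)
with universes for the three layers, and with the structure of each layer.  All equations between
terms are equations in the total family `Tm Γ`. -/

/-- A category with families, without comprehension, with a type `sort s Γ` for each universe. -/
structure CwF (C : Type u) [Category.{v} C] where
  one : C
  bang (Γ : C) : Γ ⟶ one
  bang_uniq {Γ : C} (σ : Γ ⟶ one) : σ = bang Γ
  Ty : C → Type w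
  Tm : C → Type w
  typ {Γ : C} : Tm Γ → Ty Γ
  subTy {Γ Δ : C} (σ : Δ ⟶ Γ) : Ty Γ → Ty Δ
  subTm {Γ Δ : C} (σ : Δ ⟶ Γ) : Tm Γ → Tm Δ
  subTy_id {Γ : C} (A : Ty Γ) : subTy (𝟙 Γ) A = A
  subTy_comp {Γ Δ Θ : C} (σ : Δ ⟶ Γ) (δ : Θ ⟶ Δ) (A : Ty Γ) :
    subTy (δ ≫ σ) A = subTy δ (subTy σ A)
  subTm_id {Γ : C} (t : Tm Γ) : subTm (𝟙 Γ) t = t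
  subTm_comp {Γ Δ Θ : C} (σ : Δ ⟶ Γ) (δ : Θ ⟶ Δ) (t : Tm Γ) :
    subTm (δ ≫ σ) t = subTm δ (subTm σ t)
  typ_sub {Γ Δ : C} (σ : Δ ⟶ Γ) (t : Tm Γ) : typ (subTm σ t) = subTy σ (typ t)
  sort (s : Srt) (Γ : C) : Ty Γ
  sort_sub {Γ Δ : C} (s : Srt) (σ : Δ ⟶ Γ) : subTy σ (sort s Γ) = sort s Δ

namespace CwF

variable {C : Type u} [Category.{v} C] (M : CwF.{u, v, w} C)

/-- The terms of type `A`. -/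
@[ext]
structure Elt (Γ : C) (A : M.Ty Γ) : Type w where
  tm : M.Tm Γ
  ty : M.typ tm = A

/-- The elements of a universe. -/
abbrev Code (s : Srt) (Γ : C) : Type w := M.Elt Γ (M.sort s Γ)

variable {M}

/-- Substitution in an element of a universe. -/
def Code.sub {s : Srt} {Γ Δ : C} (a : M.Code s Γ) (σ : Δ ⟶ Γ) : M.Code s Δ :=
  ⟨M.subTm σ a.tm, by rw [M.typ_sub, a.ty, M.sort_sub]⟩

theorem Code.sub_id {s : Srt} {Γ : C} (a : M.Code s Γ) : a.sub (𝟙 Γ) = a :=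
  Elt.ext (M.subTm_id _)

theorem Code.sub_comp {s : Srt} {Γ Δ Θ : C} (a : M.Code s Γ) (σ : Δ ⟶ Γ) (δ : Θ ⟶ Δ) :
    a.sub (δ ≫ σ) = (a.sub σ).sub δ :=
  Elt.ext (M.subTm_comp _ _ _)

end CwF

/-- Every element of a universe is a type, which does not depend on the universe; every universe is an element of the next one; and
propositions are elements of the lowest knowledge universe. -/
structure CwFU (C : Type u) [Category.{v} C] extends CwF.{u, v, w} C where
  El {s : Srt} {Γ : C} (a : toCwF.Code s Γ) : Ty Γ
  El_sub {s : Srt} {Γ Δ : C} (a : toCwF.Code s Γ) (σ : Δ ⟶ Γ) : El (a.sub σ) = subTy σ (El a)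
  El_congr {s s' : Srt} {Γ : C} (a : toCwF.Code s Γ) (b : toCwF.Code s' Γ) (h : a.tm = b.tm) :
    El a = El b
  univ (s : Srt) (Γ : C) : toCwF.Code s.next Γ
  univ_sub (s : Srt) {Γ Δ : C} (σ : Δ ⟶ Γ) : (univ s Γ).sub σ = univ s Δ
  El_univ (s : Srt) (Γ : C) : El (univ s Γ) = sort s Γ
  incl {Γ : C} (P : toCwF.Code .prop Γ) : toCwF.Code (.tyL 0) Γ
  incl_sub {Γ Δ : C} (P : toCwF.Code .prop Γ) (σ : Δ ⟶ Γ) : (incl P).sub σ = incl (P.sub σ)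
  El_incl {Γ : C} (P : toCwF.Code .prop Γ) : El (incl P) = El P

namespace CwFU

variable {C : Type u} [Category.{v} C] (M : CwFU.{u, v, w} C)

/-- The terms of the type with code `a`. -/
abbrev Val {s : Srt} {Γ : C} (a : M.Code s Γ) : Type w := M.Elt Γ (M.El a)

/-- What a context may be extended by: a computational type, a propositional variable, or an
assumption. -/
inductive Entry (Γ : C) : Type w
  | comp (i : ℕ) (a : M.Code (.uc i) Γ)
  | pvar
  | hyp (P : M.Code .prop Γ)

variable {M}

/-- Substitution in a term, up to an equation between codes. -/
def Val.sub {s : Srt} {Γ Δ : C} {a : M.Code s Γ} (t : M.Val a) (σ : Δ ⟶ Γ) {b : M.Code s Δ}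
    (h : a.sub σ = b := by rfl) : M.Val b :=
  ⟨M.subTm σ t.tm, by rw [M.typ_sub, t.ty, ← M.El_sub, h]⟩

/-- The type of a context entry. -/
@[reducible]
def Entry.ty {Γ : C} : M.Entry Γ → M.Ty Γ
  | comp _ a => M.El a
  | pvar => M.sort .prop Γ
  | hyp P => M.El P

/-- Substitution in a context entry. -/
@[reducible]
def Entry.sub {Γ Δ : C} (σ : Δ ⟶ Γ) : M.Entry Γ → M.Entry Δ
  | comp i a => comp i (a.sub σ)
  | pvar => pvar
  | hyp P => hyp (P.sub σ)

theorem Entry.ty_sub {Γ Δ : C} (σ : Δ ⟶ Γ) (e : M.Entry Γ) : (e.sub σ).ty = M.subTy σ e.ty := by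
  cases e
  · exact M.El_sub _ _
  · exact (M.sort_sub _ _).symm
  · exact M.El_sub _ _

end CwFU

/-- Comprehension. -/
structure CwFE (C : Type u) [Category.{v} C] extends CwFU.{u, v, w} C where
  ext (Γ : C) (e : toCwFU.Entry Γ) : C
  p {Γ : C} (e : toCwFU.Entry Γ) : ext Γ e ⟶ Γ
  q {Γ : C} (e : toCwFU.Entry Γ) : toCwF.Elt (ext Γ e) (subTy (p e) e.ty)
  pair {Γ Δ : C} (σ : Δ ⟶ Γ) (e : toCwFU.Entry Γ) (t : toCwF.Elt Δ (subTy σ e.ty)) : Δ ⟶ ext Γ e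
  pair_p {Γ Δ : C} (σ : Δ ⟶ Γ) (e : toCwFU.Entry Γ) (t : toCwF.Elt Δ (subTy σ e.ty)) :
    pair σ e t ≫ p e = σ
  pair_q {Γ Δ : C} (σ : Δ ⟶ Γ) (e : toCwFU.Entry Γ) (t : toCwF.Elt Δ (subTy σ e.ty)) :
    subTm (pair σ e t) (q e).tm = t.tm
  pair_uniq {Γ Δ : C} {e : toCwFU.Entry Γ} (σ τ : Δ ⟶ ext Γ e) (h : σ ≫ p e = τ ≫ p e)
    (h' : subTm σ (q e).tm = subTm τ (q e).tm) : σ = τ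

namespace CwFE

variable {C : Type u} [Category.{v} C] {M : CwFE.{u, v, w} C}

/-- `Γ, x : a`. -/
abbrev cons {i : ℕ} {Γ : C} (a : M.Code (.uc i) Γ) : C := M.ext Γ (.comp i a)

/-- The most recent variable of `Γ, x : a`. -/
def var {i : ℕ} {Γ : C} (a : M.Code (.uc i) Γ) : M.Val (a.sub (M.p (.comp i a))) :=
  ⟨(M.q (.comp i a)).tm, by rw [(M.q _).ty, M.El_sub]⟩

/-- `Γ, x : a`, instantiated at `x`. -/
def at1 {i : ℕ} {Γ : C} {a : M.Code (.uc i) Γ} (x : M.Val a) : Γ ⟶ cons a :=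
  M.pair (𝟙 Γ) (.comp i a) ⟨x.tm, by rw [x.ty, M.subTy_id]⟩

/-- The map `⟨σ, x⟩` into `Γ, x : a`. -/
def snoc {i : ℕ} {Γ Δ : C} (σ : Δ ⟶ Γ) (a : M.Code (.uc i) Γ) (x : M.Val (a.sub σ)) :
    Δ ⟶ cons a :=
  M.pair σ (.comp i a) ⟨x.tm, by rw [x.ty, M.El_sub]⟩

theorem snoc_p {i : ℕ} {Γ Δ : C} (σ : Δ ⟶ Γ) (a : M.Code (.uc i) Γ) (x : M.Val (a.sub σ)) :
    snoc σ a x ≫ M.p (.comp i a) = σ :=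
  M.pair_p _ _ _

theorem snoc_q {i : ℕ} {Γ Δ : C} (σ : Δ ⟶ Γ) (a : M.Code (.uc i) Γ) (x : M.Val (a.sub σ)) :
    M.subTm (snoc σ a x) (var a).tm = x.tm :=
  M.pair_q _ _ _

theorem wk_snoc {i : ℕ} {s : Srt} {Γ Δ : C} (σ : Δ ⟶ Γ) (a : M.Code (.uc i) Γ)
    (x : M.Val (a.sub σ)) (b : M.Code s Γ) :
    (b.sub (M.p (.comp i a))).sub (snoc σ a x) = b.sub σ := by
  rw [← CwF.Code.sub_comp, snoc_p]

/-- The substitution `σ` under a binder of a computational type. -/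
def up {i : ℕ} {Γ Δ : C} (σ : Δ ⟶ Γ) (a : M.Code (.uc i) Γ) {a' : M.Code (.uc i) Δ}
    (h : a.sub σ = a' := by rfl) : cons a' ⟶ cons a :=
  snoc (M.p _ ≫ σ) a ⟨(var a').tm, by rw [(var a').ty, CwF.Code.sub_comp, h]⟩

theorem at1_p {i : ℕ} {Γ : C} {a : M.Code (.uc i) Γ} (x : M.Val a) :
    at1 x ≫ M.p (.comp i a) = 𝟙 Γ :=
  M.pair_p _ _ _

theorem at1_q {i : ℕ} {Γ : C} {a : M.Code (.uc i) Γ} (x : M.Val a) :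
    M.subTm (at1 x) (var a).tm = x.tm :=
  M.pair_q _ _ _

theorem up_p {i : ℕ} {Γ Δ : C} (σ : Δ ⟶ Γ) (a : M.Code (.uc i) Γ) {a' : M.Code (.uc i) Δ}
    (h : a.sub σ = a') : up σ a h ≫ M.p (.comp i a) = M.p (.comp i a') ≫ σ :=
  M.pair_p _ _ _

theorem up_q {i : ℕ} {Γ Δ : C} (σ : Δ ⟶ Γ) (a : M.Code (.uc i) Γ) {a' : M.Code (.uc i) Δ}
    (h : a.sub σ = a') : M.subTm (up σ a h) (var a).tm = (var a').tm :=
  M.pair_q _ _ _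

theorem at1_up {i : ℕ} {Γ Δ : C} (σ : Δ ⟶ Γ) {a : M.Code (.uc i) Γ} (x : M.Val a) :
    at1 (x.sub σ) ≫ up σ a = σ ≫ at1 x := by
  apply M.pair_uniq
  · rw [Category.assoc, Category.assoc, up_p, at1_p, ← Category.assoc, at1_p, Category.comp_id,
      Category.id_comp]
  · rw [M.subTm_comp, M.subTm_comp]
    change M.subTm _ (M.subTm _ (var a).tm) = M.subTm _ (M.subTm _ (var a).tm)
    rw [up_q, at1_q, at1_q]; rfl

theorem sub_at1 {i : ℕ} {s : Srt} {Γ Δ : C} (σ : Δ ⟶ Γ) {a : M.Code (.uc i) Γ} (x : M.Val a)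
    (b : M.Code s (cons a)) :
    (b.sub (at1 x)).sub σ = (b.sub (up σ a)).sub (at1 (x.sub σ)) := by
  rw [← CwF.Code.sub_comp, ← CwF.Code.sub_comp, at1_up]

theorem wk_at1 {i : ℕ} {s : Srt} {Γ : C} {a : M.Code (.uc i) Γ} (x : M.Val a) (b : M.Code s Γ) :
    (b.sub (M.p (.comp i a))).sub (at1 x) = b := by
  rw [← CwF.Code.sub_comp, at1_p, CwF.Code.sub_id]

theorem wk_up {i : ℕ} {s : Srt} {Γ Δ : C} (σ : Δ ⟶ Γ) (a : M.Code (.uc i) Γ) {a' : M.Code (.uc i) Δ}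
    (h : a.sub σ = a') (b : M.Code s Γ) :
    (b.sub (M.p (.comp i a))).sub (up σ a h) = (b.sub σ).sub (M.p (.comp i a')) := by
  rw [← CwF.Code.sub_comp, ← CwF.Code.sub_comp, up_p]

/-- `Γ, X : Prop`. -/
abbrev consProp (M : CwFE.{u, v, w} C) (Γ : C) : C := M.ext Γ .pvar

/-- The map `⟨σ, P⟩` into `Γ, X : Prop`. -/
def snocProp {Γ Δ : C} (σ : Δ ⟶ Γ) (P : M.Code .prop Δ) : Δ ⟶ M.consProp Γ :=
  M.pair σ .pvar ⟨P.tm, by rw [P.ty, M.sort_sub]⟩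

/-- The most recent variable of `Γ, X : Prop`. -/
def varProp (Γ : C) : M.Code .prop (M.consProp Γ) :=
  ⟨(M.q .pvar).tm, by rw [(M.q .pvar).ty, M.sort_sub]⟩

/-- The substitution `σ` under a binder of a propositional variable. -/
def upProp {Γ Δ : C} (σ : Δ ⟶ Γ) : M.consProp Δ ⟶ M.consProp Γ :=
  snocProp (M.p .pvar ≫ σ) (varProp Δ)

/-- The proposition `P` has a proof. -/
def Holds {Γ : C} (P : M.Code .prop Γ) : Prop := Nonempty (M.Val P)

/-- In the context `Γ, h : P` the proposition `Q` has a proof. -/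
def Entails {Γ : C} (P Q : M.Code .prop Γ) : Prop := Holds (Q.sub (M.p (.hyp P)))

end CwFE

/-- Dependent products, dependent sums and identity types in the computational universes. -/
structure CwFPi (C : Type u) [Category.{v} C] extends CwFE.{u, v, w} C where
  pi {i : ℕ} {Γ : C} (a : toCwFE.Code (.uc i) Γ) (b : toCwFE.Code (.uc i) (CwFE.cons a)) :
    toCwFE.Code (.uc i) Γ
  pi_sub {i : ℕ} {Γ Δ : C} (σ : Δ ⟶ Γ) (a : toCwFE.Code (.uc i) Γ)
    (b : toCwFE.Code (.uc i) (CwFE.cons a)) :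
    (pi a b).sub σ = pi (a.sub σ) (b.sub (CwFE.up σ a))
  lam {i : ℕ} {Γ : C} {a : toCwFE.Code (.uc i) Γ} {b : toCwFE.Code (.uc i) (CwFE.cons a)} :
    toCwFE.Val b ≃ toCwFE.Val (pi a b)
  lam_sub {i : ℕ} {Γ Δ : C} (σ : Δ ⟶ Γ) {a : toCwFE.Code (.uc i) Γ}
    {b : toCwFE.Code (.uc i) (CwFE.cons a)} (t : toCwFE.Val b) :
    subTm σ (lam t).tm = (lam (t.sub (CwFE.up σ a))).tm
  sig {i : ℕ} {Γ : C} (a : toCwFE.Code (.uc i) Γ) (b : toCwFE.Code (.uc i) (CwFE.cons a)) :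
    toCwFE.Code (.uc i) Γ
  sig_sub {i : ℕ} {Γ Δ : C} (σ : Δ ⟶ Γ) (a : toCwFE.Code (.uc i) Γ)
    (b : toCwFE.Code (.uc i) (CwFE.cons a)) :
    (sig a b).sub σ = sig (a.sub σ) (b.sub (CwFE.up σ a))
  pr {i : ℕ} {Γ : C} {a : toCwFE.Code (.uc i) Γ} {b : toCwFE.Code (.uc i) (CwFE.cons a)} :
    (Σ x : toCwFE.Val a, toCwFE.Val (b.sub (CwFE.at1 x))) ≃ toCwFE.Val (sig a b)
  pr_sub {i : ℕ} {Γ Δ : C} (σ : Δ ⟶ Γ) {a : toCwFE.Code (.uc i) Γ}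
    {b : toCwFE.Code (.uc i) (CwFE.cons a)} (x : toCwFE.Val a)
    (y : toCwFE.Val (b.sub (CwFE.at1 x))) :
    subTm σ (pr ⟨x, y⟩).tm =
      (pr (a := a.sub σ) (b := b.sub (CwFE.up σ a))
        ⟨x.sub σ, y.sub σ (CwFE.sub_at1 σ x b)⟩).tm
  idt {i : ℕ} {Γ : C} {a : toCwFE.Code (.uc i) Γ} (x y : toCwFE.Val a) : toCwFE.Code (.uc i) Γ
  idt_sub {i : ℕ} {Γ Δ : C} (σ : Δ ⟶ Γ) {a : toCwFE.Code (.uc i) Γ} (x y : toCwFE.Val a) :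
    (idt x y).sub σ = idt (a := a.sub σ) (x.sub σ) (y.sub σ)
  refl {i : ℕ} {Γ : C} {a : toCwFE.Code (.uc i) Γ} (x : toCwFE.Val a) : toCwFE.Val (idt x x)
  refl_sub {i : ℕ} {Γ Δ : C} (σ : Δ ⟶ Γ) {a : toCwFE.Code (.uc i) Γ} (x : toCwFE.Val a) :
    subTm σ (refl x).tm = (refl (a := a.sub σ) (x.sub σ)).tm

namespace CwFPi

open CwFE

variable {C : Type u} [Category.{v} C] {M : CwFPi.{u, v, w} C} {i : ℕ} {Γ Δ : C}

theorem idt_congr {a a' : M.Code (.uc i) Γ} {x y : M.Val a} {x' y' : M.Val a'} (h : a = a')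
    (hx : x.tm = x'.tm) (hy : y.tm = y'.tm) : M.idt x y = M.idt x' y' := by
  subst h
  rw [CwF.Elt.ext hx, CwF.Elt.ext hy]

theorem refl_congr {a a' : M.Code (.uc i) Γ} {x : M.Val a} {x' : M.Val a'} (h : a = a')
    (hx : x.tm = x'.tm) : (M.refl x).tm = (M.refl x').tm := by
  subst h
  rw [CwF.Elt.ext hx]

/-- `Γ, x : a, y : a`. -/
abbrev cons₂ (a : M.Code (.uc i) Γ) : C := cons (a.sub (M.p (.comp i a)))

/-- The identity type of the two variables of `Γ, x : a, y : a`. -/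
def idVars (a : M.Code (.uc i) Γ) : M.Code (.uc i) (cons₂ a) :=
  M.idt ((var a).sub (M.p _)) (var _)

/-- `Γ, x : a, y : a, r : Id x y`. -/
abbrev idCtx (a : M.Code (.uc i) Γ) : C := cons (idVars a)

/-- The map `⟨⟨σ, x⟩, y⟩` into `Γ, x : a, y : a`. -/
def map₂ (a : M.Code (.uc i) Γ) (σ : Δ ⟶ Γ) (x y : M.Val (a.sub σ)) : Δ ⟶ cons₂ a :=
  snoc (snoc σ a x) _ ⟨y.tm, by rw [wk_snoc, y.ty]⟩

theorem idVars_map₂ (a : M.Code (.uc i) Γ) (σ : Δ ⟶ Γ) (x y : M.Val (a.sub σ)) :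
    (idVars a).sub (map₂ a σ x y) = M.idt x y := by
  rw [idVars, M.idt_sub]
  apply idt_congr
  · rw [map₂, wk_snoc, wk_snoc]
  · change M.subTm _ (M.subTm _ _) = _
    rw [← M.subTm_comp, map₂, snoc_p, snoc_q]
  · exact snoc_q _ _ _

/-- The map `⟨⟨⟨σ, x⟩, y⟩, r⟩` into `Γ, x : a, y : a, r : Id x y`. -/
def map₃ (a : M.Code (.uc i) Γ) (σ : Δ ⟶ Γ) (x y : M.Val (a.sub σ)) (r : M.Val (M.idt x y)) :
    Δ ⟶ idCtx a :=
  snoc (map₂ a σ x y) _ ⟨r.tm, by rw [idVars_map₂, r.ty]⟩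

/-- `⟨⟨⟨id, x⟩, y⟩, r⟩`. -/
def inst₃ {a : M.Code (.uc i) Γ} (x y : M.Val a) (r : M.Val (M.idt x y)) : Γ ⟶ idCtx a :=
  map₃ a (𝟙 Γ) (x.sub _) (y.sub _) (r.sub _ (M.idt_sub _ _ _))

/-- `⟨⟨⟨p, x⟩, x⟩, refl x⟩`. -/
def diag (a : M.Code (.uc i) Γ) : cons a ⟶ idCtx a :=
  map₃ a (M.p _) (var a) (var a) (M.refl (var a))

/-- The substitution `σ` under two binders. -/
def up₂ (σ : Δ ⟶ Γ) (a : M.Code (.uc i) Γ) : cons₂ (a.sub σ) ⟶ cons₂ a :=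
  up (up σ a) _ (wk_up σ a rfl a)

theorem idVars_up₂ (σ : Δ ⟶ Γ) (a : M.Code (.uc i) Γ) :
    (idVars a).sub (up₂ σ a) = idVars (a.sub σ) := by
  rw [idVars, M.idt_sub]
  apply idt_congr
  · rw [up₂, wk_up, wk_up]
  · change M.subTm _ (M.subTm _ _) = M.subTm _ _
    rw [← M.subTm_comp, up₂, up_p, M.subTm_comp, up_q]
  · exact up_q _ _ _

/-- The substitution `σ` under the three binders of a motive. -/
def up₃ (σ : Δ ⟶ Γ) (a : M.Code (.uc i) Γ) : idCtx (a.sub σ) ⟶ idCtx a :=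
  up (up₂ σ a) _ (idVars_up₂ σ a)

theorem map₂_q (a : M.Code (.uc i) Γ) (σ : Δ ⟶ Γ) (x y : M.Val (a.sub σ)) :
    M.subTm (map₂ a σ x y) (var (a.sub (M.p _))).tm = y.tm := snoc_q _ _ _

theorem map₃_q (a : M.Code (.uc i) Γ) (σ : Δ ⟶ Γ) (x y : M.Val (a.sub σ))
    (r : M.Val (M.idt x y)) : M.subTm (map₃ a σ x y r) (var (idVars a)).tm = r.tm := snoc_q _ _ _

theorem at1_diag {a : M.Code (.uc i) Γ} (x : M.Val a) :
    at1 x ≫ diag a = inst₃ x x (M.refl x) := by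
  have h : at1 x ≫ map₂ a (M.p _) (var a) (var a) = map₂ a (𝟙 Γ) (x.sub _) (x.sub _) := by
    have h1 : at1 x ≫ snoc (M.p _) a (var a) = snoc (𝟙 Γ) a (x.sub _) := by
      apply M.pair_uniq
      · rw [Category.assoc, snoc_p, snoc_p, at1_p]
      · rw [M.subTm_comp]
        exact (congrArg _ (snoc_q _ _ _)).trans ((at1_q x).trans
          ((M.subTm_id _).symm.trans (snoc_q _ _ (x.sub _)).symm))
    apply M.pair_uniq
    · rw [Category.assoc, map₂, map₂, snoc_p, snoc_p, h1]
    · rw [M.subTm_comp]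
      exact (congrArg _ (snoc_q _ _ _)).trans ((at1_q x).trans
        ((M.subTm_id _).symm.trans (map₂_q a (𝟙 Γ) (x.sub _) (x.sub _)).symm))
  apply M.pair_uniq
  · rw [Category.assoc, diag, inst₃, map₃, map₃, snoc_p, snoc_p, h]
  · rw [M.subTm_comp]
    refine (congrArg _ (snoc_q _ _ _)).trans ?_
    refine Eq.trans ?_ (snoc_q _ _ _).symm
    change M.subTm (at1 x) (M.refl (var a)).tm = M.subTm (𝟙 Γ) (M.refl x).tm
    rw [M.subTm_id, M.refl_sub]
    exact refl_congr (wk_at1 x a) (at1_q x)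

theorem inst₃_up₃ (σ : Δ ⟶ Γ) {a : M.Code (.uc i) Γ} (x y : M.Val a) (r : M.Val (M.idt x y)) :
    inst₃ (a := a.sub σ) (x.sub σ) (y.sub σ) (r.sub σ (M.idt_sub σ x y)) ≫ up₃ σ a =
      σ ≫ inst₃ x y r := by
  have k : ∀ t : M.Tm Γ, M.subTm (𝟙 Δ) (M.subTm σ t) = M.subTm σ (M.subTm (𝟙 Γ) t) := fun t => by
    rw [M.subTm_id, M.subTm_id]
  apply M.pair_uniq
  · rw [Category.assoc, up₃, up_p, Category.assoc, inst₃, inst₃, map₃, map₃, snoc_p,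
      ← Category.assoc, snoc_p]
    apply M.pair_uniq
    · rw [Category.assoc, up₂, up_p, Category.assoc, map₂, map₂, snoc_p, ← Category.assoc, snoc_p]
      apply M.pair_uniq
      · rw [Category.assoc, up_p, Category.assoc, snoc_p, ← Category.assoc, snoc_p,
          Category.comp_id, Category.id_comp]
      · rw [M.subTm_comp, M.subTm_comp]
        exact (congrArg _ (up_q _ _ _)).trans ((snoc_q _ _ _).trans ((k _).trans
          (congrArg _ (snoc_q (𝟙 Γ) a (x.sub _)).symm)))
    · rw [M.subTm_comp, M.subTm_comp]
      exact (congrArg _ (up_q _ _ _)).trans ((snoc_q _ _ _).trans ((k _).trans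
        (congrArg _ (map₂_q a (𝟙 Γ) (x.sub _) (y.sub _)).symm)))
  · rw [M.subTm_comp, M.subTm_comp]
    exact (congrArg _ (up_q _ _ _)).trans ((snoc_q _ _ _).trans ((k _).trans
      (congrArg _ (map₃_q a (𝟙 Γ) (x.sub _) (y.sub _) (r.sub _ (M.idt_sub _ _ _))).symm)))

end CwFPi

/-- The eliminator of identity types. -/
structure CwFJ (C : Type u) [Category.{v} C] extends CwFPi.{u, v, w} C where
  J {i j : ℕ} {Γ : C} {a : toCwFPi.Code (.uc i) Γ} (c : toCwFPi.Code (.uc j) (CwFPi.idCtx a))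
    (d : toCwFPi.Val (c.sub (CwFPi.diag a))) (x y : toCwFPi.Val a)
    (r : toCwFPi.Val (toCwFPi.idt x y)) : toCwFPi.Val (c.sub (CwFPi.inst₃ x y r))
  J_refl {i j : ℕ} {Γ : C} {a : toCwFPi.Code (.uc i) Γ}
    (c : toCwFPi.Code (.uc j) (CwFPi.idCtx a)) (d : toCwFPi.Val (c.sub (CwFPi.diag a)))
    (x : toCwFPi.Val a) : (J c d x x (refl x)).tm = subTm (CwFE.at1 x) d.tm
  J_sub {i j : ℕ} {Γ Δ : C} (σ : Δ ⟶ Γ) {a : toCwFPi.Code (.uc i) Γ}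
    (c : toCwFPi.Code (.uc j) (CwFPi.idCtx a)) (d : toCwFPi.Val (c.sub (CwFPi.diag a)))
    (x y : toCwFPi.Val a) (r : toCwFPi.Val (toCwFPi.idt x y))
    (d' : toCwFPi.Val ((c.sub (CwFPi.up₃ σ a)).sub (CwFPi.diag (a.sub σ))))
    (hd : d'.tm = subTm (CwFE.up σ a) d.tm) :
    subTm σ (J c d x y r).tm =
      (J (c.sub (CwFPi.up₃ σ a)) d' (x.sub σ) (y.sub σ) (r.sub σ (idt_sub σ x y))).tm

/-- States, events, numbers, transitions, finite and infinite traces, and the category of trace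
extensions. -/
structure CwFTrace (C : Type u) [Category.{v} C] extends CwFJ.{u, v, w} C where
  state (Γ : C) : toCwFJ.Code (.uc 0) Γ
  state_sub {Γ Δ : C} (σ : Δ ⟶ Γ) : (state Γ).sub σ = state Δ
  event (Γ : C) : toCwFJ.Code (.uc 0) Γ
  event_sub {Γ Δ : C} (σ : Δ ⟶ Γ) : (event Γ).sub σ = event Δ
  nat (Γ : C) : toCwFJ.Code (.uc 0) Γ
  nat_sub {Γ Δ : C} (σ : Δ ⟶ Γ) : (nat Γ).sub σ = nat Δ
  trans {Γ : C} (s : toCwFJ.Val (state Γ)) (e : toCwFJ.Val (event Γ)) (s' : toCwFJ.Val (state Γ)) :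
    toCwFJ.Code (.uc 0) Γ
  trans_sub {Γ Δ : C} (σ : Δ ⟶ Γ) (s : toCwFJ.Val (state Γ)) (e : toCwFJ.Val (event Γ))
    (s' : toCwFJ.Val (state Γ)) : (trans s e s').sub σ =
      trans (s.sub σ (state_sub σ)) (e.sub σ (event_sub σ)) (s'.sub σ (state_sub σ))
  fin (Γ : C) : toCwFJ.Code (.uc 0) Γ
  fin_sub {Γ Δ : C} (σ : Δ ⟶ Γ) : (fin Γ).sub σ = fin Δ
  nil {Γ : C} (s : toCwFJ.Val (state Γ)) : toCwFJ.Val (fin Γ)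
  nil_sub {Γ Δ : C} (σ : Δ ⟶ Γ) (s : toCwFJ.Val (state Γ)) :
    (nil s).sub σ (fin_sub σ) = nil (s.sub σ (state_sub σ))
  step {Γ : C} (τ : toCwFJ.Val (fin Γ)) (e : toCwFJ.Val (event Γ)) (s : toCwFJ.Val (state Γ)) :
    toCwFJ.Val (fin Γ)
  step_sub {Γ Δ : C} (σ : Δ ⟶ Γ) (τ : toCwFJ.Val (fin Γ)) (e : toCwFJ.Val (event Γ))
    (s : toCwFJ.Val (state Γ)) : (step τ e s).sub σ (fin_sub σ) =
      step (τ.sub σ (fin_sub σ)) (e.sub σ (event_sub σ)) (s.sub σ (state_sub σ))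
  inf (Γ : C) : toCwFJ.Code (.uc 0) Γ
  inf_sub {Γ Δ : C} (σ : Δ ⟶ Γ) : (inf Γ).sub σ = inf Δ
  head {Γ : C} (π : toCwFJ.Val (inf Γ)) : toCwFJ.Val (state Γ)
  head_sub {Γ Δ : C} (σ : Δ ⟶ Γ) (π : toCwFJ.Val (inf Γ)) :
    (head π).sub σ (state_sub σ) = head (π.sub σ (inf_sub σ))
  tail {Γ : C} (π : toCwFJ.Val (inf Γ)) :
    toCwFJ.Val (toCwFJ.sig (event Γ) (inf (CwFE.cons (event Γ))))
  tail_sub {Γ Δ : C} (σ : Δ ⟶ Γ) (π : toCwFJ.Val (inf Γ)) :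
    subTm σ (tail π).tm = (tail (π.sub σ (inf_sub σ))).tm
  corec {i : ℕ} {Γ : C} {a : toCwFJ.Code (.uc i) Γ} (h : toCwFJ.Val (state (CwFE.cons a)))
    (e : toCwFJ.Val (event (CwFE.cons a))) (n : toCwFJ.Val (a.sub (p (.comp i a))))
    (x : toCwFJ.Val a) : toCwFJ.Val (inf Γ)
  corec_sub {i : ℕ} {Γ Δ : C} (σ : Δ ⟶ Γ) {a : toCwFJ.Code (.uc i) Γ}
    (h : toCwFJ.Val (state (CwFE.cons a))) (e : toCwFJ.Val (event (CwFE.cons a)))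
    (n : toCwFJ.Val (a.sub (p (.comp i a)))) (x : toCwFJ.Val a) :
    (corec h e n x).sub σ (inf_sub σ) =
      corec (a := a.sub σ) (h.sub (CwFE.up σ a) (state_sub _)) (e.sub (CwFE.up σ a) (event_sub _))
        (n.sub (CwFE.up σ a) (CwFE.wk_up σ a rfl a)) (x.sub σ)
  head_corec {i : ℕ} {Γ : C} {a : toCwFJ.Code (.uc i) Γ} (h : toCwFJ.Val (state (CwFE.cons a)))
    (e : toCwFJ.Val (event (CwFE.cons a))) (n : toCwFJ.Val (a.sub (p (.comp i a))))
    (x : toCwFJ.Val a) : head (corec h e n x) = h.sub (CwFE.at1 x) (state_sub _)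
  tail_corec {i : ℕ} {Γ : C} {a : toCwFJ.Code (.uc i) Γ} (h : toCwFJ.Val (state (CwFE.cons a)))
    (e : toCwFJ.Val (event (CwFE.cons a))) (n : toCwFJ.Val (a.sub (p (.comp i a))))
    (x : toCwFJ.Val a) : tail (corec h e n x) =
      toCwFJ.pr ⟨e.sub (CwFE.at1 x) (event_sub _),
        (corec h e n (n.sub (CwFE.at1 x) (CwFE.wk_at1 x a))).sub (𝟙 Γ)
          ((inf_sub _).trans (inf_sub _).symm)⟩
  extn {Γ : C} (τ τ' : toCwFJ.Val (fin Γ)) : toCwFJ.Code (.uc 0) Γ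
  extn_sub {Γ Δ : C} (σ : Δ ⟶ Γ) (τ τ' : toCwFJ.Val (fin Γ)) :
    (extn τ τ').sub σ = extn (τ.sub σ (fin_sub σ)) (τ'.sub σ (fin_sub σ))
  idE {Γ : C} (τ : toCwFJ.Val (fin Γ)) : toCwFJ.Val (extn τ τ)
  idE_sub {Γ Δ : C} (σ : Δ ⟶ Γ) (τ : toCwFJ.Val (fin Γ)) :
    (idE τ).sub σ (extn_sub σ τ τ) = idE (τ.sub σ (fin_sub σ))
  compE {Γ : C} {τ τ' τ'' : toCwFJ.Val (fin Γ)} (ε₁ : toCwFJ.Val (extn τ τ'))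
    (ε₂ : toCwFJ.Val (extn τ' τ'')) : toCwFJ.Val (extn τ τ'')
  compE_sub {Γ Δ : C} (σ : Δ ⟶ Γ) {τ τ' τ'' : toCwFJ.Val (fin Γ)} (ε₁ : toCwFJ.Val (extn τ τ'))
    (ε₂ : toCwFJ.Val (extn τ' τ'')) : (compE ε₁ ε₂).sub σ (extn_sub σ τ τ'') =
      compE (ε₁.sub σ (extn_sub σ τ τ')) (ε₂.sub σ (extn_sub σ τ' τ''))
  id_compE {Γ : C} {τ τ' : toCwFJ.Val (fin Γ)} (ε : toCwFJ.Val (extn τ τ')) : compE (idE τ) ε = ε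
  compE_id {Γ : C} {τ τ' : toCwFJ.Val (fin Γ)} (ε : toCwFJ.Val (extn τ τ')) : compE ε (idE τ') = ε
  compE_assoc {Γ : C} {τ₀ τ₁ τ₂ τ₃ : toCwFJ.Val (fin Γ)} (ε₁ : toCwFJ.Val (extn τ₀ τ₁))
    (ε₂ : toCwFJ.Val (extn τ₁ τ₂)) (ε₃ : toCwFJ.Val (extn τ₂ τ₃)) :
    compE (compE ε₁ ε₂) ε₃ = compE ε₁ (compE ε₂ ε₃)

/-- The knowledge layer: in every context, a presheaf `K` on the category of finite traces and
their extensions, and the types `Kinf π`. -/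
structure CwFK (C : Type u) [Category.{v} C] extends CwFTrace.{u, v, w} C where
  K {Γ : C} (τ : toCwFTrace.Val (fin Γ)) : toCwFTrace.Code (.tyL 0) Γ
  K_sub {Γ Δ : C} (σ : Δ ⟶ Γ) (τ : toCwFTrace.Val (fin Γ)) :
    (K τ).sub σ = K (τ.sub σ (fin_sub σ))
  Kinf {Γ : C} (π : toCwFTrace.Val (inf Γ)) : toCwFTrace.Code (.tyL 0) Γ
  Kinf_sub {Γ Δ : C} (σ : Δ ⟶ Γ) (π : toCwFTrace.Val (inf Γ)) :
    (Kinf π).sub σ = Kinf (π.sub σ (inf_sub σ))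
  restrict {Γ : C} {τ τ' : toCwFTrace.Val (fin Γ)} (ε : toCwFTrace.Val (extn τ τ'))
    (k : toCwFTrace.Val (K τ')) : toCwFTrace.Val (K τ)
  restrict_sub {Γ Δ : C} (σ : Δ ⟶ Γ) {τ τ' : toCwFTrace.Val (fin Γ)}
    (ε : toCwFTrace.Val (extn τ τ')) (k : toCwFTrace.Val (K τ')) :
    (restrict ε k).sub σ (K_sub σ τ) =
      restrict (ε.sub σ (extn_sub σ τ τ')) (k.sub σ (K_sub σ τ'))
  restrict_id {Γ : C} {τ : toCwFTrace.Val (fin Γ)} (k : toCwFTrace.Val (K τ)) :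
    restrict (idE τ) k = k
  restrict_comp {Γ : C} {τ τ' τ'' : toCwFTrace.Val (fin Γ)} (ε₁ : toCwFTrace.Val (extn τ τ'))
    (ε₂ : toCwFTrace.Val (extn τ' τ'')) (k : toCwFTrace.Val (K τ'')) :
    restrict ε₁ (restrict ε₂ k) = restrict (compE ε₁ ε₂) k

/-- A proof-irrelevant fibre of propositions, with the operations of intuitionistic first-order
logic over the computational types. -/
structure CwFProp (C : Type u) [Category.{v} C] extends CwFK.{u, v, w} C where
  irrel {Γ : C} {P : toCwFK.Code .prop Γ} (r s : toCwFK.Val P) : r = s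
  top (Γ : C) : toCwFK.Code .prop Γ
  top_sub {Γ Δ : C} (σ : Δ ⟶ Γ) : (top Γ).sub σ = top Δ
  bot (Γ : C) : toCwFK.Code .prop Γ
  bot_sub {Γ Δ : C} (σ : Δ ⟶ Γ) : (bot Γ).sub σ = bot Δ
  and {Γ : C} (P Q : toCwFK.Code .prop Γ) : toCwFK.Code .prop Γ
  and_sub {Γ Δ : C} (σ : Δ ⟶ Γ) (P Q : toCwFK.Code .prop Γ) :
    (and P Q).sub σ = and (P.sub σ) (Q.sub σ)
  or {Γ : C} (P Q : toCwFK.Code .prop Γ) : toCwFK.Code .prop Γ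
  or_sub {Γ Δ : C} (σ : Δ ⟶ Γ) (P Q : toCwFK.Code .prop Γ) :
    (or P Q).sub σ = or (P.sub σ) (Q.sub σ)
  imp {Γ : C} (P Q : toCwFK.Code .prop Γ) : toCwFK.Code .prop Γ
  imp_sub {Γ Δ : C} (σ : Δ ⟶ Γ) (P Q : toCwFK.Code .prop Γ) :
    (imp P Q).sub σ = imp (P.sub σ) (Q.sub σ)
  all {i : ℕ} {Γ : C} (a : toCwFK.Code (.uc i) Γ) (P : toCwFK.Code .prop (CwFE.cons a)) :
    toCwFK.Code .prop Γ
  all_sub {i : ℕ} {Γ Δ : C} (σ : Δ ⟶ Γ) (a : toCwFK.Code (.uc i) Γ)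
    (P : toCwFK.Code .prop (CwFE.cons a)) :
    (all a P).sub σ = all (a.sub σ) (P.sub (CwFE.up σ a))
  ex {i : ℕ} {Γ : C} (a : toCwFK.Code (.uc i) Γ) (P : toCwFK.Code .prop (CwFE.cons a)) :
    toCwFK.Code .prop Γ
  ex_sub {i : ℕ} {Γ Δ : C} (σ : Δ ⟶ Γ) (a : toCwFK.Code (.uc i) Γ)
    (P : toCwFK.Code .prop (CwFE.cons a)) :
    (ex a P).sub σ = ex (a.sub σ) (P.sub (CwFE.up σ a))
  holds_top (Γ : C) : CwFE.Holds (top Γ)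
  bot_entails {Γ : C} (R : toCwFK.Code .prop Γ) : CwFE.Entails (bot Γ) R
  holds_and {Γ : C} (P Q : toCwFK.Code .prop Γ) :
    CwFE.Holds (and P Q) ↔ CwFE.Holds P ∧ CwFE.Holds Q
  or_entails {Γ : C} (P Q R : toCwFK.Code .prop Γ) :
    CwFE.Entails (or P Q) R ↔ CwFE.Entails P R ∧ CwFE.Entails Q R
  holds_imp {Γ : C} (P Q : toCwFK.Code .prop Γ) : CwFE.Holds (imp P Q) ↔ CwFE.Entails P Q
  holds_all {i : ℕ} {Γ : C} (a : toCwFK.Code (.uc i) Γ) (P : toCwFK.Code .prop (CwFE.cons a)) :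
    CwFE.Holds (all a P) ↔ CwFE.Holds P
  ex_entails {i : ℕ} {Γ : C} (a : toCwFK.Code (.uc i) Γ) (P : toCwFK.Code .prop (CwFE.cons a))
    (R : toCwFK.Code .prop Γ) :
    CwFE.Entails (ex a P) R ↔ CwFE.Entails P (R.sub (p (.comp i a)))

namespace CwFProp

open CwFE

variable {C : Type u} [Category.{v} C] {M : CwFProp.{u, v, w} C}

/-- `φ(X)` is monotone in `X`, in every context over `Γ`. -/
def Monotone {Γ : C} (φ : M.Code .prop (M.consProp Γ)) : Prop :=
  ∀ {Δ : C} (σ : Δ ⟶ Γ) (P Q : M.Code .prop Δ), Holds (M.imp P Q) →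
    Holds (M.imp (φ.sub (snocProp σ P)) (φ.sub (snocProp σ Q)))

end CwFProp

/-- Models of the three-layer system: the structure above with fixed points of monotone formulas. -/
structure Model (C : Type u) [Category.{v} C] extends CwFProp.{u, v, w} C where
  mu {Γ : C} (φ : toCwFProp.Code .prop (toCwFProp.consProp Γ)) (h : CwFProp.Monotone φ) :
    toCwFProp.Code .prop Γ
  mu_sub {Γ Δ : C} (σ : Δ ⟶ Γ) (φ : toCwFProp.Code .prop (toCwFProp.consProp Γ))
    (h : CwFProp.Monotone φ) (h' : CwFProp.Monotone (φ.sub (CwFE.upProp σ))) :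
    (mu φ h).sub σ = mu (φ.sub (CwFE.upProp σ)) h'
  fold {Γ : C} (φ : toCwFProp.Code .prop (toCwFProp.consProp Γ)) (h : CwFProp.Monotone φ) :
    CwFE.Holds (imp (φ.sub (CwFE.snocProp (𝟙 Γ) (mu φ h))) (mu φ h))
  unfold {Γ : C} (φ : toCwFProp.Code .prop (toCwFProp.consProp Γ)) (h : CwFProp.Monotone φ) :
    CwFE.Holds (imp (mu φ h) (φ.sub (CwFE.snocProp (𝟙 Γ) (mu φ h))))
  nu {Γ : C} (φ : toCwFProp.Code .prop (toCwFProp.consProp Γ)) (h : CwFProp.Monotone φ) :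
    toCwFProp.Code .prop Γ
  nu_sub {Γ Δ : C} (σ : Δ ⟶ Γ) (φ : toCwFProp.Code .prop (toCwFProp.consProp Γ))
    (h : CwFProp.Monotone φ) (h' : CwFProp.Monotone (φ.sub (CwFE.upProp σ))) :
    (nu φ h).sub σ = nu (φ.sub (CwFE.upProp σ)) h'
  out {Γ : C} (φ : toCwFProp.Code .prop (toCwFProp.consProp Γ)) (h : CwFProp.Monotone φ) :
    CwFE.Holds (imp (nu φ h) (φ.sub (CwFE.snocProp (𝟙 Γ) (nu φ h))))
  into {Γ : C} (φ : toCwFProp.Code .prop (toCwFProp.consProp Γ)) (h : CwFProp.Monotone φ) :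
    CwFE.Holds (imp (φ.sub (CwFE.snocProp (𝟙 Γ) (nu φ h))) (nu φ h))

/-- `⟦⊥⟧` is uninhabited: it has no global section. -/
def Model.BotUninhabited {C : Type u} [Category.{v} C] (M : Model.{u, v, w} C) : Prop :=
  IsEmpty (M.Elt M.one (M.El (M.bot M.one)))


/-- Models in sets: contexts are sets, types are families of sets, terms are sections, context
extension is the total space, and propositions are subsets (the fibre of propositions is given by
`Ω`), with `⊥` the empty subset. -/
structure SetModel where
  model : Model.{1, 0, 1} Type
  fam {Γ : Type} : model.Ty Γ → Γ → Type
  fam_sub {Γ Δ : Type} (σ : Δ ⟶ Γ) (A : model.Ty Γ) (δ : Δ) :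
    fam (model.subTy σ A) δ = fam A (σ δ)
  sec {Γ : Type} (A : model.Ty Γ) : model.Elt Γ A ≃ ((γ : Γ) → fam A γ)
  sec_sub {Γ Δ : Type} (σ : Δ ⟶ Γ) {A : model.Ty Γ} (t : model.Elt Γ A)
    (t' : model.Elt Δ (model.subTy σ A)) (h : t'.tm = model.subTm σ t.tm) (δ : Δ) :
    sec _ t' δ ≍ sec A t (σ δ)
  tot {Γ : Type} (e : model.Entry Γ) : model.ext Γ e ≃ Σ γ : Γ, fam e.ty γ
  tot_p {Γ : Type} (e : model.Entry Γ) (x : model.ext Γ e) : (tot e x).1 = model.p e x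
  tot_q {Γ : Type} (e : model.Entry Γ) (x : model.ext Γ e) :
    (tot e x).2 ≍ sec _ (model.q e) x
  omega (Γ : Type) : model.Code .prop Γ ≃ Set Γ
  omega_sub {Γ Δ : Type} (σ : Δ ⟶ Γ) (P : model.Code .prop Γ) :
    omega Δ (P.sub σ) = {δ | σ δ ∈ omega Γ P}
  mem_omega {Γ : Type} (P : model.Code .prop Γ) (γ : Γ) :
    γ ∈ omega Γ P ↔ Nonempty (fam (model.El P) γ)
  omega_bot (Γ : Type) : omega Γ (model.bot Γ) = ∅


/-! ## The syntactic model

Contexts, substitutions, types and terms modulo derivable equality. -/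

namespace Syn

/-- Well-formed contexts. -/
structure SynCtx : Type where
  ctx : Ctx
  wf : Der (.ctx ctx)

theorem der_sort {Γ : Ctx} (s : Srt) (h : Der (.ctx Γ)) : Der (.tm Γ s.tm s.next.tm) := by
  cases s
  · exact .uc h
  · exact .tyL h
  · exact .prop h

theorem der_conv_sort {Γ Δ : Ctx} {t σ s} (h : Der (.sb Δ σ Γ)) (ht : Der (.tm Δ t (.sub (Srt.tm s) σ))) :
    Der (.tm Δ t s.tm) := .conv ht (.eq_sort (s := s) h)

theorem eq_conv_sort {Γ Δ : Ctx} {t t' σ s} (h : Der (.sb Δ σ Γ))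
    (ht : Der (.eq Δ t t' (.sub (Srt.tm s) σ))) : Der (.eq Δ t t' s.tm) :=
  .eq_conv ht (.eq_sort (s := s) h)

/-- Typed substitutions modulo equality. -/
instance sbSetoid (Δ Γ : SynCtx) : Setoid {σ : Sb // Der (.sb Δ.ctx σ Γ.ctx)} where
  r σ τ := Der (.sbEq Δ.ctx σ.1 τ.1 Γ.ctx)
  iseqv := ⟨fun σ => .sbEq_refl σ.2, .sbEq_symm, .sbEq_trans⟩

def Hom (Δ Γ : SynCtx) : Type := Quotient (sbSetoid Δ Γ)

/-- The class of a substitution. -/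
def mkHom {Δ Γ : SynCtx} (σ : Sb) (h : Der (.sb Δ.ctx σ Γ.ctx)) : Hom Δ Γ := ⟦⟨σ, h⟩⟧

/-- A representative. -/
noncomputable def Hom.raw {Δ Γ : SynCtx} (σ : Hom Δ Γ) : Sb := (Quotient.out σ).1

theorem Hom.der {Δ Γ : SynCtx} (σ : Hom Δ Γ) : Der (.sb Δ.ctx σ.raw Γ.ctx) := (Quotient.out σ).2

theorem Hom.ext {Δ Γ : SynCtx} {σ τ : Hom Δ Γ} (h : Der (.sbEq Δ.ctx σ.raw τ.raw Γ.ctx)) : σ = τ := by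
  rw [← Quotient.out_eq σ, ← Quotient.out_eq τ]
  exact Quotient.sound h

theorem raw_mkHom {Δ Γ : SynCtx} {σ : Sb} (h : Der (.sb Δ.ctx σ Γ.ctx)) :
    Der (.sbEq Δ.ctx (mkHom σ h).raw σ Γ.ctx) :=
  Quotient.exact (Quotient.out_eq (mkHom σ h))

noncomputable instance : Category SynCtx where
  Hom := Hom
  id Γ := mkHom .id (.sb_id Γ.wf)
  comp δ σ := mkHom (.comp σ.raw δ.raw) (.sb_comp σ.der δ.der)
  id_comp σ := Hom.ext <| .sbEq_trans (raw_mkHom _) <|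
    .sbEq_trans (.sbEq_comp (.sbEq_refl σ.der) (raw_mkHom _)) (.sbEq_comp_id σ.der)
  comp_id σ := Hom.ext <| .sbEq_trans (raw_mkHom _) <|
    .sbEq_trans (.sbEq_comp (raw_mkHom _) (.sbEq_refl σ.der)) (.sbEq_id_comp σ.der)
  assoc γ δ σ := Hom.ext <| .sbEq_trans (raw_mkHom _) <| .sbEq_trans
    (.sbEq_comp (.sbEq_refl σ.der) (raw_mkHom _)) <| .sbEq_symm <| .sbEq_trans (raw_mkHom _) <|
    .sbEq_trans (.sbEq_comp (raw_mkHom _) (.sbEq_refl γ.der)) (.sbEq_assoc σ.der δ.der γ.der)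

/-- Representative of a morphism. -/
noncomputable abbrev rep {Δ Γ : SynCtx} (σ : Δ ⟶ Γ) : Sb := Hom.raw σ

theorem hom_der {Δ Γ : SynCtx} (σ : Δ ⟶ Γ) : Der (.sb Δ.ctx (rep σ) Γ.ctx) := Hom.der σ

theorem raw_id (Γ : SynCtx) : Der (.sbEq Γ.ctx (rep (𝟙 Γ)) .id Γ.ctx) := raw_mkHom _

theorem raw_comp {Γ Δ Θ : SynCtx} (δ : Θ ⟶ Δ) (σ : Δ ⟶ Γ) :
    Der (.sbEq Θ.ctx (rep (δ ≫ σ)) (.comp (rep σ) (rep δ)) Γ.ctx) := raw_mkHom _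

/-- Equality of types. -/
def TyEq (Γ : Ctx) : Tm → Tm → Prop :=
  Relation.EqvGen fun A B => ∃ s : Srt, Der (.eq Γ A B s.tm)

theorem TyEq.of {Γ : Ctx} {A B} {s : Srt} (h : Der (.eq Γ A B s.tm)) : TyEq Γ A B := .rel _ _ ⟨s, h⟩

theorem TyEq.conv {Γ : Ctx} {A B} (h : TyEq Γ A B) :
    (∀ t, Der (.tm Γ t A) ↔ Der (.tm Γ t B)) ∧ ∀ t t', Der (.eq Γ t t' A) ↔ Der (.eq Γ t t' B) := by
  induction h with
  | rel A B h =>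
    obtain ⟨s, h⟩ := h
    exact ⟨fun t => ⟨fun ht => .conv ht h, fun ht => .conv ht (.eq_symm h)⟩,
      fun t t' => ⟨fun ht => .eq_conv ht h, fun ht => .eq_conv ht (.eq_symm h)⟩⟩
  | refl => exact ⟨fun _ => .rfl, fun _ _ => .rfl⟩
  | symm _ _ _ ih => exact ⟨fun t => (ih.1 t).symm, fun t t' => (ih.2 t t').symm⟩
  | trans _ _ _ _ _ ih ih' =>
    exact ⟨fun t => (ih.1 t).trans (ih'.1 t), fun t t' => (ih.2 t t').trans (ih'.2 t t')⟩

theorem TyEq.sub {Γ Δ : Ctx} {A B σ} (h : TyEq Γ A B) (hσ : Der (.sb Δ σ Γ)) :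
    TyEq Δ (.sub A σ) (.sub B σ) := by
  induction h with
  | rel A B h =>
    obtain ⟨s, h⟩ := h
    exact .of (eq_conv_sort hσ (.eq_sub h (.sbEq_refl hσ)))
  | refl => exact .refl _
  | symm _ _ _ ih => exact .symm _ _ ih
  | trans _ _ _ _ _ ih ih' => exact .trans _ _ _ ih ih'

theorem TyEq.sub_right {Γ Δ : Ctx} {A σ σ'} (h : ∃ s : Srt, Der (.tm Γ A s.tm))
    (hσ : Der (.sb Δ σ Γ)) (e : Der (.sbEq Δ σ σ' Γ)) : TyEq Δ (.sub A σ) (.sub A σ') :=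
  h.elim fun s h => .of (s := s) (eq_conv_sort hσ (.eq_sub (.eq_refl h) e))

/-- Types modulo equality. -/
instance tySetoid (Γ : SynCtx) : Setoid {A : Tm // ∃ s : Srt, Der (.tm Γ.ctx A s.tm)} where
  r A B := TyEq Γ.ctx A.1 B.1
  iseqv := ⟨fun _ => .refl _, .symm _ _, .trans _ _ _⟩

def STy (Γ : SynCtx) : Type := Quotient (tySetoid Γ)

/-- The class of a type. -/
def mkTy {Γ : SynCtx} (A : Tm) (h : ∃ s : Srt, Der (.tm Γ.ctx A s.tm)) : STy Γ := ⟦⟨A, h⟩⟧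

noncomputable def STy.raw {Γ : SynCtx} (A : STy Γ) : Tm := (Quotient.out A).1

theorem STy.der {Γ : SynCtx} (A : STy Γ) : ∃ s : Srt, Der (.tm Γ.ctx A.raw s.tm) := (Quotient.out A).2

theorem STy.eq_mk {Γ : SynCtx} (A : STy Γ) : A = mkTy A.raw A.der := (Quotient.out_eq A).symm

theorem mkTy_eq {Γ : SynCtx} {A B hA hB} : mkTy (Γ := Γ) A hA = mkTy B hB ↔ TyEq Γ.ctx A B :=
  ⟨fun h => Quotient.exact h, fun h => Quotient.sound h⟩

theorem mkTy_of {Γ : SynCtx} {A B hA hB} {s : Srt} (h : Der (.eq Γ.ctx A B s.tm)) :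
    mkTy (Γ := Γ) A hA = mkTy B hB := mkTy_eq.2 (.of h)

/-- Terms together with their types, modulo equality. -/
instance tmSetoid (Γ : SynCtx) :
    Setoid {x : Tm × Tm // Der (.tm Γ.ctx x.1 x.2) ∧ ∃ s : Srt, Der (.tm Γ.ctx x.2 s.tm)} where
  r x y := TyEq Γ.ctx x.1.2 y.1.2 ∧ Der (.eq Γ.ctx x.1.1 y.1.1 x.1.2)
  iseqv := ⟨fun x => ⟨.refl _, .eq_refl x.2.1⟩,
    fun h => ⟨.symm _ _ h.1, (h.1.conv.2 _ _).1 (.eq_symm h.2)⟩,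
    fun h h' => ⟨.trans _ _ _ h.1 h'.1, .eq_trans h.2 ((h.1.conv.2 _ _).2 h'.2)⟩⟩

def STm (Γ : SynCtx) : Type := Quotient (tmSetoid Γ)

/-- The class of a term. -/
def mkTm {Γ : SynCtx} (t A : Tm) (h : Der (.tm Γ.ctx t A)) (hA : ∃ s : Srt, Der (.tm Γ.ctx A s.tm)) :
    STm Γ := ⟦⟨(t, A), h, hA⟩⟧

noncomputable def STm.raw {Γ : SynCtx} (t : STm Γ) : Tm := (Quotient.out t).1.1

/-- The type of a term. -/
def STm.typ {Γ : SynCtx} : STm Γ → STy Γ :=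
  Quotient.map (fun x => ⟨x.1.2, x.2.2⟩) fun _ _ h => h.1

theorem typ_mkTm {Γ : SynCtx} {t A h hA} : (mkTm (Γ := Γ) t A h hA).typ = mkTy A hA := rfl

theorem STm.der {Γ : SynCtx} {t : STm Γ} {A hA} (h : t.typ = mkTy A hA) : Der (.tm Γ.ctx t.raw A) := by
  rw [← Quotient.out_eq t] at h
  exact ((mkTy_eq.1 h).conv.1 _).1 (Quotient.out t).2.1

theorem raw_mkTm {Γ : SynCtx} {t A} (h : Der (.tm Γ.ctx t A)) (hA) :
    Der (.eq Γ.ctx (mkTm (Γ := Γ) t A h hA).raw t A) := by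
  have e := Quotient.exact (Quotient.out_eq (mkTm (Γ := Γ) t A h hA))
  exact (e.1.conv.2 _ _).1 e.2

theorem STm.ext {Γ : SynCtx} {t t' : STm Γ} {A hA} (h : t.typ = mkTy A hA) (h' : t'.typ = t.typ)
    (e : Der (.eq Γ.ctx t.raw t'.raw A)) : t = t' := by
  rw [← Quotient.out_eq t] at h h' ⊢
  rw [← Quotient.out_eq t'] at h' ⊢
  exact Quotient.sound ⟨.symm _ _ (mkTy_eq.1 h'), ((mkTy_eq.1 h).conv.2 _ _).2 e⟩

/-- Substitution in types. -/
noncomputable def STy.sub {Γ Δ : SynCtx} (σ : Δ ⟶ Γ) (A : STy Γ) : STy Δ :=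
  mkTy (.sub A.raw (rep σ)) (A.der.imp fun _ h => der_conv_sort (hom_der σ) (.sub h (hom_der σ)))

theorem sub_mkTy {Γ Δ : SynCtx} (σ : Δ ⟶ Γ) {A hA hB} :
    (mkTy (Γ := Γ) A hA).sub σ = mkTy (.sub A (rep σ)) hB :=
  mkTy_eq.2 ((mkTy_eq.1 (STy.eq_mk (mkTy (Γ := Γ) A hA)).symm).sub (hom_der σ))

/-- The type of a representative. -/
noncomputable def STm.rawTy {Γ : SynCtx} (t : STm Γ) : Tm := (Quotient.out t).1.2

theorem STm.typ_eq {Γ : SynCtx} (t : STm Γ) : t.typ = mkTy t.rawTy (Quotient.out t).2.2 := by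
  conv_lhs => rw [← Quotient.out_eq t]
  rfl

/-- Substitution in terms. -/
noncomputable def STm.sub {Γ Δ : SynCtx} (σ : Δ ⟶ Γ) (t : STm Γ) : STm Δ :=
  mkTm (.sub t.raw (rep σ)) (.sub t.rawTy (rep σ)) (.sub (Quotient.out t).2.1 (hom_der σ))
    ((Quotient.out t).2.2.imp fun _ h => der_conv_sort (hom_der σ) (.sub h (hom_der σ)))

theorem STm.typ_sub {Γ Δ : SynCtx} (σ : Δ ⟶ Γ) (t : STm Γ) : (t.sub σ).typ = t.typ.sub σ := by
  rw [t.typ_eq]; exact (sub_mkTy _).symm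

theorem STm.raw_sub {Γ Δ : SynCtx} (σ : Δ ⟶ Γ) {t : STm Γ} {A hA} (h : t.typ = mkTy A hA) :
    Der (.eq Δ.ctx (t.sub σ).raw (.sub t.raw (rep σ)) (.sub A (rep σ))) :=
  (((mkTy_eq.1 (t.typ_eq.symm.trans h)).sub (hom_der σ)).conv.2 _ _).1 (raw_mkTm _ _)

theorem sb_conv {Γ Δ : Ctx} {t t' A σ σ'} (hA : ∃ s : Srt, Der (.tm Γ A s.tm)) (hσ : Der (.sb Δ σ Γ))
    (e : Der (.sbEq Δ σ σ' Γ)) (h : Der (.eq Δ t t' (.sub A σ'))) :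
    Der (.eq Δ t t' (.sub A σ)) :=
  ((TyEq.sub_right hA hσ e).conv.2 _ _).2 h

theorem STy.sub_id {Γ : SynCtx} (A : STy Γ) : A.sub (𝟙 Γ) = A := by
  obtain ⟨s, h⟩ := A.der
  conv_rhs => rw [A.eq_mk]
  exact mkTy_eq.2 (.trans _ _ _ (TyEq.sub_right ⟨s, h⟩ (hom_der _) (raw_id _))
    (TyEq.of (.eq_sub_id h)))

theorem der_sub {Γ Δ : SynCtx} {A} {s : Srt} (h : Der (.tm Γ.ctx A s.tm)) (σ : Δ ⟶ Γ) :
    Der (.tm Δ.ctx (.sub A (rep σ)) s.tm) :=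
  der_conv_sort (hom_der σ) (.sub h (hom_der σ))

theorem tyEq_comp {Γ Δ Θ : SynCtx} {A} (σ : Δ ⟶ Γ) (δ : Θ ⟶ Δ)
    (h : ∃ s : Srt, Der (.tm Γ.ctx A s.tm)) :
    TyEq Θ.ctx (.sub A (rep (δ ≫ σ))) (.sub (.sub A (rep σ)) (rep δ)) := by
  obtain ⟨s, h⟩ := h
  exact .trans _ _ _ (TyEq.sub_right ⟨s, h⟩ (hom_der _) (raw_comp _ _)) (.symm _ _ (TyEq.of
    (eq_conv_sort (hom_der δ) (.eq_push (der_sub h σ) (hom_der δ)))))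

theorem STy.sub_comp {Γ Δ Θ : SynCtx} (σ : Δ ⟶ Γ) (δ : Θ ⟶ Δ) (A : STy Γ) :
    A.sub (δ ≫ σ) = (A.sub σ).sub δ :=
  (mkTy_eq.2 (tyEq_comp σ δ A.der)).trans (sub_mkTy δ
    (hB := A.der.imp fun _ h => der_sub (der_sub h σ) δ)).symm

theorem STm.sub_id {Γ : SynCtx} (t : STm Γ) : t.sub (𝟙 Γ) = t := by
  symm
  refine STm.ext t.typ_eq ((t.typ_sub _).trans (STy.sub_id _)) (.eq_symm ?_)
  have e := TyEq.sub_right (Quotient.out t).2.2 (hom_der (𝟙 Γ)) (raw_id Γ)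
  have hA := (Quotient.out t).2.2
  have ht := (Quotient.out t).2.1
  have e' : TyEq Γ.ctx (.sub t.rawTy .id) t.rawTy := hA.elim fun _ h => TyEq.of (.eq_sub_id h)
  exact .eq_trans ((e'.conv.2 _ _).1 ((e.conv.2 _ _).1 (.eq_trans (t.raw_sub _ t.typ_eq)
    (.eq_sub (.eq_refl ht) (raw_id Γ))))) (.eq_sub_id ht)

theorem STm.sub_comp {Γ Δ Θ : SynCtx} (σ : Δ ⟶ Γ) (δ : Θ ⟶ Δ) (t : STm Γ) :
    t.sub (δ ≫ σ) = (t.sub σ).sub δ := by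
  have hA := (Quotient.out t).2.2
  have ht := (Quotient.out t).2.1
  have hty : (t.sub σ).typ = mkTy (.sub t.rawTy (rep σ)) (hA.imp fun _ h => der_sub h σ) := rfl
  have hty' : (t.sub (δ ≫ σ)).typ = mkTy (.sub t.rawTy (rep (δ ≫ σ)))
    (hA.imp fun _ h => der_sub h _) := rfl
  refine STm.ext hty' ?_ ?_
  · rw [STm.typ_sub, STm.typ_sub, STm.typ_sub, STy.sub_comp]
  · refine .eq_trans (t.raw_sub _ t.typ_eq) (.eq_trans (.eq_sub (.eq_refl ht) (raw_comp _ _))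
      (((tyEq_comp σ δ hA).conv.2 _ _).2 (.eq_symm (.eq_trans ((t.sub σ).raw_sub δ hty) (.eq_trans
        (.eq_sub (t.raw_sub σ t.typ_eq) (.sbEq_refl (hom_der δ)))
        (.eq_push (.sub ht (hom_der σ)) (hom_der δ)))))))

/-- The category of contexts with its types and terms. -/
noncomputable abbrev cwf : CwF.{0, 0, 0} SynCtx where
  one := ⟨[], .ctx_nil⟩
  bang Γ := mkHom .bang (.sb_bang Γ.wf)
  bang_uniq {Γ} σ := Hom.ext (.sbEq_trans (.sbEq_bang (hom_der σ)) (.sbEq_symm (raw_mkHom _)))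
  Ty := STy
  Tm := STm
  typ := STm.typ
  subTy := STy.sub
  subTm := STm.sub
  subTy_id := STy.sub_id
  subTy_comp := STy.sub_comp
  subTm_id := STm.sub_id
  subTm_comp := STm.sub_comp
  typ_sub := STm.typ_sub
  sort s Γ := mkTy s.tm ⟨s.next, der_sort s Γ.wf⟩
  sort_sub {Γ Δ} s σ := (sub_mkTy σ (hB := ⟨s.next, der_conv_sort (hom_der σ)
    (.sub (der_sort s Γ.wf) (hom_der σ))⟩)).trans (mkTy_of (.eq_sort (hom_der σ)))


theorem code_der {s : Srt} {Γ : SynCtx} (a : cwf.Code s Γ) : Der (.tm Γ.ctx a.tm.raw s.tm) :=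
  STm.der (hA := ⟨s.next, der_sort s Γ.wf⟩) a.ty

/-- The class of an element of a universe. -/
def mkCode {s : Srt} {Γ : SynCtx} (t : Tm) (h : Der (.tm Γ.ctx t s.tm)) : cwf.Code s Γ :=
  ⟨mkTm t s.tm h ⟨s.next, der_sort s Γ.wf⟩, rfl⟩

theorem raw_mkCode {s : Srt} {Γ : SynCtx} {t : Tm} (h : Der (.tm Γ.ctx t s.tm)) :
    Der (.eq Γ.ctx (mkCode (s := s) t h).tm.raw t s.tm) := raw_mkTm h ⟨s.next, der_sort s Γ.wf⟩

theorem code_ext {s : Srt} {Γ : SynCtx} {a b : cwf.Code s Γ}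
    (h : Der (.eq Γ.ctx a.tm.raw b.tm.raw s.tm)) : a = b :=
  CwF.Elt.ext (STm.ext (hA := ⟨s.next, der_sort s Γ.wf⟩) a.ty (b.ty.trans a.ty.symm) h)

theorem raw_code_sub {s : Srt} {Γ Δ : SynCtx} (a : cwf.Code s Γ) (σ : Δ ⟶ Γ) :
    Der (.eq Δ.ctx (a.sub σ).tm.raw (.sub a.tm.raw (rep σ)) s.tm) :=
  eq_conv_sort (hom_der σ) (STm.raw_sub (hA := ⟨s.next, der_sort s Γ.wf⟩) σ a.ty)

/-- The universes of the syntactic model. -/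
noncomputable abbrev cwfU : CwFU.{0, 0, 0} SynCtx where
  toCwF := cwf
  El {s _} a := mkTy a.tm.raw ⟨s, code_der a⟩
  El_sub {s _ _} a σ := (mkTy_of (raw_code_sub a σ)).trans
    (sub_mkTy σ (hB := ⟨s, der_sub (code_der a) σ⟩)).symm
  El_congr a b h := by
    obtain ⟨t, ht⟩ := a
    obtain ⟨t', ht'⟩ := b
    obtain rfl : t = t' := h
    rfl
  univ s Γ := mkCode s.tm (der_sort s Γ.wf)
  univ_sub s {_ _} σ := code_ext <| .eq_trans (raw_code_sub _ _) <| .eq_trans (eq_conv_sort (hom_der σ)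
    (.eq_sub (raw_mkCode _) (.sbEq_refl (hom_der σ)))) <|
    .eq_trans (.eq_sort (hom_der σ)) (.eq_symm (raw_mkCode _))
  El_univ s _ := mkTy_of (raw_mkCode _)
  incl P := mkCode P.tm.raw (.incl (code_der P))
  incl_sub P σ := code_ext <| .eq_trans (raw_code_sub _ _) <| .eq_trans (eq_conv_sort (s := .tyL 0)
    (hom_der σ) (.eq_sub (raw_mkCode _) (.sbEq_refl (hom_der σ)))) <|
    .eq_trans (.eq_symm (.eq_incl (raw_code_sub P σ))) (.eq_symm (raw_mkCode _))
  El_incl P := mkTy_of (raw_mkCode (s := .tyL 0) (.incl (code_der P)))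

/-- The type by which a context entry extends a context. -/
noncomputable abbrev entryTm {Γ : SynCtx} : cwfU.Entry Γ → Tm
  | .comp _ a => a.tm.raw
  | .pvar => .prop
  | .hyp P => P.tm.raw

theorem entry_ctx {Γ : SynCtx} (e : cwfU.Entry Γ) : Der (.ctx (entryTm e :: Γ.ctx)) := by
  cases e with
  | comp i a => exact .ctx_comp Γ.wf (code_der a)
  | pvar => exact .ctx_pvar Γ.wf
  | hyp P => exact .ctx_hyp Γ.wf (code_der P)

theorem entry_der {Γ : SynCtx} (e : cwfU.Entry Γ) : ∃ s : Srt, Der (.tm Γ.ctx (entryTm e) s.tm) := by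
  cases e with
  | comp i a => exact ⟨_, code_der a⟩
  | pvar => exact ⟨.tyL 0, .prop Γ.wf⟩
  | hyp P => exact ⟨_, code_der P⟩

theorem entry_ty {Γ : SynCtx} (e : cwfU.Entry Γ) : e.ty = mkTy (entryTm e) (entry_der e) := by
  cases e <;> rfl

/-- Context extension. -/
noncomputable abbrev sext (Γ : SynCtx) (e : cwfU.Entry Γ) : SynCtx := ⟨entryTm e :: Γ.ctx, entry_ctx e⟩

/-- The projection. -/
noncomputable def sp {Γ : SynCtx} (e : cwfU.Entry Γ) : sext Γ e ⟶ Γ := mkHom .p (.sb_p (entry_ctx e))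

theorem raw_p {Γ : SynCtx} (e : cwfU.Entry Γ) : Der (.sbEq (sext Γ e).ctx (rep (sp e)) .p Γ.ctx) :=
  raw_mkHom _

theorem sub_entry_ty {Γ Δ : SynCtx} (σ : Δ ⟶ Γ) (e : cwfU.Entry Γ) :
    e.ty.sub σ = mkTy (.sub (entryTm e) (rep σ)) ((entry_der e).imp fun _ h => der_sub h σ) := by
  rw [entry_ty]; exact sub_mkTy _

theorem wk_der {Γ : SynCtx} (e : cwfU.Entry Γ) {A} {s : Srt} (h : Der (.tm Γ.ctx A s.tm)) :
    Der (.tm (sext Γ e).ctx (.wk A) s.tm) :=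
  der_conv_sort (.sb_p (entry_ctx e)) (.sub h (.sb_p (entry_ctx e)))

/-- The variable. -/
noncomputable def sq {Γ : SynCtx} (e : cwfU.Entry Γ) : cwf.Elt (sext Γ e) (e.ty.sub (sp e)) :=
  ⟨mkTm .q (.wk (entryTm e)) (.q (entry_ctx e)) ((entry_der e).imp fun _ h => wk_der e h),
    (mkTy_eq.2 (.symm _ _ (TyEq.sub_right (entry_der e) (hom_der _) (raw_p e)))).trans
      (sub_entry_ty (sp e) e).symm⟩

theorem raw_q {Γ : SynCtx} (e : cwfU.Entry Γ) :
    Der (.eq (sext Γ e).ctx (sq e).tm.raw .q (.wk (entryTm e))) :=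
  raw_mkTm (.q (entry_ctx e)) ((entry_der e).imp fun _ h => wk_der e h)

theorem elt_der {Γ Δ : SynCtx} {σ : Δ ⟶ Γ} {e : cwfU.Entry Γ} (t : cwf.Elt Δ (e.ty.sub σ)) :
    Der (.tm Δ.ctx t.tm.raw (.sub (entryTm e) (rep σ))) :=
  STm.der (t.ty.trans (sub_entry_ty σ e))

/-- Extension of a substitution by a term. -/
noncomputable def spair {Γ Δ : SynCtx} (σ : Δ ⟶ Γ) (e : cwfU.Entry Γ) (t : cwf.Elt Δ (e.ty.sub σ)) :
    Δ ⟶ sext Γ e :=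
  mkHom (.ext (rep σ) t.tm.raw) (.sb_ext (hom_der σ) (entry_ctx e) (elt_der t))

theorem raw_pair {Γ Δ : SynCtx} (σ : Δ ⟶ Γ) (e : cwfU.Entry Γ) (t : cwf.Elt Δ (e.ty.sub σ)) :
    Der (.sbEq Δ.ctx (rep (spair σ e t)) (.ext (rep σ) t.tm.raw) (sext Γ e).ctx) := raw_mkHom _

theorem spair_p {Γ Δ : SynCtx} (σ : Δ ⟶ Γ) (e : cwfU.Entry Γ) (t : cwf.Elt Δ (e.ty.sub σ)) :
    spair σ e t ≫ sp e = σ :=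
  Hom.ext <| .sbEq_trans (raw_comp _ _) <| .sbEq_trans (.sbEq_comp (raw_p e) (raw_pair σ e t)) <|
    .sbEq_p (hom_der σ) (entry_ctx e) (elt_der t)

theorem spair_q {Γ Δ : SynCtx} (σ : Δ ⟶ Γ) (e : cwfU.Entry Γ) (t : cwf.Elt Δ (e.ty.sub σ)) :
    (sq e).tm.sub (spair σ e t) = t.tm := by
  have h : ((sq e).tm.sub (spair σ e t)).typ = e.ty.sub σ := by
    refine (STm.typ_sub _ _).trans ((congrArg _ (sq e).ty).trans ?_)
    exact (STy.sub_comp _ _ _).symm.trans (congrArg (fun τ => e.ty.sub τ) (spair_p σ e t))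
  refine STm.ext (h.trans (sub_entry_ty σ e)) (t.ty.trans h.symm) ?_
  have hA : ∃ s : Srt, Der (.tm (sext Γ e).ctx (.wk (entryTm e)) s.tm) :=
    (entry_der e).imp fun _ h => wk_der e h
  have hA' : ∃ s : Srt, Der (.tm Δ.ctx (.sub (.wk (entryTm e)) (rep (spair σ e t))) s.tm) :=
    hA.imp fun _ h => der_sub h _
  have hq : (sq e).tm.typ = mkTy (.wk (entryTm e)) hA := rfl
  have e1 := STm.raw_sub (spair σ e t) hq
  have e2 : TyEq Δ.ctx (.sub (.wk (entryTm e)) (rep (spair σ e t))) (.sub (entryTm e) (rep σ)) := by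
    have h1 : ((sq e).tm.sub (spair σ e t)).typ = mkTy _ hA' :=
      (STm.typ_sub _ _).trans ((congrArg _ hq).trans (sub_mkTy _))
    exact mkTy_eq.1 (h1.symm.trans (h.trans (sub_entry_ty σ e)))
  exact .eq_trans ((e2.conv.2 _ _).1 (.eq_trans e1 (.eq_sub (raw_q e) (raw_pair σ e t))))
    (.eq_q (hom_der σ) (entry_ctx e) (elt_der t))

theorem spair_uniq {Γ Δ : SynCtx} {e : cwfU.Entry Γ} (σ τ : Δ ⟶ sext Γ e)
    (h : σ ≫ sp e = τ ≫ sp e) (h' : (sq e).tm.sub σ = (sq e).tm.sub τ) : σ = τ := by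
  have hA : ∃ s : Srt, Der (.tm (sext Γ e).ctx (.wk (entryTm e)) s.tm) :=
    (entry_der e).imp fun _ h => wk_der e h
  have hq : (sq e).tm.typ = mkTy (.wk (entryTm e)) hA := rfl
  have key : ∀ ρ : Δ ⟶ sext Γ e,
      Der (.sbEq Δ.ctx (.comp .p (rep ρ)) (rep (ρ ≫ sp e)) Γ.ctx) ∧
      Der (.eq Δ.ctx (.sub .q (rep ρ)) ((sq e).tm.sub ρ).raw
        (.sub (entryTm e) (rep (ρ ≫ sp e)))) := by
    intro ρ
    have h1 := Der.sbEq_symm (.sbEq_trans (raw_comp ρ (sp e))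
      (.sbEq_comp (raw_p e) (.sbEq_refl (hom_der ρ))))
    refine ⟨h1, ?_⟩
    have h2 := Der.eq_symm
      (.eq_trans (STm.raw_sub ρ hq) (.eq_sub (raw_q e) (.sbEq_refl (hom_der ρ))))
    obtain ⟨s, hs⟩ := entry_der e
    have h3 : TyEq Δ.ctx (.sub (.wk (entryTm e)) (rep ρ)) (.sub (entryTm e) (.comp .p (rep ρ))) :=
      TyEq.of (eq_conv_sort (hom_der ρ) (.eq_push (wk_der e hs) (hom_der ρ)))
    have h4 := TyEq.sub_right ⟨s, hs⟩ (.sb_comp (.sb_p (entry_ctx e)) (hom_der ρ)) h1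
    exact (h4.conv.2 _ _).1 ((h3.conv.2 _ _).1 h2)
  have k1 := key σ
  have k2 := key τ
  rw [← h, ← h'] at k2
  obtain ⟨s, hs⟩ := entry_der e
  have h4 := TyEq.sub_right ⟨s, hs⟩ (.sb_comp (.sb_p (entry_ctx e)) (hom_der σ)) k1.1
  refine Hom.ext (.sbEq_trans (.sbEq_symm (.sbEq_eta (entry_ctx e) (hom_der σ)))
    (.sbEq_trans (.sbEq_ext (.sbEq_trans k1.1 (.sbEq_symm k2.1)) (entry_ctx e)
      ((h4.conv.2 _ _).2 (.eq_trans k1.2 (.eq_symm k2.2)))) (.sbEq_eta (entry_ctx e) (hom_der τ))))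

/-- The comprehension of the syntactic model. -/
noncomputable abbrev cwfE : CwFE.{0, 0, 0} SynCtx where
  toCwFU := cwfU
  ext := sext
  p := sp
  q := sq
  pair := spair
  pair_p := spair_p
  pair_q := spair_q
  pair_uniq := spair_uniq


/-! Substitution calculus. -/

section Calculus

variable {Γ Δ Θ : Ctx} {A t : Tm} {σ σ' δ : Sb} {s : Srt}

theorem tm_sub (hA : Der (.tm Γ A s.tm)) (hσ : Der (.sb Δ σ Γ)) : Der (.tm Δ (.sub A σ) s.tm) :=
  der_conv_sort hσ (.sub hA hσ)

theorem sub_congr (hA : Der (.tm Γ A s.tm)) (hσ : Der (.sb Δ σ Γ)) (e : Der (.sbEq Δ σ σ' Γ)) :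
    Der (.eq Δ (.sub A σ) (.sub A σ') s.tm) :=
  eq_conv_sort hσ (.eq_sub (.eq_refl hA) e)

theorem sub_congr_left {B : Tm} (e : Der (.eq Γ A B s.tm)) (hσ : Der (.sb Δ σ Γ)) :
    Der (.eq Δ (.sub A σ) (.sub B σ) s.tm) :=
  eq_conv_sort hσ (.eq_sub e (.sbEq_refl hσ))

theorem push_sort (hA : Der (.tm Γ A s.tm)) (hσ : Der (.sb Δ σ Γ)) :
    Der (.eq Δ (.sub A σ) (A.push σ) s.tm) :=
  eq_conv_sort hσ (.eq_push hA hσ)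

theorem sub_sub (hA : Der (.tm Γ A s.tm)) (hσ : Der (.sb Δ σ Γ)) (hδ : Der (.sb Θ δ Δ)) :
    Der (.eq Θ (.sub (.sub A σ) δ) (.sub A (.comp σ δ)) s.tm) :=
  push_sort (tm_sub hA hσ) hδ

theorem ext_comp (hA : Der (.tm Γ A s.tm)) (hc : Der (.ctx (A :: Γ))) (hσ : Der (.sb Δ σ Γ))
    (ht : Der (.tm Δ t (.sub A σ))) (hδ : Der (.sb Θ δ Δ)) :
    Der (.sbEq Θ (.comp (.ext σ t) δ) (.ext (.comp σ δ) (.sub t δ)) (A :: Γ)) := by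
  have hp := Der.sb_p hc
  have he := Der.sb_ext hσ hc ht
  have hed := Der.sb_comp he hδ
  have k1 : Der (.sbEq Θ (.comp .p (.comp (.ext σ t) δ)) (.comp σ δ) Γ) :=
    .sbEq_trans (.sbEq_symm (.sbEq_assoc hp he hδ)) (.sbEq_comp (.sbEq_p hσ hc ht) (.sbEq_refl hδ))
  have e1 : Der (.eq Δ (.sub A.wk (.ext σ t)) (.sub A σ) s.tm) :=
    .eq_trans (sub_sub hA hp he) (sub_congr hA (.sb_comp hp he) (.sbEq_p hσ hc ht))
  have e2 : Der (.eq Θ (.sub (.sub A σ) δ) (.sub A (.comp .p (.comp (.ext σ t) δ))) s.tm) :=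
    .eq_trans (sub_sub hA hσ hδ) (.eq_symm (sub_congr hA (.sb_comp hp hed) k1))
  have k2 : Der (.eq Θ (.sub .q (.comp (.ext σ t) δ)) (.sub t δ) (.sub (.sub A σ) δ)) :=
    .eq_trans (.eq_conv (.eq_symm (.eq_push (.sub (.q hc) he) hδ)) (sub_congr_left e1 hδ))
      (.eq_sub (.eq_q hσ hc ht) (.sbEq_refl hδ))
  exact .sbEq_trans (.sbEq_symm (.sbEq_eta hc hed)) (.sbEq_ext k1 hc (.eq_conv k2 e2))

/-- The data that make `σ.lift` a substitution from `Δ, A'` to `Γ, A`. -/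
structure Fits (Γ : Ctx) (A : Tm) (Δ : Ctx) (A' : Tm) (σ : Sb) (s : Srt) : Prop where
  hA : Der (.tm Γ A s.tm)
  hc : Der (.ctx (A :: Γ))
  hc' : Der (.ctx (A' :: Δ))
  hσ : Der (.sb Δ σ Γ)
  e : Der (.eq Δ A' (.sub A σ) s.tm)

namespace Fits

variable {A' A'' : Tm}

theorem q (f : Fits Γ A Δ A' σ s) : Der (.tm (A' :: Δ) .q (.sub A (.comp σ .p))) :=
  .conv (.q f.hc') (.eq_trans (sub_congr_left f.e (.sb_p f.hc')) (sub_sub f.hA f.hσ (.sb_p f.hc')))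

theorem lift (f : Fits Γ A Δ A' σ s) : Der (.sb (A' :: Δ) σ.lift (A :: Γ)) :=
  .sb_ext (.sb_comp f.hσ (.sb_p f.hc')) f.hc f.q

theorem congr (f : Fits Γ A Δ A' σ s) (h : Der (.sbEq Δ σ σ' Γ)) :
    Der (.sbEq (A' :: Δ) σ.lift σ'.lift (A :: Γ)) :=
  .sbEq_ext (.sbEq_comp h (.sbEq_refl (.sb_p f.hc'))) f.hc (.eq_refl f.q)

theorem ext (f : Fits Γ A Δ A' σ s) (hδ : Der (.sb Θ δ Δ)) (ht : Der (.tm Θ t (.sub A' δ))) :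
    Der (.sbEq Θ (.comp σ.lift (.ext δ t)) (.ext (.comp σ δ) t) (A :: Γ)) := by
  have hp := Der.sb_p f.hc'
  have he := Der.sb_ext hδ f.hc' ht
  have k : Der (.sbEq Θ (.comp (.comp σ .p) (.ext δ t)) (.comp σ δ) Γ) :=
    .sbEq_trans (.sbEq_assoc f.hσ hp he) (.sbEq_comp (.sbEq_refl f.hσ) (.sbEq_p hδ f.hc' ht))
  have hσp := Der.sb_comp f.hσ hp
  refine .sbEq_trans (ext_comp f.hA f.hc hσp f.q he) (.sbEq_ext k f.hc (.eq_conv (s := s)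
    (.eq_q hδ f.hc' ht) ?_))
  exact .eq_trans (sub_congr_left f.e hδ) (.eq_trans (sub_sub f.hA f.hσ hδ) (.eq_symm (sub_congr f.hA
    (.sb_comp hσp he) k)))

theorem comp (f : Fits Γ A Δ A' σ s) (g : Fits Δ A' Θ A'' δ s) :
    Der (.sbEq (A'' :: Θ) (.comp σ.lift δ.lift) (Sb.lift (.comp σ δ)) (A :: Γ)) := by
  have hp := Der.sb_p g.hc'
  refine .sbEq_trans (f.ext (.sb_comp g.hσ hp) g.q) (.sbEq_ext (.sbEq_symm (.sbEq_assoc f.hσ g.hσ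
    hp)) f.hc (.eq_refl (.conv (s := s) g.q ?_)))
  exact .eq_trans (sub_congr_left f.e (.sb_comp g.hσ hp)) (sub_sub f.hA f.hσ (.sb_comp g.hσ hp))

theorem trans (f : Fits Γ A Δ A' σ s) (g : Fits Δ A' Θ A'' δ s) : Fits Γ A Θ A'' (.comp σ δ) s :=
  ⟨f.hA, f.hc, g.hc', .sb_comp f.hσ g.hσ,
    .eq_trans g.e (.eq_trans (sub_congr_left f.e g.hσ) (sub_sub f.hA f.hσ g.hσ))⟩

theorem of_eq (f : Fits Γ A Δ A' σ s) (h : Der (.sbEq Δ σ σ' Γ)) (h' : Der (.sb Δ σ' Γ)) :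
    Fits Γ A Δ A' σ' s :=
  ⟨f.hA, f.hc, f.hc', h', .eq_trans f.e (sub_congr f.hA f.hσ h)⟩

end Fits

theorem fits_id {A' : Tm} (hA : Der (.tm Γ A s.tm)) (hc : Der (.ctx (A :: Γ)))
    (hc' : Der (.ctx (A' :: Γ))) (hΓ : Der (.ctx Γ)) (e : Der (.eq Γ A' A s.tm)) :
    Fits Γ A Γ A' .id s :=
  ⟨hA, hc, hc', .sb_id hΓ, .eq_trans e (.eq_symm (.eq_sub_id hA))⟩

/-- The substitution `⟨p ∘ p, q⟩ ∘ ⟨id, q⟩` is the identity. -/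
theorem lift_inst {i : ℕ} (hA : Der (.tm Γ A (.uc i))) (hc : Der (.ctx (A :: Γ))) :
    Der (.ctx (A.wk :: A :: Γ)) ∧ Der (.sb (A.wk :: A :: Γ) (Sb.lift .p) (A :: Γ)) ∧
    Der (.sb (A :: Γ) (.inst .q) (A.wk :: A :: Γ)) ∧
    Der (.sbEq (A :: Γ) (.comp (Sb.lift .p) (.inst .q)) .id (A :: Γ)) := by
  have hp := Der.sb_p hc
  have hid := Der.sb_id hc
  have hAw : Der (.tm (A :: Γ) A.wk (.uc i)) := tm_sub (s := .uc i) hA hp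
  have hc2 := Der.ctx_comp hc hAw
  have f : Fits Γ A (A :: Γ) A.wk .p (.uc i) := ⟨hA, hc, hc2, hp, .eq_refl hAw⟩
  have hq : Der (.tm (A :: Γ) .q (.sub A.wk .id)) :=
    .conv (s := .uc i) (.q hc) (.eq_symm (.eq_sub_id hAw))
  refine ⟨hc2, f.lift, .sb_ext hid hc2 hq, .sbEq_trans (f.ext hid hq) (.sbEq_trans
    (.sbEq_ext (.sbEq_refl (.sb_comp hp hid)) hc (.eq_conv (s := .uc i)
      (.eq_symm (.eq_sub_id (.q hc))) ?_)) (.sbEq_eta hc hid))⟩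
  exact .eq_trans (.eq_symm (.eq_sub_id hAw)) (sub_sub (s := .uc i) hA hp hid)

end Calculus


open CwFE

theorem val_der {s : Srt} {Γ : SynCtx} {a : cwf.Code s Γ} (x : cwfU.Val a) :
    Der (.tm Γ.ctx x.tm.raw a.tm.raw) := STm.der x.ty

theorem val_der' {s : Srt} {Γ : SynCtx} {a : cwf.Code s Γ} (x : cwfU.Val a) {F : Tm}
    (e : Der (.eq Γ.ctx a.tm.raw F s.tm)) : Der (.tm Γ.ctx x.tm.raw F) := .conv (val_der x) e

theorem val_ext {s : Srt} {Γ : SynCtx} {a : cwf.Code s Γ} {x y : cwfU.Val a} {F : Tm}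
    (e : Der (.eq Γ.ctx a.tm.raw F s.tm)) (h : Der (.eq Γ.ctx x.tm.raw y.tm.raw F)) : x = y :=
  CwF.Elt.ext (STm.ext x.ty (y.ty.trans x.ty.symm) (.eq_conv h (.eq_symm e)))

/-- The class of a term of a type given by a code. -/
noncomputable def mkVal {s : Srt} {Γ : SynCtx} (a : cwf.Code s Γ) {F : Tm} (e : Der (.eq Γ.ctx a.tm.raw F s.tm))
    (t : Tm) (h : Der (.tm Γ.ctx t F)) : cwfU.Val a :=
  ⟨mkTm t a.tm.raw (.conv h (.eq_symm e)) ⟨s, code_der a⟩, rfl⟩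

theorem raw_mkVal {s : Srt} {Γ : SynCtx} {a : cwf.Code s Γ} {F : Tm}
    (e : Der (.eq Γ.ctx a.tm.raw F s.tm)) {t : Tm} (h : Der (.tm Γ.ctx t F)) :
    Der (.eq Γ.ctx (mkVal a e t h).tm.raw t F) :=
  .eq_conv (raw_mkTm (.conv h (.eq_symm e)) ⟨s, code_der a⟩) e

theorem raw_val_sub {s : Srt} {Γ Δ : SynCtx} {a : cwf.Code s Γ} (x : cwfU.Val a) (σ : Δ ⟶ Γ)
    {b : cwf.Code s Δ} (h : a.sub σ = b) :
    Der (.eq Δ.ctx (x.sub σ h).tm.raw (.sub x.tm.raw (rep σ)) b.tm.raw) := by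
  subst h
  exact .eq_conv (STm.raw_sub σ x.ty) (.eq_symm (raw_code_sub a σ))

/-- Substitution in an operation with values in a universe. -/
theorem code_law {s : Srt} {Γ Δ : SynCtx} {a : cwf.Code s Γ} {t : Tm} (ht : Der (.tm Γ.ctx t s.tm))
    (ha : Der (.eq Γ.ctx a.tm.raw t s.tm)) (σ : Δ ⟶ Γ) {b : cwf.Code s Δ} {t' : Tm}
    (hb : Der (.eq Δ.ctx b.tm.raw t' s.tm)) (hc : Der (.eq Δ.ctx t' (t.push (rep σ)) s.tm)) :
    a.sub σ = b :=
  code_ext <| .eq_trans (raw_code_sub a σ) <| .eq_trans (eq_conv_sort (hom_der σ) <|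
    .eq_trans (.eq_sub ha (.sbEq_refl (hom_der σ))) (.eq_push ht (hom_der σ))) <|
    .eq_trans (.eq_symm hc) (.eq_symm hb)

/-- Substitution in an operation with values in a type. -/
theorem val_law {s : Srt} {Γ Δ : SynCtx} {a : cwf.Code s Γ} {x : cwfU.Val a} {t F : Tm}
    (ht : Der (.tm Γ.ctx t F)) (e : Der (.eq Γ.ctx a.tm.raw F s.tm))
    (hx : Der (.eq Γ.ctx x.tm.raw t F)) (σ : Δ ⟶ Γ) {b : cwf.Code s Δ} (h : a.sub σ = b)
    {y : cwfU.Val b} {t' F' : Tm} (e' : Der (.eq Δ.ctx b.tm.raw F' s.tm))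
    (hy : Der (.eq Δ.ctx y.tm.raw t' F')) (hc : Der (.eq Δ.ctx t' (t.push (rep σ)) F')) :
    x.sub σ h = y := by
  have h1 : Der (.eq Δ.ctx (.sub F (rep σ)) b.tm.raw s.tm) := by
    rw [← h]
    exact .eq_symm (.eq_trans (raw_code_sub a σ) (eq_conv_sort (hom_der σ)
      (.eq_sub e (.sbEq_refl (hom_der σ)))))
  refine val_ext e' (.eq_trans (.eq_conv (raw_val_sub x σ h) e') (.eq_trans (.eq_conv (.eq_trans
    (.eq_sub hx (.sbEq_refl (hom_der σ))) (.eq_push ht (hom_der σ))) (.eq_trans h1 e')) ?_))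
  exact .eq_trans (.eq_symm hc) (.eq_symm hy)

section Binders

variable {i : ℕ} {Γ Δ : SynCtx}

theorem raw_var (a : cwf.Code (.uc i) Γ) :
    Der (.eq (a.tm.raw :: Γ.ctx) (var (M := cwfE) a).tm.raw .q (.wk a.tm.raw)) :=
  raw_q (.comp i a)

theorem ctx_cons (a : cwf.Code (.uc i) Γ) : Der (.ctx (a.tm.raw :: Γ.ctx)) := entry_ctx (.comp i a)

theorem der_p (a : cwf.Code (.uc i) Γ) : Der (.sb (a.tm.raw :: Γ.ctx) .p Γ.ctx) :=
  .sb_p (ctx_cons a)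

theorem raw_up (σ : Δ ⟶ Γ) (a : cwf.Code (.uc i) Γ) {a' : cwf.Code (.uc i) Δ}
    (h : a.sub σ = a' := by rfl) :
    Der (.sbEq (a'.tm.raw :: Δ.ctx) (rep (up (M := cwfE) σ a h)) (rep σ).lift
      (a.tm.raw :: Γ.ctx)) := by
  refine .sbEq_trans (raw_mkHom (Δ := cons (M := cwfE) a') (Γ := cons (M := cwfE) a) _) ?_
  have h1 : Der (.sbEq (a'.tm.raw :: Δ.ctx) (rep (sp (.comp i a') ≫ σ)) (.comp (rep σ) .p) Γ.ctx) :=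
    .sbEq_trans (raw_comp (sp (.comp i a')) σ) (.sbEq_comp (.sbEq_refl (hom_der σ)) (raw_p (.comp i a')))
  refine .sbEq_ext h1 (ctx_cons a) (.eq_conv (raw_var a') (s := .uc i) ?_)
  have h2 : Der (.eq (a'.tm.raw :: Δ.ctx) (.wk a'.tm.raw) (.wk (.sub a.tm.raw (rep σ))) (.uc i)) := by
    rw [← h]
    exact eq_conv_sort (s := .uc i) (der_p _) (.eq_sub (raw_code_sub a σ) (.sbEq_refl (der_p _)))
  refine .eq_trans h2 (.eq_trans (eq_conv_sort (s := .uc i) (der_p _) (.eq_push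
    (der_sub (s := .uc i) (code_der a) σ) (der_p _))) ?_)
  exact .eq_symm (eq_conv_sort (s := .uc i) (hom_der (sp (.comp i a') ≫ σ)) (.eq_sub (.eq_refl (code_der a)) h1))

theorem raw_code_up {s : Srt} (σ : Δ ⟶ Γ) (a : cwf.Code (.uc i) Γ) {a' : cwf.Code (.uc i) Δ}
    (b : cwf.Code s (cons (M := cwfE) a)) (h : a.sub σ = a' := by rfl) :
    Der (.eq (a'.tm.raw :: Δ.ctx) (b.sub (up (M := cwfE) σ a h)).tm.raw
      (.sub b.tm.raw (rep σ).lift) s.tm) :=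
  .eq_trans (raw_code_sub b (up (M := cwfE) σ a h)) (eq_conv_sort (hom_der (up (M := cwfE) σ a h))
    (.eq_sub (.eq_refl (code_der b)) (raw_up σ a h)))

theorem raw_val_up {s : Srt} (σ : Δ ⟶ Γ) {a : cwf.Code (.uc i) Γ} {a' : cwf.Code (.uc i) Δ}
    {b : cwf.Code s (cons (M := cwfE) a)} (t : cwfU.Val b) {h : a.sub σ = a'}
    {b' : cwf.Code s (cons (M := cwfE) a')} (hb : b.sub (up (M := cwfE) σ a h) = b') :
    Der (.eq (a'.tm.raw :: Δ.ctx) (t.sub (up (M := cwfE) σ a h) hb).tm.raw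
      (.sub t.tm.raw (rep σ).lift) b'.tm.raw) := by
  refine .eq_trans (raw_val_sub t _ hb) ?_
  subst hb
  exact .eq_conv (.eq_sub (.eq_refl (val_der t)) (raw_up σ a h)) (.eq_symm (raw_code_sub b (up (M := cwfE) σ a h)))

theorem raw_at1 {a : cwf.Code (.uc i) Γ} (x : cwfU.Val a) :
    Der (.sbEq Γ.ctx (rep (at1 (M := cwfE) x)) (.inst x.tm.raw) (a.tm.raw :: Γ.ctx)) := by
  refine .sbEq_trans (raw_mkHom _) (.sbEq_ext (raw_id Γ) (ctx_cons a) (.eq_refl ?_))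
  exact .conv (val_der x) (s := .uc i) (.eq_symm (.eq_trans (eq_conv_sort (s := .uc i) (hom_der (𝟙 Γ))
    (.eq_sub (.eq_refl (code_der a)) (raw_id Γ))) (.eq_sub_id (code_der a))))

theorem raw_code_at1 {s : Srt} {a : cwf.Code (.uc i) Γ} (x : cwfU.Val a)
    (b : cwf.Code s (cons (M := cwfE) a)) :
    Der (.eq Γ.ctx (b.sub (at1 (M := cwfE) x)).tm.raw (.sub b.tm.raw (.inst x.tm.raw)) s.tm) :=
  .eq_trans (raw_code_sub _ _) (eq_conv_sort (hom_der (at1 (M := cwfE) x))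
    (.eq_sub (.eq_refl (code_der b)) (raw_at1 x)))

theorem raw_val_at1 {s : Srt} {a : cwf.Code (.uc i) Γ} (x : cwfU.Val a)
    {b : cwf.Code s (cons (M := cwfE) a)} (t : cwfU.Val b) {b' : cwf.Code s Γ}
    (hb : b.sub (at1 (M := cwfE) x) = b') :
    Der (.eq Γ.ctx (t.sub (at1 (M := cwfE) x) hb).tm.raw (.sub t.tm.raw (.inst x.tm.raw))
      b'.tm.raw) := by
  refine .eq_trans (raw_val_sub t _ hb) ?_
  subst hb
  exact .eq_conv (.eq_sub (.eq_refl (val_der t)) (raw_at1 x)) (.eq_symm (raw_code_sub b _))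

end Binders

section Products

variable {i : ℕ} {Γ : SynCtx}

noncomputable def spi (a : cwf.Code (.uc i) Γ) (b : cwf.Code (.uc i) (cons (M := cwfE) a)) :
    cwf.Code (.uc i) Γ :=
  mkCode (.pi i a.tm.raw b.tm.raw) (.pi (code_der a) (code_der b))

noncomputable def ssig (a : cwf.Code (.uc i) Γ) (b : cwf.Code (.uc i) (cons (M := cwfE) a)) :
    cwf.Code (.uc i) Γ :=
  mkCode (.sig i a.tm.raw b.tm.raw) (.sig (code_der a) (code_der b))

theorem raw_pi (a : cwf.Code (.uc i) Γ) (b : cwf.Code (.uc i) (cons (M := cwfE) a)) :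
    Der (.eq Γ.ctx (spi a b).tm.raw (.pi i a.tm.raw b.tm.raw) (.uc i)) := raw_mkCode _

theorem raw_sig (a : cwf.Code (.uc i) Γ) (b : cwf.Code (.uc i) (cons (M := cwfE) a)) :
    Der (.eq Γ.ctx (ssig a b).tm.raw (.sig i a.tm.raw b.tm.raw) (.uc i)) := raw_mkCode _

theorem spi_sub {Δ : SynCtx} (σ : Δ ⟶ Γ) (a : cwf.Code (.uc i) Γ)
    (b : cwf.Code (.uc i) (cons (M := cwfE) a)) :
    (spi a b).sub σ = spi (a.sub σ) (b.sub (up (M := cwfE) σ a)) :=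
  code_law (.pi (code_der a) (code_der b)) (raw_pi a b) σ (raw_pi _ _)
    (.eq_pi (raw_code_sub a σ) (raw_code_up σ a b))

theorem ssig_sub {Δ : SynCtx} (σ : Δ ⟶ Γ) (a : cwf.Code (.uc i) Γ)
    (b : cwf.Code (.uc i) (cons (M := cwfE) a)) :
    (ssig a b).sub σ = ssig (a.sub σ) (b.sub (up (M := cwfE) σ a)) :=
  code_law (.sig (code_der a) (code_der b)) (raw_sig a b) σ (raw_sig _ _)
    (.eq_sig (raw_code_sub a σ) (raw_code_up σ a b))


noncomputable def slam {a : cwf.Code (.uc i) Γ} {b : cwf.Code (.uc i) (cons (M := cwfE) a)}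
    (t : cwfU.Val b) : cwfU.Val (spi a b) :=
  mkVal _ (raw_pi a b) (.lam i a.tm.raw b.tm.raw t.tm.raw) (.lam (code_der a) (code_der b) (val_der t))

theorem raw_lam {a : cwf.Code (.uc i) Γ} {b : cwf.Code (.uc i) (cons (M := cwfE) a)}
    (t : cwfU.Val b) : Der (.eq Γ.ctx (slam t).tm.raw (.lam i a.tm.raw b.tm.raw t.tm.raw)
      (.pi i a.tm.raw b.tm.raw)) :=
  raw_mkVal (raw_pi a b) (.lam (code_der a) (code_der b) (val_der t))

/-- The body of the `η`-expansion of `f`. -/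
theorem app_var {Γ : Ctx} {A B f : Tm} (hc : Der (.ctx (A :: Γ))) (hA : Der (.tm Γ A (.uc i)))
    (hB : Der (.tm (A :: Γ) B (.uc i))) (hf : Der (.tm Γ f (.pi i A B))) :
    Der (.tm (A :: Γ) A.wk (.uc i)) ∧ Der (.tm (A.wk :: A :: Γ) (.sub B (Sb.lift .p)) (.uc i)) ∧
    Der (.eq (A :: Γ) (.sub (.sub B (Sb.lift .p)) (.inst .q)) B (.uc i)) ∧
    Der (.eq (A :: Γ) (.wk (.pi i A B)) (.pi i A.wk (.sub B (Sb.lift .p))) (.uc i)) ∧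
    Der (.tm (A :: Γ) f.wk (.pi i A.wk (.sub B (Sb.lift .p)))) := by
  obtain ⟨hc2, hl, hi, hli⟩ := lift_inst hA hc
  have hp := Der.sb_p hc
  have hAw : Der (.tm (A :: Γ) A.wk (.uc i)) := der_conv_sort (s := .uc i) hp (.sub hA hp)
  have hBl : Der (.tm (A.wk :: A :: Γ) (.sub B (Sb.lift .p)) (.uc i)) :=
    der_conv_sort (s := .uc i) hl (.sub hB hl)
  have hP : Der (.eq (A :: Γ) (.wk (.pi i A B)) (.pi i A.wk (.sub B (Sb.lift .p))) (.uc i)) :=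
    eq_conv_sort (s := .uc i) hp (.eq_push (.pi hA hB) hp)
  exact ⟨hAw, hBl, .eq_trans (eq_conv_sort (s := .uc i) hi (.eq_push hBl hi)) (.eq_trans
    (eq_conv_sort (s := .uc i) (.sb_comp hl hi) (.eq_sub (.eq_refl hB) hli)) (.eq_sub_id hB)),
    hP, .conv (s := .uc i) (.sub hf hp) hP⟩

noncomputable def sapp {a : cwf.Code (.uc i) Γ} {b : cwf.Code (.uc i) (cons (M := cwfE) a)}
    (f : cwfU.Val (spi a b)) : cwfU.Val b :=
  have h := app_var (ctx_cons a) (code_der a) (code_der b) (val_der' f (raw_pi a b))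
  mkVal b (.eq_symm h.2.2.1)
    (.app i a.tm.raw.wk (.sub b.tm.raw (Sb.lift .p)) f.tm.raw.wk .q)
    (.app h.1 h.2.1 h.2.2.2.2 (.q (ctx_cons a)))

theorem raw_app {a : cwf.Code (.uc i) Γ} {b : cwf.Code (.uc i) (cons (M := cwfE) a)}
    (f : cwfU.Val (spi a b)) : Der (.eq (a.tm.raw :: Γ.ctx) (sapp f).tm.raw
      (.app i a.tm.raw.wk (.sub b.tm.raw (Sb.lift .p)) f.tm.raw.wk .q) b.tm.raw) := by
  have h := app_var (ctx_cons a) (code_der a) (code_der b) (val_der' f (raw_pi a b))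
  exact .eq_conv (raw_mkVal (Γ := cons (M := cwfE) a) (a := b) (.eq_symm h.2.2.1)
    (.app h.1 h.2.1 h.2.2.2.2 (.q (ctx_cons a)))) (s := .uc i) h.2.2.1

noncomputable def slamEquiv {a : cwf.Code (.uc i) Γ} {b : cwf.Code (.uc i) (cons (M := cwfE) a)} :
    cwfU.Val b ≃ cwfU.Val (spi a b) where
  toFun := slam
  invFun := sapp
  left_inv t := by
    have hA := code_der a
    have hB := code_der b
    have ht := val_der t
    have hc := ctx_cons a
    have h := app_var hc hA hB (.lam hA hB ht)
    obtain ⟨hc2, hl, hi, hli⟩ := lift_inst hA hc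
    have hp := Der.sb_p hc
    refine val_ext (Γ := cons (M := cwfE) a) (a := b) (.eq_refl hB) (.eq_trans (raw_app _) ?_)
    refine .eq_conv (s := .uc i) (A := .sub (.sub b.tm.raw (Sb.lift .p)) (.inst .q)) ?_ h.2.2.1
    have e1 : Der (.eq (a.tm.raw :: Γ.ctx) (slam t).tm.raw.wk (.lam i a.tm.raw.wk
        (.sub b.tm.raw (Sb.lift .p)) (.sub t.tm.raw (Sb.lift .p)))
        (.pi i a.tm.raw.wk (.sub b.tm.raw (Sb.lift .p)))) :=
      .eq_conv (s := .uc i) (.eq_trans (.eq_sub (raw_lam t) (.sbEq_refl hp))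
        (.eq_push (.lam hA hB ht) hp)) h.2.2.2.1
    refine .eq_trans (.eq_app (.eq_refl h.1) (.eq_refl h.2.1) e1 (.eq_refl (.q hc)))
      (.eq_trans (.pi_beta h.1 h.2.1 (.sub ht hl) (.q hc)) ?_)
    refine .eq_trans (.eq_push (.sub ht hl) hi) (.eq_conv (s := .uc i) ?_ (.eq_symm h.2.2.1))
    exact .eq_trans (.eq_conv (s := .uc i) (.eq_sub (.eq_refl ht) hli) (.eq_trans
      (eq_conv_sort (s := .uc i) (.sb_comp hl hi) (.eq_sub (.eq_refl hB) hli)) (.eq_sub_id hB)))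
      (.eq_sub_id ht)
  right_inv f := by
    refine val_ext (raw_pi a b) (.eq_trans (raw_lam _) (.eq_trans (.eq_lam (.eq_refl (code_der a))
      (.eq_refl (code_der b)) (raw_app f)) (.pi_eta (code_der a) (code_der b)
      (val_der' f (raw_pi a b)))))

theorem slam_sub {Δ : SynCtx} (σ : Δ ⟶ Γ) {a : cwf.Code (.uc i) Γ}
    {b : cwf.Code (.uc i) (cons (M := cwfE) a)} (t : cwfU.Val b) :
    cwf.subTm σ (slam t).tm = (slam (t.sub (up (M := cwfE) σ a))).tm :=
  congrArg CwF.Elt.tm <| val_law (.lam (code_der a) (code_der b) (val_der t)) (raw_pi a b) (raw_lam t) σ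
    (spi_sub σ a b) (raw_pi _ _) (raw_lam _)
    (.eq_lam (raw_code_sub a σ) (raw_code_up σ a b) (raw_val_up σ t rfl))

theorem sigma_ext {a : cwf.Code (.uc i) Γ} {b : cwf.Code (.uc i) (cons (M := cwfE) a)}
    {z z' : Σ x : cwfU.Val a, cwfU.Val (b.sub (at1 (M := cwfE) x))} (h : z.1 = z'.1)
    (h' : z.2.tm = z'.2.tm) : z = z' := by
  obtain ⟨x, y⟩ := z
  obtain ⟨x', y'⟩ := z'
  obtain rfl : x = x' := h
  obtain rfl : y = y' := CwF.Elt.ext h'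
  rfl

noncomputable def spr {a : cwf.Code (.uc i) Γ} {b : cwf.Code (.uc i) (cons (M := cwfE) a)}
    (x : cwfU.Val a) (y : cwfU.Val (b.sub (at1 (M := cwfE) x))) : cwfU.Val (ssig a b) :=
  mkVal _ (raw_sig a b) (.pair i a.tm.raw b.tm.raw x.tm.raw y.tm.raw)
    (.pair (code_der a) (code_der b) (val_der x) (val_der' y (raw_code_at1 x b)))

theorem raw_pr {a : cwf.Code (.uc i) Γ} {b : cwf.Code (.uc i) (cons (M := cwfE) a)}
    (x : cwfU.Val a) (y : cwfU.Val (b.sub (at1 (M := cwfE) x))) :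
    Der (.eq Γ.ctx (spr x y).tm.raw (.pair i a.tm.raw b.tm.raw x.tm.raw y.tm.raw)
      (.sig i a.tm.raw b.tm.raw)) :=
  raw_mkVal (raw_sig a b) (.pair (code_der a) (code_der b) (val_der x)
    (val_der' y (raw_code_at1 x b)))

noncomputable def sfst {a : cwf.Code (.uc i) Γ} {b : cwf.Code (.uc i) (cons (M := cwfE) a)}
    (c : cwfU.Val (ssig a b)) : cwfU.Val a :=
  mkVal a (.eq_refl (code_der a)) (.fst i a.tm.raw b.tm.raw c.tm.raw)
    (.fst (code_der a) (code_der b) (val_der' c (raw_sig a b)))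

theorem raw_fst {a : cwf.Code (.uc i) Γ} {b : cwf.Code (.uc i) (cons (M := cwfE) a)}
    (c : cwfU.Val (ssig a b)) :
    Der (.eq Γ.ctx (sfst c).tm.raw (.fst i a.tm.raw b.tm.raw c.tm.raw) a.tm.raw) :=
  raw_mkVal (.eq_refl (code_der a)) (.fst (code_der a) (code_der b) (val_der' c (raw_sig a b)))

theorem code_inst_congr {a : cwf.Code (.uc i) Γ} {b : cwf.Code (.uc i) (cons (M := cwfE) a)}
    {r r' : Tm} (hr : Der (.eq Γ.ctx r r' a.tm.raw)) (h : Der (.tm Γ.ctx r a.tm.raw)) :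
    Der (.eq Γ.ctx (.sub b.tm.raw (.inst r)) (.sub b.tm.raw (.inst r')) (.uc i)) := by
  have e : Der (.eq Γ.ctx (.sub a.tm.raw .id) a.tm.raw (.uc i)) := .eq_sub_id (code_der a)
  exact eq_conv_sort (s := .uc i) (.sb_ext (.sb_id Γ.wf) (ctx_cons a) (.conv (s := .uc i) h (.eq_symm e)))
    (.eq_sub (.eq_refl (code_der b)) (.sbEq_ext (.sbEq_refl (.sb_id Γ.wf)) (ctx_cons a)
      (.eq_conv (s := .uc i) hr (.eq_symm e))))

theorem snd_type {a : cwf.Code (.uc i) Γ} {b : cwf.Code (.uc i) (cons (M := cwfE) a)}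
    (c : cwfU.Val (ssig a b)) :
    Der (.eq Γ.ctx (b.sub (at1 (M := cwfE) (sfst c))).tm.raw
      (.sub b.tm.raw (.inst (.fst i a.tm.raw b.tm.raw c.tm.raw))) (.uc i)) :=
  .eq_trans (raw_code_at1 (sfst c) b) (code_inst_congr (raw_fst c) (val_der (sfst c)))

noncomputable def ssnd {a : cwf.Code (.uc i) Γ} {b : cwf.Code (.uc i) (cons (M := cwfE) a)}
    (c : cwfU.Val (ssig a b)) : cwfU.Val (b.sub (at1 (M := cwfE) (sfst c))) :=
  mkVal _ (snd_type c) (.snd i a.tm.raw b.tm.raw c.tm.raw)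
    (.snd (code_der a) (code_der b) (val_der' c (raw_sig a b)))

theorem raw_snd {a : cwf.Code (.uc i) Γ} {b : cwf.Code (.uc i) (cons (M := cwfE) a)}
    (c : cwfU.Val (ssig a b)) :
    Der (.eq Γ.ctx (ssnd c).tm.raw (.snd i a.tm.raw b.tm.raw c.tm.raw)
      (.sub b.tm.raw (.inst (.fst i a.tm.raw b.tm.raw c.tm.raw)))) :=
  raw_mkVal (snd_type c) (.snd (code_der a) (code_der b) (val_der' c (raw_sig a b)))

noncomputable def sprEquiv {a : cwf.Code (.uc i) Γ} {b : cwf.Code (.uc i) (cons (M := cwfE) a)} :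
    (Σ x : cwfU.Val a, cwfU.Val (b.sub (at1 (M := cwfE) x))) ≃ cwfU.Val (ssig a b) where
  toFun z := spr z.1 z.2
  invFun c := ⟨sfst c, ssnd c⟩
  left_inv := by
    rintro ⟨x, y⟩
    have hA := code_der a
    have hB := code_der b
    have hx := val_der x
    have hy := val_der' y (raw_code_at1 x b)
    have h1 : sfst (spr x y) = x := val_ext (.eq_refl hA) (.eq_trans (raw_fst _) (.eq_trans
      (.eq_fst (.eq_refl hA) (.eq_refl hB) (raw_pr x y)) (.fst_beta hA hB hx hy)))
    refine sigma_ext h1 ?_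
    have h2 : (b.sub (at1 (M := cwfE) (sfst (spr x y)))) = b.sub (at1 (M := cwfE) x) := by rw [h1]
    refine STm.ext (ssnd _).ty ?_ (.eq_conv (s := .uc i) ?_ (.eq_symm (snd_type (spr x y))))
    · exact y.ty.trans ((congrArg cwfU.El h2.symm).trans (ssnd _).ty.symm)
    have e : Der (.eq Γ.ctx (.sub b.tm.raw (.inst (.fst i a.tm.raw b.tm.raw (spr x y).tm.raw)))
        (.sub b.tm.raw (.inst x.tm.raw)) (.uc i)) :=
      code_inst_congr (.eq_trans (.eq_symm (raw_fst (spr x y))) (by rw [h1]; exact .eq_refl hx))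
        (.fst hA hB (val_der' _ (raw_sig a b)))
    refine .eq_trans (raw_snd _) (.eq_trans (.eq_snd (.eq_refl hA) (.eq_refl hB) (raw_pr x y)) ?_)
    exact .eq_conv (s := .uc i) (.snd_beta hA hB hx hy) (.eq_symm e)
  right_inv c := by
    have hA := code_der a
    have hB := code_der b
    have e : Der (.eq Γ.ctx (.sub b.tm.raw (.inst (.fst i a.tm.raw b.tm.raw c.tm.raw)))
        (.sub b.tm.raw (.inst (sfst c).tm.raw)) (.uc i)) :=
      .eq_symm (code_inst_congr (raw_fst c) (val_der (sfst c)))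
    exact val_ext (raw_sig a b) (.eq_trans (raw_pr _ _) (.eq_trans (.eq_pair (.eq_refl hA)
      (.eq_refl hB) (raw_fst c) (.eq_conv (s := .uc i) (raw_snd c) e))
      (.sig_eta hA hB (val_der' c (raw_sig a b)))))

theorem spr_sub {Δ : SynCtx} (σ : Δ ⟶ Γ) {a : cwf.Code (.uc i) Γ}
    {b : cwf.Code (.uc i) (cons (M := cwfE) a)} (x : cwfU.Val a)
    (y : cwfU.Val (b.sub (at1 (M := cwfE) x))) :
    cwf.subTm σ (spr x y).tm = (spr (a := a.sub σ) (b := b.sub (up (M := cwfE) σ a)) (x.sub σ)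
      (y.sub σ (sub_at1 (M := cwfE) σ x b))).tm :=
  congrArg CwF.Elt.tm <| val_law (.pair (code_der a) (code_der b) (val_der x)
    (val_der' y (raw_code_at1 x b))) (raw_sig a b) (raw_pr x y) σ
    (ssig_sub σ a b) (raw_sig _ _) (raw_pr _ _)
    (.eq_pair (raw_code_sub a σ) (raw_code_up σ a b) (raw_val_sub x σ rfl)
      (.eq_conv (s := .uc i) (raw_val_sub y σ (sub_at1 (M := cwfE) σ x b)) (raw_code_at1 _ _)))

noncomputable def sidt {a : cwf.Code (.uc i) Γ} (x y : cwfU.Val a) : cwf.Code (.uc i) Γ :=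
  mkCode (.idt i a.tm.raw x.tm.raw y.tm.raw) (.idt (code_der a) (val_der x) (val_der y))

theorem raw_idt {a : cwf.Code (.uc i) Γ} (x y : cwfU.Val a) :
    Der (.eq Γ.ctx (sidt x y).tm.raw (.idt i a.tm.raw x.tm.raw y.tm.raw) (.uc i)) := raw_mkCode _

theorem sidt_sub {Δ : SynCtx} (σ : Δ ⟶ Γ) {a : cwf.Code (.uc i) Γ} (x y : cwfU.Val a) :
    (sidt x y).sub σ = sidt (a := a.sub σ) (x.sub σ) (y.sub σ) :=
  code_law (.idt (code_der a) (val_der x) (val_der y)) (raw_idt x y) σ (raw_idt _ _)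
    (.eq_idt (raw_code_sub a σ) (raw_val_sub x σ rfl) (raw_val_sub y σ rfl))

noncomputable def srefl {a : cwf.Code (.uc i) Γ} (x : cwfU.Val a) : cwfU.Val (sidt x x) :=
  mkVal _ (raw_idt x x) (.refl i a.tm.raw x.tm.raw) (.refl (code_der a) (val_der x))

theorem raw_refl {a : cwf.Code (.uc i) Γ} (x : cwfU.Val a) :
    Der (.eq Γ.ctx (srefl x).tm.raw (.refl i a.tm.raw x.tm.raw)
      (.idt i a.tm.raw x.tm.raw x.tm.raw)) :=
  raw_mkVal (raw_idt x x) (.refl (code_der a) (val_der x))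

theorem srefl_sub {Δ : SynCtx} (σ : Δ ⟶ Γ) {a : cwf.Code (.uc i) Γ} (x : cwfU.Val a) :
    cwf.subTm σ (srefl x).tm = (srefl (a := a.sub σ) (x.sub σ)).tm :=
  congrArg CwF.Elt.tm <| val_law (.refl (code_der a) (val_der x)) (raw_idt x x) (raw_refl x) σ
    (sidt_sub σ x x) (raw_idt _ _) (raw_refl _)
    (.eq_refl_tm (raw_code_sub a σ) (raw_val_sub x σ rfl))

end Products

noncomputable abbrev cwfPi : CwFPi.{0, 0, 0} SynCtx where
  toCwFE := cwfE
  pi := spi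
  pi_sub := spi_sub
  lam := slamEquiv
  lam_sub := slam_sub
  sig := ssig
  sig_sub := ssig_sub
  pr := sprEquiv
  pr_sub := spr_sub
  idt := sidt
  idt_sub := sidt_sub
  refl := srefl
  refl_sub := srefl_sub


/-! Identity types: the motive of `J`. -/

section Identity

theorem wk_lift_ty {Γ Δ : Ctx} {B B' T : Tm} {ρ : Sb} {s s' : Srt} (g : Fits Γ B Δ B' ρ s)
    (hT : Der (.tm Γ T s'.tm)) :
    Der (.eq (B' :: Δ) (.sub T (.comp .p ρ.lift)) (.wk (.sub T ρ)) s'.tm) ∧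
    Der (.eq (B' :: Δ) (.sub T.wk ρ.lift) (.wk (.sub T ρ)) s'.tm) := by
  have hp := Der.sb_p g.hc
  have hp' := Der.sb_p g.hc'
  have k : Der (.sbEq (B' :: Δ) (.comp .p ρ.lift) (.comp ρ .p) Γ) :=
    .sbEq_p (.sb_comp g.hσ hp') g.hc g.q
  have e := Der.eq_trans (sub_congr hT (.sb_comp hp g.lift) k) (.eq_symm (sub_sub hT g.hσ hp'))
  exact ⟨e, .eq_trans (sub_sub hT hp g.lift) e⟩

theorem wk_lift {Γ Δ : Ctx} {B B' t T : Tm} {ρ : Sb} {s s' : Srt} (g : Fits Γ B Δ B' ρ s)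
    (hT : Der (.tm Γ T s'.tm)) (ht : Der (.tm Γ t T)) :
    Der (.eq (B' :: Δ) (.sub t.wk ρ.lift) (.wk (.sub t ρ)) (.wk (.sub T ρ))) := by
  have hp := Der.sb_p g.hc
  have hp' := Der.sb_p g.hc'
  have k : Der (.sbEq (B' :: Δ) (.comp .p ρ.lift) (.comp ρ .p) Γ) :=
    .sbEq_p (.sb_comp g.hσ hp') g.hc g.q
  have e := wk_lift_ty g hT
  exact .eq_trans (.eq_conv (.eq_push (.sub ht hp) g.lift) e.2) (.eq_trans (.eq_conv
    (.eq_sub (.eq_refl ht) k) e.1) (.eq_symm (.eq_push (.sub ht g.hσ) hp')))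

/-- A context `Γ, x : A, y : B` with `B = A`. -/
structure Dbl (Γ : Ctx) (A B : Tm) (i : ℕ) : Prop where
  hA : Der (.tm Γ A (.uc i))
  hc : Der (.ctx (A :: Γ))
  e : Der (.eq (A :: Γ) B A.wk (.uc i))
  hB : Der (.tm (A :: Γ) B (.uc i))

namespace Dbl

variable {Γ Δ : Ctx} {A B A' B' : Tm} {σ : Sb} {i : ℕ}

theorem hc₂ (h : Dbl Γ A B i) : Der (.ctx (B :: A :: Γ)) := .ctx_comp h.hc h.hB

theorem tm_id (h : Dbl Γ A B i) : Der (.tm (B :: A :: Γ) (.idt i B.wk Tm.q.wk .q) (.uc i)) :=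
  .idt (tm_sub (s := .uc i) h.hB (.sb_p h.hc₂)) (.conv (s := .uc i) (.sub (.q h.hc) (.sb_p h.hc₂))
    (.eq_symm (sub_congr_left (s := .uc i) h.e (.sb_p h.hc₂)))) (.q h.hc₂)

theorem hc₃ (h : Dbl Γ A B i) : Der (.ctx (.idt i B.wk Tm.q.wk .q :: B :: A :: Γ)) :=
  .ctx_comp h.hc₂ h.tm_id

theorem fits (h : Dbl Γ A B i) (h' : Dbl Δ A' B' i) (f : Fits Γ A Δ A' σ (.uc i)) :
    Fits (A :: Γ) B (A' :: Δ) B' σ.lift (.uc i) :=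
  ⟨h.hB, h.hc₂, h'.hc₂, f.lift, .eq_trans h'.e (.eq_trans (sub_congr_left (s := .uc i) f.e
    (.sb_p h'.hc)) (.eq_trans (.eq_symm (wk_lift_ty (s' := .uc i) f h.hA).2)
    (.eq_symm (sub_congr_left (s := .uc i) h.e f.lift))))⟩

theorem fits_id (h : Dbl Γ A B i) (h' : Dbl Δ A' B' i) (f : Fits Γ A Δ A' σ (.uc i)) :
    Fits (B :: A :: Γ) (.idt i B.wk Tm.q.wk .q) (B' :: A' :: Δ) (.idt i B'.wk Tm.q.wk .q) σ.lift.lift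
      (.uc i) := by
  have g := h.fits h' f
  refine ⟨h.tm_id, h.hc₃, h'.hc₃, g.lift, .eq_symm (.eq_trans (push_sort (s := .uc i) h.tm_id g.lift)
    (.eq_symm ?_))⟩
  have hp' := Der.sb_p h'.hc₂
  have hAw : Der (.tm (A :: Γ) A.wk (.uc i)) := tm_sub (s := .uc i) h.hA (.sb_p h.hc)
  have e1 : Der (.eq (B' :: A' :: Δ) B'.wk (.wk (.sub B σ.lift)) (.uc i)) :=
    sub_congr_left (s := .uc i) g.e hp'
  have e2 : Der (.eq (B' :: A' :: Δ) (.wk (.sub A.wk σ.lift)) (.wk (.sub B σ.lift)) (.uc i)) :=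
    sub_congr_left (s := .uc i) (.eq_symm (sub_congr_left (s := .uc i) h.e f.lift)) hp'
  have e3 : Der (.eq (B' :: A' :: Δ) B'.wk (.wk (.sub A.wk σ.lift)) (.uc i)) :=
    .eq_trans e1 (.eq_symm e2)
  refine .eq_idt (.eq_trans e1 (.eq_symm (wk_lift_ty (s' := .uc i) g h.hB).2)) ?_ ?_
  · have w := wk_lift (s' := .uc i) g hAw (.q h.hc)
    refine .eq_symm (.eq_conv (s := .uc i) (.eq_trans w ?_) (.eq_symm e3))
    have u := Der.eq_q (.sb_comp f.hσ (.sb_p f.hc')) h.hc f.q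
    have v : Der (.eq (A' :: Δ) (.sub A (.comp σ .p)) (.sub A.wk σ.lift) (.uc i)) :=
      .eq_trans (.eq_symm (sub_sub (s := .uc i) h.hA f.hσ (.sb_p f.hc')))
        (.eq_symm (wk_lift_ty (s' := .uc i) f h.hA).2)
    exact .eq_sub (.eq_conv (s := .uc i) u v) (.sbEq_refl hp')
  · have u := Der.eq_q (.sb_comp g.hσ (.sb_p g.hc')) h.hc₂ g.q
    refine .eq_symm (.eq_conv (s := .uc i) u (.eq_symm (.eq_trans e1 ?_)))
    exact sub_sub (s := .uc i) h.hB g.hσ hp'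

theorem fits₁ (h : Dbl Γ A B i) (hΓ : Der (.ctx Γ)) : Fits Γ A Γ A .id (.uc i) :=
  Syn.fits_id h.hA h.hc h.hc hΓ (.eq_refl h.hA)

end Dbl

variable {Γ Δ : Ctx} {A B x y r : Tm} {σ : Sb} {i : ℕ}

theorem dbl_wk (hA : Der (.tm Γ A (.uc i))) (hc : Der (.ctx (A :: Γ))) : Dbl Γ A A.wk i :=
  ⟨hA, hc, .eq_refl (tm_sub (s := .uc i) hA (.sb_p hc)), tm_sub (s := .uc i) hA (.sb_p hc)⟩

/-- Terms that instantiate `Γ, x : A, y : A, r : Id x y`. -/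
theorem triple (h : Dbl Γ A B i) (hσ : Der (.sb Δ σ Γ)) (hx : Der (.tm Δ x (.sub A σ)))
    (hy : Der (.tm Δ y (.sub A σ))) (hr : Der (.tm Δ r (.idt i (.sub A σ) x y))) :
    Der (.eq Δ (.sub B (.ext σ x)) (.sub A σ) (.uc i)) ∧
    Der (.tm Δ y (.sub B (.ext σ x))) ∧
    Der (.eq Δ (.sub (.idt i B.wk Tm.q.wk .q) (.ext (.ext σ x) y)) (.idt i (.sub A σ) x y) (.uc i)) ∧
    Der (.tm Δ r (.sub (.idt i B.wk Tm.q.wk .q) (.ext (.ext σ x) y))) := by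
  have h1 := Der.sb_ext hσ h.hc hx
  have k1 := Der.sbEq_p hσ h.hc hx
  have hp := Der.sb_p h.hc
  have e0 : Der (.eq Δ (.sub A.wk (.ext σ x)) (.sub A σ) (.uc i)) :=
    .eq_trans (sub_sub (s := .uc i) h.hA hp h1) (sub_congr (s := .uc i) h.hA (.sb_comp hp h1) k1)
  have e1 : Der (.eq Δ (.sub B (.ext σ x)) (.sub A σ) (.uc i)) :=
    .eq_trans (sub_congr_left (s := .uc i) h.e h1) e0
  have hy' : Der (.tm Δ y (.sub B (.ext σ x))) := .conv (s := .uc i) hy (.eq_symm e1)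
  have h2 := Der.sb_ext h1 h.hc₂ hy'
  have k2 := Der.sbEq_p h1 h.hc₂ hy'
  have hp2 := Der.sb_p h.hc₂
  have e2 : Der (.eq Δ (.sub B.wk (.ext (.ext σ x) y)) (.sub A σ) (.uc i)) :=
    .eq_trans (sub_sub (s := .uc i) h.hB hp2 h2) (.eq_trans (sub_congr (s := .uc i) h.hB
      (.sb_comp hp2 h2) k2) e1)
  have hAw : Der (.tm (A :: Γ) A.wk (.uc i)) := tm_sub (s := .uc i) h.hA hp
  have e3 : Der (.eq Δ (.sub A.wk (.comp .p (.ext (.ext σ x) y))) (.sub A σ) (.uc i)) :=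
    .eq_trans (sub_congr (s := .uc i) hAw (.sb_comp hp2 h2) k2) e0
  have e4 : Der (.eq Δ (.sub A.wk.wk (.ext (.ext σ x) y)) (.sub A σ) (.uc i)) :=
    .eq_trans (sub_sub (s := .uc i) hAw hp2 h2) e3
  have e : Der (.eq Δ (.sub (.idt i B.wk Tm.q.wk .q) (.ext (.ext σ x) y)) (.idt i (.sub A σ) x y)
      (.uc i)) := by
    refine .eq_trans (push_sort (s := .uc i) h.tm_id h2) (.eq_idt e2 ?_ ?_)
    · refine .eq_conv (s := .uc i) ?_ (.eq_symm e2)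
      refine .eq_trans (.eq_conv (s := .uc i) (.eq_push (.sub (.q h.hc) hp2) h2) e4) ?_
      refine .eq_trans (.eq_conv (s := .uc i) (.eq_sub (.eq_refl (.q h.hc)) k2) e3) ?_
      exact .eq_q hσ h.hc hx
    · exact .eq_conv (s := .uc i) (.eq_q h1 h.hc₂ hy') (.eq_trans e1 (.eq_symm e2))
  exact ⟨e1, hy', e, .conv (s := .uc i) hr (.eq_symm e)⟩


/-- `⟨⟨⟨p, q⟩, q⟩, q⟩` between two versions of `Γ, x : A, y : A, r : Id x y`. -/
def ren₃ : Sb := Sb.lift (Sb.lift (Sb.lift .id))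

end Identity

section J

open CwFPi

variable {i j : ℕ} {Γ Δ : SynCtx}

theorem raw_wk (a : cwf.Code (.uc i) Γ) {s : Srt} (b : cwf.Code s Γ) :
    Der (.eq (a.tm.raw :: Γ.ctx) (b.sub (sp (.comp i a))).tm.raw b.tm.raw.wk s.tm) :=
  .eq_trans (raw_code_sub b (sp (.comp i a))) (eq_conv_sort (hom_der (sp (.comp i a)))
    (.eq_sub (.eq_refl (code_der b)) (raw_p (.comp i a))))

theorem raw_val_wk (a : cwf.Code (.uc i) Γ) {s : Srt} {b : cwf.Code s Γ} (t : cwfU.Val b) :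
    Der (.eq (a.tm.raw :: Γ.ctx) (t.sub (sp (.comp i a))).tm.raw t.tm.raw.wk
      (b.sub (sp (.comp i a))).tm.raw) :=
  .eq_trans (raw_val_sub t (sp (.comp i a)) rfl) (.eq_conv (.eq_sub (.eq_refl (val_der t))
    (raw_p (.comp i a))) (.eq_symm (raw_code_sub b (sp (.comp i a)))))

/-- The code of the weakening of `a`. -/
noncomputable abbrev wkc (a : cwf.Code (.uc i) Γ) : cwf.Code (.uc i) (cons (M := cwfE) a) :=
  a.sub (sp (.comp i a))

theorem dbl (a : cwf.Code (.uc i) Γ) : Dbl Γ.ctx a.tm.raw (wkc a).tm.raw i :=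
  ⟨code_der a, ctx_cons a, raw_wk a a, code_der (wkc a)⟩

theorem raw_idVars (a : cwf.Code (.uc i) Γ) :
    Der (.eq ((wkc a).tm.raw :: a.tm.raw :: Γ.ctx) (idVars (M := cwfPi) a).tm.raw
      (.idt i (wkc a).tm.raw.wk Tm.q.wk .q) (.uc i)) := by
  refine .eq_trans (raw_idt (Γ := cons (M := cwfE) (wkc a)) (a := (wkc a).sub (sp (.comp i (wkc a))))
    ((var (M := cwfE) a).sub (sp (.comp i (wkc a)))) (var (M := cwfE) (wkc a))) ?_
  have e := raw_wk (wkc a) (wkc a)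
  have hp := der_p (wkc a)
  refine .eq_idt e ?_ (.eq_conv (s := .uc i) (raw_var (wkc a)) (.eq_symm e))
  refine .eq_trans (raw_val_wk (wkc a) (b := wkc a) (var (M := cwfE) a)) (.eq_conv (s := .uc i) ?_ (.eq_symm e))
  refine .eq_conv (s := .uc i) (.eq_sub (raw_var a) (.sbEq_refl hp)) ?_
  exact .eq_symm (sub_congr_left (s := .uc i) (raw_wk a a) hp)

/-- The context of a motive, with the identity type computed. -/
abbrev jCtx (Γ : Ctx) (A : Tm) (i : ℕ) : Ctx := (A.idVars i) :: A.wk :: A :: Γ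

/-- The identity between the two forms of the context of a motive. -/
theorem fits_ren (a : cwf.Code (.uc i) Γ) :
    Fits ((wkc a).tm.raw :: a.tm.raw :: Γ.ctx) (idVars (M := cwfPi) a).tm.raw
      (a.tm.raw.wk :: a.tm.raw :: Γ.ctx) (a.tm.raw.idVars i) (Sb.lift (Sb.lift .id)) (.uc i) := by
  have f := (dbl a).fits_id (dbl_wk (code_der a) (ctx_cons a)) ((dbl a).fits₁ Γ.wf)
  exact ⟨code_der (idVars (M := cwfPi) a), ctx_cons (idVars (M := cwfPi) a), f.hc', f.hσ,
    .eq_trans f.e (.eq_symm (sub_congr_left (s := .uc i) (raw_idVars a) f.hσ))⟩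

theorem ren_der (a : cwf.Code (.uc i) Γ) :
    Der (.sb (jCtx Γ.ctx a.tm.raw i) ren₃ (idCtx (M := cwfPi) a).ctx) := (fits_ren a).lift

/-- A triple of terms as a substitution into the context of a motive. -/
theorem ren_triple (a : cwf.Code (.uc i) Γ) {Δ : Ctx} {σ : Sb} {x y r : Tm}
    (hσ : Der (.sb Δ σ Γ.ctx)) (hx : Der (.tm Δ x (.sub a.tm.raw σ)))
    (hy : Der (.tm Δ y (.sub a.tm.raw σ))) (hr : Der (.tm Δ r (.idt i (.sub a.tm.raw σ) x y))) :
    Der (.sb Δ (.ext (.ext (.ext σ x) y) r) (jCtx Γ.ctx a.tm.raw i)) ∧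
    Der (.sb Δ (.ext (.ext (.ext σ x) y) r) (idCtx (M := cwfPi) a).ctx) ∧
    Der (.sbEq Δ (.comp ren₃ (.ext (.ext (.ext σ x) y) r)) (.ext (.ext (.ext σ x) y) r)
      (idCtx (M := cwfPi) a).ctx) := by
  have h := dbl a
  have h' := dbl_wk (code_der a) (ctx_cons a)
  obtain ⟨e1, hy₁, e2, hr₁⟩ := triple h hσ hx hy hr
  obtain ⟨e1', hy₁', e2', hr₁'⟩ := triple h' hσ hx hy hr
  have f₁ := h.fits₁ Γ.wf
  have f₂ := h.fits h' f₁
  have f₃ := fits_ren a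
  have m1 := Der.sb_ext hσ h.hc hx
  have m2' := Der.sb_ext m1 h'.hc₂ hy₁'
  have m3' := Der.sb_ext m2' h'.hc₃ hr₁'
  have m2 := Der.sb_ext m1 h.hc₂ hy₁
  have hr₂ : Der (.tm Δ r (.sub (idVars (M := cwfPi) a).tm.raw (.ext (.ext σ x) y))) :=
    .conv (s := .uc i) hr₁ (.eq_symm (sub_congr_left (s := .uc i) (raw_idVars a) m2))
  have k1 : Der (.sbEq Δ (.comp (Sb.lift .id) (.ext σ x)) (.ext σ x) (a.tm.raw :: Γ.ctx)) :=
    .sbEq_trans (f₁.ext hσ hx) (.sbEq_symm (.sbEq_ext (.sbEq_symm (.sbEq_id_comp hσ)) h.hc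
      (.eq_refl hx)))
  have k2 : Der (.sbEq Δ (.comp (Sb.lift (Sb.lift .id)) (.ext (.ext σ x) y)) (.ext (.ext σ x) y)
      ((wkc a).tm.raw :: a.tm.raw :: Γ.ctx)) :=
    .sbEq_trans (f₂.ext m1 hy₁') (.sbEq_symm (.sbEq_ext (.sbEq_symm k1) h.hc₂ (.eq_refl hy₁)))
  exact ⟨m3', .sb_ext m2 (ctx_cons (idVars (M := cwfPi) a)) hr₂, .sbEq_trans (f₃.ext m2' hr₁')
    (.sbEq_symm (.sbEq_ext (.sbEq_symm k2) (ctx_cons (idVars (M := cwfPi) a)) (.eq_refl hr₂)))⟩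

theorem raw_snoc (σ : Δ ⟶ Γ) (a : cwf.Code (.uc i) Γ) (x : cwfU.Val (a.sub σ)) {σ' : Sb} {x' : Tm}
    (h : Der (.sbEq Δ.ctx (rep σ) σ' Γ.ctx)) (h' : Der (.eq Δ.ctx x.tm.raw x' (a.sub σ).tm.raw)) :
    Der (.sbEq Δ.ctx (rep (snoc (M := cwfE) σ a x)) (.ext σ' x') (a.tm.raw :: Γ.ctx)) :=
  .sbEq_trans (raw_mkHom (Γ := cons (M := cwfE) a) _) (.sbEq_ext h (ctx_cons a)
    (.eq_conv (s := .uc i) h' (raw_code_sub a σ)))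

theorem conv_code {s : Srt} {a b : cwf.Code s Γ} (h : a = b) {t t' : Tm}
    (e : Der (.eq Γ.ctx t t' a.tm.raw)) : Der (.eq Γ.ctx t t' b.tm.raw) := h ▸ e

theorem raw_map₃ (a : cwf.Code (.uc i) Γ) (σ : Δ ⟶ Γ) (x y : cwfU.Val (a.sub σ))
    (r : cwfU.Val (sidt x y)) {σ' : Sb} {x' y' r' : Tm}
    (h : Der (.sbEq Δ.ctx (rep σ) σ' Γ.ctx)) (hx : Der (.eq Δ.ctx x.tm.raw x' (a.sub σ).tm.raw))
    (hy : Der (.eq Δ.ctx y.tm.raw y' (a.sub σ).tm.raw))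
    (hr : Der (.eq Δ.ctx r.tm.raw r' (sidt x y).tm.raw)) :
    Der (.sbEq Δ.ctx (rep (map₃ (M := cwfPi) a σ x y r)) (.ext (.ext (.ext σ' x') y') r')
      (idCtx (M := cwfPi) a).ctx) := by
  refine raw_snoc _ _ _ (raw_snoc _ _ _ (raw_snoc σ a x h hx) ?_) ?_
  · exact conv_code (wk_snoc (M := cwfE) σ a x a).symm hy
  · exact conv_code (idVars_map₂ (M := cwfPi) a σ x y).symm hr


theorem motive_sub {Δ : SynCtx} {a : cwf.Code (.uc i) Γ} (c : cwf.Code (.uc j) (idCtx (M := cwfPi) a))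
    (ρ : Δ ⟶ idCtx (M := cwfPi) a) {m : Sb}
    (h : Der (.sbEq Δ.ctx (rep ρ) m (idCtx (M := cwfPi) a).ctx))
    (h' : Der (.sb Δ.ctx m (jCtx Γ.ctx a.tm.raw i)) ∧ Der (.sb Δ.ctx m (idCtx (M := cwfPi) a).ctx) ∧
      Der (.sbEq Δ.ctx (.comp ren₃ m) m (idCtx (M := cwfPi) a).ctx)) :
    Der (.eq Δ.ctx (c.sub ρ).tm.raw (.sub (.sub c.tm.raw ren₃) m) (.uc j)) :=
  .eq_trans (raw_code_sub c ρ) (.eq_trans (sub_congr (s := .uc j) (code_der c) (hom_der ρ) h)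
    (.eq_symm (.eq_trans (sub_sub (s := .uc j) (code_der c) (ren_der a) h'.1)
      (sub_congr (s := .uc j) (code_der c) (.sb_comp (ren_der a) h'.1) h'.2.2))))

theorem motive_der {a : cwf.Code (.uc i) Γ} (c : cwf.Code (.uc j) (idCtx (M := cwfPi) a)) :
    Der (.tm (jCtx Γ.ctx a.tm.raw i) (.sub c.tm.raw ren₃) (.uc j)) :=
  tm_sub (s := .uc j) (code_der c) (ren_der a)

theorem diag_triple (a : cwf.Code (.uc i) Γ) :
    Der (.sb (a.tm.raw :: Γ.ctx) (.diag a.tm.raw i) (jCtx Γ.ctx a.tm.raw i)) ∧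
    Der (.sb (a.tm.raw :: Γ.ctx) (.diag a.tm.raw i) (idCtx (M := cwfPi) a).ctx) ∧
    Der (.sbEq (a.tm.raw :: Γ.ctx) (.comp ren₃ (.diag a.tm.raw i)) (.diag a.tm.raw i)
      (idCtx (M := cwfPi) a).ctx) :=
  have hq := Der.q (ctx_cons a)
  ren_triple a (der_p a) hq hq (.refl (tm_sub (s := .uc i) (code_der a) (der_p a)) hq)

theorem raw_diag (a : cwf.Code (.uc i) Γ) :
    Der (.sbEq (a.tm.raw :: Γ.ctx) (rep (diag (M := cwfPi) a)) (.diag a.tm.raw i)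
      (idCtx (M := cwfPi) a).ctx) := by
  have e := raw_wk a a
  have hv := Der.eq_conv (s := .uc i) (raw_var a) (.eq_symm e)
  refine raw_map₃ (Δ := cons (M := cwfE) a) a (sp (.comp i a)) (var (M := cwfE) a)
    (var (M := cwfE) a) (srefl (var (M := cwfE) a)) (raw_p (.comp i a)) hv hv ?_
  exact .eq_conv (s := .uc i) (.eq_trans (raw_refl (Γ := cons (M := cwfE) a) (var (M := cwfE) a))
    (.eq_refl_tm e hv)) (.eq_symm (raw_idt (Γ := cons (M := cwfE) a) _ _))

theorem raw_val_id {s : Srt} {a : cwf.Code s Γ} (x : cwfU.Val a) {b : cwf.Code s Γ}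
    (h : a.sub (𝟙 Γ) = b) : Der (.eq Γ.ctx (x.sub (𝟙 Γ) h).tm.raw x.tm.raw b.tm.raw) := by
  have hb : a = b := (CwF.Code.sub_id a).symm.trans h
  subst hb
  have e : (x.sub (𝟙 Γ) h).tm = x.tm := STm.sub_id _
  rw [e]
  exact .eq_refl (val_der x)

theorem inst₃_triple {a : cwf.Code (.uc i) Γ} (x y : cwfU.Val a) (r : cwfU.Val (sidt x y)) :
    Der (.sb Γ.ctx (.inst₃ x.tm.raw y.tm.raw r.tm.raw) (jCtx Γ.ctx a.tm.raw i)) ∧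
    Der (.sb Γ.ctx (.inst₃ x.tm.raw y.tm.raw r.tm.raw) (idCtx (M := cwfPi) a).ctx) ∧
    Der (.sbEq Γ.ctx (.comp ren₃ (.inst₃ x.tm.raw y.tm.raw r.tm.raw))
      (.inst₃ x.tm.raw y.tm.raw r.tm.raw) (idCtx (M := cwfPi) a).ctx) := by
  have e : Der (.eq Γ.ctx a.tm.raw (.sub a.tm.raw .id) (.uc i)) := .eq_symm (.eq_sub_id (code_der a))
  exact ren_triple a (.sb_id Γ.wf) (.conv (s := .uc i) (val_der x) e)
    (.conv (s := .uc i) (val_der y) e) (.conv (s := .uc i) (val_der' r (raw_idt x y))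
    (.eq_idt e (.eq_refl (val_der x)) (.eq_refl (val_der y))))

theorem raw_inst₃ {a : cwf.Code (.uc i) Γ} (x y : cwfU.Val a) (r : cwfU.Val (sidt x y)) :
    Der (.sbEq Γ.ctx (rep (inst₃ (M := cwfPi) x y r)) (.inst₃ x.tm.raw y.tm.raw r.tm.raw)
      (idCtx (M := cwfPi) a).ctx) :=
  raw_map₃ a (𝟙 Γ) (x.sub _) (y.sub _) (r.sub _ (sidt_sub _ _ _)) (raw_id Γ)
    (raw_val_id x rfl) (raw_val_id y rfl) (raw_val_id r _)

theorem J_type {a : cwf.Code (.uc i) Γ} (c : cwf.Code (.uc j) (idCtx (M := cwfPi) a))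
    (x y : cwfU.Val a) (r : cwfU.Val (sidt x y)) :
    Der (.eq Γ.ctx (c.sub (inst₃ (M := cwfPi) x y r)).tm.raw
      (.sub (.sub c.tm.raw ren₃) (.inst₃ x.tm.raw y.tm.raw r.tm.raw)) (.uc j)) :=
  motive_sub c _ (raw_inst₃ x y r) (inst₃_triple x y r)

theorem J_base {a : cwf.Code (.uc i) Γ} (c : cwf.Code (.uc j) (idCtx (M := cwfPi) a)) :
    Der (.eq (a.tm.raw :: Γ.ctx) (c.sub (diag (M := cwfPi) a)).tm.raw
      (.sub (.sub c.tm.raw ren₃) (.diag a.tm.raw i)) (.uc j)) :=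
  motive_sub (Δ := cons (M := cwfE) a) c _ (raw_diag a) (diag_triple a)

theorem J_der {a : cwf.Code (.uc i) Γ} (c : cwf.Code (.uc j) (idCtx (M := cwfPi) a))
    (d : cwfU.Val (c.sub (diag (M := cwfPi) a))) (x y : cwfU.Val a) (r : cwfU.Val (sidt x y)) :
    Der (.tm Γ.ctx (.J i j a.tm.raw (.sub c.tm.raw ren₃) d.tm.raw x.tm.raw y.tm.raw r.tm.raw)
      (.sub (.sub c.tm.raw ren₃) (.inst₃ x.tm.raw y.tm.raw r.tm.raw))) :=
  .J (code_der a) (motive_der c) (.conv (s := .uc j) (val_der d) (J_base c)) (val_der x) (val_der y)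
    (val_der' r (raw_idt x y))

noncomputable def sJ {a : cwf.Code (.uc i) Γ} (c : cwf.Code (.uc j) (idCtx (M := cwfPi) a))
    (d : cwfU.Val (c.sub (diag (M := cwfPi) a))) (x y : cwfU.Val a) (r : cwfU.Val (sidt x y)) :
    cwfU.Val (c.sub (inst₃ (M := cwfPi) x y r)) :=
  mkVal _ (J_type c x y r) _ (J_der c d x y r)

theorem raw_J {a : cwf.Code (.uc i) Γ} (c : cwf.Code (.uc j) (idCtx (M := cwfPi) a))
    (d : cwfU.Val (c.sub (diag (M := cwfPi) a))) (x y : cwfU.Val a) (r : cwfU.Val (sidt x y)) :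
    Der (.eq Γ.ctx (sJ c d x y r).tm.raw
      (.J i j a.tm.raw (.sub c.tm.raw ren₃) d.tm.raw x.tm.raw y.tm.raw r.tm.raw)
      (.sub (.sub c.tm.raw ren₃) (.inst₃ x.tm.raw y.tm.raw r.tm.raw))) :=
  raw_mkVal (J_type c x y r) (J_der c d x y r)

theorem sJ_refl {a : cwf.Code (.uc i) Γ} (c : cwf.Code (.uc j) (idCtx (M := cwfPi) a))
    (d : cwfU.Val (c.sub (diag (M := cwfPi) a))) (x : cwfU.Val a) :
    (sJ c d x x (srefl x)).tm = cwf.subTm (at1 (M := cwfE) x) d.tm := by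
  have hC := motive_der c
  have hd : Der (.tm (a.tm.raw :: Γ.ctx) d.tm.raw (.sub (.sub c.tm.raw ren₃) (.diag a.tm.raw i))) :=
    .conv (s := .uc j) (val_der d) (J_base c)
  have hr : Der (.eq Γ.ctx (srefl x).tm.raw (.refl i a.tm.raw x.tm.raw)
      (.idt i a.tm.raw x.tm.raw x.tm.raw)) := raw_refl x
  have e : Der (.eq Γ.ctx a.tm.raw (.sub a.tm.raw .id) (.uc i)) := .eq_symm (.eq_sub_id (code_der a))
  have hx : Der (.tm Γ.ctx x.tm.raw (.sub a.tm.raw .id)) := .conv (s := .uc i) (val_der x) e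
  have hI : Der (.eq Γ.ctx (.idt i a.tm.raw x.tm.raw x.tm.raw) (.idt i (.sub a.tm.raw .id) x.tm.raw
      x.tm.raw) (.uc i)) := .eq_idt e (.eq_refl (val_der x)) (.eq_refl (val_der x))
  have h' := dbl_wk (code_der a) (ctx_cons a)
  have tr := triple h' (.sb_id Γ.wf) hx hx (.conv (s := .uc i) (val_der' (srefl x) (raw_idt x x)) hI)
  have m2 := Der.sb_ext (.sb_ext (.sb_id Γ.wf) h'.hc hx) h'.hc₂ tr.2.1
  have eF : Der (.eq Γ.ctx (.sub (.sub c.tm.raw ren₃) (.inst₃ x.tm.raw x.tm.raw (srefl x).tm.raw))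
      (.sub (.sub c.tm.raw ren₃) (.inst₃ x.tm.raw x.tm.raw (.refl i a.tm.raw x.tm.raw))) (.uc j)) :=
    sub_congr (s := .uc j) hC (inst₃_triple x x (srefl x)).1 (.sbEq_ext (.sbEq_refl m2) h'.hc₃
      (.eq_conv (s := .uc i) hr (.eq_trans hI (.eq_symm tr.2.2.1))))
  have b := Der.eq_trans (raw_J c d x x (srefl x)) (.eq_trans (.eq_J (.eq_refl (code_der a))
    (.eq_refl hC) (.eq_refl hd) (.eq_refl (val_der x)) (.eq_refl (val_der x)) hr)
    (.eq_conv (s := .uc j) (.J_beta (code_der a) hC hd (val_der x)) (.eq_symm eF)))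
  have hb : (c.sub (diag (M := cwfPi) a)).sub (at1 (M := cwfE) x) =
      c.sub (inst₃ (M := cwfPi) x x (srefl x)) :=
    (CwF.Code.sub_comp c _ _).symm.trans (congrArg (fun ρ => c.sub ρ) (at1_diag (M := cwfPi) x))
  exact congrArg CwF.Elt.tm (val_ext (y := d.sub (at1 (M := cwfE) x) hb) (J_type c x x (srefl x))
    (.eq_trans b (.eq_symm (.eq_conv (s := .uc j) (raw_val_at1 x d hb) (J_type c x x (srefl x))))))

theorem fits_of {Γ Δ : SynCtx} {b : cwf.Code (.uc i) Γ} {σ : Δ ⟶ Γ} {b' : cwf.Code (.uc i) Δ}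
    (h : b.sub σ = b') : Fits Γ.ctx b.tm.raw Δ.ctx b'.tm.raw (rep σ) (.uc i) :=
  ⟨code_der b, ctx_cons b, ctx_cons b', hom_der σ, h ▸ raw_code_sub b σ⟩

theorem Fits.swap {Γ Δ Δ' Θ : Ctx} {A A' B A'' : Tm} {σ σ' δ δ' : Sb} {s : Srt}
    (f : Fits Γ A Δ A' σ s) (g : Fits Δ A' Θ A'' δ s) (f' : Fits Γ A Δ' B σ' s)
    (g' : Fits Δ' B Θ A'' δ' s) (h : Der (.sbEq Θ (.comp σ δ) (.comp σ' δ') Γ)) :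
    Der (.sbEq (A'' :: Θ) (.comp σ.lift δ.lift) (.comp σ'.lift δ'.lift) (A :: Γ)) :=
  .sbEq_trans (f.comp g) (.sbEq_trans ((f.trans g).congr h) (.sbEq_symm (f'.comp g')))

theorem raw_up₂ {Δ : SynCtx} (σ : Δ ⟶ Γ) (a : cwf.Code (.uc i) Γ) :
    Der (.sbEq ((wkc (a.sub σ)).tm.raw :: (a.sub σ).tm.raw :: Δ.ctx) (rep (up₂ (M := cwfPi) σ a))
      (rep σ).lift.lift ((wkc a).tm.raw :: a.tm.raw :: Γ.ctx)) :=
  have h := wk_up (M := cwfE) σ a rfl a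
  .sbEq_trans (raw_up (up (M := cwfE) σ a) (wkc a) h) ((fits_of h).congr (raw_up σ a))

theorem raw_up₃ {Δ : SynCtx} (σ : Δ ⟶ Γ) (a : cwf.Code (.uc i) Γ) :
    Der (.sbEq (idCtx (M := cwfPi) (a.sub σ)).ctx (rep (up₃ (M := cwfPi) σ a))
      (rep σ).lift.lift.lift (idCtx (M := cwfPi) a).ctx) :=
  have h := idVars_up₂ (M := cwfPi) σ a
  .sbEq_trans (raw_up (up₂ (M := cwfPi) σ a) (idVars (M := cwfPi) a) h)
    ((fits_of h).congr (raw_up₂ σ a))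

theorem ren_up {Δ : SynCtx} (σ : Δ ⟶ Γ) (a : cwf.Code (.uc i) Γ) :
    Der (.sb (jCtx Δ.ctx (a.sub σ).tm.raw i) (rep σ).lift.lift.lift (jCtx Γ.ctx a.tm.raw i)) ∧
    Der (.sbEq (jCtx Δ.ctx (a.sub σ).tm.raw i) (.comp (rep σ).lift.lift.lift ren₃)
      (.comp ren₃ (rep σ).lift.lift.lift) (idCtx (M := cwfPi) a).ctx) := by
  have F : Fits Γ.ctx a.tm.raw Δ.ctx (a.sub σ).tm.raw (rep σ) (.uc i) := fits_of rfl
  have h := dbl a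
  have h' := dbl (a.sub σ)
  have k := dbl_wk (code_der a) (ctx_cons a)
  have k' := dbl_wk (code_der (a.sub σ)) (ctx_cons (a.sub σ))
  have I := h.fits₁ Γ.wf
  have I' := h'.fits₁ Δ.wf
  have e1 := F.swap I' I F (.sbEq_trans (.sbEq_comp_id F.hσ) (.sbEq_symm (.sbEq_id_comp F.hσ)))
  have G2 := h.fits h' F
  have e2 := G2.swap (h'.fits k' I') (h.fits k I) (k.fits k' F) e1
  have G3 := (fits_of (idVars_up₂ (M := cwfPi) σ a)).of_eq (raw_up₂ σ a) G2.lift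
  have R3 := k.fits_id k' F
  exact ⟨R3.lift, G3.swap (fits_ren (a.sub σ)) (fits_ren a) R3 e2⟩

theorem motive_up {Δ : SynCtx} (σ : Δ ⟶ Γ) {a : cwf.Code (.uc i) Γ}
    (c : cwf.Code (.uc j) (idCtx (M := cwfPi) a)) :
    Der (.eq (jCtx Δ.ctx (a.sub σ).tm.raw i) (.sub (c.sub (up₃ (M := cwfPi) σ a)).tm.raw ren₃)
      (.sub (.sub c.tm.raw ren₃) (rep σ).lift.lift.lift) (.uc j)) := by
  have hr := ren_der (a.sub σ)
  have hu := hom_der (up₃ (M := cwfPi) σ a)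
  have h := ren_up σ a
  have e1 := Der.sbEq_comp (raw_up₃ σ a) (.sbEq_refl hr)
  refine .eq_trans (sub_congr_left (s := .uc j) (raw_code_sub c (up₃ (M := cwfPi) σ a)) hr)
    (.eq_trans (sub_sub (s := .uc j) (code_der c) hu hr) (.eq_trans (sub_congr (s := .uc j)
      (code_der c) (.sb_comp hu hr) (.sbEq_trans e1 h.2)) (.eq_symm ?_)))
  exact sub_sub (s := .uc j) (code_der c) (ren_der a) h.1

theorem sJ_sub {Δ : SynCtx} (σ : Δ ⟶ Γ) {a : cwf.Code (.uc i) Γ}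
    (c : cwf.Code (.uc j) (idCtx (M := cwfPi) a)) (d : cwfU.Val (c.sub (diag (M := cwfPi) a)))
    (x y : cwfU.Val a) (r : cwfU.Val (sidt x y))
    (d' : cwfU.Val ((c.sub (up₃ (M := cwfPi) σ a)).sub (diag (M := cwfPi) (a.sub σ))))
    (hd : d'.tm = cwf.subTm (up (M := cwfE) σ a) d.tm) :
    cwf.subTm σ (sJ c d x y r).tm = (sJ (a := a.sub σ) (c.sub (up₃ (M := cwfPi) σ a)) d' (x.sub σ)
      (y.sub σ) (r.sub σ (sidt_sub σ x y))).tm := by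
  have hb : (c.sub (inst₃ (M := cwfPi) x y r)).sub σ = (c.sub (up₃ (M := cwfPi) σ a)).sub
      (inst₃ (M := cwfPi) (a := a.sub σ) (x.sub σ) (y.sub σ) (r.sub σ (sidt_sub σ x y))) :=
    (CwF.Code.sub_comp c _ _).symm.trans ((congrArg (fun ρ => c.sub ρ)
      (inst₃_up₃ (M := cwfPi) σ x y r)).symm.trans (CwF.Code.sub_comp c _ _))
  refine congrArg CwF.Elt.tm (val_law (J_der c d x y r) (J_type c x y r) (raw_J c d x y r) σ hb
    (J_type _ _ _ _) (raw_J _ d' _ _ _) ?_)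
  refine .eq_J (raw_code_sub a σ) (motive_up σ c) ?_ (raw_val_sub x σ rfl) (raw_val_sub y σ rfl)
    (.eq_conv (s := .uc i) (raw_val_sub r σ (sidt_sub σ x y)) (raw_idt _ _))
  have t1 : TyEq ((a.sub σ).tm.raw :: Δ.ctx) (.sub (c.sub (diag (M := cwfPi) a)).tm.raw
      (rep (up (M := cwfE) σ a)))
      ((c.sub (up₃ (M := cwfPi) σ a)).sub (diag (M := cwfPi) (a.sub σ))).tm.raw := by
    have := (congrArg STm.typ hd).symm.trans d'.ty
    exact mkTy_eq.1 ((sub_mkTy (up (M := cwfE) σ a) (hB := ⟨.uc j, der_sub (s := .uc j)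
      (code_der (c.sub (diag (M := cwfPi) a))) (up (M := cwfE) σ a)⟩)).symm.trans
      ((congrArg (STy.sub _) d.ty.symm).trans ((STm.typ_sub _ _).symm.trans this)))
  have t2 : Der (.eq ((a.sub σ).tm.raw :: Δ.ctx) d'.tm.raw (.sub d.tm.raw (rep σ).lift)
      (.sub (c.sub (diag (M := cwfPi) a)).tm.raw (rep (up (M := cwfE) σ a)))) := by
    rw [hd]
    exact .eq_trans (STm.raw_sub (up (M := cwfE) σ a) d.ty) (.eq_sub (.eq_refl (val_der d)) (raw_up σ a))
  exact .eq_conv (s := .uc j) ((t1.conv.2 _ _).1 t2) (J_base (c.sub (up₃ (M := cwfPi) σ a)))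

end J

noncomputable abbrev cwfJ : CwFJ.{0, 0, 0} SynCtx where
  toCwFPi := cwfPi
  J := sJ
  J_refl := sJ_refl
  J_sub := sJ_sub


section Traces

variable {i : ℕ} {Γ Δ : SynCtx}

noncomputable def sstate (Γ : SynCtx) : cwf.Code (.uc 0) Γ := mkCode .state (.state Γ.wf)
noncomputable def sevent (Γ : SynCtx) : cwf.Code (.uc 0) Γ := mkCode .event (.event Γ.wf)
noncomputable def snat (Γ : SynCtx) : cwf.Code (.uc 0) Γ := mkCode .nat (.nat Γ.wf)
noncomputable def sfin (Γ : SynCtx) : cwf.Code (.uc 0) Γ := mkCode .fin (.fin Γ.wf)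
noncomputable def sinf (Γ : SynCtx) : cwf.Code (.uc 0) Γ := mkCode .inf (.inf Γ.wf)

theorem raw_state (Γ : SynCtx) : Der (.eq Γ.ctx (sstate Γ).tm.raw .state (.uc 0)) := raw_mkCode _
theorem raw_event (Γ : SynCtx) : Der (.eq Γ.ctx (sevent Γ).tm.raw .event (.uc 0)) := raw_mkCode _
theorem raw_nat (Γ : SynCtx) : Der (.eq Γ.ctx (snat Γ).tm.raw .nat (.uc 0)) := raw_mkCode _
theorem raw_fin (Γ : SynCtx) : Der (.eq Γ.ctx (sfin Γ).tm.raw .fin (.uc 0)) := raw_mkCode _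
theorem raw_inf (Γ : SynCtx) : Der (.eq Γ.ctx (sinf Γ).tm.raw .inf (.uc 0)) := raw_mkCode _

theorem sstate_sub (σ : Δ ⟶ Γ) : (sstate Γ).sub σ = sstate Δ :=
  code_law (.state Γ.wf) (raw_state Γ) σ (raw_state Δ) (.eq_refl (.state Δ.wf))
theorem sevent_sub (σ : Δ ⟶ Γ) : (sevent Γ).sub σ = sevent Δ :=
  code_law (.event Γ.wf) (raw_event Γ) σ (raw_event Δ) (.eq_refl (.event Δ.wf))
theorem snat_sub (σ : Δ ⟶ Γ) : (snat Γ).sub σ = snat Δ :=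
  code_law (.nat Γ.wf) (raw_nat Γ) σ (raw_nat Δ) (.eq_refl (.nat Δ.wf))
theorem sfin_sub (σ : Δ ⟶ Γ) : (sfin Γ).sub σ = sfin Δ :=
  code_law (.fin Γ.wf) (raw_fin Γ) σ (raw_fin Δ) (.eq_refl (.fin Δ.wf))
theorem sinf_sub (σ : Δ ⟶ Γ) : (sinf Γ).sub σ = sinf Δ :=
  code_law (.inf Γ.wf) (raw_inf Γ) σ (raw_inf Δ) (.eq_refl (.inf Δ.wf))

theorem state_der (s : cwfU.Val (sstate Γ)) : Der (.tm Γ.ctx s.tm.raw .state) :=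
  val_der' s (raw_state Γ)
theorem event_der (s : cwfU.Val (sevent Γ)) : Der (.tm Γ.ctx s.tm.raw .event) :=
  val_der' s (raw_event Γ)
theorem fin_der (s : cwfU.Val (sfin Γ)) : Der (.tm Γ.ctx s.tm.raw .fin) := val_der' s (raw_fin Γ)
theorem inf_der (s : cwfU.Val (sinf Γ)) : Der (.tm Γ.ctx s.tm.raw .inf) := val_der' s (raw_inf Γ)

theorem state_eq (s : cwfU.Val (sstate Γ)) (σ : Δ ⟶ Γ) :
    Der (.eq Δ.ctx (s.sub σ (sstate_sub σ)).tm.raw (.sub s.tm.raw (rep σ)) .state) :=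
  .eq_conv (s := .uc 0) (raw_val_sub s σ (sstate_sub σ)) (raw_state Δ)
theorem event_eq (s : cwfU.Val (sevent Γ)) (σ : Δ ⟶ Γ) :
    Der (.eq Δ.ctx (s.sub σ (sevent_sub σ)).tm.raw (.sub s.tm.raw (rep σ)) .event) :=
  .eq_conv (s := .uc 0) (raw_val_sub s σ (sevent_sub σ)) (raw_event Δ)
theorem fin_eq (s : cwfU.Val (sfin Γ)) (σ : Δ ⟶ Γ) :
    Der (.eq Δ.ctx (s.sub σ (sfin_sub σ)).tm.raw (.sub s.tm.raw (rep σ)) .fin) :=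
  .eq_conv (s := .uc 0) (raw_val_sub s σ (sfin_sub σ)) (raw_fin Δ)
theorem inf_eq (s : cwfU.Val (sinf Γ)) (σ : Δ ⟶ Γ) :
    Der (.eq Δ.ctx (s.sub σ (sinf_sub σ)).tm.raw (.sub s.tm.raw (rep σ)) .inf) :=
  .eq_conv (s := .uc 0) (raw_val_sub s σ (sinf_sub σ)) (raw_inf Δ)

noncomputable def strans (s : cwfU.Val (sstate Γ)) (e : cwfU.Val (sevent Γ))
    (s' : cwfU.Val (sstate Γ)) : cwf.Code (.uc 0) Γ :=
  mkCode (.trans s.tm.raw e.tm.raw s'.tm.raw) (.trans (state_der s) (event_der e) (state_der s'))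

theorem strans_sub (σ : Δ ⟶ Γ) (s : cwfU.Val (sstate Γ)) (e : cwfU.Val (sevent Γ))
    (s' : cwfU.Val (sstate Γ)) : (strans s e s').sub σ = strans (s.sub σ (sstate_sub σ))
      (e.sub σ (sevent_sub σ)) (s'.sub σ (sstate_sub σ)) :=
  code_law (s := .uc 0) (.trans (state_der s) (event_der e) (state_der s')) (raw_mkCode (s := .uc 0) _) σ
    (raw_mkCode (s := .uc 0) _) (.eq_trans_tm (state_eq s σ) (event_eq e σ) (state_eq s' σ))

noncomputable def snil (s : cwfU.Val (sstate Γ)) : cwfU.Val (sfin Γ) :=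
  mkVal _ (raw_fin Γ) _ (.nil (state_der s))

theorem raw_nil (s : cwfU.Val (sstate Γ)) : Der (.eq Γ.ctx (snil s).tm.raw (.nil s.tm.raw) .fin) :=
  raw_mkVal (raw_fin Γ) _

theorem snil_sub (σ : Δ ⟶ Γ) (s : cwfU.Val (sstate Γ)) :
    (snil s).sub σ (sfin_sub σ) = snil (s.sub σ (sstate_sub σ)) :=
  val_law (.nil (state_der s)) (raw_fin Γ) (raw_nil s) σ _ (raw_fin Δ) (raw_nil _)
    (.eq_nil (state_eq s σ))

noncomputable def sstep (τ : cwfU.Val (sfin Γ)) (e : cwfU.Val (sevent Γ)) (s : cwfU.Val (sstate Γ)) :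
    cwfU.Val (sfin Γ) :=
  mkVal _ (raw_fin Γ) _ (.step (fin_der τ) (event_der e) (state_der s))

theorem raw_step (τ : cwfU.Val (sfin Γ)) (e : cwfU.Val (sevent Γ)) (s : cwfU.Val (sstate Γ)) :
    Der (.eq Γ.ctx (sstep τ e s).tm.raw (.step τ.tm.raw e.tm.raw s.tm.raw) .fin) :=
  raw_mkVal (raw_fin Γ) _

theorem sstep_sub (σ : Δ ⟶ Γ) (τ : cwfU.Val (sfin Γ)) (e : cwfU.Val (sevent Γ))
    (s : cwfU.Val (sstate Γ)) : (sstep τ e s).sub σ (sfin_sub σ) = sstep (τ.sub σ (sfin_sub σ))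
      (e.sub σ (sevent_sub σ)) (s.sub σ (sstate_sub σ)) :=
  val_law (.step (fin_der τ) (event_der e) (state_der s)) (raw_fin Γ) (raw_step τ e s) σ _
    (raw_fin Δ) (raw_step _ _ _) (.eq_step (fin_eq τ σ) (event_eq e σ) (state_eq s σ))

noncomputable def shead (π : cwfU.Val (sinf Γ)) : cwfU.Val (sstate Γ) :=
  mkVal _ (raw_state Γ) _ (.head (inf_der π))

theorem raw_head (π : cwfU.Val (sinf Γ)) :
    Der (.eq Γ.ctx (shead π).tm.raw (.head π.tm.raw) .state) := raw_mkVal (raw_state Γ) _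

theorem shead_sub (σ : Δ ⟶ Γ) (π : cwfU.Val (sinf Γ)) :
    (shead π).sub σ (sstate_sub σ) = shead (π.sub σ (sinf_sub σ)) :=
  val_law (.head (inf_der π)) (raw_state Γ) (raw_head π) σ _ (raw_state Δ) (raw_head _)
    (.eq_head (inf_eq π σ))

/-- The type of tails. -/
noncomputable abbrev stails (Γ : SynCtx) : cwf.Code (.uc 0) Γ :=
  ssig (sevent Γ) (sinf (cons (M := cwfE) (sevent Γ)))

theorem raw_tails (Γ : SynCtx) : Der (.eq Γ.ctx (stails Γ).tm.raw (.sig 0 .event .inf) (.uc 0)) :=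
  .eq_trans (raw_sig _ _) (.eq_sig (raw_event Γ) (raw_inf (cons (M := cwfE) (sevent Γ))))

theorem tails_der (Γ : SynCtx) : Der (.tm Γ.ctx (.sig 0 .event .inf) (.uc 0)) :=
  .sig (.event Γ.wf) (.inf (.ctx_comp Γ.wf (.event Γ.wf)))

theorem stails_sub (σ : Δ ⟶ Γ) : (stails Γ).sub σ = stails Δ := by
  have e : Der (.eq Δ.ctx .event (.sub .event (rep σ)) (.uc 0)) :=
    .eq_symm (push_sort (s := .uc 0) (.event Γ.wf) (hom_der σ))
  have f : Fits Γ.ctx .event Δ.ctx .event (rep σ) (.uc 0) :=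
    ⟨.event Γ.wf, .ctx_comp Γ.wf (.event Γ.wf), .ctx_comp Δ.wf (.event Δ.wf), hom_der σ, e⟩
  exact code_law (tails_der Γ) (raw_tails Γ) σ (raw_tails Δ)
    (.eq_sig e (.eq_symm (push_sort (s := .uc 0) (.inf f.hc) f.lift)))

noncomputable def stail (π : cwfU.Val (sinf Γ)) : cwfU.Val (stails Γ) :=
  mkVal _ (raw_tails Γ) _ (.tail (inf_der π))

theorem raw_tail (π : cwfU.Val (sinf Γ)) :
    Der (.eq Γ.ctx (stail π).tm.raw (.tail π.tm.raw) (.sig 0 .event .inf)) :=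
  raw_mkVal (raw_tails Γ) _

theorem stail_sub (σ : Δ ⟶ Γ) (π : cwfU.Val (sinf Γ)) :
    cwf.subTm σ (stail π).tm = (stail (π.sub σ (sinf_sub σ))).tm :=
  congrArg CwF.Elt.tm (val_law (.tail (inf_der π)) (raw_tails Γ) (raw_tail π) σ (stails_sub σ)
    (raw_tails Δ) (raw_tail _) (.eq_tail (inf_eq π σ)))

theorem next_der {a : cwf.Code (.uc i) Γ} (n : cwfU.Val (wkc a)) :
    Der (.tm (a.tm.raw :: Γ.ctx) n.tm.raw a.tm.raw.wk) :=
  val_der' (Γ := cons (M := cwfE) a) n (raw_wk a a)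

section Corec

variable {a : cwf.Code (.uc i) Γ} (h : cwfU.Val (sstate (cons (M := cwfE) a)))
  (e : cwfU.Val (sevent (cons (M := cwfE) a))) (n : cwfU.Val (wkc a)) (x : cwfU.Val a)

theorem corec_der : Der (.tm Γ.ctx (.corec i a.tm.raw h.tm.raw e.tm.raw n.tm.raw x.tm.raw) .inf) :=
  .corec (code_der a) (state_der h) (event_der e) (next_der n) (val_der x)

noncomputable def scorec : cwfU.Val (sinf Γ) := mkVal _ (raw_inf Γ) _ (corec_der h e n x)

theorem raw_corec : Der (.eq Γ.ctx (scorec h e n x).tm.raw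
    (.corec i a.tm.raw h.tm.raw e.tm.raw n.tm.raw x.tm.raw) .inf) := raw_mkVal (raw_inf Γ) _

theorem scorec_sub (σ : Δ ⟶ Γ) : (scorec h e n x).sub σ (sinf_sub σ) =
    scorec (a := a.sub σ) (h.sub (up (M := cwfE) σ a) (sstate_sub _))
      (e.sub (up (M := cwfE) σ a) (sevent_sub _))
      (n.sub (up (M := cwfE) σ a) (wk_up (M := cwfE) σ a rfl a)) (x.sub σ) := by
  refine val_law (corec_der h e n x) (raw_inf Γ) (raw_corec h e n x) σ _ (raw_inf Δ)
    (raw_corec _ _ _ _) (.eq_corec (raw_code_sub a σ) ?_ ?_ ?_ (raw_val_sub x σ rfl))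
  · exact .eq_conv (s := .uc 0) (raw_val_up σ h _) (raw_state (cons (M := cwfE) (a.sub σ)))
  · exact .eq_conv (s := .uc 0) (raw_val_up σ e _) (raw_event (cons (M := cwfE) (a.sub σ)))
  · exact .eq_conv (s := .uc i) (raw_val_up σ n _) (raw_wk (a.sub σ) (a.sub σ))

theorem shead_corec : shead (scorec h e n x) = h.sub (at1 (M := cwfE) x) (sstate_sub _) :=
  val_ext (raw_state Γ) (.eq_trans (raw_head _) (.eq_trans (.eq_head (raw_corec h e n x)) (.eq_trans
    (.head_corec (code_der a) (state_der h) (event_der e) (next_der n) (val_der x)) (.eq_symm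
    (.eq_conv (s := .uc 0) (raw_val_at1 x h _) (raw_state Γ))))))

theorem stail_corec : stail (scorec h e n x) =
    spr (e.sub (at1 (M := cwfE) x) (sevent_sub _))
      ((scorec h e n (n.sub (at1 (M := cwfE) x) (wk_at1 (M := cwfE) x a))).sub (𝟙 Γ)
        ((sinf_sub _).trans (sinf_sub _).symm)) := by
  have hn := raw_val_at1 x n (wk_at1 (M := cwfE) x a)
  have he := Der.eq_conv (s := .uc 0) (raw_val_at1 x e (sevent_sub _)) (raw_event Γ)
  have hc := Der.tail_corec (code_der a) (state_der h) (event_der e) (next_der n) (val_der x)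
  refine val_ext (raw_tails Γ) (.eq_trans (raw_tail _) (.eq_trans (.eq_tail (raw_corec h e n x))
    (.eq_trans hc (.eq_symm ?_))))
  refine .eq_conv (s := .uc 0) (.eq_trans (raw_pr _ _) (.eq_pair (raw_event Γ)
    (raw_inf (cons (M := cwfE) (sevent Γ))) (raw_val_at1 x e (sevent_sub _)) ?_))
    (.eq_trans (.eq_symm (raw_sig _ _)) (raw_tails Γ))
  refine .eq_conv (s := .uc 0) ?_ (raw_code_at1 _ _)
  refine .eq_trans (raw_val_id _ _) ?_
  refine conv_code (sinf_sub _).symm (.eq_conv (s := .uc 0) ?_ (.eq_symm (raw_inf Γ)))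
  exact .eq_trans (raw_corec h e n _) (.eq_corec (.eq_refl (code_der a)) (.eq_refl (state_der h))
    (.eq_refl (event_der e)) (.eq_refl (next_der n)) hn)

end Corec

noncomputable def sextn (τ τ' : cwfU.Val (sfin Γ)) : cwf.Code (.uc 0) Γ :=
  mkCode (.extn τ.tm.raw τ'.tm.raw) (.extn (fin_der τ) (fin_der τ'))

theorem raw_extn (τ τ' : cwfU.Val (sfin Γ)) :
    Der (.eq Γ.ctx (sextn τ τ').tm.raw (.extn τ.tm.raw τ'.tm.raw) (.uc 0)) := raw_mkCode _

theorem sextn_sub (σ : Δ ⟶ Γ) (τ τ' : cwfU.Val (sfin Γ)) :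
    (sextn τ τ').sub σ = sextn (τ.sub σ (sfin_sub σ)) (τ'.sub σ (sfin_sub σ)) :=
  code_law (.extn (fin_der τ) (fin_der τ')) (raw_extn τ τ') σ (raw_extn _ _)
    (.eq_extn (fin_eq τ σ) (fin_eq τ' σ))

theorem extn_der {τ τ' : cwfU.Val (sfin Γ)} (ε : cwfU.Val (sextn τ τ')) :
    Der (.tm Γ.ctx ε.tm.raw (.extn τ.tm.raw τ'.tm.raw)) := val_der' ε (raw_extn τ τ')

theorem extn_eq {τ τ' : cwfU.Val (sfin Γ)} (ε : cwfU.Val (sextn τ τ')) (σ : Δ ⟶ Γ) :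
    Der (.eq Δ.ctx (ε.sub σ (sextn_sub σ τ τ')).tm.raw (.sub ε.tm.raw (rep σ))
      (.extn (τ.sub σ (sfin_sub σ)).tm.raw (τ'.sub σ (sfin_sub σ)).tm.raw)) :=
  .eq_conv (s := .uc 0) (raw_val_sub ε σ (sextn_sub σ τ τ')) (raw_extn _ _)

noncomputable def sidE (τ : cwfU.Val (sfin Γ)) : cwfU.Val (sextn τ τ) :=
  mkVal _ (raw_extn τ τ) _ (.idE (fin_der τ))

theorem raw_idE (τ : cwfU.Val (sfin Γ)) :
    Der (.eq Γ.ctx (sidE τ).tm.raw (.idE τ.tm.raw) (.extn τ.tm.raw τ.tm.raw)) :=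
  raw_mkVal (raw_extn τ τ) _

theorem sidE_sub (σ : Δ ⟶ Γ) (τ : cwfU.Val (sfin Γ)) :
    (sidE τ).sub σ (sextn_sub σ τ τ) = sidE (τ.sub σ (sfin_sub σ)) :=
  val_law (.idE (fin_der τ)) (raw_extn τ τ) (raw_idE τ) σ _ (raw_extn _ _) (raw_idE _)
    (.eq_idE (fin_eq τ σ))

section Comp

variable {τ τ' τ'' : cwfU.Val (sfin Γ)} (ε₁ : cwfU.Val (sextn τ τ')) (ε₂ : cwfU.Val (sextn τ' τ''))

theorem compE_der : Der (.tm Γ.ctx (.compE τ.tm.raw τ'.tm.raw τ''.tm.raw ε₁.tm.raw ε₂.tm.raw)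
    (.extn τ.tm.raw τ''.tm.raw)) :=
  .compE (fin_der τ) (fin_der τ') (fin_der τ'') (extn_der ε₁) (extn_der ε₂)

noncomputable def scompE : cwfU.Val (sextn τ τ'') := mkVal _ (raw_extn τ τ'') _ (compE_der ε₁ ε₂)

theorem raw_compE : Der (.eq Γ.ctx (scompE ε₁ ε₂).tm.raw
    (.compE τ.tm.raw τ'.tm.raw τ''.tm.raw ε₁.tm.raw ε₂.tm.raw) (.extn τ.tm.raw τ''.tm.raw)) :=
  raw_mkVal (raw_extn τ τ'') _

theorem scompE_sub (σ : Δ ⟶ Γ) : (scompE ε₁ ε₂).sub σ (sextn_sub σ τ τ'') =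
    scompE (ε₁.sub σ (sextn_sub σ τ τ')) (ε₂.sub σ (sextn_sub σ τ' τ'')) :=
  val_law (compE_der ε₁ ε₂) (raw_extn τ τ'') (raw_compE ε₁ ε₂) σ _ (raw_extn _ _) (raw_compE _ _)
    (.eq_compE (fin_eq τ σ) (fin_eq τ' σ) (fin_eq τ'' σ) (extn_eq ε₁ σ) (extn_eq ε₂ σ))

end Comp

theorem eq_compE' {τ τ' τ'' : cwfU.Val (sfin Γ)} {t t' u u' : Tm}
    (h : Der (.eq Γ.ctx t t' (.extn τ.tm.raw τ'.tm.raw)))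
    (h' : Der (.eq Γ.ctx u u' (.extn τ'.tm.raw τ''.tm.raw))) :
    Der (.eq Γ.ctx (.compE τ.tm.raw τ'.tm.raw τ''.tm.raw t u)
      (.compE τ.tm.raw τ'.tm.raw τ''.tm.raw t' u') (.extn τ.tm.raw τ''.tm.raw)) :=
  .eq_compE (.eq_refl (fin_der τ)) (.eq_refl (fin_der τ')) (.eq_refl (fin_der τ'')) h h'

theorem sid_compE {τ τ' : cwfU.Val (sfin Γ)} (ε : cwfU.Val (sextn τ τ')) : scompE (sidE τ) ε = ε :=
  val_ext (raw_extn τ τ') (.eq_trans (raw_compE _ _) (.eq_trans (eq_compE' (raw_idE τ)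
    (.eq_refl (extn_der ε))) (.compE_id_left (fin_der τ) (fin_der τ') (extn_der ε))))

theorem scompE_id {τ τ' : cwfU.Val (sfin Γ)} (ε : cwfU.Val (sextn τ τ')) : scompE ε (sidE τ') = ε :=
  val_ext (raw_extn τ τ') (.eq_trans (raw_compE _ _) (.eq_trans (eq_compE' (.eq_refl (extn_der ε))
    (raw_idE τ')) (.compE_id_right (fin_der τ) (fin_der τ') (extn_der ε))))

theorem scompE_assoc {τ₀ τ₁ τ₂ τ₃ : cwfU.Val (sfin Γ)} (ε₁ : cwfU.Val (sextn τ₀ τ₁))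
    (ε₂ : cwfU.Val (sextn τ₁ τ₂)) (ε₃ : cwfU.Val (sextn τ₂ τ₃)) :
    scompE (scompE ε₁ ε₂) ε₃ = scompE ε₁ (scompE ε₂ ε₃) := by
  refine val_ext (raw_extn τ₀ τ₃) (.eq_trans (raw_compE _ _) (.eq_trans (eq_compE' (raw_compE ε₁ ε₂)
    (.eq_refl (extn_der ε₃))) (.eq_trans (.compE_assoc (fin_der τ₀) (fin_der τ₁) (fin_der τ₂)
    (fin_der τ₃) (extn_der ε₁) (extn_der ε₂) (extn_der ε₃)) (.eq_symm ?_))))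
  exact .eq_trans (raw_compE _ _) (eq_compE' (.eq_refl (extn_der ε₁)) (raw_compE ε₂ ε₃))

noncomputable def sK (τ : cwfU.Val (sfin Γ)) : cwf.Code (.tyL 0) Γ :=
  mkCode (.K τ.tm.raw) (.K (fin_der τ))

theorem raw_K (τ : cwfU.Val (sfin Γ)) : Der (.eq Γ.ctx (sK τ).tm.raw (.K τ.tm.raw) (.tyL 0)) :=
  raw_mkCode (s := .tyL 0) _

theorem sK_sub (σ : Δ ⟶ Γ) (τ : cwfU.Val (sfin Γ)) : (sK τ).sub σ = sK (τ.sub σ (sfin_sub σ)) :=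
  code_law (s := .tyL 0) (.K (fin_der τ)) (raw_K τ) σ (raw_K _) (.eq_K (fin_eq τ σ))

noncomputable def sKinf (π : cwfU.Val (sinf Γ)) : cwf.Code (.tyL 0) Γ :=
  mkCode (.Kinf π.tm.raw) (.Kinf (inf_der π))

theorem sKinf_sub (σ : Δ ⟶ Γ) (π : cwfU.Val (sinf Γ)) :
    (sKinf π).sub σ = sKinf (π.sub σ (sinf_sub σ)) :=
  code_law (s := .tyL 0) (.Kinf (inf_der π)) (raw_mkCode (s := .tyL 0) _) σ
    (raw_mkCode (s := .tyL 0) _) (.eq_Kinf (inf_eq π σ))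

theorem K_der {τ : cwfU.Val (sfin Γ)} (k : cwfU.Val (sK τ)) : Der (.tm Γ.ctx k.tm.raw (.K τ.tm.raw)) :=
  val_der' k (raw_K τ)

theorem restrict_der {τ τ' : cwfU.Val (sfin Γ)} (ε : cwfU.Val (sextn τ τ')) (k : cwfU.Val (sK τ')) :
    Der (.tm Γ.ctx (.restrict τ.tm.raw τ'.tm.raw ε.tm.raw k.tm.raw) (.K τ.tm.raw)) :=
  .restrict (fin_der τ) (fin_der τ') (extn_der ε) (K_der k)

noncomputable def srestrict {τ τ' : cwfU.Val (sfin Γ)} (ε : cwfU.Val (sextn τ τ'))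
    (k : cwfU.Val (sK τ')) : cwfU.Val (sK τ) := mkVal _ (raw_K τ) _ (restrict_der ε k)

theorem raw_restrict {τ τ' : cwfU.Val (sfin Γ)} (ε : cwfU.Val (sextn τ τ')) (k : cwfU.Val (sK τ')) :
    Der (.eq Γ.ctx (srestrict ε k).tm.raw (.restrict τ.tm.raw τ'.tm.raw ε.tm.raw k.tm.raw)
      (.K τ.tm.raw)) := raw_mkVal (raw_K τ) _

theorem srestrict_sub (σ : Δ ⟶ Γ) {τ τ' : cwfU.Val (sfin Γ)} (ε : cwfU.Val (sextn τ τ'))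
    (k : cwfU.Val (sK τ')) : (srestrict ε k).sub σ (sK_sub σ τ) =
      srestrict (ε.sub σ (sextn_sub σ τ τ')) (k.sub σ (sK_sub σ τ')) :=
  val_law (restrict_der ε k) (raw_K τ) (raw_restrict ε k) σ _ (raw_K _) (raw_restrict _ _)
    (.eq_restrict (fin_eq τ σ) (fin_eq τ' σ) (extn_eq ε σ) (.eq_conv (s := .tyL 0)
      (raw_val_sub k σ (sK_sub σ τ')) (raw_K _)))

theorem srestrict_id {τ : cwfU.Val (sfin Γ)} (k : cwfU.Val (sK τ)) : srestrict (sidE τ) k = k :=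
  val_ext (raw_K τ) (.eq_trans (raw_restrict _ _) (.eq_trans (.eq_restrict (.eq_refl (fin_der τ))
    (.eq_refl (fin_der τ)) (raw_idE τ) (.eq_refl (K_der k))) (.restrict_id (fin_der τ) (K_der k))))

theorem srestrict_comp {τ τ' τ'' : cwfU.Val (sfin Γ)} (ε₁ : cwfU.Val (sextn τ τ'))
    (ε₂ : cwfU.Val (sextn τ' τ'')) (k : cwfU.Val (sK τ'')) :
    srestrict ε₁ (srestrict ε₂ k) = srestrict (scompE ε₁ ε₂) k := by
  refine val_ext (raw_K τ) (.eq_trans (raw_restrict _ _) (.eq_trans (.eq_restrict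
    (.eq_refl (fin_der τ)) (.eq_refl (fin_der τ')) (.eq_refl (extn_der ε₁)) (raw_restrict ε₂ k))
    (.eq_trans (.restrict_comp (fin_der τ) (fin_der τ') (fin_der τ'') (extn_der ε₁) (extn_der ε₂)
    (K_der k)) (.eq_symm ?_))))
  exact .eq_trans (raw_restrict _ _) (.eq_restrict (.eq_refl (fin_der τ)) (.eq_refl (fin_der τ''))
    (raw_compE ε₁ ε₂) (.eq_refl (K_der k)))

end Traces

noncomputable abbrev cwfTrace : CwFTrace.{0, 0, 0} SynCtx where
  toCwFJ := cwfJ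
  state := sstate
  state_sub := sstate_sub
  event := sevent
  event_sub := sevent_sub
  nat := snat
  nat_sub := snat_sub
  trans := strans
  trans_sub := strans_sub
  fin := sfin
  fin_sub := sfin_sub
  nil := snil
  nil_sub := snil_sub
  step := sstep
  step_sub := sstep_sub
  inf := sinf
  inf_sub := sinf_sub
  head := shead
  head_sub := shead_sub
  tail := stail
  tail_sub := stail_sub
  corec := scorec
  corec_sub σ _ h e n x := scorec_sub h e n x σ
  head_corec := shead_corec
  tail_corec := stail_corec
  extn := sextn
  extn_sub := sextn_sub
  idE := sidE
  idE_sub := sidE_sub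
  compE := scompE
  compE_sub σ _ _ _ ε₁ ε₂ := scompE_sub ε₁ ε₂ σ
  id_compE := sid_compE
  compE_id := scompE_id
  compE_assoc := scompE_assoc

noncomputable abbrev cwfK : CwFK.{0, 0, 0} SynCtx where
  toCwFTrace := cwfTrace
  K := sK
  K_sub := sK_sub
  Kinf := sKinf
  Kinf_sub := sKinf_sub
  restrict := srestrict
  restrict_sub := srestrict_sub
  restrict_id := srestrict_id
  restrict_comp := srestrict_comp


/-! Propositions. -/

section Cut

variable {Γ Δ : Ctx} {X R t r : Tm} {σ : Sb}

/-- Substitution of a proof of `X` in a proof of a proposition that does not depend on it. -/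
theorem cut (hX : Der (.ctx (X :: Γ))) (hR : Der (.tm Γ R .prop)) (hσ : Der (.sb Δ σ Γ))
    (ht : Der (.tm Δ t (.sub X σ))) (hr : Der (.tm (X :: Γ) r R.wk)) :
    Der (.tm Δ (.sub r (.ext σ t)) (.sub R σ)) := by
  have he := Der.sb_ext hσ hX ht
  refine .conv (s := .prop) (.sub hr he) (.eq_trans (sub_sub (s := .prop) hR (.sb_p hX) he)
    (sub_congr (s := .prop) hR (.sb_comp (.sb_p hX) he) (.sbEq_p hσ hX ht)))

/-- Weakening below an assumption. -/
theorem wk_under {P Y : Tm} (hY : Der (.ctx (Y :: Γ))) (hP : Der (.tm Γ P .prop))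
    (hc : Der (.ctx (P :: Γ))) (hR : Der (.tm Γ R .prop)) (hr : Der (.tm (P :: Γ) r R.wk)) :
    Der (.tm (P.wk :: Y :: Γ) (.sub r (Sb.lift .p)) R.wk.wk) := by
  have hPw : Der (.tm (Y :: Γ) P.wk .prop) := tm_sub (s := .prop) hP (.sb_p hY)
  have f : Fits Γ P (Y :: Γ) P.wk .p .prop :=
    ⟨hP, hc, .ctx_hyp hY hPw, .sb_p hY, .eq_refl hPw⟩
  exact .conv (s := .prop) (.sub hr f.lift) (wk_lift_ty (s' := .prop) f hR).2

end Cut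

section Propositions

variable {i : ℕ} {Γ Δ : SynCtx}

theorem prop_der (P : cwf.Code .prop Γ) : Der (.tm Γ.ctx P.tm.raw .prop) := code_der P

theorem ctx_hyp (P : cwf.Code .prop Γ) : Der (.ctx (P.tm.raw :: Γ.ctx)) := entry_ctx (.hyp P)

theorem prop_sub (P : cwf.Code .prop Γ) (σ : Δ ⟶ Γ) :
    Der (.eq Δ.ctx (P.sub σ).tm.raw (.sub P.tm.raw (rep σ)) .prop) := raw_code_sub P σ

theorem holds_iff (P : cwf.Code .prop Γ) {F : Tm} (e : Der (.eq Γ.ctx P.tm.raw F .prop)) :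
    Holds (M := cwfE) P ↔ ∃ r, Der (.tm Γ.ctx r F) :=
  ⟨fun ⟨x⟩ => ⟨_, val_der' x e⟩, fun ⟨_, h⟩ => ⟨mkVal P e _ h⟩⟩

theorem raw_hyp (P R : cwf.Code .prop Γ) :
    Der (.eq (P.tm.raw :: Γ.ctx) (R.sub (sp (.hyp P))).tm.raw R.tm.raw.wk .prop) :=
  .eq_trans (prop_sub R (sp (.hyp P))) (sub_congr (s := .prop) (prop_der R)
    (hom_der (sp (.hyp P))) (raw_p (.hyp P)))

theorem entails_iff (P R : cwf.Code .prop Γ) :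
    Entails (M := cwfE) P R ↔ ∃ r, Der (.tm (P.tm.raw :: Γ.ctx) r R.tm.raw.wk) :=
  holds_iff (Γ := sext Γ (.hyp P)) (R.sub (sp (.hyp P))) (raw_hyp P R)

theorem sirrel {P : cwf.Code .prop Γ} (r s : cwfU.Val P) : r = s :=
  val_ext (.eq_refl (prop_der P)) (.irrel (prop_der P) (val_der r) (val_der s))

noncomputable def strue (Γ : SynCtx) : cwf.Code .prop Γ := mkCode (s := .prop) .top (.top Γ.wf)
noncomputable def sfalse (Γ : SynCtx) : cwf.Code .prop Γ := mkCode (s := .prop) .bot (.bot Γ.wf)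
noncomputable def sand (P Q : cwf.Code .prop Γ) : cwf.Code .prop Γ :=
  mkCode (s := .prop) (.and P.tm.raw Q.tm.raw) (.and (prop_der P) (prop_der Q))
noncomputable def sor (P Q : cwf.Code .prop Γ) : cwf.Code .prop Γ :=
  mkCode (s := .prop) (.or P.tm.raw Q.tm.raw) (.or (prop_der P) (prop_der Q))
noncomputable def simpl (P Q : cwf.Code .prop Γ) : cwf.Code .prop Γ :=
  mkCode (s := .prop) (.imp P.tm.raw Q.tm.raw) (.imp (prop_der P) (prop_der Q))
noncomputable def sall (a : cwf.Code (.uc i) Γ) (P : cwf.Code .prop (cons (M := cwfE) a)) :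
    cwf.Code .prop Γ :=
  mkCode (s := .prop) (.all i a.tm.raw P.tm.raw) (.all (code_der a) (prop_der P))
noncomputable def sex (a : cwf.Code (.uc i) Γ) (P : cwf.Code .prop (cons (M := cwfE) a)) :
    cwf.Code .prop Γ :=
  mkCode (s := .prop) (.ex i a.tm.raw P.tm.raw) (.ex (code_der a) (prop_der P))

theorem raw_top (Γ : SynCtx) : Der (.eq Γ.ctx (strue Γ).tm.raw .top .prop) :=
  raw_mkCode (s := .prop) _
theorem raw_bot (Γ : SynCtx) : Der (.eq Γ.ctx (sfalse Γ).tm.raw .bot .prop) :=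
  raw_mkCode (s := .prop) _
theorem raw_and (P Q : cwf.Code .prop Γ) :
    Der (.eq Γ.ctx (sand P Q).tm.raw (.and P.tm.raw Q.tm.raw) .prop) := raw_mkCode (s := .prop) _
theorem raw_or (P Q : cwf.Code .prop Γ) :
    Der (.eq Γ.ctx (sor P Q).tm.raw (.or P.tm.raw Q.tm.raw) .prop) := raw_mkCode (s := .prop) _
theorem raw_imp (P Q : cwf.Code .prop Γ) :
    Der (.eq Γ.ctx (simpl P Q).tm.raw (.imp P.tm.raw Q.tm.raw) .prop) := raw_mkCode (s := .prop) _
theorem raw_all (a : cwf.Code (.uc i) Γ) (P : cwf.Code .prop (cons (M := cwfE) a)) :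
    Der (.eq Γ.ctx (sall a P).tm.raw (.all i a.tm.raw P.tm.raw) .prop) := raw_mkCode (s := .prop) _
theorem raw_ex (a : cwf.Code (.uc i) Γ) (P : cwf.Code .prop (cons (M := cwfE) a)) :
    Der (.eq Γ.ctx (sex a P).tm.raw (.ex i a.tm.raw P.tm.raw) .prop) := raw_mkCode (s := .prop) _

theorem strue_sub (σ : Δ ⟶ Γ) : (strue Γ).sub σ = strue Δ :=
  code_law (s := .prop) (.top Γ.wf) (raw_top Γ) σ (raw_top Δ) (.eq_refl (.top Δ.wf))
theorem sfalse_sub (σ : Δ ⟶ Γ) : (sfalse Γ).sub σ = sfalse Δ :=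
  code_law (s := .prop) (.bot Γ.wf) (raw_bot Γ) σ (raw_bot Δ) (.eq_refl (.bot Δ.wf))
theorem sand_sub (σ : Δ ⟶ Γ) (P Q : cwf.Code .prop Γ) :
    (sand P Q).sub σ = sand (P.sub σ) (Q.sub σ) :=
  code_law (s := .prop) (.and (prop_der P) (prop_der Q)) (raw_and P Q) σ (raw_and _ _)
    (.eq_and (prop_sub P σ) (prop_sub Q σ))
theorem sor_sub (σ : Δ ⟶ Γ) (P Q : cwf.Code .prop Γ) :
    (sor P Q).sub σ = sor (P.sub σ) (Q.sub σ) :=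
  code_law (s := .prop) (.or (prop_der P) (prop_der Q)) (raw_or P Q) σ (raw_or _ _)
    (.eq_or (prop_sub P σ) (prop_sub Q σ))
theorem simpl_sub (σ : Δ ⟶ Γ) (P Q : cwf.Code .prop Γ) :
    (simpl P Q).sub σ = simpl (P.sub σ) (Q.sub σ) :=
  code_law (s := .prop) (.imp (prop_der P) (prop_der Q)) (raw_imp P Q) σ (raw_imp _ _)
    (.eq_imp (prop_sub P σ) (prop_sub Q σ))
theorem sall_sub (σ : Δ ⟶ Γ) (a : cwf.Code (.uc i) Γ)
    (P : cwf.Code .prop (cons (M := cwfE) a)) :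
    (sall a P).sub σ = sall (a.sub σ) (P.sub (up (M := cwfE) σ a)) :=
  code_law (s := .prop) (.all (code_der a) (prop_der P)) (raw_all a P) σ (raw_all _ _)
    (.eq_all (raw_code_sub a σ) (raw_code_up σ a P))
theorem sex_sub (σ : Δ ⟶ Γ) (a : cwf.Code (.uc i) Γ)
    (P : cwf.Code .prop (cons (M := cwfE) a)) :
    (sex a P).sub σ = sex (a.sub σ) (P.sub (up (M := cwfE) σ a)) :=
  code_law (s := .prop) (.ex (code_der a) (prop_der P)) (raw_ex a P) σ (raw_ex _ _)
    (.eq_ex (raw_code_sub a σ) (raw_code_up σ a P))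

theorem sholds_top (Γ : SynCtx) : Holds (M := cwfE) (strue Γ) :=
  (holds_iff _ (raw_top Γ)).2 ⟨_, .topI Γ.wf⟩

/-- The most recent assumption, with its computed weakening. -/
theorem hyp_der (P : cwf.Code .prop Γ) {F G : Tm} (hF : Der (.tm Γ.ctx F .prop))
    (e : Der (.eq Γ.ctx P.tm.raw F .prop)) (hG : F.push .p = G) :
    Der (.tm (P.tm.raw :: Γ.ctx) .q G) := by
  have hp := Der.sb_p (ctx_hyp P)
  subst hG
  exact .conv (s := .prop) (.q (ctx_hyp P)) (.eq_trans (sub_congr_left (s := .prop) e hp)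
    (push_sort (s := .prop) hF hp))

theorem wk_prop (P R : cwf.Code .prop Γ) : Der (.tm (P.tm.raw :: Γ.ctx) R.tm.raw.wk .prop) :=
  tm_sub (s := .prop) (prop_der R) (.sb_p (ctx_hyp P))

theorem sbot_entails (R : cwf.Code .prop Γ) : Entails (M := cwfE) (sfalse Γ) R :=
  (entails_iff _ _).2 ⟨_, .botE (wk_prop _ R) (hyp_der _ (.bot Γ.wf) (raw_bot Γ) rfl)⟩

theorem sholds_and (P Q : cwf.Code .prop Γ) : Holds (M := cwfE) (sand P Q) ↔
    Holds (M := cwfE) P ∧ Holds (M := cwfE) Q := by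
  rw [holds_iff _ (raw_and P Q), holds_iff P (.eq_refl (prop_der P)),
    holds_iff Q (.eq_refl (prop_der Q))]
  exact ⟨fun ⟨_, h⟩ => ⟨⟨_, .andE₁ (prop_der P) (prop_der Q) h⟩,
    ⟨_, .andE₂ (prop_der P) (prop_der Q) h⟩⟩,
    fun ⟨⟨_, h⟩, ⟨_, h'⟩⟩ => ⟨_, .andI (prop_der P) (prop_der Q) h h'⟩⟩

theorem sor_entails (P Q R : cwf.Code .prop Γ) : Entails (M := cwfE) (sor P Q) R ↔
    Entails (M := cwfE) P R ∧ Entails (M := cwfE) Q R := by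
  rw [entails_iff, entails_iff, entails_iff]
  have hor : Der (.tm Γ.ctx (.or P.tm.raw Q.tm.raw) .prop) := .or (prop_der P) (prop_der Q)
  constructor
  · rintro ⟨r, hr⟩
    have key : ∀ (X : cwf.Code .prop Γ) (t : Tm),
        Der (.tm (X.tm.raw :: Γ.ctx) t (.or P.tm.raw.wk Q.tm.raw.wk)) →
        ∃ r, Der (.tm (X.tm.raw :: Γ.ctx) r R.tm.raw.wk) := fun X t ht => by
      have hp := Der.sb_p (ctx_hyp X)
      exact ⟨_, cut (ctx_hyp (sor P Q)) (prop_der R) hp (.conv (s := .prop) ht (.eq_symm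
        (.eq_trans (sub_congr_left (s := .prop) (raw_or P Q) hp)
        (push_sort (s := .prop) hor hp)))) hr⟩
    exact ⟨key P _ (.orI₁ (wk_prop P P) (wk_prop P Q) (.q (ctx_hyp P))),
      key Q _ (.orI₂ (wk_prop Q P) (wk_prop Q Q) (.q (ctx_hyp Q)))⟩
  · rintro ⟨⟨s, hs⟩, ⟨t, ht⟩⟩
    have hO := ctx_hyp (sor P Q)
    exact ⟨_, .orE (wk_prop _ P) (wk_prop _ Q) (wk_prop _ R) (hyp_der _ hor (raw_or P Q) rfl)
      (wk_under hO (prop_der P) (ctx_hyp P) (prop_der R) hs)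
      (wk_under hO (prop_der Q) (ctx_hyp Q) (prop_der R) ht)⟩

theorem sholds_imp (P Q : cwf.Code .prop Γ) :
    Holds (M := cwfE) (simpl P Q) ↔ Entails (M := cwfE) P Q := by
  rw [holds_iff _ (raw_imp P Q), entails_iff]
  constructor
  · rintro ⟨f, hf⟩
    have hp := Der.sb_p (ctx_hyp P)
    exact ⟨_, .impE (wk_prop P P) (wk_prop P Q) (.conv (s := .prop) (.sub hf hp)
      (push_sort (s := .prop) (.imp (prop_der P) (prop_der Q)) hp)) (.q (ctx_hyp P))⟩
  · exact fun ⟨_, h⟩ => ⟨_, .impI (prop_der P) (prop_der Q) h⟩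

/-- A formula under a weakened binder. -/
theorem under {Θ : Ctx} {σ : Sb} (a : cwf.Code (.uc i) Γ) (P : cwf.Code .prop (cons (M := cwfE) a))
    (hσ : Der (.sb Θ σ Γ.ctx)) (hΘ : Der (.ctx Θ)) :
    Fits Γ.ctx a.tm.raw Θ (.sub a.tm.raw σ) σ (.uc i) ∧
    Der (.tm Θ (.sub a.tm.raw σ) (.uc i)) ∧
    Der (.tm (.sub a.tm.raw σ :: Θ) (.sub P.tm.raw σ.lift) .prop) := by
  have h : Der (.tm Θ (.sub a.tm.raw σ) (.uc i)) := tm_sub (s := .uc i) (code_der a) hσ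
  have f : Fits Γ.ctx a.tm.raw Θ (.sub a.tm.raw σ) σ (.uc i) :=
    ⟨code_der a, ctx_cons a, .ctx_comp hΘ h, hσ, .eq_refl h⟩
  exact ⟨f, h, tm_sub (s := .prop) (prop_der P) f.lift⟩

theorem sholds_all (a : cwf.Code (.uc i) Γ) (P : cwf.Code .prop (cons (M := cwfE) a)) :
    Holds (M := cwfE) (sall a P) ↔ Holds (M := cwfE) P := by
  rw [holds_iff _ (raw_all a P), holds_iff P (.eq_refl (prop_der P))]
  constructor
  · rintro ⟨f, hf⟩
    have hp := der_p a
    obtain ⟨-, hl, hi, hli⟩ := lift_inst (code_der a) (ctx_cons a)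
    obtain ⟨-, h1, h2⟩ := under a P hp (ctx_cons a)
    have e := Der.eq_trans (sub_sub (s := .prop) (prop_der P) hl hi) (.eq_trans (sub_congr
      (s := .prop) (prop_der P) (.sb_comp hl hi) hli) (.eq_sub_id (prop_der P)))
    exact ⟨_, .conv (s := .prop) (.allE h1 h2 (.conv (s := .prop) (.sub hf hp) (push_sort
      (s := .prop) (.all (code_der a) (prop_der P)) hp)) (.q (ctx_cons a))) e⟩
  · exact fun ⟨_, h⟩ => ⟨_, .allI (code_der a) (prop_der P) h⟩

theorem sex_entails (a : cwf.Code (.uc i) Γ) (P : cwf.Code .prop (cons (M := cwfE) a))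
    (R : cwf.Code .prop Γ) : Entails (M := cwfE) (sex a P) R ↔
      Entails (M := cwfE) P (R.sub (sp (.comp i a))) := by
  rw [entails_iff, entails_iff]
  have hex : Der (.tm Γ.ctx (.ex i a.tm.raw P.tm.raw) .prop) := .ex (code_der a) (prop_der P)
  have hpa := der_p a
  have hpP := Der.sb_p (ctx_hyp P)
  have hpp := Der.sb_comp hpa hpP
  have eR : Der (.eq (P.tm.raw :: a.tm.raw :: Γ.ctx) (R.sub (sp (.comp i a))).tm.raw.wk
      R.tm.raw.wk.wk .prop) := sub_congr_left (s := .prop) (raw_wk a R) hpP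
  have hRw : Der (.tm (a.tm.raw :: Γ.ctx) R.tm.raw.wk .prop) := tm_sub (s := .prop) (prop_der R) hpa
  constructor
  · rintro ⟨r, hr⟩
    have hE := ctx_hyp (sex a P)
    obtain ⟨f, h1, h2⟩ := under a P hpp (ctx_hyp P)
    have hid := Der.sb_id (ctx_hyp P)
    have hq : Der (.tm (P.tm.raw :: a.tm.raw :: Γ.ctx) Tm.q.wk (.sub a.tm.raw (.comp .p .p))) :=
      .conv (s := .uc i) (.sub (.q (ctx_cons a)) hpP) (sub_sub (s := .uc i) (code_der a) hpa hpP)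
    have hq' : Der (.tm (P.tm.raw :: a.tm.raw :: Γ.ctx) Tm.q.wk
        (.sub (.sub a.tm.raw (.comp .p .p)) .id)) :=
      .conv (s := .uc i) hq (.eq_symm (.eq_sub_id h1))
    have hi := Der.sb_ext hid f.hc' hq'
    have e : Der (.sbEq (P.tm.raw :: a.tm.raw :: Γ.ctx)
        (.comp (Sb.lift (.comp .p .p)) (.inst Tm.q.wk)) .p (a.tm.raw :: Γ.ctx)) :=
      .sbEq_trans (f.ext hid hq') (.sbEq_trans (.sbEq_symm (.sbEq_ext (.sbEq_symm
        (.sbEq_comp_id hpp)) (ctx_cons a) (.eq_refl hq))) (.sbEq_eta (ctx_cons a) hpP))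
    have e' := Der.eq_trans (sub_sub (s := .prop) (prop_der P) f.lift hi)
      (sub_congr (s := .prop) (prop_der P) (.sb_comp f.lift hi) e)
    have ht := Der.exI h1 h2 hq (.conv (s := .prop) (.q (ctx_hyp P)) (.eq_symm e'))
    refine ⟨_, .conv (s := .prop) (cut hE (prop_der R) hpp (.conv (s := .prop) ht (.eq_symm
      (.eq_trans (sub_congr_left (s := .prop) (raw_ex a P) hpp) (push_sort (s := .prop) hex hpp))))
      hr) (.eq_symm (.eq_trans eR (sub_sub (s := .prop) (prop_der R) hpa hpP)))⟩
  · rintro ⟨s, hs⟩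
    have hE := ctx_hyp (sex a P)
    have hp := Der.sb_p hE
    obtain ⟨f, h1, h2⟩ := under a P hp hE
    have g : Fits (a.tm.raw :: Γ.ctx) P.tm.raw (a.tm.raw.wk :: (sex a P).tm.raw :: Γ.ctx)
        (.sub P.tm.raw (Sb.lift .p)) (Sb.lift .p) .prop :=
      ⟨prop_der P, ctx_hyp P, .ctx_hyp f.hc' h2, f.lift, .eq_refl h2⟩
    refine ⟨_, .exE h1 h2 (wk_prop _ R) (hyp_der _ hex (raw_ex a P) rfl) (.conv (s := .prop)
      (.sub (.conv (s := .prop) hs eR) g.lift) (.eq_trans (wk_lift_ty (s' := .prop) g hRw).2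
      (sub_congr_left (s := .prop) (wk_lift_ty (s' := .prop) f (prop_der R)).2 (.sb_p g.hc'))))⟩

end Propositions

noncomputable abbrev cwfProp : CwFProp.{0, 0, 0} SynCtx where
  toCwFK := cwfK
  irrel := sirrel
  top := strue
  top_sub := strue_sub
  bot := sfalse
  bot_sub := sfalse_sub
  and := sand
  and_sub := sand_sub
  or := sor
  or_sub := sor_sub
  imp := simpl
  imp_sub := simpl_sub
  all := sall
  all_sub := sall_sub
  ex := sex
  ex_sub := sex_sub
  holds_top := sholds_top
  bot_entails := sbot_entails
  holds_and := sholds_and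
  or_entails := sor_entails
  holds_imp := sholds_imp
  holds_all := sholds_all
  ex_entails := sex_entails

section FixedPoints

variable {Γ Δ : SynCtx}

theorem ctx_pvar (Γ : SynCtx) : Der (.ctx (.prop :: Γ.ctx)) := .ctx_pvar Γ.wf

theorem raw_snocProp (σ : Δ ⟶ Γ) (P : cwf.Code .prop Δ) {σ' : Sb} {P' : Tm}
    (h : Der (.sbEq Δ.ctx (rep σ) σ' Γ.ctx)) (h' : Der (.eq Δ.ctx P.tm.raw P' .prop)) :
    Der (.sbEq Δ.ctx (rep (snocProp (M := cwfE) σ P)) (.ext σ' P') (.prop :: Γ.ctx)) :=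
  .sbEq_trans (raw_mkHom (Γ := consProp cwfE Γ) _) (.sbEq_ext h (ctx_pvar Γ)
    (.eq_conv (s := .tyL 0) h' (.eq_symm (.eq_sort (s := .prop) (hom_der σ)))))

theorem raw_sub_snocProp (φ : cwf.Code .prop (consProp cwfE Γ)) (σ : Δ ⟶ Γ)
    (P : cwf.Code .prop Δ) {σ' : Sb} {P' : Tm}
    (h : Der (.sbEq Δ.ctx (rep σ) σ' Γ.ctx)) (h' : Der (.eq Δ.ctx P.tm.raw P' .prop)) :
    Der (.eq Δ.ctx (φ.sub (snocProp (M := cwfE) σ P)).tm.raw (.sub φ.tm.raw (.ext σ' P')) .prop) :=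
  .eq_trans (prop_sub φ _) (sub_congr (s := .prop) (prop_der φ) (hom_der _)
    (raw_snocProp σ P h h'))

/-- The most recent propositional variable. -/
theorem pvar_der {Γ : Ctx} (hc : Der (.ctx (.prop :: Γ))) : Der (.tm (.prop :: Γ) .q .prop) :=
  .conv (s := .tyL 0) (.q hc) (.eq_sort (s := .prop) (.sb_p hc))

theorem raw_upProp (σ : Δ ⟶ Γ) (φ : cwf.Code .prop (consProp cwfE Γ)) :
    Der (.eq (.prop :: Δ.ctx) (φ.sub (upProp (M := cwfE) σ)).tm.raw (.sub φ.tm.raw (rep σ).lift)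
      .prop) := by
  refine raw_sub_snocProp (Δ := consProp cwfE Δ) φ _ _ ?_ ?_
  · exact .sbEq_trans (raw_comp (sp (Γ := Δ) .pvar) σ) (.sbEq_comp (.sbEq_refl (hom_der σ))
      (raw_p (Γ := Δ) .pvar))
  · exact .eq_conv (s := .tyL 0) (raw_q (Γ := Δ) .pvar)
      (.eq_sort (s := .prop) (.sb_p (ctx_pvar Δ)))

theorem mono_raw {φ : cwf.Code .prop (consProp cwfE Γ)}
    (h : CwFProp.Monotone (M := cwfProp) (Γ := Γ) φ) :
    ∃ m, Der (.tm (monoCtx Γ.ctx) m (monoGoal φ.tm.raw)) := by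
  have c1 := ctx_pvar Γ
  have c2 := Der.ctx_pvar c1
  have q1 := pvar_der c1
  have q2 := pvar_der c2
  have p2 := Der.sb_p c2
  have q1' : Der (.tm (.prop :: .prop :: Γ.ctx) Tm.q.wk .prop) := tm_sub (s := .prop) q1 p2
  have c3 : Der (.ctx (monoCtx Γ.ctx)) := .ctx_hyp c2 (.imp q1' q2)
  have p3 := Der.sb_p c3
  have hσ := Der.sb_comp (.sb_p c1) (.sb_comp p2 p3)
  let D : SynCtx := ⟨monoCtx Γ.ctx, c3⟩
  have hP : Der (.tm D.ctx Tm.q.wk.wk .prop) := tm_sub (s := .prop) q1' p3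
  have hQ : Der (.tm D.ctx Tm.q.wk .prop) := tm_sub (s := .prop) q2 p3
  let P : cwf.Code .prop D := mkCode (s := .prop) Tm.q.wk.wk hP
  let Q : cwf.Code .prop D := mkCode (s := .prop) Tm.q.wk hQ
  have eP : Der (.eq D.ctx P.tm.raw Tm.q.wk.wk .prop) := raw_mkCode (s := .prop) hP
  have eQ : Der (.eq D.ctx Q.tm.raw Tm.q.wk .prop) := raw_mkCode (s := .prop) hQ
  let σ : D ⟶ Γ := mkHom _ hσ
  have eσ := raw_mkHom (Δ := D) (Γ := Γ) hσ
  have e := h σ P Q ((holds_iff _ (.eq_trans (raw_imp P Q) (.eq_imp eP eQ))).2 ⟨.q, .conv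
    (s := .prop) (.q c3) (push_sort (s := .prop) (.imp q1' q2) p3)⟩)
  exact (holds_iff _ (.eq_trans (raw_imp _ _) (.eq_imp (raw_sub_snocProp φ σ P eσ eP)
    (raw_sub_snocProp φ σ Q eσ eQ)))).1 e

variable (φ : cwf.Code .prop (consProp cwfE Γ))

theorem mu_der (h : CwFProp.Monotone (M := cwfProp) (Γ := Γ) φ) :
    Der (.tm Γ.ctx (.mu φ.tm.raw) .prop) :=
  (mono_raw h).elim fun _ hm => .mu Γ.wf (prop_der φ) hm

theorem nu_der (h : CwFProp.Monotone (M := cwfProp) (Γ := Γ) φ) :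
    Der (.tm Γ.ctx (.nu φ.tm.raw) .prop) :=
  (mono_raw h).elim fun _ hm => .nu Γ.wf (prop_der φ) hm

noncomputable def smu (h : CwFProp.Monotone (M := cwfProp) (Γ := Γ) φ) :
    cwf.Code .prop Γ := mkCode (s := .prop) _ (mu_der φ h)
noncomputable def snu (h : CwFProp.Monotone (M := cwfProp) (Γ := Γ) φ) :
    cwf.Code .prop Γ := mkCode (s := .prop) _ (nu_der φ h)

theorem raw_mu (h : CwFProp.Monotone (M := cwfProp) (Γ := Γ) φ) :
    Der (.eq Γ.ctx (smu φ h).tm.raw (.mu φ.tm.raw) .prop) :=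
  raw_mkCode (s := .prop) _
theorem raw_nu (h : CwFProp.Monotone (M := cwfProp) (Γ := Γ) φ) :
    Der (.eq Γ.ctx (snu φ h).tm.raw (.nu φ.tm.raw) .prop) :=
  raw_mkCode (s := .prop) _

theorem smu_sub (h : CwFProp.Monotone (M := cwfProp) (Γ := Γ) φ) (σ : Δ ⟶ Γ)
    (h' : CwFProp.Monotone (M := cwfProp) (Γ := Δ) (φ.sub (upProp (M := cwfE) σ))) :
    (smu φ h).sub σ = smu (φ.sub (upProp (M := cwfE) σ)) h' :=
  (mono_raw h').elim fun _ hm => code_law (s := .prop) (mu_der φ h) (raw_mu φ h) σ (raw_mu _ h')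
    (.eq_mu (raw_upProp σ φ) hm)

theorem snu_sub (h : CwFProp.Monotone (M := cwfProp) (Γ := Γ) φ) (σ : Δ ⟶ Γ)
    (h' : CwFProp.Monotone (M := cwfProp) (Γ := Δ) (φ.sub (upProp (M := cwfE) σ))) :
    (snu φ h).sub σ = snu (φ.sub (upProp (M := cwfE) σ)) h' :=
  (mono_raw h').elim fun _ hm => code_law (s := .prop) (nu_der φ h) (raw_nu φ h) σ (raw_nu _ h')
    (.eq_nu (raw_upProp σ φ) hm)

theorem fix_imp {P Q : Tm} {X Y : cwf.Code .prop Γ} {r : Tm}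
    (e : Der (.eq Γ.ctx X.tm.raw P .prop)) (e' : Der (.eq Γ.ctx Y.tm.raw Q .prop))
    (hr : Der (.tm Γ.ctx r (.imp P Q))) : Holds (M := cwfE) (simpl X Y) :=
  (holds_iff _ (.eq_trans (raw_imp X Y) (.eq_imp e e'))).2 ⟨r, hr⟩

theorem raw_unfold_mu (h : CwFProp.Monotone (M := cwfProp) (Γ := Γ) φ) :
    Der (.eq Γ.ctx (φ.sub (snocProp (M := cwfE) (𝟙 Γ) (smu φ h))).tm.raw
    (.sub φ.tm.raw (.inst (.mu φ.tm.raw))) .prop) :=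
  raw_sub_snocProp φ _ _ (raw_id Γ) (raw_mu φ h)

theorem raw_unfold_nu (h : CwFProp.Monotone (M := cwfProp) (Γ := Γ) φ) :
    Der (.eq Γ.ctx (φ.sub (snocProp (M := cwfE) (𝟙 Γ) (snu φ h))).tm.raw
    (.sub φ.tm.raw (.inst (.nu φ.tm.raw))) .prop) :=
  raw_sub_snocProp φ _ _ (raw_id Γ) (raw_nu φ h)

end FixedPoints

/-- The syntactic model. -/
noncomputable def model : Model.{0, 0, 0} SynCtx where
  toCwFProp := cwfProp
  mu := smu
  mu_sub σ φ h h' := smu_sub φ h σ h'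
  fold {Γ} φ h := (mono_raw h).elim fun _ hm => fix_imp (raw_unfold_mu φ h) (raw_mu φ h)
    (.fold Γ.wf (prop_der φ) hm)
  unfold {Γ} φ h := (mono_raw h).elim fun _ hm => fix_imp (raw_mu φ h) (raw_unfold_mu φ h)
    (.unfold Γ.wf (prop_der φ) hm)
  nu := snu
  nu_sub σ φ h h' := snu_sub φ h σ h'
  out {Γ} φ h := (mono_raw h).elim fun _ hm => fix_imp (raw_nu φ h) (raw_unfold_nu φ h)
    (.out Γ.wf (prop_der φ) hm)
  into {Γ} φ h := (mono_raw h).elim fun _ hm => fix_imp (raw_unfold_nu φ h) (raw_nu φ h)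
    (.into Γ.wf (prop_der φ) hm)

end Syn

end NMDEKL

namespace NMDEKL

namespace Sem

open CwFE CwFPi

variable {C : Type u} [Category.{v} C] (M : Model.{u, v, w} C)

/-- Environments over `Δ`: the values of the variables of a context, the most recent one first. -/
abbrev Env (Δ : C) : Type w := List (M.Tm Δ)

variable {M}

/-- Substitution in an environment. -/
abbrev Env.sub {Γ Δ : C} (σ : Δ ⟶ Γ) (ρ : Env M Γ) : Env M Δ := ρ.map (M.subTm σ)

/-- An environment weakened by a context entry and extended by the new variable. -/
abbrev Env.under {Δ : C} (e : M.Entry Δ) (ρ : Env M Δ) : Env M (M.ext Δ e) :=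
  (M.q e).tm :: ρ.sub (M.p e)

/-- An environment under a binder of a computational type. -/
abbrev Env.bind {i : ℕ} {Δ : C} (a : M.Code (.uc i) Δ) (ρ : Env M Δ) : Env M (cons a) :=
  ρ.under (.comp i a)

/-- An environment under the three binders of a motive of `J`. -/
abbrev Env.bind₃ {i : ℕ} {Δ : C} (a : M.Code (.uc i) Δ) (ρ : Env M Δ) : Env M (idCtx a) :=
  ((ρ.bind a).bind (a.sub (M.p (.comp i a)))).bind (idVars a)

/-- `v` is a proof of `P`. -/
def Proves {Δ : C} (P : M.Code .prop Δ) (v : M.Tm Δ) : Prop := M.typ v = M.El P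

variable (M)

mutual

/-- `t` has the value `v` in the environment `ρ`.  The value of a proof is a proof of the proposition
that can be read off from its annotations.  The knowledge universes, which are not arguments of any
operation, have no value (see `IsTyL`). -/
def Ev : Tm → ∀ {Δ : C}, Env M Δ → M.Tm Δ → Prop
  | .sub t σ, _, ρ, v => ∃ ρ', EvS σ ρ ρ' ∧ Ev t ρ' v
  | .q, _, ρ, v => ∃ ρ', ρ = v :: ρ'
  | .uc i, Δ, _, v => v = (M.univ (.uc i) Δ).tm
  | .tyL _, _, _, _ => False
  | .prop, Δ, _, v => v = (M.univ .prop Δ).tm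
  | .pi i A B, Δ, ρ, v => ∃ a : M.Code (.uc i) Δ, Ev A ρ a.tm ∧
      ∃ b : M.Code (.uc i) (cons a), Ev B (ρ.bind a) b.tm ∧ v = (M.pi a b).tm
  | .lam i A B t, Δ, ρ, v => ∃ a : M.Code (.uc i) Δ, Ev A ρ a.tm ∧
      ∃ b : M.Code (.uc i) (cons a), Ev B (ρ.bind a) b.tm ∧
      ∃ x : M.Val b, Ev t (ρ.bind a) x.tm ∧ v = (M.lam x).tm
  | .app i A B f a, Δ, ρ, v => ∃ A' : M.Code (.uc i) Δ, Ev A ρ A'.tm ∧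
      ∃ b : M.Code (.uc i) (cons A'), Ev B (ρ.bind A') b.tm ∧
      ∃ g : M.Val (M.pi A' b), Ev f ρ g.tm ∧ ∃ x : M.Val A', Ev a ρ x.tm ∧
      v = M.subTm (at1 x) (M.lam.symm g).tm
  | .sig i A B, Δ, ρ, v => ∃ a : M.Code (.uc i) Δ, Ev A ρ a.tm ∧
      ∃ b : M.Code (.uc i) (cons a), Ev B (ρ.bind a) b.tm ∧ v = (M.sig a b).tm
  | .pair i A B s t, Δ, ρ, v => ∃ a : M.Code (.uc i) Δ, Ev A ρ a.tm ∧
      ∃ b : M.Code (.uc i) (cons a), Ev B (ρ.bind a) b.tm ∧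
      ∃ x : M.Val a, Ev s ρ x.tm ∧ ∃ y : M.Val (b.sub (at1 x)), Ev t ρ y.tm ∧
      v = (M.pr ⟨x, y⟩).tm
  | .fst i A B c, Δ, ρ, v => ∃ a : M.Code (.uc i) Δ, Ev A ρ a.tm ∧
      ∃ b : M.Code (.uc i) (cons a), Ev B (ρ.bind a) b.tm ∧
      ∃ z : M.Val (M.sig a b), Ev c ρ z.tm ∧ v = (M.pr.symm z).1.tm
  | .snd i A B c, Δ, ρ, v => ∃ a : M.Code (.uc i) Δ, Ev A ρ a.tm ∧
      ∃ b : M.Code (.uc i) (cons a), Ev B (ρ.bind a) b.tm ∧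
      ∃ z : M.Val (M.sig a b), Ev c ρ z.tm ∧ v = (M.pr.symm z).2.tm
  | .idt i A s t, Δ, ρ, v => ∃ a : M.Code (.uc i) Δ, Ev A ρ a.tm ∧
      ∃ x : M.Val a, Ev s ρ x.tm ∧ ∃ y : M.Val a, Ev t ρ y.tm ∧ v = (M.idt x y).tm
  | .refl i A s, Δ, ρ, v => ∃ a : M.Code (.uc i) Δ, Ev A ρ a.tm ∧
      ∃ x : M.Val a, Ev s ρ x.tm ∧ v = (M.refl x).tm
  | .J i j A D d s t r, Δ, ρ, v => ∃ a : M.Code (.uc i) Δ, Ev A ρ a.tm ∧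
      ∃ c : M.Code (.uc j) (idCtx a), Ev D (ρ.bind₃ a) c.tm ∧
      ∃ d' : M.Val (c.sub (diag a)), Ev d (ρ.bind a) d'.tm ∧
      ∃ x : M.Val a, Ev s ρ x.tm ∧ ∃ y : M.Val a, Ev t ρ y.tm ∧
      ∃ z : M.Val (M.idt x y), Ev r ρ z.tm ∧ v = (M.J c d' x y z).tm
  | .state, Δ, _, v => v = (M.state Δ).tm
  | .event, Δ, _, v => v = (M.event Δ).tm
  | .nat, Δ, _, v => v = (M.nat Δ).tm
  | .trans s e s', Δ, ρ, v => ∃ x : M.Val (M.state Δ), Ev s ρ x.tm ∧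
      ∃ y : M.Val (M.event Δ), Ev e ρ y.tm ∧ ∃ x' : M.Val (M.state Δ), Ev s' ρ x'.tm ∧
      v = (M.trans x y x').tm
  | .fin, Δ, _, v => v = (M.fin Δ).tm
  | .nil s, Δ, ρ, v => ∃ x : M.Val (M.state Δ), Ev s ρ x.tm ∧ v = (M.nil x).tm
  | .step τ e s, Δ, ρ, v => ∃ z : M.Val (M.fin Δ), Ev τ ρ z.tm ∧
      ∃ y : M.Val (M.event Δ), Ev e ρ y.tm ∧ ∃ x : M.Val (M.state Δ), Ev s ρ x.tm ∧
      v = (M.step z y x).tm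
  | .inf, Δ, _, v => v = (M.inf Δ).tm
  | .head π, Δ, ρ, v => ∃ z : M.Val (M.inf Δ), Ev π ρ z.tm ∧ v = (M.head z).tm
  | .tail π, Δ, ρ, v => ∃ z : M.Val (M.inf Δ), Ev π ρ z.tm ∧ v = (M.tail z).tm
  | .corec i X h e n x, Δ, ρ, v => ∃ a : M.Code (.uc i) Δ, Ev X ρ a.tm ∧
      ∃ h' : M.Val (M.state (cons a)), Ev h (ρ.bind a) h'.tm ∧
      ∃ e' : M.Val (M.event (cons a)), Ev e (ρ.bind a) e'.tm ∧
      ∃ n' : M.Val (a.sub (M.p (.comp i a))), Ev n (ρ.bind a) n'.tm ∧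
      ∃ y : M.Val a, Ev x ρ y.tm ∧ v = (M.corec h' e' n' y).tm
  | .extn τ τ', Δ, ρ, v => ∃ x : M.Val (M.fin Δ), Ev τ ρ x.tm ∧
      ∃ y : M.Val (M.fin Δ), Ev τ' ρ y.tm ∧ v = (M.extn x y).tm
  | .idE τ, Δ, ρ, v => ∃ x : M.Val (M.fin Δ), Ev τ ρ x.tm ∧ v = (M.idE x).tm
  | .compE τ τ' τ'' ε₁ ε₂, Δ, ρ, v => ∃ x : M.Val (M.fin Δ), Ev τ ρ x.tm ∧
      ∃ y : M.Val (M.fin Δ), Ev τ' ρ y.tm ∧ ∃ z : M.Val (M.fin Δ), Ev τ'' ρ z.tm ∧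
      ∃ f : M.Val (M.extn x y), Ev ε₁ ρ f.tm ∧ ∃ g : M.Val (M.extn y z), Ev ε₂ ρ g.tm ∧
      v = (M.compE f g).tm
  | .K τ, Δ, ρ, v => ∃ x : M.Val (M.fin Δ), Ev τ ρ x.tm ∧ v = (M.K x).tm
  | .Kinf π, Δ, ρ, v => ∃ z : M.Val (M.inf Δ), Ev π ρ z.tm ∧ v = (M.Kinf z).tm
  | .restrict τ τ' ε k, Δ, ρ, v => ∃ x : M.Val (M.fin Δ), Ev τ ρ x.tm ∧
      ∃ y : M.Val (M.fin Δ), Ev τ' ρ y.tm ∧ ∃ f : M.Val (M.extn x y), Ev ε ρ f.tm ∧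
      ∃ z : M.Val (M.K y), Ev k ρ z.tm ∧ v = (M.restrict f z).tm
  | .top, Δ, _, v => v = (M.top Δ).tm
  | .bot, Δ, _, v => v = (M.bot Δ).tm
  | .and P Q, Δ, ρ, v => ∃ X : M.Code .prop Δ, Ev P ρ X.tm ∧ ∃ Y : M.Code .prop Δ, Ev Q ρ Y.tm ∧
      v = (M.and X Y).tm
  | .or P Q, Δ, ρ, v => ∃ X : M.Code .prop Δ, Ev P ρ X.tm ∧ ∃ Y : M.Code .prop Δ, Ev Q ρ Y.tm ∧
      v = (M.or X Y).tm
  | .imp P Q, Δ, ρ, v => ∃ X : M.Code .prop Δ, Ev P ρ X.tm ∧ ∃ Y : M.Code .prop Δ, Ev Q ρ Y.tm ∧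
      v = (M.imp X Y).tm
  | .all i A P, Δ, ρ, v => ∃ a : M.Code (.uc i) Δ, Ev A ρ a.tm ∧
      ∃ X : M.Code .prop (cons a), Ev P (ρ.bind a) X.tm ∧ v = (M.all a X).tm
  | .ex i A P, Δ, ρ, v => ∃ a : M.Code (.uc i) Δ, Ev A ρ a.tm ∧
      ∃ X : M.Code .prop (cons a), Ev P (ρ.bind a) X.tm ∧ v = (M.ex a X).tm
  | .mu φ, Δ, ρ, v => ∃ X : M.Code .prop (M.consProp Δ), Ev φ (ρ.under .pvar) X.tm ∧
      ∃ h : CwFProp.Monotone X, v = (M.mu X h).tm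
  | .nu φ, Δ, ρ, v => ∃ X : M.Code .prop (M.consProp Δ), Ev φ (ρ.under .pvar) X.tm ∧
      ∃ h : CwFProp.Monotone X, v = (M.nu X h).tm
  | .topI, Δ, _, v => Proves (M.top Δ) v
  | .botE P _, Δ, ρ, v => ∃ X : M.Code .prop Δ, Ev P ρ X.tm ∧ Proves X v
  | .andI P Q _ _, Δ, ρ, v => ∃ X : M.Code .prop Δ, Ev P ρ X.tm ∧
      ∃ Y : M.Code .prop Δ, Ev Q ρ Y.tm ∧ Proves (M.and X Y) v
  | .andE₁ P _ _, Δ, ρ, v => ∃ X : M.Code .prop Δ, Ev P ρ X.tm ∧ Proves X v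
  | .andE₂ _ Q _, Δ, ρ, v => ∃ X : M.Code .prop Δ, Ev Q ρ X.tm ∧ Proves X v
  | .orI₁ P Q _, Δ, ρ, v => ∃ X : M.Code .prop Δ, Ev P ρ X.tm ∧
      ∃ Y : M.Code .prop Δ, Ev Q ρ Y.tm ∧ Proves (M.or X Y) v
  | .orI₂ P Q _, Δ, ρ, v => ∃ X : M.Code .prop Δ, Ev P ρ X.tm ∧
      ∃ Y : M.Code .prop Δ, Ev Q ρ Y.tm ∧ Proves (M.or X Y) v
  | .orE _ _ R _ _ _, Δ, ρ, v => ∃ X : M.Code .prop Δ, Ev R ρ X.tm ∧ Proves X v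
  | .impI P Q _, Δ, ρ, v => ∃ X : M.Code .prop Δ, Ev P ρ X.tm ∧
      ∃ Y : M.Code .prop Δ, Ev Q ρ Y.tm ∧ Proves (M.imp X Y) v
  | .impE _ Q _ _, Δ, ρ, v => ∃ X : M.Code .prop Δ, Ev Q ρ X.tm ∧ Proves X v
  | .allI i A P _, Δ, ρ, v => ∃ a : M.Code (.uc i) Δ, Ev A ρ a.tm ∧
      ∃ X : M.Code .prop (cons a), Ev P (ρ.bind a) X.tm ∧ Proves (M.all a X) v
  | .allE _ _ P _ a, Δ, ρ, v => ∃ x : M.Tm Δ, Ev a ρ x ∧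
      ∃ X : M.Code .prop Δ, Ev P (x :: ρ) X.tm ∧ Proves X v
  | .exI i A P _ _, Δ, ρ, v => ∃ a : M.Code (.uc i) Δ, Ev A ρ a.tm ∧
      ∃ X : M.Code .prop (cons a), Ev P (ρ.bind a) X.tm ∧ Proves (M.ex a X) v
  | .exE _ _ _ R _ _, Δ, ρ, v => ∃ X : M.Code .prop Δ, Ev R ρ X.tm ∧ Proves X v
  | .fold φ, Δ, ρ, v => ∃ X : M.Code .prop (M.consProp Δ), Ev φ (ρ.under .pvar) X.tm ∧
      ∃ h : CwFProp.Monotone X, Proves (M.imp (X.sub (snocProp (𝟙 Δ) (M.mu X h))) (M.mu X h)) v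
  | .unfold φ, Δ, ρ, v => ∃ X : M.Code .prop (M.consProp Δ), Ev φ (ρ.under .pvar) X.tm ∧
      ∃ h : CwFProp.Monotone X, Proves (M.imp (M.mu X h) (X.sub (snocProp (𝟙 Δ) (M.mu X h)))) v
  | .out φ, Δ, ρ, v => ∃ X : M.Code .prop (M.consProp Δ), Ev φ (ρ.under .pvar) X.tm ∧
      ∃ h : CwFProp.Monotone X, Proves (M.imp (M.nu X h) (X.sub (snocProp (𝟙 Δ) (M.nu X h)))) v
  | .into φ, Δ, ρ, v => ∃ X : M.Code .prop (M.consProp Δ), Ev φ (ρ.under .pvar) X.tm ∧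
      ∃ h : CwFProp.Monotone X, Proves (M.imp (X.sub (snocProp (𝟙 Δ) (M.nu X h))) (M.nu X h)) v
  termination_by structural t => t

/-- `σ` has the value `ρ'` in the environment `ρ`. -/
def EvS : Sb → ∀ {Δ : C}, Env M Δ → Env M Δ → Prop
  | .id, _, ρ, ρ' => ρ' = ρ
  | .comp σ δ, _, ρ, ρ' => ∃ ρ₁, EvS δ ρ ρ₁ ∧ EvS σ ρ₁ ρ'
  | .p, _, ρ, ρ' => ∃ v, ρ = v :: ρ'
  | .ext σ t, _, ρ, ρ' => ∃ ρ₁, EvS σ ρ ρ₁ ∧ ∃ v, Ev t ρ v ∧ ρ' = v :: ρ₁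
  | .bang, _, _, ρ' => ρ' = []
  termination_by structural σ => σ

end

end Sem

namespace Sem

open CwFE CwFPi

variable {C : Type u} [Category.{v} C] {M : Model.{u, v, w} C}

theorem Proves.unique {Δ : C} {P : M.Code .prop Δ} {v v' : M.Tm Δ} (h : Proves P v)
    (h' : Proves P v') : v = v' :=
  congrArg CwF.Elt.tm (M.irrel (P := P) ⟨v, h⟩ ⟨v', h'⟩)

mutual

theorem Ev.unique : ∀ (t : Tm) {Δ : C} {ρ : Env M Δ} {v v' : M.Tm Δ},
    Ev M t ρ v → Ev M t ρ v' → v = v'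
  | .sub t σ, _, _, _, _, ⟨_, hσ, h⟩, ⟨_, hσ', h'⟩ => by
      cases EvS.unique σ hσ hσ'; exact Ev.unique t h h'
  | .q, _, _, _, _, ⟨_, h⟩, ⟨_, h'⟩ => by cases h; cases h'; rfl
  | .tyL _, _, _, _, _, h, _ => h.elim
  | .uc _, _, _, _, _, h, h' | .prop, _, _, _, _, h, h'
  | .state, _, _, _, _, h, h' | .event, _, _, _, _, h, h' | .nat, _, _, _, _, h, h'
  | .fin, _, _, _, _, h, h' | .inf, _, _, _, _, h, h'
  | .top, _, _, _, _, h, h' | .bot, _, _, _, _, h, h' => Eq.trans h (Eq.symm h')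
  | .pi i A B, _, _, _, _, ⟨a, hA, b, hB, h⟩, ⟨a', hA', b', hB', h'⟩ => by
      cases CwF.Elt.ext (Ev.unique A hA hA'); cases CwF.Elt.ext (Ev.unique B hB hB')
      rw [h, h']
  | .lam i A B t, _, _, _, _, ⟨a, hA, b, hB, x, hx, h⟩, ⟨a', hA', b', hB', x', hx', h'⟩ => by
      cases CwF.Elt.ext (Ev.unique A hA hA'); cases CwF.Elt.ext (Ev.unique B hB hB')
      cases CwF.Elt.ext (Ev.unique t hx hx'); rw [h, h']
  | .app i A B f t, _, _, _, _, ⟨a, hA, b, hB, g, hg, x, hx, h⟩,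
      ⟨a', hA', b', hB', g', hg', x', hx', h'⟩ => by
      cases CwF.Elt.ext (Ev.unique A hA hA'); cases CwF.Elt.ext (Ev.unique B hB hB')
      cases CwF.Elt.ext (Ev.unique f hg hg'); cases CwF.Elt.ext (Ev.unique t hx hx'); rw [h, h']
  | .sig i A B, _, _, _, _, ⟨a, hA, b, hB, h⟩, ⟨a', hA', b', hB', h'⟩ => by
      cases CwF.Elt.ext (Ev.unique A hA hA'); cases CwF.Elt.ext (Ev.unique B hB hB')
      rw [h, h']
  | .pair i A B s t, _, _, _, _, ⟨a, hA, b, hB, g, hg, x, hx, h⟩,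
      ⟨a', hA', b', hB', g', hg', x', hx', h'⟩ => by
      cases CwF.Elt.ext (Ev.unique A hA hA'); cases CwF.Elt.ext (Ev.unique B hB hB')
      cases CwF.Elt.ext (Ev.unique s hg hg'); cases CwF.Elt.ext (Ev.unique t hx hx'); rw [h, h']
  | .fst i A B t, _, _, _, _, ⟨a, hA, b, hB, x, hx, h⟩, ⟨a', hA', b', hB', x', hx', h'⟩ => by
      cases CwF.Elt.ext (Ev.unique A hA hA'); cases CwF.Elt.ext (Ev.unique B hB hB')
      cases CwF.Elt.ext (Ev.unique t hx hx'); rw [h, h']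
  | .snd i A B t, _, _, _, _, ⟨a, hA, b, hB, x, hx, h⟩, ⟨a', hA', b', hB', x', hx', h'⟩ => by
      cases CwF.Elt.ext (Ev.unique A hA hA'); cases CwF.Elt.ext (Ev.unique B hB hB')
      cases CwF.Elt.ext (Ev.unique t hx hx'); rw [h, h']
  | .idt i A s t, _, _, _, _, ⟨a, hA, x, hx, y, hy, h⟩, ⟨a', hA', x', hx', y', hy', h'⟩ => by
      cases CwF.Elt.ext (Ev.unique A hA hA'); cases CwF.Elt.ext (Ev.unique s hx hx')
      cases CwF.Elt.ext (Ev.unique t hy hy'); rw [h, h']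
  | .refl i A s, _, _, _, _, ⟨a, hA, x, hx, h⟩, ⟨a', hA', x', hx', h'⟩ => by
      cases CwF.Elt.ext (Ev.unique A hA hA'); cases CwF.Elt.ext (Ev.unique s hx hx')
      rw [h, h']
  | .J i j A D d s t r, _, _, _, _, ⟨a, hA, c, hc, d₁, hd, x, hx, y, hy, z, hz, h⟩,
      ⟨a', hA', c', hc', d₁', hd', x', hx', y', hy', z', hz', h'⟩ => by
      cases CwF.Elt.ext (Ev.unique A hA hA'); cases CwF.Elt.ext (Ev.unique D hc hc')
      cases CwF.Elt.ext (Ev.unique d hd hd'); cases CwF.Elt.ext (Ev.unique s hx hx')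
      cases CwF.Elt.ext (Ev.unique t hy hy'); cases CwF.Elt.ext (Ev.unique r hz hz'); rw [h, h']
  | .trans s t r, _, _, _, _, ⟨x, hx, y, hy, z, hz, h⟩, ⟨x', hx', y', hy', z', hz', h'⟩ => by
      cases CwF.Elt.ext (Ev.unique s hx hx'); cases CwF.Elt.ext (Ev.unique t hy hy')
      cases CwF.Elt.ext (Ev.unique r hz hz'); rw [h, h']
  | .nil s, _, _, _, _, ⟨x, hx, h⟩, ⟨x', hx', h'⟩ => by
      cases CwF.Elt.ext (Ev.unique s hx hx'); rw [h, h']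
  | .step s t r, _, _, _, _, ⟨x, hx, y, hy, z, hz, h⟩, ⟨x', hx', y', hy', z', hz', h'⟩ => by
      cases CwF.Elt.ext (Ev.unique s hx hx'); cases CwF.Elt.ext (Ev.unique t hy hy')
      cases CwF.Elt.ext (Ev.unique r hz hz'); rw [h, h']
  | .head s, _, _, _, _, ⟨x, hx, h⟩, ⟨x', hx', h'⟩ => by
      cases CwF.Elt.ext (Ev.unique s hx hx'); rw [h, h']
  | .tail s, _, _, _, _, ⟨x, hx, h⟩, ⟨x', hx', h'⟩ => by
      cases CwF.Elt.ext (Ev.unique s hx hx'); rw [h, h']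
  | .corec i A s t r l, _, _, _, _, ⟨a, hA, x, hx, y, hy, z, hz, u, hu, h⟩,
      ⟨a', hA', x', hx', y', hy', z', hz', u', hu', h'⟩ => by
      cases CwF.Elt.ext (Ev.unique A hA hA'); cases CwF.Elt.ext (Ev.unique s hx hx')
      cases CwF.Elt.ext (Ev.unique t hy hy'); cases CwF.Elt.ext (Ev.unique r hz hz')
      cases CwF.Elt.ext (Ev.unique l hu hu'); rw [h, h']
  | .extn s t, _, _, _, _, ⟨x, hx, y, hy, h⟩, ⟨x', hx', y', hy', h'⟩ => by
      cases CwF.Elt.ext (Ev.unique s hx hx'); cases CwF.Elt.ext (Ev.unique t hy hy'); rw [h, h']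
  | .idE s, _, _, _, _, ⟨x, hx, h⟩, ⟨x', hx', h'⟩ => by
      cases CwF.Elt.ext (Ev.unique s hx hx'); rw [h, h']
  | .compE s t r k l, _, _, _, _, ⟨x, hx, y, hy, z, hz, f, hf, g, hg, h⟩,
      ⟨x', hx', y', hy', z', hz', f', hf', g', hg', h'⟩ => by
      cases CwF.Elt.ext (Ev.unique s hx hx'); cases CwF.Elt.ext (Ev.unique t hy hy')
      cases CwF.Elt.ext (Ev.unique r hz hz'); cases CwF.Elt.ext (Ev.unique k hf hf')
      cases CwF.Elt.ext (Ev.unique l hg hg'); rw [h, h']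
  | .K s, _, _, _, _, ⟨x, hx, h⟩, ⟨x', hx', h'⟩ => by
      cases CwF.Elt.ext (Ev.unique s hx hx'); rw [h, h']
  | .Kinf s, _, _, _, _, ⟨x, hx, h⟩, ⟨x', hx', h'⟩ => by
      cases CwF.Elt.ext (Ev.unique s hx hx'); rw [h, h']
  | .restrict s t r k, _, _, _, _, ⟨x, hx, y, hy, z, hz, f, hf, h⟩,
      ⟨x', hx', y', hy', z', hz', f', hf', h'⟩ => by
      cases CwF.Elt.ext (Ev.unique s hx hx'); cases CwF.Elt.ext (Ev.unique t hy hy')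
      cases CwF.Elt.ext (Ev.unique r hz hz'); cases CwF.Elt.ext (Ev.unique k hf hf'); rw [h, h']
  | .and s t, _, _, _, _, ⟨x, hx, y, hy, h⟩, ⟨x', hx', y', hy', h'⟩
  | .or s t, _, _, _, _, ⟨x, hx, y, hy, h⟩, ⟨x', hx', y', hy', h'⟩
  | .imp s t, _, _, _, _, ⟨x, hx, y, hy, h⟩, ⟨x', hx', y', hy', h'⟩
  | .all _ s t, _, _, _, _, ⟨x, hx, y, hy, h⟩, ⟨x', hx', y', hy', h'⟩
  | .ex _ s t, _, _, _, _, ⟨x, hx, y, hy, h⟩, ⟨x', hx', y', hy', h'⟩ => by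
      cases CwF.Elt.ext (Ev.unique s hx hx'); cases CwF.Elt.ext (Ev.unique t hy hy'); rw [h, h']
  | .mu s, _, _, _, _, ⟨x, hx, _, h⟩, ⟨x', hx', _, h'⟩
  | .nu s, _, _, _, _, ⟨x, hx, _, h⟩, ⟨x', hx', _, h'⟩ => by
      cases CwF.Elt.ext (Ev.unique s hx hx'); rw [h, h']
  | .topI, _, _, _, _, h, h' => Proves.unique h h'
  | .botE s _, _, _, _, _, ⟨x, hx, h⟩, ⟨x', hx', h'⟩
  | .andE₁ s _ _, _, _, _, _, ⟨x, hx, h⟩, ⟨x', hx', h'⟩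
  | .andE₂ _ s _, _, _, _, _, ⟨x, hx, h⟩, ⟨x', hx', h'⟩
  | .orE _ _ s _ _ _, _, _, _, _, ⟨x, hx, h⟩, ⟨x', hx', h'⟩
  | .impE _ s _ _, _, _, _, _, ⟨x, hx, h⟩, ⟨x', hx', h'⟩
  | .exE _ _ _ s _ _, _, _, _, _, ⟨x, hx, h⟩, ⟨x', hx', h'⟩ => by
      cases CwF.Elt.ext (Ev.unique s hx hx'); exact h.unique h'
  | .andI s t _ _, _, _, _, _, ⟨x, hx, y, hy, h⟩, ⟨x', hx', y', hy', h'⟩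
  | .orI₁ s t _, _, _, _, _, ⟨x, hx, y, hy, h⟩, ⟨x', hx', y', hy', h'⟩
  | .orI₂ s t _, _, _, _, _, ⟨x, hx, y, hy, h⟩, ⟨x', hx', y', hy', h'⟩
  | .impI s t _, _, _, _, _, ⟨x, hx, y, hy, h⟩, ⟨x', hx', y', hy', h'⟩
  | .allI _ s t _, _, _, _, _, ⟨x, hx, y, hy, h⟩, ⟨x', hx', y', hy', h'⟩
  | .exI _ s t _ _, _, _, _, _, ⟨x, hx, y, hy, h⟩, ⟨x', hx', y', hy', h'⟩ => by
      cases CwF.Elt.ext (Ev.unique s hx hx'); cases CwF.Elt.ext (Ev.unique t hy hy')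
      exact h.unique h'
  | .allE _ _ t _ s, _, _, _, _, ⟨x, hx, y, hy, h⟩, ⟨x', hx', y', hy', h'⟩ => by
      cases Ev.unique s hx hx'; cases CwF.Elt.ext (Ev.unique t hy hy')
      exact h.unique h'
  | .fold s, _, _, _, _, ⟨x, hx, _, h⟩, ⟨x', hx', _, h'⟩
  | .unfold s, _, _, _, _, ⟨x, hx, _, h⟩, ⟨x', hx', _, h'⟩
  | .out s, _, _, _, _, ⟨x, hx, _, h⟩, ⟨x', hx', _, h'⟩
  | .into s, _, _, _, _, ⟨x, hx, _, h⟩, ⟨x', hx', _, h'⟩ => by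
      cases CwF.Elt.ext (Ev.unique s hx hx'); exact h.unique h'
  termination_by structural t => t

theorem EvS.unique : ∀ (σ : Sb) {Δ : C} {ρ ρ' ρ'' : Env M Δ},
    EvS M σ ρ ρ' → EvS M σ ρ ρ'' → ρ' = ρ''
  | .id, _, _, _, _, h, h' | .bang, _, _, _, _, h, h' => Eq.trans h (Eq.symm h')
  | .comp σ δ, _, _, _, _, ⟨_, h, k⟩, ⟨_, h', k'⟩ => by
      cases EvS.unique δ h h'; exact EvS.unique σ k k'
  | .p, _, _, _, _, ⟨_, h⟩, ⟨_, h'⟩ => by cases h; cases h'; rfl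
  | .ext σ t, _, _, _, _, ⟨_, h, _, k, e⟩, ⟨_, h', _, k', e'⟩ => by
      cases EvS.unique σ h h'; cases Ev.unique t k k'; rw [e, e']
  termination_by structural σ => σ

end

end Sem

namespace Sem

open CwFE CwFPi

variable {C : Type u} [Category.{v} C] {M : Model.{u, v, w} C}

/-! Substitution in environments -/

theorem Env.sub_comp {Γ Δ Θ : C} (σ : Δ ⟶ Γ) (δ : Θ ⟶ Δ) (ρ : Env M Γ) :
    ρ.sub (δ ≫ σ) = (ρ.sub σ).sub δ := by
  rw [Env.sub, Env.sub, Env.sub, List.map_map]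
  exact List.map_congr_left fun t _ => M.subTm_comp σ δ t

theorem Env.sub_id {Γ : C} (ρ : Env M Γ) : ρ.sub (𝟙 Γ) = ρ :=
  (List.map_congr_left fun t _ => M.subTm_id t).trans (List.map_id _)

theorem Env.bind_snoc {i : ℕ} {Γ Δ : C} (σ : Δ ⟶ Γ) (a : M.Code (.uc i) Γ)
    (x : M.Val (a.sub σ)) (ρ : Env M Γ) :
    (ρ.bind a).sub (snoc σ a x) = x.tm :: ρ.sub σ := by
  refine congrArg₂ List.cons (snoc_q σ a x) ?_
  exact (Env.sub_comp _ _ _).symm.trans (congrArg (fun τ => ρ.sub τ) (snoc_p σ a x))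

theorem Env.bind_at1 {i : ℕ} {Γ : C} {a : M.Code (.uc i) Γ} (x : M.Val a) (ρ : Env M Γ) :
    (ρ.bind a).sub (at1 x) = x.tm :: ρ := by
  refine congrArg₂ List.cons (at1_q x) ?_
  exact (Env.sub_comp _ _ _).symm.trans
    ((congrArg (fun τ => ρ.sub τ) (at1_p x)).trans (Env.sub_id ρ))

theorem Env.bind_up {i : ℕ} {Γ Δ : C} (σ : Δ ⟶ Γ) (a : M.Code (.uc i) Γ) {a' : M.Code (.uc i) Δ}
    (h : a.sub σ = a') (ρ : Env M Γ) : (ρ.bind a).sub (up σ a h) = (ρ.sub σ).bind a' := by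
  refine congrArg₂ List.cons (up_q σ a h) ?_
  exact (Env.sub_comp _ _ _).symm.trans
    ((congrArg (fun τ => ρ.sub τ) (up_p σ a h)).trans (Env.sub_comp _ _ _))

theorem Env.bind₃_up₃ {i : ℕ} {Γ Δ : C} (σ : Δ ⟶ Γ) (a : M.Code (.uc i) Γ) (ρ : Env M Γ) :
    (ρ.bind₃ a).sub (up₃ (M := M.toCwFPi) σ a) = (ρ.sub σ).bind₃ (a.sub σ) := by
  refine (Env.bind_up _ _ _ _).trans (congrArg (Env.bind _) ?_)
  refine (Env.bind_up _ _ _ _).trans (congrArg (Env.bind _) ?_)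
  exact Env.bind_up _ _ _ _

theorem Env.bind₃_map₃ {i : ℕ} {Γ Δ : C} (σ : Δ ⟶ Γ) (a : M.Code (.uc i) Γ)
    (x y : M.Val (a.sub σ)) (r : M.Val (M.idt x y)) (ρ : Env M Γ) :
    (ρ.bind₃ a).sub (map₃ (M := M.toCwFPi) a σ x y r) = r.tm :: y.tm :: x.tm :: ρ.sub σ := by
  refine (Env.bind_snoc _ _ _ _).trans (congrArg (List.cons _) ?_)
  refine (Env.bind_snoc _ _ _ _).trans (congrArg (List.cons _) ?_)
  exact Env.bind_snoc _ _ _ _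

theorem snocProp_p {Γ Δ : C} (σ : Δ ⟶ Γ) (P : M.Code .prop Δ) :
    snocProp (M := M.toCwFE) σ P ≫ M.p .pvar = σ :=
  M.pair_p _ _ _

theorem Env.under_snocProp {Γ Δ : C} (σ : Δ ⟶ Γ) (P : M.Code .prop Δ) (ρ : Env M Γ) :
    (ρ.under .pvar).sub (snocProp (M := M.toCwFE) σ P) = P.tm :: ρ.sub σ := by
  refine congrArg₂ List.cons (M.pair_q _ _ _) ?_
  exact (Env.sub_comp _ _ _).symm.trans (congrArg (fun τ => ρ.sub τ) (snocProp_p σ P))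

theorem Env.under_upProp {Γ Δ : C} (σ : Δ ⟶ Γ) (ρ : Env M Γ) :
    (ρ.under .pvar).sub (upProp (M := M.toCwFE) σ) = (ρ.sub σ).under .pvar := by
  rw [upProp, Env.under_snocProp, Env.sub_comp]; rfl

/-! Substitution in the operations of a model -/

theorem Proves.sub {Γ Δ : C} {P : M.Code .prop Γ} {v : M.Tm Γ} (h : Proves P v) (σ : Δ ⟶ Γ)
    {Q : M.Code .prop Δ} (e : P.sub σ = Q) : Proves Q (M.subTm σ v) := by
  rw [Proves, M.typ_sub, h, ← e, M.El_sub]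

theorem lam_symm_sub {i : ℕ} {Γ Δ : C} (σ : Δ ⟶ Γ) {a : M.Code (.uc i) Γ}
    {b : M.Code (.uc i) (cons a)} (f : M.Val (M.pi a b)) :
    M.subTm (up σ a) (M.lam.symm f).tm = (M.lam.symm (f.sub σ (M.pi_sub σ a b))).tm := by
  obtain ⟨t, rfl⟩ := M.lam.surjective f
  rw [M.lam.symm_apply_apply]
  have h : (M.lam t).sub σ (M.pi_sub σ a b) = M.lam (t.sub (up σ a)) :=
    CwF.Elt.ext (M.lam_sub σ t)
  rw [h, M.lam.symm_apply_apply]; rfl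

theorem pr_symm_sub {i : ℕ} {Γ Δ : C} (σ : Δ ⟶ Γ) {a : M.Code (.uc i) Γ}
    {b : M.Code (.uc i) (cons a)} (z : M.Val (M.sig a b)) :
    M.subTm σ (M.pr.symm z).1.tm = (M.pr.symm (z.sub σ (M.sig_sub σ a b))).1.tm ∧
    M.subTm σ (M.pr.symm z).2.tm = (M.pr.symm (z.sub σ (M.sig_sub σ a b))).2.tm := by
  obtain ⟨⟨x, y⟩, rfl⟩ := M.pr.surjective z
  rw [M.pr.symm_apply_apply]
  have h : (M.pr ⟨x, y⟩).sub σ (M.sig_sub σ a b) =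
      M.pr (a := a.sub σ) ⟨x.sub σ, y.sub σ (sub_at1 σ x b)⟩ := CwF.Elt.ext (M.pr_sub σ x y)
  rw [h, M.pr.symm_apply_apply]
  exact ⟨rfl, rfl⟩

theorem up_diag {i : ℕ} {Γ Δ : C} (σ : Δ ⟶ Γ) (a : M.Code (.uc i) Γ) :
    diag (M := M.toCwFPi) (a.sub σ) ≫ up₃ σ a = up σ a ≫ diag a := by
  have h1 : M.subTm (up σ a) (var a).tm = (var (a.sub σ)).tm := up_q σ a rfl
  apply M.pair_uniq
  · rw [Category.assoc, up₃, up_p, Category.assoc, diag, diag, map₃, map₃, snoc_p,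
      ← Category.assoc, snoc_p]
    apply M.pair_uniq
    · rw [Category.assoc, up₂, up_p, Category.assoc, map₂, map₂, snoc_p, ← Category.assoc, snoc_p]
      apply M.pair_uniq
      · rw [Category.assoc, up_p, Category.assoc, snoc_p, ← Category.assoc, snoc_p, up_p]
      · rw [M.subTm_comp, M.subTm_comp]
        exact (congrArg _ (up_q _ _ _)).trans ((snoc_q _ _ _).trans (h1.symm.trans
          (congrArg _ (snoc_q _ a (var a)).symm)))
    · rw [M.subTm_comp, M.subTm_comp]
      exact (congrArg _ (up_q _ _ _)).trans ((snoc_q _ _ _).trans (h1.symm.trans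
        (congrArg _ (map₂_q a _ (var a) (var a)).symm)))
  · rw [M.subTm_comp, M.subTm_comp]
    refine (congrArg _ (up_q _ _ _)).trans ((map₃_q _ _ _ _ _).trans (Eq.trans ?_
      (congrArg _ (map₃_q a _ (var a) (var a) (M.refl (var a))).symm)))
    rw [M.refl_sub]
    exact refl_congr (wk_up σ a rfl a).symm h1.symm

theorem comp_snocProp {Γ Δ Θ : C} (δ : Θ ⟶ Δ) (σ : Δ ⟶ Γ) (P : M.Code .prop Δ) :
    δ ≫ snocProp (M := M.toCwFE) σ P = snocProp (δ ≫ σ) (P.sub δ) := by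
  apply M.pair_uniq
  · rw [Category.assoc, snocProp, snocProp, M.pair_p, M.pair_p]
  · rw [M.subTm_comp, snocProp, snocProp, M.pair_q, M.pair_q]; rfl

theorem varProp_snocProp {Γ Δ : C} (σ : Δ ⟶ Γ) (P : M.Code .prop Δ) :
    (varProp (M := M.toCwFE) Γ).sub (snocProp σ P) = P :=
  CwF.Elt.ext (M.pair_q _ _ _)

theorem snocProp_upProp {Γ Δ Θ : C} (σ : Δ ⟶ Γ) (δ : Θ ⟶ Δ) (P : M.Code .prop Θ) :
    snocProp (M := M.toCwFE) δ P ≫ upProp σ = snocProp (δ ≫ σ) P := by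
  rw [upProp, comp_snocProp, varProp_snocProp, ← Category.assoc, snocProp_p]

theorem Monotone.sub {Γ Δ : C} {φ : M.Code .prop (M.consProp Γ)}
    (h : CwFProp.Monotone (M := M.toCwFProp) φ) (σ : Δ ⟶ Γ) :
    CwFProp.Monotone (M := M.toCwFProp) (φ.sub (upProp (M := M.toCwFE) σ)) := by
  intro Θ δ P Q hPQ
  rw [← CwF.Code.sub_comp, ← CwF.Code.sub_comp, snocProp_upProp, snocProp_upProp]
  exact h (δ ≫ σ) P Q hPQ

theorem sub_snocProp {Γ Δ : C} (σ : Δ ⟶ Γ) (φ : M.Code .prop (M.consProp Γ)) (P : M.Code .prop Γ) :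
    (φ.sub (snocProp (M := M.toCwFE) (𝟙 Γ) P)).sub σ =
      (φ.sub (upProp (M := M.toCwFE) σ)).sub (snocProp (𝟙 Δ) (P.sub σ)) := by
  rw [← CwF.Code.sub_comp, ← CwF.Code.sub_comp, comp_snocProp, snocProp_upProp, Category.comp_id,
    Category.id_comp]

/-! Stability of evaluation under substitution -/

theorem Ev.bind {i : ℕ} {Γ Δ : C} {σ : Δ ⟶ Γ} {a : M.Code (.uc i) Γ} {ρ : Env M Γ} {t : Tm}
    {v : M.Tm (cons (a.sub σ))} (h : Ev M t ((ρ.bind a).sub (up σ a)) v) :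
    Ev M t ((ρ.sub σ).bind (a.sub σ)) v := by
  rwa [Env.bind_up] at h

theorem Ev.underProp {Γ Δ : C} {σ : Δ ⟶ Γ} {ρ : Env M Γ} {t : Tm}
    {v : M.Tm (M.consProp Δ)} (h : Ev M t ((ρ.under .pvar).sub (upProp (M := M.toCwFE) σ)) v) :
    Ev M t ((ρ.sub σ).under .pvar) v := by
  rwa [Env.under_upProp] at h

mutual

theorem Ev.map : ∀ (t : Tm) {Γ Δ : C} {ρ : Env M Γ} {v : M.Tm Γ} (σ : Δ ⟶ Γ),
    Ev M t ρ v → Ev M t (ρ.sub σ) (M.subTm σ v)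
  | .sub t δ, _, _, _, _, σ, ⟨_, hδ, h⟩ => ⟨_, EvS.map δ σ hδ, Ev.map t σ h⟩
  | .q, _, _, _, _, _, ⟨_, h⟩ => by cases h; exact ⟨_, rfl⟩
  | .tyL _, _, _, _, _, _, h => h.elim
  | .uc _, _, _, _, _, σ, h | .prop, _, _, _, _, σ, h => by
      cases h; exact congrArg CwF.Elt.tm (M.univ_sub _ σ)
  | .pi i A B, _, _, _, _, σ, ⟨a, hA, b, hB, h⟩ => by
      cases h
      exact ⟨a.sub σ, Ev.map A σ hA, b.sub (up σ a), (Ev.map B _ hB).bind,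
        congrArg CwF.Elt.tm (M.pi_sub σ a b)⟩
  | .lam i A B t, _, _, _, _, σ, ⟨a, hA, b, hB, x, hx, h⟩ => by
      cases h
      exact ⟨a.sub σ, Ev.map A σ hA, b.sub (up σ a), (Ev.map B _ hB).bind, x.sub (up σ a),
        (Ev.map t _ hx).bind, M.lam_sub σ x⟩
  | .app i A B f t, _, _, _, _, σ, ⟨a, hA, b, hB, g, hg, x, hx, h⟩ => by
      cases h
      refine ⟨a.sub σ, Ev.map A σ hA, b.sub (up σ a), (Ev.map B _ hB).bind,
        g.sub σ (M.pi_sub σ a b), Ev.map f σ hg, x.sub σ, Ev.map t σ hx, ?_⟩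
      rw [← lam_symm_sub, ← M.subTm_comp, ← M.subTm_comp, at1_up]
  | .sig i A B, _, _, _, _, σ, ⟨a, hA, b, hB, h⟩ => by
      cases h
      exact ⟨a.sub σ, Ev.map A σ hA, b.sub (up σ a), (Ev.map B _ hB).bind,
        congrArg CwF.Elt.tm (M.sig_sub σ a b)⟩
  | .pair i A B s t, _, _, _, _, σ, ⟨a, hA, b, hB, x, hx, y, hy, h⟩ => by
      cases h
      exact ⟨a.sub σ, Ev.map A σ hA, b.sub (up σ a), (Ev.map B _ hB).bind, x.sub σ, Ev.map s σ hx,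
        y.sub σ (sub_at1 σ x b), Ev.map t σ hy, M.pr_sub σ x y⟩
  | .fst i A B t, _, _, _, _, σ, ⟨a, hA, b, hB, z, hz, h⟩ => by
      cases h
      exact ⟨a.sub σ, Ev.map A σ hA, b.sub (up σ a), (Ev.map B _ hB).bind,
        z.sub σ (M.sig_sub σ a b), Ev.map t σ hz, (pr_symm_sub σ z).1⟩
  | .snd i A B t, _, _, _, _, σ, ⟨a, hA, b, hB, z, hz, h⟩ => by
      cases h
      exact ⟨a.sub σ, Ev.map A σ hA, b.sub (up σ a), (Ev.map B _ hB).bind,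
        z.sub σ (M.sig_sub σ a b), Ev.map t σ hz, (pr_symm_sub σ z).2⟩
  | .idt i A s t, _, _, _, _, σ, ⟨a, hA, x, hx, y, hy, h⟩ => by
      cases h
      exact ⟨a.sub σ, Ev.map A σ hA, x.sub σ, Ev.map s σ hx, y.sub σ, Ev.map t σ hy,
        congrArg CwF.Elt.tm (M.idt_sub σ x y)⟩
  | .refl i A s, _, _, _, _, σ, ⟨a, hA, x, hx, h⟩ => by
      cases h
      exact ⟨a.sub σ, Ev.map A σ hA, x.sub σ, Ev.map s σ hx, M.refl_sub σ x⟩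
  | .J i j A D d s t r, _, _, _, _, σ, ⟨a, hA, c, hc, d', hd, x, hx, y, hy, z, hz, h⟩ => by
      cases h
      have hc' := Ev.map D (up₃ (M := M.toCwFPi) σ a) hc
      rw [Env.bind₃_up₃] at hc'
      refine ⟨a.sub σ, Ev.map A σ hA, c.sub (up₃ (M := M.toCwFPi) σ a), hc',
        d'.sub (up σ a) ?_, (Ev.map d _ hd).bind, x.sub σ, Ev.map s σ hx, y.sub σ, Ev.map t σ hy,
        z.sub σ (M.idt_sub σ x y), Ev.map r σ hz, M.J_sub σ c d' x y z _ rfl⟩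
      rw [← CwF.Code.sub_comp, ← CwF.Code.sub_comp, up_diag]
  | .state, _, _, _, _, σ, h => by cases h; exact congrArg CwF.Elt.tm (M.state_sub σ)
  | .event, _, _, _, _, σ, h => by cases h; exact congrArg CwF.Elt.tm (M.event_sub σ)
  | .nat, _, _, _, _, σ, h => by cases h; exact congrArg CwF.Elt.tm (M.nat_sub σ)
  | .trans s t r, _, _, _, _, σ, ⟨x, hx, y, hy, z, hz, h⟩ => by
      cases h
      exact ⟨x.sub σ (M.state_sub σ), Ev.map s σ hx, y.sub σ (M.event_sub σ), Ev.map t σ hy,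
        z.sub σ (M.state_sub σ), Ev.map r σ hz, congrArg CwF.Elt.tm (M.trans_sub σ x y z)⟩
  | .fin, _, _, _, _, σ, h => by cases h; exact congrArg CwF.Elt.tm (M.fin_sub σ)
  | .nil s, _, _, _, _, σ, ⟨x, hx, h⟩ => by
      cases h
      exact ⟨x.sub σ (M.state_sub σ), Ev.map s σ hx, congrArg CwF.Elt.tm (M.nil_sub σ x)⟩
  | .step s t r, _, _, _, _, σ, ⟨x, hx, y, hy, z, hz, h⟩ => by
      cases h
      exact ⟨x.sub σ (M.fin_sub σ), Ev.map s σ hx, y.sub σ (M.event_sub σ), Ev.map t σ hy,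
        z.sub σ (M.state_sub σ), Ev.map r σ hz, congrArg CwF.Elt.tm (M.step_sub σ x y z)⟩
  | .inf, _, _, _, _, σ, h => by cases h; exact congrArg CwF.Elt.tm (M.inf_sub σ)
  | .head s, _, _, _, _, σ, ⟨x, hx, h⟩ => by
      cases h
      exact ⟨x.sub σ (M.inf_sub σ), Ev.map s σ hx, congrArg CwF.Elt.tm (M.head_sub σ x)⟩
  | .tail s, _, _, _, _, σ, ⟨x, hx, h⟩ => by
      cases h
      exact ⟨x.sub σ (M.inf_sub σ), Ev.map s σ hx, M.tail_sub σ x⟩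
  | .corec i A s t r x, _, _, _, _, σ, ⟨a, hA, h', hs, e', ht, n', hr, y, hy, h⟩ => by
      cases h
      exact ⟨a.sub σ, Ev.map A σ hA, h'.sub (up σ a) (M.state_sub _), (Ev.map s _ hs).bind,
        e'.sub (up σ a) (M.event_sub _), (Ev.map t _ ht).bind,
        n'.sub (up σ a) (wk_up σ a rfl a), (Ev.map r _ hr).bind, y.sub σ, Ev.map x σ hy,
        congrArg CwF.Elt.tm (M.corec_sub σ h' e' n' y)⟩
  | .extn s t, _, _, _, _, σ, ⟨x, hx, y, hy, h⟩ => by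
      cases h
      exact ⟨x.sub σ (M.fin_sub σ), Ev.map s σ hx, y.sub σ (M.fin_sub σ), Ev.map t σ hy,
        congrArg CwF.Elt.tm (M.extn_sub σ x y)⟩
  | .idE s, _, _, _, _, σ, ⟨x, hx, h⟩ => by
      cases h
      exact ⟨x.sub σ (M.fin_sub σ), Ev.map s σ hx, congrArg CwF.Elt.tm (M.idE_sub σ x)⟩
  | .compE s t r k l, _, _, _, _, σ, ⟨x, hx, y, hy, z, hz, f, hf, g, hg, h⟩ => by
      cases h
      exact ⟨x.sub σ (M.fin_sub σ), Ev.map s σ hx, y.sub σ (M.fin_sub σ), Ev.map t σ hy,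
        z.sub σ (M.fin_sub σ), Ev.map r σ hz, f.sub σ (M.extn_sub σ x y), Ev.map k σ hf,
        g.sub σ (M.extn_sub σ y z), Ev.map l σ hg, congrArg CwF.Elt.tm (M.compE_sub σ f g)⟩
  | .K s, _, _, _, _, σ, ⟨x, hx, h⟩ => by
      cases h
      exact ⟨x.sub σ (M.fin_sub σ), Ev.map s σ hx, congrArg CwF.Elt.tm (M.K_sub σ x)⟩
  | .Kinf s, _, _, _, _, σ, ⟨x, hx, h⟩ => by
      cases h
      exact ⟨x.sub σ (M.inf_sub σ), Ev.map s σ hx, congrArg CwF.Elt.tm (M.Kinf_sub σ x)⟩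
  | .restrict s t r k, _, _, _, _, σ, ⟨x, hx, y, hy, f, hf, z, hz, h⟩ => by
      cases h
      exact ⟨x.sub σ (M.fin_sub σ), Ev.map s σ hx, y.sub σ (M.fin_sub σ), Ev.map t σ hy,
        f.sub σ (M.extn_sub σ x y), Ev.map r σ hf, z.sub σ (M.K_sub σ y), Ev.map k σ hz,
        congrArg CwF.Elt.tm (M.restrict_sub σ f z)⟩
  | .top, _, _, _, _, σ, h => by cases h; exact congrArg CwF.Elt.tm (M.top_sub σ)
  | .bot, _, _, _, _, σ, h => by cases h; exact congrArg CwF.Elt.tm (M.bot_sub σ)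
  | .and P Q, _, _, _, _, σ, ⟨X, hX, Y, hY, h⟩ => by
      cases h
      exact ⟨X.sub σ, Ev.map P σ hX, Y.sub σ, Ev.map Q σ hY, congrArg CwF.Elt.tm (M.and_sub σ X Y)⟩
  | .or P Q, _, _, _, _, σ, ⟨X, hX, Y, hY, h⟩ => by
      cases h
      exact ⟨X.sub σ, Ev.map P σ hX, Y.sub σ, Ev.map Q σ hY, congrArg CwF.Elt.tm (M.or_sub σ X Y)⟩
  | .imp P Q, _, _, _, _, σ, ⟨X, hX, Y, hY, h⟩ => by
      cases h
      exact ⟨X.sub σ, Ev.map P σ hX, Y.sub σ, Ev.map Q σ hY, congrArg CwF.Elt.tm (M.imp_sub σ X Y)⟩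
  | .all i A P, _, _, _, _, σ, ⟨a, hA, X, hX, h⟩ => by
      cases h
      exact ⟨a.sub σ, Ev.map A σ hA, X.sub (up σ a), (Ev.map P _ hX).bind,
        congrArg CwF.Elt.tm (M.all_sub σ a X)⟩
  | .ex i A P, _, _, _, _, σ, ⟨a, hA, X, hX, h⟩ => by
      cases h
      exact ⟨a.sub σ, Ev.map A σ hA, X.sub (up σ a), (Ev.map P _ hX).bind,
        congrArg CwF.Elt.tm (M.ex_sub σ a X)⟩
  | .mu φ, _, _, _, _, σ, ⟨X, hX, m, h⟩ => by
      cases h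
      exact ⟨X.sub (upProp σ), (Ev.map φ _ hX).underProp, Monotone.sub m σ,
        congrArg CwF.Elt.tm (M.mu_sub σ X m _)⟩
  | .nu φ, _, _, _, _, σ, ⟨X, hX, m, h⟩ => by
      cases h
      exact ⟨X.sub (upProp σ), (Ev.map φ _ hX).underProp, Monotone.sub m σ,
        congrArg CwF.Elt.tm (M.nu_sub σ X m _)⟩
  | .topI, _, _, _, _, σ, h => Proves.sub h σ (M.top_sub σ)
  | .botE P _, _, _, _, _, σ, ⟨X, hX, h⟩ | .andE₁ P _ _, _, _, _, _, σ, ⟨X, hX, h⟩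
  | .andE₂ _ P _, _, _, _, _, σ, ⟨X, hX, h⟩ | .orE _ _ P _ _ _, _, _, _, _, σ, ⟨X, hX, h⟩
  | .impE _ P _ _, _, _, _, _, σ, ⟨X, hX, h⟩ | .exE _ _ _ P _ _, _, _, _, _, σ, ⟨X, hX, h⟩ =>
      ⟨X.sub σ, Ev.map P σ hX, h.sub σ rfl⟩
  | .andI P Q _ _, _, _, _, _, σ, ⟨X, hX, Y, hY, h⟩ =>
      ⟨X.sub σ, Ev.map P σ hX, Y.sub σ, Ev.map Q σ hY, h.sub σ (M.and_sub σ X Y)⟩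
  | .orI₁ P Q _, _, _, _, _, σ, ⟨X, hX, Y, hY, h⟩ | .orI₂ P Q _, _, _, _, _, σ, ⟨X, hX, Y, hY, h⟩ =>
      ⟨X.sub σ, Ev.map P σ hX, Y.sub σ, Ev.map Q σ hY, h.sub σ (M.or_sub σ X Y)⟩
  | .impI P Q _, _, _, _, _, σ, ⟨X, hX, Y, hY, h⟩ =>
      ⟨X.sub σ, Ev.map P σ hX, Y.sub σ, Ev.map Q σ hY, h.sub σ (M.imp_sub σ X Y)⟩
  | .allI i A P _, _, _, _, _, σ, ⟨a, hA, X, hX, h⟩ =>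
      ⟨a.sub σ, Ev.map A σ hA, X.sub (up σ a), (Ev.map P _ hX).bind, h.sub σ (M.all_sub σ a X)⟩
  | .allE _ _ P _ t, _, _, _, _, σ, ⟨x, hx, X, hX, h⟩ =>
      ⟨M.subTm σ x, Ev.map t σ hx, X.sub σ, Ev.map P σ hX, h.sub σ rfl⟩
  | .exI i A P _ _, _, _, _, _, σ, ⟨a, hA, X, hX, h⟩ =>
      ⟨a.sub σ, Ev.map A σ hA, X.sub (up σ a), (Ev.map P _ hX).bind, h.sub σ (M.ex_sub σ a X)⟩
  | .fold φ, _, _, _, _, σ, ⟨X, hX, m, h⟩ =>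
      ⟨X.sub (upProp σ), (Ev.map φ _ hX).underProp, Monotone.sub m σ, h.sub σ (by
        rw [M.imp_sub, sub_snocProp, M.mu_sub σ X m (Monotone.sub m σ)])⟩
  | .unfold φ, _, _, _, _, σ, ⟨X, hX, m, h⟩ =>
      ⟨X.sub (upProp σ), (Ev.map φ _ hX).underProp, Monotone.sub m σ, h.sub σ (by
        rw [M.imp_sub, sub_snocProp, M.mu_sub σ X m (Monotone.sub m σ)])⟩
  | .out φ, _, _, _, _, σ, ⟨X, hX, m, h⟩ =>
      ⟨X.sub (upProp σ), (Ev.map φ _ hX).underProp, Monotone.sub m σ, h.sub σ (by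
        rw [M.imp_sub, sub_snocProp, M.nu_sub σ X m (Monotone.sub m σ)])⟩
  | .into φ, _, _, _, _, σ, ⟨X, hX, m, h⟩ =>
      ⟨X.sub (upProp σ), (Ev.map φ _ hX).underProp, Monotone.sub m σ, h.sub σ (by
        rw [M.imp_sub, sub_snocProp, M.nu_sub σ X m (Monotone.sub m σ)])⟩
  termination_by structural t => t

theorem EvS.map : ∀ (τ : Sb) {Γ Δ : C} {ρ ρ' : Env M Γ} (σ : Δ ⟶ Γ),
    EvS M τ ρ ρ' → EvS M τ (ρ.sub σ) (ρ'.sub σ)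
  | .id, _, _, _, _, _, h | .bang, _, _, _, _, _, h => by cases h; rfl
  | .comp τ δ, _, _, _, _, σ, ⟨_, h, k⟩ => ⟨_, EvS.map δ σ h, EvS.map τ σ k⟩
  | .p, _, _, _, _, _, ⟨_, h⟩ => by cases h; exact ⟨_, rfl⟩
  | .ext τ t, _, _, _, _, σ, ⟨_, h, _, k, e⟩ => by
      cases e; exact ⟨_, EvS.map τ σ h, _, Ev.map t σ k, rfl⟩
  termination_by structural τ => τ

end

end Sem

namespace Sem

open CwFE CwFPi

variable {C : Type u} [Category.{v} C] {M : Model.{u, v, w} C}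

/-! Environments that satisfy a context, and semantic equality -/

/-- The values in `ρ` have the types listed in the context. -/
def Sat : Ctx → ∀ {Δ : C}, Env M Δ → Prop
  | [], _, ρ => ρ = []
  | A :: Γ, Δ, ρ => ∃ v ρ', ρ = v :: ρ' ∧ Sat Γ ρ' ∧
      ∃ (s : Srt) (a : M.Code s Δ), Ev M A ρ' a.tm ∧ M.typ v = M.El a

/-- The knowledge universes, up to substitution. -/
def IsTyL : Tm → Prop
  | .tyL _ => True
  | .sub t _ => IsTyL t
  | _ => False

/-- `t` and `t'` are the same type. -/
def TyEqv {Δ : C} (ρ : Env M Δ) (t t' : Tm) : Prop :=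
  (IsTyL t ∧ IsTyL t') ∨ ∃ (s : Srt) (a : M.Code s Δ), Ev M t ρ a.tm ∧ Ev M t' ρ a.tm

/-- `t` and `t'` have the same value in `ρ`, of the type given by the value of `A`; or `A` is a
knowledge universe, and `t` and `t'` are the same type. -/
def Eqv {Δ : C} (ρ : Env M Δ) (t t' A : Tm) : Prop :=
  (IsTyL A ∧ TyEqv ρ t t') ∨
    ∃ (s : Srt) (a : M.Code s Δ) (x : M.Val a), Ev M A ρ a.tm ∧ Ev M t ρ x.tm ∧ Ev M t' ρ x.tm

/-- Semantic equality under a binder of type `A`. -/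
def EqvB {Δ : C} (ρ : Env M Δ) (A t t' T : Tm) : Prop :=
  ∀ ⦃i : ℕ⦄ (a : M.Code (.uc i) Δ), Ev M A ρ a.tm → Eqv (ρ.bind a) t t' T

theorem Sat.map {Γ : Ctx} {Δ Θ : C} {ρ : Env M Δ} (h : Sat Γ ρ) (σ : Θ ⟶ Δ) : Sat Γ (ρ.sub σ) := by
  induction Γ generalizing ρ with
  | nil => cases h; rfl
  | cons A Γ ih =>
    obtain ⟨v, ρ', rfl, h, s, a, hA, hv⟩ := h
    exact ⟨_, _, rfl, ih h, s, a.sub σ, hA.map A σ, by rw [M.typ_sub, hv, M.El_sub]⟩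

theorem Sat.cons {Γ : Ctx} {A : Tm} {Δ : C} {ρ : Env M Δ} (h : Sat Γ ρ) {s : Srt} {a : M.Code s Δ}
    (hA : Ev M A ρ a.tm) (x : M.Val a) : Sat (A :: Γ) (x.tm :: ρ) :=
  ⟨_, _, rfl, h, s, a, hA, x.ty⟩

theorem Sat.under {Γ : Ctx} {A : Tm} {Δ : C} {ρ : Env M Δ} (h : Sat Γ ρ) (e : M.Entry Δ) {s : Srt}
    {a : M.Code s Δ} (hA : Ev M A ρ a.tm) (he : M.El a = e.ty) : Sat (A :: Γ) (ρ.under e) :=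
  (h.map (M.p e)).cons (a := a.sub (M.p e)) (hA.map A _)
    ⟨(M.q e).tm, by rw [(M.q e).ty, M.El_sub, he]⟩

theorem Sat.bind {Γ : Ctx} {A : Tm} {Δ : C} {ρ : Env M Δ} (h : Sat Γ ρ) {i : ℕ}
    {a : M.Code (.uc i) Δ} (hA : Ev M A ρ a.tm) : Sat (A :: Γ) (ρ.bind a) :=
  h.under (.comp i a) hA rfl

theorem Sat.hyp {Γ : Ctx} {A : Tm} {Δ : C} {ρ : Env M Δ} (h : Sat Γ ρ)
    {a : M.Code .prop Δ} (hA : Ev M A ρ a.tm) : Sat (A :: Γ) (ρ.under (.hyp a)) :=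
  h.under (.hyp a) hA rfl

theorem Sat.pvar {Γ : Ctx} {Δ : C} {ρ : Env M Δ} (h : Sat Γ ρ) : Sat (.prop :: Γ) (ρ.under .pvar) :=
  h.under .pvar (s := .tyL 0) (a := M.univ .prop Δ) rfl (M.El_univ .prop Δ)

theorem IsTyL.not_ev : ∀ {t : Tm} {Δ : C} {ρ : Env M Δ} {v : M.Tm Δ}, IsTyL t → ¬ Ev M t ρ v
  | .tyL _, _, _, _, _, h => h
  | .sub t _, _, _, _, h, ⟨_, _, h'⟩ => IsTyL.not_ev (t := t) h h'

theorem IsTyL.push : ∀ {t : Tm} (σ : Sb), IsTyL t → IsTyL (t.push σ)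
  | .tyL _, _, h => h
  | .sub _ _, _, h => h

section

variable {Δ : C} {ρ : Env M Δ} {t t' t'' A B A' B' : Tm} {i : ℕ}

theorem TyEqv.symm (h : TyEqv ρ t t') : TyEqv ρ t' t :=
  h.imp And.symm fun ⟨s, a, h, h'⟩ => ⟨s, a, h', h⟩

theorem TyEqv.trans (h : TyEqv ρ t t') (k : TyEqv ρ t' t'') : TyEqv ρ t t'' := by
  rcases h with h | ⟨s, a, h, h'⟩ <;> rcases k with k | ⟨s', a', k, k'⟩
  · exact .inl ⟨h.1, k.2⟩
  · exact (h.2.not_ev k).elim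
  · exact (k.1.not_ev h').elim
  · exact .inr ⟨s, a, h, by rwa [h'.unique _ k]⟩

theorem Eqv.symm (h : Eqv ρ t t' A) : Eqv ρ t' t A :=
  h.imp (.imp_right .symm) fun ⟨s, a, x, hA, h, h'⟩ => ⟨s, a, x, hA, h', h⟩

theorem Eqv.trans (h : Eqv ρ t t' A) (k : Eqv ρ t' t'' A) : Eqv ρ t t'' A := by
  rcases h with h | ⟨s, a, x, hA, h, h'⟩ <;> rcases k with k | ⟨s', a', x', kA, k, k'⟩
  · exact .inl ⟨h.1, h.2.trans k.2⟩
  · exact (h.1.not_ev kA).elim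
  · exact (k.1.not_ev hA).elim
  · exact .inr ⟨s, a, x, hA, h, by rwa [h'.unique _ k]⟩

theorem Eqv.val (h : Eqv ρ t t' A) {s : Srt} {a : M.Code s Δ} (hA : Ev M A ρ a.tm) :
    ∃ x : M.Val a, Ev M t ρ x.tm ∧ Ev M t' ρ x.tm := by
  rcases h with h | ⟨_, a', x, hA', h, h'⟩
  · exact (h.1.not_ev hA).elim
  · exact ⟨⟨x.tm, x.ty.trans (M.El_congr a' a (hA'.unique _ hA))⟩, h, h'⟩

theorem Eqv.of_val {s : Srt} {a : M.Code s Δ} (x : M.Val a) (hA : Ev M A ρ a.tm)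
    (h : Ev M t ρ x.tm) (h' : Ev M t' ρ x.tm) : Eqv ρ t t' A :=
  .inr ⟨s, a, x, hA, h, h'⟩

theorem Eqv.code {s : Srt} (hs : Ev M s.tm ρ (M.univ s Δ).tm) (h : Eqv ρ t t' s.tm) :
    ∃ a : M.Code s Δ, Ev M t ρ a.tm ∧ Ev M t' ρ a.tm :=
  let ⟨x, h, h'⟩ := h.val hs
  ⟨⟨x.tm, x.ty.trans (M.El_univ s Δ)⟩, h, h'⟩

theorem Eqv.uc (h : Eqv ρ t t' (.uc i)) :
    ∃ a : M.Code (.uc i) Δ, Ev M t ρ a.tm ∧ Ev M t' ρ a.tm :=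
  Eqv.code (s := .uc i) rfl h

theorem Eqv.prop (h : Eqv ρ t t' .prop) :
    ∃ a : M.Code .prop Δ, Ev M t ρ a.tm ∧ Ev M t' ρ a.tm :=
  Eqv.code (s := .prop) rfl h

theorem Eqv.of_code {s : Srt} (a : M.Code s Δ) (h : Ev M t ρ a.tm) (h' : Ev M t' ρ a.tm) :
    Eqv ρ t t' s.tm := by
  have ht : M.typ a.tm = M.El (M.univ s Δ) := a.ty.trans (M.El_univ s Δ).symm
  cases s with
  | uc i => exact .of_val (a := M.univ (.uc i) Δ) ⟨a.tm, ht⟩ rfl h h'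
  | tyL i => exact .inl ⟨trivial, .inr ⟨_, a, h, h'⟩⟩
  | prop => exact .of_val (a := M.univ .prop Δ) ⟨a.tm, ht⟩ rfl h h'

theorem Eqv.of_uc (a : M.Code (.uc i) Δ) (h : Ev M t ρ a.tm) (h' : Ev M t' ρ a.tm) :
    Eqv ρ t t' (.uc i) := Eqv.of_code (s := .uc i) a h h'

theorem Eqv.of_prop (a : M.Code .prop Δ) (h : Ev M t ρ a.tm) (h' : Ev M t' ρ a.tm) :
    Eqv ρ t t' .prop := Eqv.of_code (s := .prop) a h h'

theorem Eqv.of_tyL {s : Srt} (a : M.Code s Δ) (h : Ev M t ρ a.tm) (h' : Ev M t' ρ a.tm) :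
    Eqv ρ t t' (.tyL i) :=
  .inl ⟨trivial, .inr ⟨_, a, h, h'⟩⟩

theorem Eqv.tyEqv {s : Srt} (h : Eqv ρ t t' s.tm) : TyEqv ρ t t' := by
  cases s with
  | uc i => exact h.uc.elim fun a h => .inr ⟨_, a, h⟩
  | tyL i =>
    rcases h with h | ⟨_, _, _, h, _⟩
    · exact h.2
    · exact h.elim
  | prop => exact h.prop.elim fun a h => .inr ⟨_, a, h⟩

theorem Eqv.conv {s : Srt} (h : Eqv ρ t t' A) (e : Eqv ρ A B s.tm) : Eqv ρ t t' B := by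
  rcases h with h | ⟨s, a, x, hA, h, h'⟩ <;> rcases e.tyEqv with k | ⟨s', a', k, k'⟩
  · exact .inl ⟨k.2, h.2⟩
  · exact (h.1.not_ev k).elim
  · exact (k.1.not_ev hA).elim
  · exact .of_val x (by rwa [hA.unique _ k]) h h'

theorem Eqv.incl (h : Eqv ρ t t' .prop) : Eqv ρ t t' (.tyL 0) :=
  h.prop.elim fun a h => .of_tyL a h.1 h.2

theorem Eqv.sub {σ σ' : Sb} {ρ' : Env M Δ} (hσ : EvS M σ ρ ρ') (hσ' : EvS M σ' ρ ρ')
    (h : Eqv ρ' t t' A) : Eqv ρ (.sub t σ) (.sub t' σ') (.sub A σ) := by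
  rcases h with ⟨hA, h | ⟨s, a, h, h'⟩⟩ | ⟨s, a, x, hA, h, h'⟩
  · exact .inl ⟨hA, .inl h⟩
  · exact .inl ⟨hA, .inr ⟨s, a, ⟨_, hσ, h⟩, ⟨_, hσ', h'⟩⟩⟩
  · exact .of_val x ⟨_, hσ, hA⟩ ⟨_, hσ, h⟩ ⟨_, hσ', h'⟩

theorem Eqv.sub_id (h : Eqv ρ t t A) : Eqv ρ (.sub t .id) t A := by
  rcases h with ⟨hA, h | ⟨s, a, h, _⟩⟩ | ⟨s, a, x, hA, h, _⟩
  · exact .inl ⟨hA, .inl h⟩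
  · exact .inl ⟨hA, .inr ⟨s, a, ⟨_, rfl, h⟩, h⟩⟩
  · exact .of_val x hA ⟨_, rfl, h⟩ h

theorem Eqv.sort_sub {ρ' : Env M Δ} {σ : Sb} (s : Srt) (hσ : EvS M σ ρ ρ') :
    Eqv ρ (.sub s.tm σ) s.tm s.next.tm := by
  cases s with
  | uc i => exact .of_uc (M.univ (.uc i) Δ) ⟨_, hσ, rfl⟩ rfl
  | tyL i => exact .inl ⟨trivial, .inl ⟨trivial, trivial⟩⟩
  | prop => exact .of_tyL (M.univ .prop Δ) ⟨_, hσ, rfl⟩ rfl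

end

/-! Pushing a substitution through a term former -/

theorem EvS.lift {σ : Sb} {Δ : C} {ρ ρ' : Env M Δ} (h : EvS M σ ρ ρ') (e : M.Entry Δ) :
    EvS M σ.lift (ρ.under e) (ρ'.under e) :=
  ⟨_, ⟨_, ⟨_, rfl⟩, h.map σ _⟩, _, ⟨_, rfl⟩, rfl⟩

theorem Ev.push : ∀ (t : Tm) {σ : Sb} {Δ : C} {ρ ρ' : Env M Δ} {v : M.Tm Δ},
    EvS M σ ρ ρ' → Ev M t ρ' v → Ev M (t.push σ) ρ v
  | .sub _ _, _, _, _, _, _, hσ, ⟨_, k, h⟩ => ⟨_, ⟨_, hσ, k⟩, h⟩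
  | .uc _, _, _, _, _, _, _, h | .tyL _, _, _, _, _, _, _, h | .prop, _, _, _, _, _, _, h
  | .state, _, _, _, _, _, _, h | .event, _, _, _, _, _, _, h | .nat, _, _, _, _, _, _, h
  | .fin, _, _, _, _, _, _, h | .inf, _, _, _, _, _, _, h
  | .top, _, _, _, _, _, _, h | .bot, _, _, _, _, _, _, h => h
  | .pi _ _ _, _, _, _, _, _, hσ, ⟨a, hA, b, hB, h⟩
  | .sig _ _ _, _, _, _, _, _, hσ, ⟨a, hA, b, hB, h⟩
  | .all _ _ _, _, _, _, _, _, hσ, ⟨a, hA, b, hB, h⟩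
  | .ex _ _ _, _, _, _, _, _, hσ, ⟨a, hA, b, hB, h⟩ =>
      ⟨a, ⟨_, hσ, hA⟩, b, ⟨_, hσ.lift _, hB⟩, h⟩
  | .lam _ _ _ _, _, _, _, _, _, hσ, ⟨a, hA, b, hB, x, hx, h⟩ =>
      ⟨a, ⟨_, hσ, hA⟩, b, ⟨_, hσ.lift _, hB⟩, x, ⟨_, hσ.lift _, hx⟩, h⟩
  | .app _ _ _ _ _, _, _, _, _, _, hσ, ⟨a, hA, b, hB, x, hx, y, hy, h⟩
  | .pair _ _ _ _ _, _, _, _, _, _, hσ, ⟨a, hA, b, hB, x, hx, y, hy, h⟩ =>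
      ⟨a, ⟨_, hσ, hA⟩, b, ⟨_, hσ.lift _, hB⟩, x, ⟨_, hσ, hx⟩, y, ⟨_, hσ, hy⟩, h⟩
  | .fst _ _ _ _, _, _, _, _, _, hσ, ⟨a, hA, b, hB, x, hx, h⟩
  | .snd _ _ _ _, _, _, _, _, _, hσ, ⟨a, hA, b, hB, x, hx, h⟩ =>
      ⟨a, ⟨_, hσ, hA⟩, b, ⟨_, hσ.lift _, hB⟩, x, ⟨_, hσ, hx⟩, h⟩
  | .idt _ _ _ _, _, _, _, _, _, hσ, ⟨a, hA, x, hx, y, hy, h⟩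
  | .trans _ _ _, _, _, _, _, _, hσ, ⟨a, hA, x, hx, y, hy, h⟩
  | .step _ _ _, _, _, _, _, _, hσ, ⟨a, hA, x, hx, y, hy, h⟩ =>
      ⟨a, ⟨_, hσ, hA⟩, x, ⟨_, hσ, hx⟩, y, ⟨_, hσ, hy⟩, h⟩
  | .refl _ _ _, _, _, _, _, _, hσ, ⟨a, hA, x, hx, h⟩
  | .extn _ _, _, _, _, _, _, hσ, ⟨a, hA, x, hx, h⟩
  | .and _ _, _, _, _, _, _, hσ, ⟨a, hA, x, hx, h⟩
  | .or _ _, _, _, _, _, _, hσ, ⟨a, hA, x, hx, h⟩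
  | .imp _ _, _, _, _, _, _, hσ, ⟨a, hA, x, hx, h⟩ => ⟨a, ⟨_, hσ, hA⟩, x, ⟨_, hσ, hx⟩, h⟩
  | .J _ _ _ _ _ _ _ _, _, _, _, _, _, hσ, ⟨a, hA, c, hc, d, hd, x, hx, y, hy, z, hz, h⟩ =>
      ⟨a, ⟨_, hσ, hA⟩, c, ⟨_, ((hσ.lift _).lift _).lift _, hc⟩, d, ⟨_, hσ.lift _, hd⟩,
        x, ⟨_, hσ, hx⟩, y, ⟨_, hσ, hy⟩, z, ⟨_, hσ, hz⟩, h⟩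
  | .nil _, _, _, _, _, _, hσ, ⟨x, hx, h⟩ | .head _, _, _, _, _, _, hσ, ⟨x, hx, h⟩
  | .tail _, _, _, _, _, _, hσ, ⟨x, hx, h⟩ | .idE _, _, _, _, _, _, hσ, ⟨x, hx, h⟩
  | .K _, _, _, _, _, _, hσ, ⟨x, hx, h⟩ | .Kinf _, _, _, _, _, _, hσ, ⟨x, hx, h⟩ =>
      ⟨x, ⟨_, hσ, hx⟩, h⟩
  | .corec _ _ _ _ _ _, _, _, _, _, _, hσ, ⟨a, hA, x, hx, y, hy, z, hz, u, hu, h⟩ =>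
      ⟨a, ⟨_, hσ, hA⟩, x, ⟨_, hσ.lift _, hx⟩, y, ⟨_, hσ.lift _, hy⟩, z, ⟨_, hσ.lift _, hz⟩,
        u, ⟨_, hσ, hu⟩, h⟩
  | .compE _ _ _ _ _, _, _, _, _, _, hσ, ⟨a, hA, x, hx, y, hy, z, hz, u, hu, h⟩ =>
      ⟨a, ⟨_, hσ, hA⟩, x, ⟨_, hσ, hx⟩, y, ⟨_, hσ, hy⟩, z, ⟨_, hσ, hz⟩, u, ⟨_, hσ, hu⟩, h⟩
  | .restrict _ _ _ _, _, _, _, _, _, hσ, ⟨a, hA, x, hx, y, hy, z, hz, h⟩ =>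
      ⟨a, ⟨_, hσ, hA⟩, x, ⟨_, hσ, hx⟩, y, ⟨_, hσ, hy⟩, z, ⟨_, hσ, hz⟩, h⟩
  | .mu _, _, _, _, _, _, hσ, ⟨x, hx, h⟩ | .nu _, _, _, _, _, _, hσ, ⟨x, hx, h⟩ =>
      ⟨x, ⟨_, hσ.lift _, hx⟩, h⟩
  | .q, _, _, _, _, _, hσ, h | .topI, _, _, _, _, _, hσ, h | .botE _ _, _, _, _, _, _, hσ, h
  | .andI _ _ _ _, _, _, _, _, _, hσ, h | .andE₁ _ _ _, _, _, _, _, _, hσ, h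
  | .andE₂ _ _ _, _, _, _, _, _, hσ, h | .orI₁ _ _ _, _, _, _, _, _, hσ, h
  | .orI₂ _ _ _, _, _, _, _, _, hσ, h | .orE _ _ _ _ _ _, _, _, _, _, _, hσ, h
  | .impI _ _ _, _, _, _, _, _, hσ, h | .impE _ _ _ _, _, _, _, _, _, hσ, h
  | .allI _ _ _ _, _, _, _, _, _, hσ, h | .allE _ _ _ _ _, _, _, _, _, _, hσ, h
  | .exI _ _ _ _ _, _, _, _, _, _, hσ, h | .exE _ _ _ _ _ _, _, _, _, _, _, hσ, h
  | .fold _, _, _, _, _, _, hσ, h | .unfold _, _, _, _, _, _, hσ, h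
  | .out _, _, _, _, _, _, hσ, h | .into _, _, _, _, _, _, hσ, h => ⟨_, hσ, h⟩

theorem Eqv.push {Δ : C} {ρ ρ' : Env M Δ} {t A : Tm} {σ : Sb} (hσ : EvS M σ ρ ρ')
    (h : Eqv ρ' t t A) : Eqv ρ (.sub t σ) (t.push σ) (.sub A σ) := by
  rcases h with ⟨hA, ⟨h, _⟩ | ⟨s, a, h, _⟩⟩ | ⟨s, a, x, hA, h, _⟩
  · exact .inl ⟨hA, .inl ⟨h, h.push σ⟩⟩
  · exact .inl ⟨hA, .inr ⟨s, a, ⟨_, hσ, h⟩, h.push _ hσ⟩⟩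
  · exact .of_val x ⟨_, hσ, hA⟩ ⟨_, hσ, h⟩ (h.push _ hσ)

end Sem

namespace Sem

open CwFE CwFPi

variable {C : Type u} [Category.{v} C] {M : Model.{u, v, w} C}

/-! Instantiation -/

theorem evS_inst {Δ : C} {ρ : Env M Δ} {s : Tm} {x : M.Tm Δ} (hs : Ev M s ρ x) :
    EvS M (.inst s) ρ (x :: ρ) :=
  ⟨ρ, rfl, x, hs, rfl⟩

theorem Ev.inst {i : ℕ} {Δ : C} {ρ : Env M Δ} {a : M.Code (.uc i) Δ} {t s : Tm} {v : M.Tm (cons a)}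
    (h : Ev M t (ρ.bind a) v) (x : M.Val a) (hs : Ev M s ρ x.tm) :
    Ev M (.sub t (.inst s)) ρ (M.subTm (at1 x) v) :=
  ⟨_, evS_inst hs, by simpa only [Env.bind_at1] using h.map t (at1 x)⟩

theorem Ev.wk {Δ : C} {ρ : Env M Δ} {t : Tm} {v : M.Tm Δ} (h : Ev M t ρ v) (e : M.Entry Δ) :
    Ev M t.wk (ρ.under e) (M.subTm (M.p e) v) :=
  ⟨_, ⟨_, rfl⟩, h.map t _⟩

theorem at1_var_up {i : ℕ} {Δ : C} (a : M.Code (.uc i) Δ) :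
    at1 (var a) ≫ up (M.p (.comp i a)) a = 𝟙 (cons a) := by
  apply M.pair_uniq
  · rw [Category.assoc, up_p, ← Category.assoc, at1_p]
  · rw [M.subTm_comp]
    exact (congrArg _ (up_q _ _ _)).trans ((at1_q _).trans (M.subTm_id _).symm)

section Products

variable {Δ : C} {ρ : Env M Δ} {i : ℕ} {A A' B B' t t' f f' a a' b b' c c' : Tm}

theorem Eqv.pi (hA : Eqv ρ A A' (.uc i)) (hB : EqvB ρ A B B' (.uc i)) :
    Eqv ρ (.pi i A B) (.pi i A' B') (.uc i) := by
  obtain ⟨α, hA, hA'⟩ := hA.uc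
  obtain ⟨β, hB, hB'⟩ := (hB α hA).uc
  exact .of_uc (M.pi α β) ⟨α, hA, β, hB, rfl⟩ ⟨α, hA', β, hB', rfl⟩

theorem Eqv.lam (hA : Eqv ρ A A' (.uc i)) (hB : EqvB ρ A B B' (.uc i)) (ht : EqvB ρ A t t' B) :
    Eqv ρ (.lam i A B t) (.lam i A' B' t') (.pi i A B) := by
  obtain ⟨α, hA, hA'⟩ := hA.uc
  obtain ⟨β, hB, hB'⟩ := (hB α hA).uc
  obtain ⟨x, ht, ht'⟩ := (ht α hA).val hB
  exact .of_val (M.lam x) ⟨α, hA, β, hB, rfl⟩ ⟨α, hA, β, hB, x, ht, rfl⟩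
    ⟨α, hA', β, hB', x, ht', rfl⟩

theorem Eqv.app (hA : Eqv ρ A A' (.uc i)) (hB : EqvB ρ A B B' (.uc i))
    (hf : Eqv ρ f f' (.pi i A B)) (ha : Eqv ρ a a' A) :
    Eqv ρ (.app i A B f a) (.app i A' B' f' a') (.sub B (.inst a)) := by
  obtain ⟨α, hA, hA'⟩ := hA.uc
  obtain ⟨β, hB, hB'⟩ := (hB α hA).uc
  obtain ⟨g, hf, hf'⟩ := hf.val (a := M.pi α β) ⟨α, hA, β, hB, rfl⟩
  obtain ⟨x, ha, ha'⟩ := ha.val hA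
  exact .of_val ((M.lam.symm g).sub (at1 x)) (hB.inst x ha) ⟨α, hA, β, hB, g, hf, x, ha, rfl⟩
    ⟨α, hA', β, hB', g, hf', x, ha', rfl⟩

theorem Eqv.pi_beta (hA : Eqv ρ A A (.uc i)) (hB : EqvB ρ A B B (.uc i)) (ht : EqvB ρ A t t B)
    (ha : Eqv ρ a a A) :
    Eqv ρ (.app i A B (.lam i A B t) a) (.sub t (.inst a)) (.sub B (.inst a)) := by
  obtain ⟨α, hA, _⟩ := hA.uc
  obtain ⟨β, hB, _⟩ := (hB α hA).uc
  obtain ⟨y, ht, _⟩ := (ht α hA).val hB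
  obtain ⟨x, ha, _⟩ := ha.val hA
  exact .of_val (y.sub (at1 x)) (hB.inst x ha)
    ⟨α, hA, β, hB, M.lam y, ⟨α, hA, β, hB, y, ht, rfl⟩, x, ha,
      by rw [M.lam.symm_apply_apply]; rfl⟩ (ht.inst x ha)

theorem Eqv.pi_eta (hA : Eqv ρ A A (.uc i)) (hB : EqvB ρ A B B (.uc i))
    (hf : Eqv ρ f f (.pi i A B)) :
    Eqv ρ (.lam i A B (.app i A.wk (.sub B (Sb.lift .p)) f.wk .q)) f (.pi i A B) := by
  obtain ⟨α, hA, _⟩ := hA.uc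
  obtain ⟨β, hB, _⟩ := (hB α hA).uc
  have hP : Ev M (.pi i A B) ρ (M.pi α β).tm := ⟨α, hA, β, hB, rfl⟩
  obtain ⟨g, hf, _⟩ := hf.val hP
  refine .of_val g hP ⟨α, hA, β, hB, M.lam.symm g, ⟨α.sub (M.p _), hA.wk _,
    β.sub (up (M.p _) α), ⟨_, EvS.lift (σ := .p) (ρ' := ρ.sub (M.p _)) ⟨_, rfl⟩ _, ?_⟩,
    g.sub _ (M.pi_sub _ _ _), hf.wk _, var α, ⟨_, rfl⟩, ?_⟩, by rw [M.lam.apply_symm_apply]⟩ hf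
  · exact (hB.map B (up (M.p _) α)).bind
  · rw [← lam_symm_sub, ← M.subTm_comp, at1_var_up, M.subTm_id]

theorem Eqv.sig (hA : Eqv ρ A A' (.uc i)) (hB : EqvB ρ A B B' (.uc i)) :
    Eqv ρ (.sig i A B) (.sig i A' B') (.uc i) := by
  obtain ⟨α, hA, hA'⟩ := hA.uc
  obtain ⟨β, hB, hB'⟩ := (hB α hA).uc
  exact .of_uc (M.sig α β) ⟨α, hA, β, hB, rfl⟩ ⟨α, hA', β, hB', rfl⟩

theorem Eqv.pair (hA : Eqv ρ A A' (.uc i)) (hB : EqvB ρ A B B' (.uc i)) (ha : Eqv ρ a a' A)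
    (hb : Eqv ρ b b' (.sub B (.inst a))) :
    Eqv ρ (.pair i A B a b) (.pair i A' B' a' b') (.sig i A B) := by
  obtain ⟨α, hA, hA'⟩ := hA.uc
  obtain ⟨β, hB, hB'⟩ := (hB α hA).uc
  obtain ⟨x, ha, ha'⟩ := ha.val hA
  obtain ⟨y, hb, hb'⟩ := hb.val (a := β.sub (at1 x)) (hB.inst x ha)
  exact .of_val (M.pr ⟨x, y⟩) ⟨α, hA, β, hB, rfl⟩ ⟨α, hA, β, hB, x, ha, y, hb, rfl⟩
    ⟨α, hA', β, hB', x, ha', y, hb', rfl⟩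

theorem Eqv.fst (hA : Eqv ρ A A' (.uc i)) (hB : EqvB ρ A B B' (.uc i))
    (hc : Eqv ρ c c' (.sig i A B)) : Eqv ρ (.fst i A B c) (.fst i A' B' c') A := by
  obtain ⟨α, hA, hA'⟩ := hA.uc
  obtain ⟨β, hB, hB'⟩ := (hB α hA).uc
  obtain ⟨z, hc, hc'⟩ := hc.val (a := M.sig α β) ⟨α, hA, β, hB, rfl⟩
  exact .of_val (M.pr.symm z).1 hA ⟨α, hA, β, hB, z, hc, rfl⟩ ⟨α, hA', β, hB', z, hc', rfl⟩

theorem Eqv.snd (hA : Eqv ρ A A' (.uc i)) (hB : EqvB ρ A B B' (.uc i))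
    (hc : Eqv ρ c c' (.sig i A B)) :
    Eqv ρ (.snd i A B c) (.snd i A' B' c') (.sub B (.inst (.fst i A B c))) := by
  obtain ⟨α, hA, hA'⟩ := hA.uc
  obtain ⟨β, hB, hB'⟩ := (hB α hA).uc
  obtain ⟨z, hc, hc'⟩ := hc.val (a := M.sig α β) ⟨α, hA, β, hB, rfl⟩
  exact .of_val (a := β.sub (at1 (M.pr.symm z).1)) (M.pr.symm z).2
    (hB.inst _ ⟨α, hA, β, hB, z, hc, rfl⟩) ⟨α, hA, β, hB, z, hc, rfl⟩
    ⟨α, hA', β, hB', z, hc', rfl⟩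

theorem Eqv.fst_beta (hA : Eqv ρ A A (.uc i)) (hB : EqvB ρ A B B (.uc i)) (ha : Eqv ρ a a A)
    (hb : Eqv ρ b b (.sub B (.inst a))) : Eqv ρ (.fst i A B (.pair i A B a b)) a A := by
  obtain ⟨α, hA, _⟩ := hA.uc
  obtain ⟨β, hB, _⟩ := (hB α hA).uc
  obtain ⟨x, ha, _⟩ := ha.val hA
  obtain ⟨y, hb, _⟩ := hb.val (a := β.sub (at1 x)) (hB.inst x ha)
  exact .of_val x hA ⟨α, hA, β, hB, M.pr ⟨x, y⟩, ⟨α, hA, β, hB, x, ha, y, hb, rfl⟩,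
    by rw [M.pr.symm_apply_apply]⟩ ha

theorem Eqv.snd_beta (hA : Eqv ρ A A (.uc i)) (hB : EqvB ρ A B B (.uc i)) (ha : Eqv ρ a a A)
    (hb : Eqv ρ b b (.sub B (.inst a))) :
    Eqv ρ (.snd i A B (.pair i A B a b)) b (.sub B (.inst a)) := by
  obtain ⟨α, hA, _⟩ := hA.uc
  obtain ⟨β, hB, _⟩ := (hB α hA).uc
  obtain ⟨x, ha, _⟩ := ha.val hA
  obtain ⟨y, hb, _⟩ := hb.val (a := β.sub (at1 x)) (hB.inst x ha)
  exact .of_val (a := β.sub (at1 x)) y (hB.inst x ha)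
    ⟨α, hA, β, hB, M.pr ⟨x, y⟩, ⟨α, hA, β, hB, x, ha, y, hb, rfl⟩,
      by rw [M.pr.symm_apply_apply]⟩ hb

theorem Eqv.sig_eta (hA : Eqv ρ A A (.uc i)) (hB : EqvB ρ A B B (.uc i))
    (hc : Eqv ρ c c (.sig i A B)) :
    Eqv ρ (.pair i A B (.fst i A B c) (.snd i A B c)) c (.sig i A B) := by
  obtain ⟨α, hA, _⟩ := hA.uc
  obtain ⟨β, hB, _⟩ := (hB α hA).uc
  have hS : Ev M (.sig i A B) ρ (M.sig α β).tm := ⟨α, hA, β, hB, rfl⟩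
  obtain ⟨z, hc, _⟩ := hc.val hS
  exact .of_val z hS ⟨α, hA, β, hB, (M.pr.symm z).1, ⟨α, hA, β, hB, z, hc, rfl⟩,
    (M.pr.symm z).2, ⟨α, hA, β, hB, z, hc, rfl⟩, congrArg CwF.Elt.tm (M.pr.apply_symm_apply z).symm⟩ hc

end Products

section Identity

variable {Δ : C} {ρ : Env M Δ} {i j : ℕ} {A A' a a' b b' D D' d d' r r' : Tm}

theorem Eqv.idt (hA : Eqv ρ A A' (.uc i)) (ha : Eqv ρ a a' A) (hb : Eqv ρ b b' A) :
    Eqv ρ (.idt i A a b) (.idt i A' a' b') (.uc i) := by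
  obtain ⟨α, hA, hA'⟩ := hA.uc
  obtain ⟨x, ha, ha'⟩ := ha.val hA
  obtain ⟨y, hb, hb'⟩ := hb.val hA
  exact .of_uc (M.idt x y) ⟨α, hA, x, ha, y, hb, rfl⟩ ⟨α, hA', x, ha', y, hb', rfl⟩

theorem Eqv.refl (hA : Eqv ρ A A' (.uc i)) (ha : Eqv ρ a a' A) :
    Eqv ρ (.refl i A a) (.refl i A' a') (.idt i A a a) := by
  obtain ⟨α, hA, hA'⟩ := hA.uc
  obtain ⟨x, ha, ha'⟩ := ha.val hA
  exact .of_val (M.refl x) ⟨α, hA, x, ha, x, ha, rfl⟩ ⟨α, hA, x, ha, rfl⟩ ⟨α, hA', x, ha', rfl⟩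

theorem ev_idVars {α : M.Code (.uc i) Δ} (hA : Ev M A ρ α.tm) :
    Ev M (A.idVars i) ((ρ.bind α).bind (α.sub (M.p _))) (idVars α).tm :=
  ⟨(α.sub (M.p _)).sub (M.p _), (hA.wk _).wk _, (var α).sub (M.p _), ⟨_, ⟨_, rfl⟩, ⟨_, rfl⟩⟩, var _,
    ⟨_, rfl⟩, rfl⟩

theorem Sat.bind₃ {Γ : Ctx} (h : Sat Γ ρ) {α : M.Code (.uc i) Δ} (hA : Ev M A ρ α.tm) :
    Sat (A.idVars i :: A.wk :: A :: Γ) (ρ.bind₃ α) :=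
  ((h.bind hA).bind (a := α.sub (M.p _)) (hA.wk _)).bind (ev_idVars hA)

theorem ev_diag {α : M.Code (.uc i) Δ} (hA : Ev M A ρ α.tm) {c : M.Tm (idCtx α)}
    (hD : Ev M D (ρ.bind₃ α) c) :
    Ev M (.sub D (.diag A i)) (ρ.bind α) (M.subTm (diag (M := M.toCwFPi) α) c) := by
  have h := hD.map D (diag (M := M.toCwFPi) α)
  rw [diag, Env.bind₃_map₃] at h
  exact ⟨_, ⟨_, ⟨_, ⟨_, ⟨_, rfl⟩, _, ⟨_, rfl⟩, rfl⟩, _, ⟨_, rfl⟩, rfl⟩, _,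
    ⟨α.sub (M.p _), hA.wk _, var α, ⟨_, rfl⟩, rfl⟩, rfl⟩, h⟩

theorem ev_inst₃ {α : M.Code (.uc i) Δ} {c : M.Tm (idCtx α)} (hD : Ev M D (ρ.bind₃ α) c)
    {x y : M.Val α} {z : M.Val (M.idt x y)} (ha : Ev M a ρ x.tm) (hb : Ev M b ρ y.tm)
    (hr : Ev M r ρ z.tm) :
    Ev M (.sub D (.inst₃ a b r)) ρ (M.subTm (inst₃ (M := M.toCwFPi) x y z) c) := by
  have h := hD.map D (inst₃ (M := M.toCwFPi) x y z)
  rw [inst₃, Env.bind₃_map₃, Env.sub_id] at h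
  change Ev M D (M.subTm (𝟙 Δ) z.tm :: M.subTm (𝟙 Δ) y.tm :: M.subTm (𝟙 Δ) x.tm :: ρ) _ at h
  rw [M.subTm_id, M.subTm_id, M.subTm_id] at h
  exact ⟨_, ⟨_, ⟨_, ⟨_, rfl, _, ha, rfl⟩, _, hb, rfl⟩, _, hr, rfl⟩, h⟩

/-- Semantic equality under the three binders of a motive. -/
def EqvB₃ (ρ : Env M Δ) (i : ℕ) (A t t' T : Tm) : Prop :=
  ∀ a : M.Code (.uc i) Δ, Ev M A ρ a.tm → Eqv (ρ.bind₃ a) t t' T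

theorem Eqv.J (hA : Eqv ρ A A' (.uc i)) (hD : EqvB₃ ρ i A D D' (.uc j))
    (hd : EqvB ρ A d d' (.sub D (.diag A i))) (ha : Eqv ρ a a' A) (hb : Eqv ρ b b' A)
    (hr : Eqv ρ r r' (.idt i A a b)) :
    Eqv ρ (.J i j A D d a b r) (.J i j A' D' d' a' b' r') (.sub D (.inst₃ a b r)) := by
  obtain ⟨α, hA, hA'⟩ := hA.uc
  obtain ⟨c, hD, hD'⟩ := (hD α hA).uc
  obtain ⟨e, hd, hd'⟩ := (hd α hA).val (a := c.sub (diag (M := M.toCwFPi) α)) (ev_diag hA hD)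
  obtain ⟨x, ha, ha'⟩ := ha.val hA
  obtain ⟨y, hb, hb'⟩ := hb.val hA
  obtain ⟨z, hr, hr'⟩ := hr.val (a := M.idt x y) ⟨α, hA, x, ha, y, hb, rfl⟩
  exact .of_val (M.J c e x y z) (ev_inst₃ hD ha hb hr)
    ⟨α, hA, c, hD, e, hd, x, ha, y, hb, z, hr, rfl⟩
    ⟨α, hA', c, hD', e, hd', x, ha', y, hb', z, hr', rfl⟩

theorem Eqv.J_beta (hA : Eqv ρ A A (.uc i)) (hD : EqvB₃ ρ i A D D (.uc j))
    (hd : EqvB ρ A d d (.sub D (.diag A i))) (ha : Eqv ρ a a A) :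
    Eqv ρ (.J i j A D d a a (.refl i A a)) (.sub d (.inst a))
      (.sub D (.inst₃ a a (.refl i A a))) := by
  obtain ⟨α, hA, _⟩ := hA.uc
  obtain ⟨c, hD, _⟩ := (hD α hA).uc
  obtain ⟨e, hd, _⟩ := (hd α hA).val (a := c.sub (diag (M := M.toCwFPi) α)) (ev_diag hA hD)
  obtain ⟨x, ha, _⟩ := ha.val hA
  have hr : Ev M (.refl i A a) ρ (M.refl x).tm := ⟨α, hA, x, ha, rfl⟩
  exact .of_val (M.J c e x x (M.refl x)) (ev_inst₃ hD ha ha hr)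
    ⟨α, hA, c, hD, e, hd, x, ha, x, ha, _, hr, rfl⟩
    (by rw [M.J_refl]; exact hd.inst x ha)

end Identity

end Sem

namespace Sem

open CwFE CwFPi

variable {C : Type u} [Category.{v} C] {M : Model.{u, v, w} C}

section Traces

variable {Δ : C} {ρ : Env M Δ} {i : ℕ}

theorem Eqv.trans_tm {s₁ s₂ e₁ e₂ t₁ t₂ : Tm} (hs : Eqv ρ s₁ s₂ .state) (he : Eqv ρ e₁ e₂ .event)
    (ht : Eqv ρ t₁ t₂ .state) : Eqv ρ (.trans s₁ e₁ t₁) (.trans s₂ e₂ t₂) (.uc 0) := by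
  obtain ⟨x, hs, hs'⟩ := hs.val (a := M.state Δ) rfl
  obtain ⟨y, he, he'⟩ := he.val (a := M.event Δ) rfl
  obtain ⟨z, ht, ht'⟩ := ht.val (a := M.state Δ) rfl
  exact .of_uc (M.trans x y z) ⟨x, hs, y, he, z, ht, rfl⟩ ⟨x, hs', y, he', z, ht', rfl⟩

theorem Eqv.nil {s s' : Tm} (hs : Eqv ρ s s' .state) : Eqv ρ (.nil s) (.nil s') .fin := by
  obtain ⟨x, hs, hs'⟩ := hs.val (a := M.state Δ) rfl
  exact .of_val (a := M.fin Δ) (M.nil x) rfl ⟨x, hs, rfl⟩ ⟨x, hs', rfl⟩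

theorem Eqv.step {τ τ' e e' s s' : Tm} (hτ : Eqv ρ τ τ' .fin) (he : Eqv ρ e e' .event)
    (hs : Eqv ρ s s' .state) : Eqv ρ (.step τ e s) (.step τ' e' s') .fin := by
  obtain ⟨z, hτ, hτ'⟩ := hτ.val (a := M.fin Δ) rfl
  obtain ⟨y, he, he'⟩ := he.val (a := M.event Δ) rfl
  obtain ⟨x, hs, hs'⟩ := hs.val (a := M.state Δ) rfl
  exact .of_val (a := M.fin Δ) (M.step z y x) rfl ⟨z, hτ, y, he, x, hs, rfl⟩
    ⟨z, hτ', y, he', x, hs', rfl⟩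

theorem Eqv.head {π π' : Tm} (h : Eqv ρ π π' .inf) : Eqv ρ (.head π) (.head π') .state := by
  obtain ⟨z, h, h'⟩ := h.val (a := M.inf Δ) rfl
  exact .of_val (a := M.state Δ) (M.head z) rfl ⟨z, h, rfl⟩ ⟨z, h', rfl⟩

theorem ev_tailTy : Ev M (.sig 0 .event .inf) ρ (M.sig (M.event Δ) (M.inf (cons (M.event Δ)))).tm :=
  ⟨M.event Δ, rfl, M.inf _, rfl, rfl⟩

theorem Eqv.tail {π π' : Tm} (h : Eqv ρ π π' .inf) :
    Eqv ρ (.tail π) (.tail π') (.sig 0 .event .inf) := by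
  obtain ⟨z, h, h'⟩ := h.val (a := M.inf Δ) rfl
  exact .of_val (M.tail z) ev_tailTy ⟨z, h, rfl⟩ ⟨z, h', rfl⟩

section Corec

variable {X X' h h' e e' n n' x x' : Tm}

theorem Eqv.corec (hX : Eqv ρ X X' (.uc i)) (hh : EqvB ρ X h h' .state) (he : EqvB ρ X e e' .event)
    (hn : EqvB ρ X n n' X.wk) (hx : Eqv ρ x x' X) :
    Eqv ρ (.corec i X h e n x) (.corec i X' h' e' n' x') .inf := by
  obtain ⟨a, hX, hX'⟩ := hX.uc
  obtain ⟨y, hh, hh'⟩ := (hh a hX).val (a := M.state (cons a)) rfl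
  obtain ⟨z, he, he'⟩ := (he a hX).val (a := M.event (cons a)) rfl
  obtain ⟨k, hn, hn'⟩ := (hn a hX).val (a := a.sub (M.p _)) (hX.wk _)
  obtain ⟨x, hx, hx'⟩ := hx.val hX
  exact .of_val (a := M.inf Δ) (M.corec y z k x) rfl ⟨a, hX, y, hh, z, he, k, hn, x, hx, rfl⟩
    ⟨a, hX', y, hh', z, he', k, hn', x, hx', rfl⟩

theorem Eqv.head_corec (hX : Eqv ρ X X (.uc i)) (hh : EqvB ρ X h h .state)
    (he : EqvB ρ X e e .event) (hn : EqvB ρ X n n X.wk) (hx : Eqv ρ x x X) :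
    Eqv ρ (.head (.corec i X h e n x)) (.sub h (.inst x)) .state := by
  obtain ⟨a, hX, _⟩ := hX.uc
  obtain ⟨y, hh, _⟩ := (hh a hX).val (a := M.state (cons a)) rfl
  obtain ⟨z, he, _⟩ := (he a hX).val (a := M.event (cons a)) rfl
  obtain ⟨k, hn, _⟩ := (hn a hX).val (a := a.sub (M.p _)) (hX.wk _)
  obtain ⟨x, hx, _⟩ := hx.val hX
  exact .of_val (a := M.state Δ) (M.head (M.corec y z k x)) rfl
    ⟨_, ⟨a, hX, y, hh, z, he, k, hn, x, hx, rfl⟩, rfl⟩ (by rw [M.head_corec]; exact hh.inst x hx)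

theorem Eqv.tail_corec (hX : Eqv ρ X X (.uc i)) (hh : EqvB ρ X h h .state)
    (he : EqvB ρ X e e .event) (hn : EqvB ρ X n n X.wk) (hx : Eqv ρ x x X) :
    Eqv ρ (.tail (.corec i X h e n x))
      (.pair 0 .event .inf (.sub e (.inst x)) (.corec i X h e n (.sub n (.inst x))))
      (.sig 0 .event .inf) := by
  obtain ⟨a, hX, _⟩ := hX.uc
  obtain ⟨y, hh, _⟩ := (hh a hX).val (a := M.state (cons a)) rfl
  obtain ⟨z, he, _⟩ := (he a hX).val (a := M.event (cons a)) rfl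
  obtain ⟨k, hn, _⟩ := (hn a hX).val (a := a.sub (M.p _)) (hX.wk _)
  obtain ⟨x, hx, _⟩ := hx.val hX
  refine .of_val (M.tail (M.corec y z k x)) ev_tailTy
    ⟨_, ⟨a, hX, y, hh, z, he, k, hn, x, hx, rfl⟩, rfl⟩ ?_
  rw [M.tail_corec]
  refine ⟨M.event Δ, rfl, M.inf _, rfl, _, he.inst x hx, _, ?_, rfl⟩
  exact ⟨a, hX, y, hh, z, he, k, hn, k.sub (at1 x) (wk_at1 x a), hn.inst x hx, M.subTm_id _⟩

end Corec

theorem Eqv.extn {τ₁ τ₂ τ₁' τ₂' : Tm} (h : Eqv ρ τ₁ τ₂ .fin) (h' : Eqv ρ τ₁' τ₂' .fin) :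
    Eqv ρ (.extn τ₁ τ₁') (.extn τ₂ τ₂') (.uc 0) := by
  obtain ⟨x, h₁, h₂⟩ := h.val (a := M.fin Δ) rfl
  obtain ⟨y, h₁', h₂'⟩ := h'.val (a := M.fin Δ) rfl
  exact .of_uc (M.extn x y) ⟨x, h₁, y, h₁', rfl⟩ ⟨x, h₂, y, h₂', rfl⟩

theorem Eqv.idE {τ τ' : Tm} (h : Eqv ρ τ τ' .fin) : Eqv ρ (.idE τ) (.idE τ') (.extn τ τ) := by
  obtain ⟨x, h, h'⟩ := h.val (a := M.fin Δ) rfl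
  exact .of_val (M.idE x) ⟨x, h, x, h, rfl⟩ ⟨x, h, rfl⟩ ⟨x, h', rfl⟩

theorem Eqv.compE {τ₁ τ₂ τ₁' τ₂' τ₁'' τ₂'' ε₁ ε₂ δ₁ δ₂ : Tm} (h : Eqv ρ τ₁ τ₂ .fin)
    (h' : Eqv ρ τ₁' τ₂' .fin) (h'' : Eqv ρ τ₁'' τ₂'' .fin) (hε : Eqv ρ ε₁ ε₂ (.extn τ₁ τ₁'))
    (hδ : Eqv ρ δ₁ δ₂ (.extn τ₁' τ₁'')) :
    Eqv ρ (.compE τ₁ τ₁' τ₁'' ε₁ δ₁) (.compE τ₂ τ₂' τ₂'' ε₂ δ₂) (.extn τ₁ τ₁'') := by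
  obtain ⟨x, h₁, h₂⟩ := h.val (a := M.fin Δ) rfl
  obtain ⟨y, h₁', h₂'⟩ := h'.val (a := M.fin Δ) rfl
  obtain ⟨z, h₁'', h₂''⟩ := h''.val (a := M.fin Δ) rfl
  obtain ⟨f, hε, hε'⟩ := hε.val (a := M.extn x y) ⟨x, h₁, y, h₁', rfl⟩
  obtain ⟨g, hδ, hδ'⟩ := hδ.val (a := M.extn y z) ⟨y, h₁', z, h₁'', rfl⟩
  exact .of_val (M.compE f g) ⟨x, h₁, z, h₁'', rfl⟩ ⟨x, h₁, y, h₁', z, h₁'', f, hε, g, hδ, rfl⟩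
    ⟨x, h₂, y, h₂', z, h₂'', f, hε', g, hδ', rfl⟩

theorem Eqv.compE_id_left {τ τ' ε : Tm} (h : Eqv ρ τ τ .fin) (h' : Eqv ρ τ' τ' .fin)
    (hε : Eqv ρ ε ε (.extn τ τ')) : Eqv ρ (.compE τ τ τ' (.idE τ) ε) ε (.extn τ τ') := by
  obtain ⟨x, h, _⟩ := h.val (a := M.fin Δ) rfl
  obtain ⟨y, h', _⟩ := h'.val (a := M.fin Δ) rfl
  obtain ⟨f, hε, _⟩ := hε.val (a := M.extn x y) ⟨x, h, y, h', rfl⟩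
  exact .of_val f ⟨x, h, y, h', rfl⟩
    ⟨x, h, x, h, y, h', M.idE x, ⟨x, h, rfl⟩, f, hε, by rw [M.id_compE]⟩ hε

theorem Eqv.compE_id_right {τ τ' ε : Tm} (h : Eqv ρ τ τ .fin) (h' : Eqv ρ τ' τ' .fin)
    (hε : Eqv ρ ε ε (.extn τ τ')) : Eqv ρ (.compE τ τ' τ' ε (.idE τ')) ε (.extn τ τ') := by
  obtain ⟨x, h, _⟩ := h.val (a := M.fin Δ) rfl
  obtain ⟨y, h', _⟩ := h'.val (a := M.fin Δ) rfl
  obtain ⟨f, hε, _⟩ := hε.val (a := M.extn x y) ⟨x, h, y, h', rfl⟩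
  exact .of_val f ⟨x, h, y, h', rfl⟩
    ⟨x, h, y, h', y, h', f, hε, M.idE y, ⟨y, h', rfl⟩, by rw [M.compE_id]⟩ hε

theorem Eqv.compE_assoc {τ₀ τ₁ τ₂ τ₃ ε₁ ε₂ ε₃ : Tm} (h₀ : Eqv ρ τ₀ τ₀ .fin) (h₁ : Eqv ρ τ₁ τ₁ .fin)
    (h₂ : Eqv ρ τ₂ τ₂ .fin) (h₃ : Eqv ρ τ₃ τ₃ .fin) (k₁ : Eqv ρ ε₁ ε₁ (.extn τ₀ τ₁))
    (k₂ : Eqv ρ ε₂ ε₂ (.extn τ₁ τ₂)) (k₃ : Eqv ρ ε₃ ε₃ (.extn τ₂ τ₃)) :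
    Eqv ρ (.compE τ₀ τ₂ τ₃ (.compE τ₀ τ₁ τ₂ ε₁ ε₂) ε₃)
      (.compE τ₀ τ₁ τ₃ ε₁ (.compE τ₁ τ₂ τ₃ ε₂ ε₃)) (.extn τ₀ τ₃) := by
  obtain ⟨x₀, h₀, _⟩ := h₀.val (a := M.fin Δ) rfl
  obtain ⟨x₁, h₁, _⟩ := h₁.val (a := M.fin Δ) rfl
  obtain ⟨x₂, h₂, _⟩ := h₂.val (a := M.fin Δ) rfl
  obtain ⟨x₃, h₃, _⟩ := h₃.val (a := M.fin Δ) rfl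
  obtain ⟨f, k₁, _⟩ := k₁.val (a := M.extn x₀ x₁) ⟨_, h₀, _, h₁, rfl⟩
  obtain ⟨g, k₂, _⟩ := k₂.val (a := M.extn x₁ x₂) ⟨_, h₁, _, h₂, rfl⟩
  obtain ⟨k, k₃, _⟩ := k₃.val (a := M.extn x₂ x₃) ⟨_, h₂, _, h₃, rfl⟩
  exact .of_val (M.compE (M.compE f g) k) ⟨_, h₀, _, h₃, rfl⟩
    ⟨_, h₀, _, h₂, _, h₃, _, ⟨_, h₀, _, h₁, _, h₂, _, k₁, _, k₂, rfl⟩, _, k₃, rfl⟩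
    ⟨_, h₀, _, h₁, _, h₃, _, k₁, _, ⟨_, h₁, _, h₂, _, h₃, _, k₂, _, k₃, rfl⟩,
      by rw [M.compE_assoc]⟩

theorem Eqv.K {τ τ' : Tm} (h : Eqv ρ τ τ' .fin) : Eqv ρ (.K τ) (.K τ') (.tyL 0) := by
  obtain ⟨x, h, h'⟩ := h.val (a := M.fin Δ) rfl
  exact .of_tyL (M.K x) ⟨x, h, rfl⟩ ⟨x, h', rfl⟩

theorem Eqv.Kinf {π π' : Tm} (h : Eqv ρ π π' .inf) : Eqv ρ (.Kinf π) (.Kinf π') (.tyL 0) := by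
  obtain ⟨x, h, h'⟩ := h.val (a := M.inf Δ) rfl
  exact .of_tyL (M.Kinf x) ⟨x, h, rfl⟩ ⟨x, h', rfl⟩

theorem Eqv.restrict {τ₁ τ₂ τ₁' τ₂' ε₁ ε₂ k₁ k₂ : Tm} (h : Eqv ρ τ₁ τ₂ .fin)
    (h' : Eqv ρ τ₁' τ₂' .fin) (hε : Eqv ρ ε₁ ε₂ (.extn τ₁ τ₁')) (hk : Eqv ρ k₁ k₂ (.K τ₁')) :
    Eqv ρ (.restrict τ₁ τ₁' ε₁ k₁) (.restrict τ₂ τ₂' ε₂ k₂) (.K τ₁) := by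
  obtain ⟨x, h₁, h₂⟩ := h.val (a := M.fin Δ) rfl
  obtain ⟨y, h₁', h₂'⟩ := h'.val (a := M.fin Δ) rfl
  obtain ⟨f, hε, hε'⟩ := hε.val (a := M.extn x y) ⟨x, h₁, y, h₁', rfl⟩
  obtain ⟨k, hk, hk'⟩ := hk.val (a := M.K y) ⟨y, h₁', rfl⟩
  exact .of_val (M.restrict f k) ⟨x, h₁, rfl⟩ ⟨x, h₁, y, h₁', f, hε, k, hk, rfl⟩
    ⟨x, h₂, y, h₂', f, hε', k, hk', rfl⟩

theorem Eqv.restrict_id {τ k : Tm} (h : Eqv ρ τ τ .fin) (hk : Eqv ρ k k (.K τ)) :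
    Eqv ρ (.restrict τ τ (.idE τ) k) k (.K τ) := by
  obtain ⟨x, h, _⟩ := h.val (a := M.fin Δ) rfl
  obtain ⟨z, hk, _⟩ := hk.val (a := M.K x) ⟨x, h, rfl⟩
  exact .of_val z ⟨x, h, rfl⟩ ⟨x, h, x, h, M.idE x, ⟨x, h, rfl⟩, z, hk, by rw [M.restrict_id]⟩ hk

theorem Eqv.restrict_comp {τ τ' τ'' ε₁ ε₂ k : Tm} (h : Eqv ρ τ τ .fin) (h' : Eqv ρ τ' τ' .fin)
    (h'' : Eqv ρ τ'' τ'' .fin) (h₁ : Eqv ρ ε₁ ε₁ (.extn τ τ')) (h₂ : Eqv ρ ε₂ ε₂ (.extn τ' τ''))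
    (hk : Eqv ρ k k (.K τ'')) :
    Eqv ρ (.restrict τ τ' ε₁ (.restrict τ' τ'' ε₂ k))
      (.restrict τ τ'' (.compE τ τ' τ'' ε₁ ε₂) k) (.K τ) := by
  obtain ⟨x, h, _⟩ := h.val (a := M.fin Δ) rfl
  obtain ⟨y, h', _⟩ := h'.val (a := M.fin Δ) rfl
  obtain ⟨z, h'', _⟩ := h''.val (a := M.fin Δ) rfl
  obtain ⟨f, h₁, _⟩ := h₁.val (a := M.extn x y) ⟨x, h, y, h', rfl⟩
  obtain ⟨g, h₂, _⟩ := h₂.val (a := M.extn y z) ⟨y, h', z, h'', rfl⟩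
  obtain ⟨k, hk, _⟩ := hk.val (a := M.K z) ⟨z, h'', rfl⟩
  exact .of_val (M.restrict f (M.restrict g k)) ⟨x, h, rfl⟩
    ⟨x, h, y, h', f, h₁, _, ⟨y, h', z, h'', g, h₂, k, hk, rfl⟩, rfl⟩
    ⟨x, h, z, h'', _, ⟨x, h, y, h', z, h'', f, h₁, g, h₂, rfl⟩, k, hk, by rw [M.restrict_comp]⟩

end Traces

/-! Logic in a model -/

theorem holds_sub {Γ Δ : C} {P : M.Code .prop Γ} (h : Holds (M := M.toCwFE) P) (σ : Δ ⟶ Γ) :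
    Holds (M := M.toCwFE) (P.sub σ) :=
  h.map fun x => x.sub σ

theorem Entails.mp {Γ Δ : C} {P Q : M.Code .prop Γ} (h : Entails (M := M.toCwFE) P Q) (σ : Δ ⟶ Γ)
    (hP : Holds (M := M.toCwFE) (P.sub σ)) : Holds (M := M.toCwFE) (Q.sub σ) := by
  obtain ⟨r⟩ := hP
  have hr : M.typ r.tm = M.subTy σ (CwFU.Entry.hyp P).ty := r.ty.trans (M.El_sub P σ)
  have := holds_sub h (M.pair σ (.hyp P) ⟨r.tm, hr⟩)
  rwa [← CwF.Code.sub_comp, M.pair_p] at this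

theorem Entails.holds {Γ : C} {P Q : M.Code .prop Γ} (h : Entails (M := M.toCwFE) P Q)
    (hP : Holds (M := M.toCwFE) P) : Holds (M := M.toCwFE) Q := by
  simpa only [CwF.Code.sub_id] using Entails.mp h (𝟙 Γ) (holds_sub hP (𝟙 Γ))

theorem Entails.refl {Γ : C} (P : M.Code .prop Γ) : Entails (M := M.toCwFE) P P :=
  ⟨⟨(M.q (.hyp P)).tm, (M.q (.hyp P)).ty.trans (M.El_sub P _).symm⟩⟩

theorem holds_ex {i : ℕ} {Γ : C} {a : M.Code (.uc i) Γ} {P : M.Code .prop (cons a)} (x : M.Val a)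
    (h : Holds (M := M.toCwFE) (P.sub (at1 x))) : Holds (M := M.toCwFE) (M.ex a P) := by
  simpa only [wk_at1] using
    Entails.mp ((M.ex_entails a P _).1 (Entails.refl (M.ex a P))) (at1 x) h

section Propositions

variable {Δ : C} {ρ : Env M Δ} {i : ℕ} {A A' P P' Q Q' R r s t a : Tm}

theorem Eqv.and (hP : Eqv ρ P P' .prop) (hQ : Eqv ρ Q Q' .prop) :
    Eqv ρ (.and P Q) (.and P' Q') .prop := by
  obtain ⟨X, hP, hP'⟩ := hP.prop
  obtain ⟨Y, hQ, hQ'⟩ := hQ.prop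
  exact .of_prop (M.and X Y) ⟨X, hP, Y, hQ, rfl⟩ ⟨X, hP', Y, hQ', rfl⟩

theorem Eqv.or (hP : Eqv ρ P P' .prop) (hQ : Eqv ρ Q Q' .prop) :
    Eqv ρ (.or P Q) (.or P' Q') .prop := by
  obtain ⟨X, hP, hP'⟩ := hP.prop
  obtain ⟨Y, hQ, hQ'⟩ := hQ.prop
  exact .of_prop (M.or X Y) ⟨X, hP, Y, hQ, rfl⟩ ⟨X, hP', Y, hQ', rfl⟩

theorem Eqv.imp (hP : Eqv ρ P P' .prop) (hQ : Eqv ρ Q Q' .prop) :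
    Eqv ρ (.imp P Q) (.imp P' Q') .prop := by
  obtain ⟨X, hP, hP'⟩ := hP.prop
  obtain ⟨Y, hQ, hQ'⟩ := hQ.prop
  exact .of_prop (M.imp X Y) ⟨X, hP, Y, hQ, rfl⟩ ⟨X, hP', Y, hQ', rfl⟩

theorem Eqv.all (hA : Eqv ρ A A' (.uc i)) (hP : EqvB ρ A P P' .prop) :
    Eqv ρ (.all i A P) (.all i A' P') .prop := by
  obtain ⟨α, hA, hA'⟩ := hA.uc
  obtain ⟨X, hP, hP'⟩ := (hP α hA).prop
  exact .of_prop (M.all α X) ⟨α, hA, X, hP, rfl⟩ ⟨α, hA', X, hP', rfl⟩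

theorem Eqv.ex (hA : Eqv ρ A A' (.uc i)) (hP : EqvB ρ A P P' .prop) :
    Eqv ρ (.ex i A P) (.ex i A' P') .prop := by
  obtain ⟨α, hA, hA'⟩ := hA.uc
  obtain ⟨X, hP, hP'⟩ := (hP α hA).prop
  exact .of_prop (M.ex α X) ⟨α, hA, X, hP, rfl⟩ ⟨α, hA', X, hP', rfl⟩

theorem Eqv.irrel (hP : Eqv ρ P P .prop) (hr : Eqv ρ r r P) (hs : Eqv ρ s s P) : Eqv ρ r s P := by
  obtain ⟨X, hP, _⟩ := hP.prop
  obtain ⟨x, hr, _⟩ := hr.val hP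
  obtain ⟨y, hs, _⟩ := hs.val hP
  exact .of_val x hP hr (by rwa [M.irrel x y])

theorem Eqv.holds {X : M.Code .prop Δ} (h : Eqv ρ r r P) (hP : Ev M P ρ X.tm) :
    Holds (M := M.toCwFE) X :=
  (h.val hP).elim fun x _ => ⟨x⟩

theorem Eqv.proof {X : M.Code .prop Δ} (hP : Ev M P ρ X.tm) (h : Holds (M := M.toCwFE) X)
    (hr : ∀ v, Proves X v → Ev M r ρ v) : Eqv ρ r r P :=
  h.elim fun x => .of_val x hP (hr _ x.ty) (hr _ x.ty)

/-- The proof `s` is typed by `Q` under the assumption of `P`. -/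
def EqvH (ρ : Env M Δ) (P s Q : Tm) : Prop :=
  ∀ X : M.Code .prop Δ, Ev M P ρ X.tm → Eqv (ρ.under (.hyp X)) s s Q

theorem EqvH.entails (h : EqvH ρ P s Q.wk) {X Y : M.Code .prop Δ} (hP : Ev M P ρ X.tm)
    (hQ : Ev M Q ρ Y.tm) : Entails (M := M.toCwFE) X Y :=
  (h X hP).holds (X := Y.sub (M.p _)) (hQ.wk _)

theorem Eqv.topI : Eqv ρ .topI .topI .top :=
  .proof (X := M.top Δ) rfl (M.holds_top Δ) fun _ h => h

theorem Eqv.botE (hP : Eqv ρ P P .prop) (hr : Eqv ρ r r .bot) : Eqv ρ (.botE P r) (.botE P r) P := by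
  obtain ⟨X, hP, _⟩ := hP.prop
  exact .proof hP (Entails.holds (M.bot_entails X) (hr.holds rfl)) fun _ h => ⟨X, hP, h⟩

theorem Eqv.andI (hP : Eqv ρ P P .prop) (hQ : Eqv ρ Q Q .prop) (hr : Eqv ρ r r P)
    (hs : Eqv ρ s s Q) : Eqv ρ (.andI P Q r s) (.andI P Q r s) (.and P Q) := by
  obtain ⟨X, hP, _⟩ := hP.prop
  obtain ⟨Y, hQ, _⟩ := hQ.prop
  exact .proof (X := M.and X Y) ⟨X, hP, Y, hQ, rfl⟩
    ((M.holds_and X Y).2 ⟨hr.holds hP, hs.holds hQ⟩) fun _ h => ⟨X, hP, Y, hQ, h⟩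

theorem Eqv.andE₁ (hP : Eqv ρ P P .prop) (hQ : Eqv ρ Q Q .prop) (hr : Eqv ρ r r (.and P Q)) :
    Eqv ρ (.andE₁ P Q r) (.andE₁ P Q r) P := by
  obtain ⟨X, hP, _⟩ := hP.prop
  obtain ⟨Y, hQ, _⟩ := hQ.prop
  exact .proof hP ((M.holds_and X Y).1 (hr.holds ⟨X, hP, Y, hQ, rfl⟩)).1 fun _ h => ⟨X, hP, h⟩

theorem Eqv.andE₂ (hP : Eqv ρ P P .prop) (hQ : Eqv ρ Q Q .prop) (hr : Eqv ρ r r (.and P Q)) :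
    Eqv ρ (.andE₂ P Q r) (.andE₂ P Q r) Q := by
  obtain ⟨X, hP, _⟩ := hP.prop
  obtain ⟨Y, hQ, _⟩ := hQ.prop
  exact .proof hQ ((M.holds_and X Y).1 (hr.holds ⟨X, hP, Y, hQ, rfl⟩)).2 fun _ h => ⟨Y, hQ, h⟩

theorem Eqv.orI₁ (hP : Eqv ρ P P .prop) (hQ : Eqv ρ Q Q .prop) (hr : Eqv ρ r r P) :
    Eqv ρ (.orI₁ P Q r) (.orI₁ P Q r) (.or P Q) := by
  obtain ⟨X, hP, _⟩ := hP.prop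
  obtain ⟨Y, hQ, _⟩ := hQ.prop
  exact .proof (X := M.or X Y) ⟨X, hP, Y, hQ, rfl⟩
    (Entails.holds ((M.or_entails X Y _).1 (Entails.refl _)).1 (hr.holds hP))
    fun _ h => ⟨X, hP, Y, hQ, h⟩

theorem Eqv.orI₂ (hP : Eqv ρ P P .prop) (hQ : Eqv ρ Q Q .prop) (hr : Eqv ρ r r Q) :
    Eqv ρ (.orI₂ P Q r) (.orI₂ P Q r) (.or P Q) := by
  obtain ⟨X, hP, _⟩ := hP.prop
  obtain ⟨Y, hQ, _⟩ := hQ.prop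
  exact .proof (X := M.or X Y) ⟨X, hP, Y, hQ, rfl⟩
    (Entails.holds ((M.or_entails X Y _).1 (Entails.refl _)).2 (hr.holds hQ))
    fun _ h => ⟨X, hP, Y, hQ, h⟩

theorem Eqv.orE (hP : Eqv ρ P P .prop) (hQ : Eqv ρ Q Q .prop) (hR : Eqv ρ R R .prop)
    (hr : Eqv ρ r r (.or P Q)) (hs : EqvH ρ P s R.wk) (ht : EqvH ρ Q t R.wk) :
    Eqv ρ (.orE P Q R r s t) (.orE P Q R r s t) R := by
  obtain ⟨X, hP, _⟩ := hP.prop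
  obtain ⟨Y, hQ, _⟩ := hQ.prop
  obtain ⟨Z, hR, _⟩ := hR.prop
  exact .proof hR (Entails.holds ((M.or_entails X Y Z).2 ⟨hs.entails hP hR, ht.entails hQ hR⟩)
    (hr.holds ⟨X, hP, Y, hQ, rfl⟩)) fun _ h => ⟨Z, hR, h⟩

theorem Eqv.impI (hP : Eqv ρ P P .prop) (hQ : Eqv ρ Q Q .prop) (hr : EqvH ρ P r Q.wk) :
    Eqv ρ (.impI P Q r) (.impI P Q r) (.imp P Q) := by
  obtain ⟨X, hP, _⟩ := hP.prop
  obtain ⟨Y, hQ, _⟩ := hQ.prop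
  exact .proof (X := M.imp X Y) ⟨X, hP, Y, hQ, rfl⟩ ((M.holds_imp X Y).2 (hr.entails hP hQ))
    fun _ h => ⟨X, hP, Y, hQ, h⟩

theorem Eqv.impE (hP : Eqv ρ P P .prop) (hQ : Eqv ρ Q Q .prop) (hr : Eqv ρ r r (.imp P Q))
    (hs : Eqv ρ s s P) : Eqv ρ (.impE P Q r s) (.impE P Q r s) Q := by
  obtain ⟨X, hP, _⟩ := hP.prop
  obtain ⟨Y, hQ, _⟩ := hQ.prop
  exact .proof hQ (Entails.holds ((M.holds_imp X Y).1 (hr.holds ⟨X, hP, Y, hQ, rfl⟩))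
    (hs.holds hP)) fun _ h => ⟨Y, hQ, h⟩

theorem Eqv.allI (hA : Eqv ρ A A (.uc i)) (hP : EqvB ρ A P P .prop) (hr : EqvB ρ A r r P) :
    Eqv ρ (.allI i A P r) (.allI i A P r) (.all i A P) := by
  obtain ⟨α, hA, _⟩ := hA.uc
  obtain ⟨X, hP, _⟩ := (hP α hA).prop
  exact .proof (X := M.all α X) ⟨α, hA, X, hP, rfl⟩
    ((M.holds_all α X).2 ((hr α hA).holds hP)) fun _ h => ⟨α, hA, X, hP, h⟩

theorem Ev.inst_env {α : M.Code (.uc i) Δ} {v : M.Tm (cons α)} (h : Ev M t (ρ.bind α) v)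
    (x : M.Val α) : Ev M t (x.tm :: ρ) (M.subTm (at1 x) v) := by
  simpa only [Env.bind_at1] using h.map t (at1 x)

theorem Eqv.allE (hA : Eqv ρ A A (.uc i)) (hP : EqvB ρ A P P .prop) (hr : Eqv ρ r r (.all i A P))
    (ha : Eqv ρ a a A) : Eqv ρ (.allE i A P r a) (.allE i A P r a) (.sub P (.inst a)) := by
  obtain ⟨α, hA, _⟩ := hA.uc
  obtain ⟨X, hP, _⟩ := (hP α hA).prop
  obtain ⟨x, ha, _⟩ := ha.val hA
  exact .proof (X := X.sub (at1 x)) (hP.inst x ha)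
    (holds_sub ((M.holds_all α X).1 (hr.holds ⟨α, hA, X, hP, rfl⟩)) _)
    fun _ h => ⟨_, ha, X.sub (at1 x), hP.inst_env x, h⟩

theorem Eqv.exI (hA : Eqv ρ A A (.uc i)) (hP : EqvB ρ A P P .prop) (ha : Eqv ρ a a A)
    (hr : Eqv ρ r r (.sub P (.inst a))) :
    Eqv ρ (.exI i A P a r) (.exI i A P a r) (.ex i A P) := by
  obtain ⟨α, hA, _⟩ := hA.uc
  obtain ⟨X, hP, _⟩ := (hP α hA).prop
  obtain ⟨x, ha, _⟩ := ha.val hA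
  exact .proof (X := M.ex α X) ⟨α, hA, X, hP, rfl⟩
    (holds_ex x (hr.holds (X := X.sub (at1 x)) (hP.inst x ha))) fun _ h => ⟨α, hA, X, hP, h⟩

theorem Eqv.exE (hA : Eqv ρ A A (.uc i)) (hP : EqvB ρ A P P .prop) (hR : Eqv ρ R R .prop)
    (hr : Eqv ρ r r (.ex i A P))
    (hs : ∀ α : M.Code (.uc i) Δ, Ev M A ρ α.tm → EqvH (ρ.bind α) P s R.wk.wk) :
    Eqv ρ (.exE i A P R r s) (.exE i A P R r s) R := by
  obtain ⟨α, hA, _⟩ := hA.uc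
  obtain ⟨X, hP, _⟩ := (hP α hA).prop
  obtain ⟨Y, hR, _⟩ := hR.prop
  exact .proof hR (Entails.holds ((M.ex_entails α X Y).2 ((hs α hA).entails hP (hR.wk _)))
    (hr.holds ⟨α, hA, X, hP, rfl⟩)) fun _ h => ⟨Y, hR, h⟩

end Propositions

/-- `σ` and `σ'` have the same value in `ρ`, which satisfies `Γ`. -/
def SbEqv {Δ : C} (ρ : Env M Δ) (σ σ' : Sb) (Γ : Ctx) : Prop :=
  ∃ ρ', EvS M σ ρ ρ' ∧ EvS M σ' ρ ρ' ∧ Sat Γ ρ'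

variable (M) in
/-- Validity of a judgement in a model. -/
def Sound : Judg → Prop
  | .ctx [] => True
  | .ctx (A :: Γ) => ∀ ⦃Δ : C⦄ ⦃ρ : Env M Δ⦄, Sat Γ ρ → ∃ (s : Srt) (a : M.Code s Δ), Ev M A ρ a.tm
  | .tm Γ t A => ∀ ⦃Δ : C⦄ ⦃ρ : Env M Δ⦄, Sat Γ ρ → Eqv ρ t t A
  | .eq Γ t t' A => ∀ ⦃Δ : C⦄ ⦃ρ : Env M Δ⦄, Sat Γ ρ → Eqv ρ t t' A
  | .sb Δ σ Γ => ∀ ⦃D : C⦄ ⦃ρ : Env M D⦄, Sat Δ ρ → SbEqv ρ σ σ Γ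
  | .sbEq Δ σ σ' Γ => ∀ ⦃D : C⦄ ⦃ρ : Env M D⦄, Sat Δ ρ → SbEqv ρ σ σ' Γ

section FixedPoints

variable {Γ : Ctx} {Δ : C} {ρ : Env M Δ} {φ φ' m : Tm}

theorem ev_inst_prop {X : M.Code .prop (M.consProp Δ)} (hφ : Ev M φ (ρ.under .pvar) X.tm)
    (P : M.Code .prop Δ) :
    Ev M φ (P.tm :: ρ) (X.sub (snocProp (M := M.toCwFE) (𝟙 Δ) P)).tm := by
  have h := hφ.map φ (snocProp (M := M.toCwFE) (𝟙 Δ) P)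
  rwa [Env.under_snocProp, Env.sub_id] at h

/-- A monotonicity proof of the system makes the value of the formula monotone. -/
theorem monotone_of_proof (hρ : Sat Γ ρ) {X : M.Code .prop (M.consProp Δ)}
    (hφ : Ev M φ (ρ.under .pvar) X.tm)
    (hm : Sound M (.tm (monoCtx Γ) m (monoGoal φ))) :
    CwFProp.Monotone (M := M.toCwFProp) X := by
  intro Θ σ P Q ⟨r⟩
  have h1 : Sat (.prop :: Γ) (P.tm :: ρ.sub σ) :=
    (hρ.map σ).cons (A := .prop) (a := M.univ .prop Θ) rfl
      ⟨P.tm, P.ty.trans (M.El_univ .prop Θ).symm⟩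
  have h2 : Sat (.prop :: .prop :: Γ) (Q.tm :: P.tm :: ρ.sub σ) :=
    h1.cons (A := .prop) (a := M.univ .prop Θ) rfl
      ⟨Q.tm, Q.ty.trans (M.El_univ .prop Θ).symm⟩
  have h3 : Sat (monoCtx Γ) (r.tm :: Q.tm :: P.tm :: ρ.sub σ) :=
    h2.cons (A := .imp Tm.q.wk .q) (a := M.imp P Q) ⟨P, ⟨_, ⟨_, rfl⟩, _, rfl⟩, Q, ⟨_, rfl⟩, rfl⟩ r
  have key : ∀ Z : M.Code .prop Θ, Ev M φ (Z.tm :: ρ.sub σ) (X.sub (snocProp σ Z)).tm := by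
    intro Z
    have h := hφ.map φ (snocProp (M := M.toCwFE) σ Z)
    rwa [Env.under_snocProp] at h
  have hσ : EvS M (.comp .p (.comp .p .p)) (r.tm :: Q.tm :: P.tm :: ρ.sub σ) (ρ.sub σ) :=
    ⟨_, ⟨_, ⟨_, rfl⟩, _, rfl⟩, _, rfl⟩
  exact (hm h3).holds ⟨_, ⟨_, ⟨_, hσ, P.tm, ⟨_, ⟨_, rfl⟩, _, ⟨_, rfl⟩, _, rfl⟩, rfl⟩, key P⟩, _,
    ⟨_, ⟨_, hσ, Q.tm, ⟨_, ⟨_, rfl⟩, _, rfl⟩, rfl⟩, key Q⟩, rfl⟩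

theorem Eqv.monotone (hρ : Sat Γ ρ) (hφ : Eqv (ρ.under .pvar) φ φ' .prop)
    (hm : Sound M (.tm (monoCtx Γ) m (monoGoal φ))) :
    ∃ X : M.Code .prop (M.consProp Δ), Ev M φ (ρ.under .pvar) X.tm ∧
      Ev M φ' (ρ.under .pvar) X.tm ∧ CwFProp.Monotone (M := M.toCwFProp) X := by
  obtain ⟨X, h, h'⟩ := hφ.prop
  exact ⟨X, h, h', monotone_of_proof hρ h hm⟩

theorem Eqv.mu (hρ : Sat Γ ρ) (hφ : Eqv (ρ.under .pvar) φ φ' .prop)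
    (hm : Sound M (.tm (monoCtx Γ) m (monoGoal φ))) : Eqv ρ (.mu φ) (.mu φ') .prop := by
  obtain ⟨X, h, h', mono⟩ := hφ.monotone hρ hm
  exact .of_prop (M.mu X mono) ⟨X, h, mono, rfl⟩ ⟨X, h', mono, rfl⟩

theorem Eqv.nu (hρ : Sat Γ ρ) (hφ : Eqv (ρ.under .pvar) φ φ' .prop)
    (hm : Sound M (.tm (monoCtx Γ) m (monoGoal φ))) : Eqv ρ (.nu φ) (.nu φ') .prop := by
  obtain ⟨X, h, h', mono⟩ := hφ.monotone hρ hm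
  exact .of_prop (M.nu X mono) ⟨X, h, mono, rfl⟩ ⟨X, h', mono, rfl⟩

theorem ev_inst_mu {X : M.Code .prop (M.consProp Δ)} (h : Ev M φ (ρ.under .pvar) X.tm)
    (mono : CwFProp.Monotone (M := M.toCwFProp) X) :
    Ev M (.sub φ (.inst (.mu φ))) ρ (X.sub (snocProp (M := M.toCwFE) (𝟙 Δ) (M.mu X mono))).tm :=
  ⟨_, evS_inst ⟨X, h, mono, rfl⟩, ev_inst_prop h _⟩

theorem ev_inst_nu {X : M.Code .prop (M.consProp Δ)} (h : Ev M φ (ρ.under .pvar) X.tm)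
    (mono : CwFProp.Monotone (M := M.toCwFProp) X) :
    Ev M (.sub φ (.inst (.nu φ))) ρ (X.sub (snocProp (M := M.toCwFE) (𝟙 Δ) (M.nu X mono))).tm :=
  ⟨_, evS_inst ⟨X, h, mono, rfl⟩, ev_inst_prop h _⟩

theorem Eqv.fold (hρ : Sat Γ ρ) (hφ : Eqv (ρ.under .pvar) φ φ .prop)
    (hm : Sound M (.tm (monoCtx Γ) m (monoGoal φ))) :
    Eqv ρ (.fold φ) (.fold φ) (.imp (.sub φ (.inst (.mu φ))) (.mu φ)) := by
  obtain ⟨X, h, _, mono⟩ := hφ.monotone hρ hm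
  exact .proof (X := M.imp _ (M.mu X mono)) ⟨_, ev_inst_mu h mono, _, ⟨X, h, mono, rfl⟩, rfl⟩
    (M.fold X mono) fun _ k => ⟨X, h, mono, k⟩

theorem Eqv.unfold (hρ : Sat Γ ρ) (hφ : Eqv (ρ.under .pvar) φ φ .prop)
    (hm : Sound M (.tm (monoCtx Γ) m (monoGoal φ))) :
    Eqv ρ (.unfold φ) (.unfold φ) (.imp (.mu φ) (.sub φ (.inst (.mu φ)))) := by
  obtain ⟨X, h, _, mono⟩ := hφ.monotone hρ hm
  exact .proof (X := M.imp (M.mu X mono) _) ⟨_, ⟨X, h, mono, rfl⟩, _, ev_inst_mu h mono, rfl⟩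
    (M.unfold X mono) fun _ k => ⟨X, h, mono, k⟩

theorem Eqv.out (hρ : Sat Γ ρ) (hφ : Eqv (ρ.under .pvar) φ φ .prop)
    (hm : Sound M (.tm (monoCtx Γ) m (monoGoal φ))) :
    Eqv ρ (.out φ) (.out φ) (.imp (.nu φ) (.sub φ (.inst (.nu φ)))) := by
  obtain ⟨X, h, _, mono⟩ := hφ.monotone hρ hm
  exact .proof (X := M.imp (M.nu X mono) _) ⟨_, ⟨X, h, mono, rfl⟩, _, ev_inst_nu h mono, rfl⟩
    (M.out X mono) fun _ k => ⟨X, h, mono, k⟩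

theorem Eqv.into (hρ : Sat Γ ρ) (hφ : Eqv (ρ.under .pvar) φ φ .prop)
    (hm : Sound M (.tm (monoCtx Γ) m (monoGoal φ))) :
    Eqv ρ (.into φ) (.into φ) (.imp (.sub φ (.inst (.nu φ))) (.nu φ)) := by
  obtain ⟨X, h, _, mono⟩ := hφ.monotone hρ hm
  exact .proof (X := M.imp _ (M.nu X mono)) ⟨_, ev_inst_nu h mono, _, ⟨X, h, mono, rfl⟩, rfl⟩
    (M.into X mono) fun _ k => ⟨X, h, mono, k⟩

end FixedPoints

end Sem

namespace Sem

open CwFE CwFPi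

variable {C : Type u} [Category.{v} C] {M : Model.{u, v, w} C}

section Substitutions

variable {Δ : C} {ρ : Env M Δ} {Γ Θ Ξ : Ctx} {σ σ' σ'' δ δ' γ : Sb} {A t t' : Tm}

theorem SbEqv.symm (h : SbEqv ρ σ σ' Γ) : SbEqv ρ σ' σ Γ :=
  let ⟨ρ', h, h', hρ⟩ := h
  ⟨ρ', h', h, hρ⟩

theorem SbEqv.trans (h : SbEqv ρ σ σ' Γ) (k : SbEqv ρ σ' σ'' Γ) : SbEqv ρ σ σ'' Γ :=
  let ⟨ρ', h, h', hρ⟩ := h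
  let ⟨_, k, k', _⟩ := k
  ⟨ρ', h, by rwa [h'.unique _ k], hρ⟩

theorem SbEqv.comp (h : SbEqv ρ δ δ' Θ) (k : Sound M (.sbEq Θ σ σ' Γ)) :
    SbEqv ρ (.comp σ δ) (.comp σ' δ') Γ :=
  let ⟨_, h, h', hρ⟩ := h
  let ⟨ρ', k, k', hρ'⟩ := k hρ
  ⟨ρ', ⟨_, h, k⟩, ⟨_, h', k'⟩, hρ'⟩

theorem SbEqv.assoc (h : SbEqv ρ γ γ Ξ) (k : Sound M (.sb Ξ δ Θ)) (l : Sound M (.sb Θ σ Γ)) :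
    SbEqv ρ (.comp (.comp σ δ) γ) (.comp σ (.comp δ γ)) Γ :=
  let ⟨_, h, _, hρ⟩ := h
  let ⟨_, k, _, hρ'⟩ := k hρ
  let ⟨ρ', l, _, hρ'⟩ := l hρ'
  ⟨ρ', ⟨_, h, _, k, l⟩, ⟨_, ⟨_, h, k⟩, l⟩, hρ'⟩

theorem Eqv.ext {ρ' : Env M Δ} (h : Eqv ρ t t' (.sub A σ)) (hσ : EvS M σ ρ ρ') (hρ : Sat Γ ρ')
    (hA : Sound M (.ctx (A :: Γ))) :
    ∃ (s : Srt) (a : M.Code s Δ) (x : M.Val a), Ev M A ρ' a.tm ∧ Ev M t ρ x.tm ∧ Ev M t' ρ x.tm :=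
  let ⟨s, a, hA⟩ := hA hρ
  let ⟨x, h⟩ := h.val ⟨ρ', hσ, hA⟩
  ⟨s, a, x, hA, h⟩

theorem SbEqv.ext (h : SbEqv ρ σ σ' Γ) (hA : Sound M (.ctx (A :: Γ)))
    (ht : Eqv ρ t t' (.sub A σ)) : SbEqv ρ (.ext σ t) (.ext σ' t') (A :: Γ) :=
  let ⟨_, h, h', hρ⟩ := h
  let ⟨_, _, x, hA, ht, ht'⟩ := ht.ext h hρ hA
  ⟨_, ⟨_, h, _, ht, rfl⟩, ⟨_, h', _, ht', rfl⟩, hρ.cons hA x⟩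

theorem SbEqv.p_ext (h : SbEqv ρ σ σ Γ) (hA : Sound M (.ctx (A :: Γ)))
    (ht : Eqv ρ t t (.sub A σ)) : SbEqv ρ (.comp .p (.ext σ t)) σ Γ :=
  let ⟨ρ', h, _, hρ⟩ := h
  let ⟨_, _, _, _, ht, _⟩ := ht.ext h hρ hA
  ⟨ρ', ⟨_, ⟨_, h, _, ht, rfl⟩, _, rfl⟩, h, hρ⟩

theorem SbEqv.eta (h : SbEqv ρ σ σ (A :: Γ)) :
    SbEqv ρ (.ext (.comp .p σ) (.sub .q σ)) σ (A :: Γ) := by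
  obtain ⟨_, h, _, v, ρ', rfl, hρ⟩ := h
  exact ⟨_, ⟨_, ⟨_, h, _, rfl⟩, _, ⟨_, h, _, rfl⟩, rfl⟩, h, v, ρ', rfl, hρ⟩

theorem Eqv.q_ext (h : SbEqv ρ σ σ Γ) (hA : Sound M (.ctx (A :: Γ)))
    (ht : Eqv ρ t t (.sub A σ)) : Eqv ρ (.sub .q (.ext σ t)) t (.sub A σ) :=
  let ⟨_, h, _, hρ⟩ := h
  let ⟨_, _, x, hA, ht, _⟩ := ht.ext h hρ hA
  .of_val x ⟨_, h, hA⟩ ⟨_, ⟨_, h, _, ht, rfl⟩, _, rfl⟩ ht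

theorem Eqv.q (h : Sat (A :: Γ) ρ) : Eqv ρ .q .q A.wk := by
  obtain ⟨v, ρ', rfl, _, s, a, hA, hv⟩ := h
  exact .of_val (a := a) ⟨v, hv⟩ ⟨ρ', ⟨v, rfl⟩, hA⟩ ⟨ρ', rfl⟩ ⟨ρ', rfl⟩

end Substitutions

variable (M) in
/-- Derivable judgements are valid in every model. -/
theorem sound {j : Judg} (h : Der j) : Sound M j := by
  induction h with
  | ctx_nil => exact trivial
  | ctx_comp _ _ _ ih₂ => exact fun _ _ hρ => (ih₂ hρ).uc.elim fun a h => ⟨_, a, h.1⟩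
  | ctx_pvar => exact fun Δ _ _ => ⟨_, M.univ .prop Δ, rfl⟩
  | ctx_hyp _ _ _ ih₂ => exact fun _ _ hρ => (ih₂ hρ).prop.elim fun a h => ⟨_, a, h.1⟩
  | sb_id => exact fun _ ρ hρ => ⟨ρ, rfl, rfl, hρ⟩
  | sb_comp _ _ ih₁ ih₂ => exact fun _ _ hρ => .comp (ih₂ hρ) @ih₁
  | sb_p => exact fun _ _ ⟨_, _, e, hρ, _⟩ => ⟨_, ⟨_, e⟩, ⟨_, e⟩, hρ⟩
  | sb_ext _ _ _ ih₁ ih₂ ih₃ => exact fun _ _ hρ => .ext (ih₁ hρ) ih₂ (ih₃ hρ)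
  | sb_bang => exact fun _ _ _ => ⟨_, rfl, rfl, rfl⟩
  | sbEq_refl _ ih₁ => exact ih₁
  | sbEq_symm _ ih₁ => exact fun _ _ hρ => (ih₁ hρ).symm
  | sbEq_trans _ _ ih₁ ih₂ => exact fun _ _ hρ => (ih₁ hρ).trans (ih₂ hρ)
  | sbEq_comp _ _ ih₁ ih₂ => exact fun _ _ hρ => .comp (ih₂ hρ) @ih₁
  | sbEq_ext _ _ _ ih₁ ih₂ ih₃ => exact fun _ _ hρ => .ext (ih₁ hρ) ih₂ (ih₃ hρ)
  | sbEq_id_comp _ ih₁ => exact fun _ _ hρ => (ih₁ hρ).elim fun ρ' h => ⟨ρ', ⟨ρ', h.1, rfl⟩, h.1, h.2.2⟩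
  | sbEq_comp_id _ ih₁ => exact fun _ ρ hρ => (ih₁ hρ).elim fun ρ' h => ⟨ρ', ⟨ρ, rfl, h.1⟩, h.2⟩
  | sbEq_assoc _ _ _ ih₁ ih₂ ih₃ => exact fun _ _ hρ => .assoc (ih₃ hρ) @ih₂ @ih₁
  | sbEq_bang _ ih₁ => exact fun _ _ hρ => (ih₁ hρ).elim fun ρ' h => ⟨ρ', h.1, h.2.2, h.2.2⟩
  | sbEq_p _ _ _ ih₁ ih₂ ih₃ => exact fun _ _ hρ => .p_ext (ih₁ hρ) ih₂ (ih₃ hρ)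
  | sbEq_eta _ _ _ ih₂ => exact fun _ _ hρ => .eta (ih₂ hρ)
  | q => exact fun _ _ hρ => .q hρ
  | sub _ _ ih₁ ih₂ => exact fun _ _ hρ => (ih₂ hρ).elim fun _ h => .sub h.1 h.1 (ih₁ h.2.2)
  | conv _ _ ih₁ ih₂ => exact fun _ _ hρ => (ih₁ hρ).conv (ih₂ hρ)
  | eq_refl _ ih₁ => exact ih₁
  | eq_symm _ ih₁ => exact fun _ _ hρ => (ih₁ hρ).symm
  | eq_trans _ _ ih₁ ih₂ => exact fun _ _ hρ => (ih₁ hρ).trans (ih₂ hρ)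
  | eq_conv _ _ ih₁ ih₂ => exact fun _ _ hρ => (ih₁ hρ).conv (ih₂ hρ)
  | eq_sub _ _ ih₁ ih₂ => exact fun _ _ hρ => (ih₂ hρ).elim fun _ h => .sub h.1 h.2.1 (ih₁ h.2.2)
  | eq_sub_id _ ih₁ => exact fun _ _ hρ => (ih₁ hρ).sub_id
  | eq_q _ _ _ ih₁ ih₂ ih₃ => exact fun _ _ hρ => .q_ext (ih₁ hρ) ih₂ (ih₃ hρ)
  | eq_sort _ ih₁ => exact fun _ _ hρ => (ih₁ hρ).elim fun _ h => .sort_sub _ h.1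
  | eq_push _ _ ih₁ ih₂ => exact fun _ _ hρ => (ih₂ hρ).elim fun _ h => .push h.1 (ih₁ h.2.2)
  | uc => exact fun Δ _ _ => .of_uc (M.univ (.uc _) Δ) rfl rfl
  | tyL => exact fun _ _ _ => .inl ⟨trivial, .inl ⟨trivial, trivial⟩⟩
  | prop => exact fun Δ _ _ => .of_tyL (M.univ .prop Δ) rfl rfl
  | incl _ ih₁ => exact fun _ _ hρ => (ih₁ hρ).incl
  | eq_incl _ ih₁ => exact fun _ _ hρ => (ih₁ hρ).incl
  | pi _ _ ih₁ ih₂ => exact fun _ _ hρ => .pi (ih₁ hρ) (fun _ _ ha => ih₂ (hρ.bind ha))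
  | lam _ _ _ ih₁ ih₂ ih₃ =>
    exact fun _ _ hρ => .lam (ih₁ hρ) (fun _ _ ha => ih₂ (hρ.bind ha))
      (fun _ _ ha => ih₃ (hρ.bind ha))
  | app _ _ _ _ ih₁ ih₂ ih₃ ih₄ =>
    exact fun _ _ hρ => .app (ih₁ hρ) (fun _ _ ha => ih₂ (hρ.bind ha)) (ih₃ hρ) (ih₄ hρ)
  | eq_pi _ _ ih₁ ih₂ => exact fun _ _ hρ => .pi (ih₁ hρ) (fun _ _ ha => ih₂ (hρ.bind ha))
  | eq_lam _ _ _ ih₁ ih₂ ih₃ =>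
    exact fun _ _ hρ => .lam (ih₁ hρ) (fun _ _ ha => ih₂ (hρ.bind ha))
      (fun _ _ ha => ih₃ (hρ.bind ha))
  | eq_app _ _ _ _ ih₁ ih₂ ih₃ ih₄ =>
    exact fun _ _ hρ => .app (ih₁ hρ) (fun _ _ ha => ih₂ (hρ.bind ha)) (ih₃ hρ) (ih₄ hρ)
  | pi_beta _ _ _ _ ih₁ ih₂ ih₃ ih₄ =>
    exact fun _ _ hρ => .pi_beta (ih₁ hρ) (fun _ _ ha => ih₂ (hρ.bind ha))
      (fun _ _ ha => ih₃ (hρ.bind ha)) (ih₄ hρ)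
  | pi_eta _ _ _ ih₁ ih₂ ih₃ =>
    exact fun _ _ hρ => .pi_eta (ih₁ hρ) (fun _ _ ha => ih₂ (hρ.bind ha)) (ih₃ hρ)
  | sig _ _ ih₁ ih₂ => exact fun _ _ hρ => .sig (ih₁ hρ) (fun _ _ ha => ih₂ (hρ.bind ha))
  | pair _ _ _ _ ih₁ ih₂ ih₃ ih₄ =>
    exact fun _ _ hρ => .pair (ih₁ hρ) (fun _ _ ha => ih₂ (hρ.bind ha)) (ih₃ hρ) (ih₄ hρ)
  | fst _ _ _ ih₁ ih₂ ih₃ =>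
    exact fun _ _ hρ => .fst (ih₁ hρ) (fun _ _ ha => ih₂ (hρ.bind ha)) (ih₃ hρ)
  | snd _ _ _ ih₁ ih₂ ih₃ =>
    exact fun _ _ hρ => .snd (ih₁ hρ) (fun _ _ ha => ih₂ (hρ.bind ha)) (ih₃ hρ)
  | eq_sig _ _ ih₁ ih₂ => exact fun _ _ hρ => .sig (ih₁ hρ) (fun _ _ ha => ih₂ (hρ.bind ha))
  | eq_pair _ _ _ _ ih₁ ih₂ ih₃ ih₄ =>
    exact fun _ _ hρ => .pair (ih₁ hρ) (fun _ _ ha => ih₂ (hρ.bind ha)) (ih₃ hρ) (ih₄ hρ)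
  | eq_fst _ _ _ ih₁ ih₂ ih₃ =>
    exact fun _ _ hρ => .fst (ih₁ hρ) (fun _ _ ha => ih₂ (hρ.bind ha)) (ih₃ hρ)
  | eq_snd _ _ _ ih₁ ih₂ ih₃ =>
    exact fun _ _ hρ => .snd (ih₁ hρ) (fun _ _ ha => ih₂ (hρ.bind ha)) (ih₃ hρ)
  | fst_beta _ _ _ _ ih₁ ih₂ ih₃ ih₄ =>
    exact fun _ _ hρ => .fst_beta (ih₁ hρ) (fun _ _ ha => ih₂ (hρ.bind ha)) (ih₃ hρ) (ih₄ hρ)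
  | snd_beta _ _ _ _ ih₁ ih₂ ih₃ ih₄ =>
    exact fun _ _ hρ => .snd_beta (ih₁ hρ) (fun _ _ ha => ih₂ (hρ.bind ha)) (ih₃ hρ) (ih₄ hρ)
  | sig_eta _ _ _ ih₁ ih₂ ih₃ =>
    exact fun _ _ hρ => .sig_eta (ih₁ hρ) (fun _ _ ha => ih₂ (hρ.bind ha)) (ih₃ hρ)
  | idt _ _ _ ih₁ ih₂ ih₃ => exact fun _ _ hρ => .idt (ih₁ hρ) (ih₂ hρ) (ih₃ hρ)
  | refl _ _ ih₁ ih₂ => exact fun _ _ hρ => .refl (ih₁ hρ) (ih₂ hρ)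
  | J _ _ _ _ _ _ ih₁ ih₂ ih₃ ih₄ ih₅ ih₆ =>
    exact fun _ _ hρ => .J (ih₁ hρ) (fun _ ha => ih₂ (hρ.bind₃ ha))
      (fun _ _ ha => ih₃ (hρ.bind ha)) (ih₄ hρ) (ih₅ hρ) (ih₆ hρ)
  | eq_idt _ _ _ ih₁ ih₂ ih₃ => exact fun _ _ hρ => .idt (ih₁ hρ) (ih₂ hρ) (ih₃ hρ)
  | eq_refl_tm _ _ ih₁ ih₂ => exact fun _ _ hρ => .refl (ih₁ hρ) (ih₂ hρ)
  | eq_J _ _ _ _ _ _ ih₁ ih₂ ih₃ ih₄ ih₅ ih₆ =>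
    exact fun _ _ hρ => .J (ih₁ hρ) (fun _ ha => ih₂ (hρ.bind₃ ha))
      (fun _ _ ha => ih₃ (hρ.bind ha)) (ih₄ hρ) (ih₅ hρ) (ih₆ hρ)
  | J_beta _ _ _ _ ih₁ ih₂ ih₃ ih₄ =>
    exact fun _ _ hρ => .J_beta (ih₁ hρ) (fun _ ha => ih₂ (hρ.bind₃ ha))
      (fun _ _ ha => ih₃ (hρ.bind ha)) (ih₄ hρ)
  | state => exact fun Δ _ _ => .of_uc (M.state Δ) rfl rfl
  | event => exact fun Δ _ _ => .of_uc (M.event Δ) rfl rfl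
  | nat => exact fun Δ _ _ => .of_uc (M.nat Δ) rfl rfl
  | trans _ _ _ ih₁ ih₂ ih₃ => exact fun _ _ hρ => .trans_tm (ih₁ hρ) (ih₂ hρ) (ih₃ hρ)
  | eq_trans_tm _ _ _ ih₁ ih₂ ih₃ => exact fun _ _ hρ => .trans_tm (ih₁ hρ) (ih₂ hρ) (ih₃ hρ)
  | fin => exact fun Δ _ _ => .of_uc (M.fin Δ) rfl rfl
  | nil _ ih₁ => exact fun _ _ hρ => .nil (ih₁ hρ)
  | step _ _ _ ih₁ ih₂ ih₃ => exact fun _ _ hρ => .step (ih₁ hρ) (ih₂ hρ) (ih₃ hρ)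
  | eq_nil _ ih₁ => exact fun _ _ hρ => .nil (ih₁ hρ)
  | eq_step _ _ _ ih₁ ih₂ ih₃ => exact fun _ _ hρ => .step (ih₁ hρ) (ih₂ hρ) (ih₃ hρ)
  | inf => exact fun Δ _ _ => .of_uc (M.inf Δ) rfl rfl
  | head _ ih₁ => exact fun _ _ hρ => .head (ih₁ hρ)
  | tail _ ih₁ => exact fun _ _ hρ => .tail (ih₁ hρ)
  | corec _ _ _ _ _ ih₁ ih₂ ih₃ ih₄ ih₅ =>
    exact fun _ _ hρ => .corec (ih₁ hρ) (fun _ _ ha => ih₂ (hρ.bind ha))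
      (fun _ _ ha => ih₃ (hρ.bind ha)) (fun _ _ ha => ih₄ (hρ.bind ha)) (ih₅ hρ)
  | eq_head _ ih₁ => exact fun _ _ hρ => .head (ih₁ hρ)
  | eq_tail _ ih₁ => exact fun _ _ hρ => .tail (ih₁ hρ)
  | eq_corec _ _ _ _ _ ih₁ ih₂ ih₃ ih₄ ih₅ =>
    exact fun _ _ hρ => .corec (ih₁ hρ) (fun _ _ ha => ih₂ (hρ.bind ha))
      (fun _ _ ha => ih₃ (hρ.bind ha)) (fun _ _ ha => ih₄ (hρ.bind ha)) (ih₅ hρ)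
  | head_corec _ _ _ _ _ ih₁ ih₂ ih₃ ih₄ ih₅ =>
    exact fun _ _ hρ => .head_corec (ih₁ hρ) (fun _ _ ha => ih₂ (hρ.bind ha))
      (fun _ _ ha => ih₃ (hρ.bind ha)) (fun _ _ ha => ih₄ (hρ.bind ha)) (ih₅ hρ)
  | tail_corec _ _ _ _ _ ih₁ ih₂ ih₃ ih₄ ih₅ =>
    exact fun _ _ hρ => .tail_corec (ih₁ hρ) (fun _ _ ha => ih₂ (hρ.bind ha))
      (fun _ _ ha => ih₃ (hρ.bind ha)) (fun _ _ ha => ih₄ (hρ.bind ha)) (ih₅ hρ)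
  | extn _ _ ih₁ ih₂ => exact fun _ _ hρ => .extn (ih₁ hρ) (ih₂ hρ)
  | idE _ ih₁ => exact fun _ _ hρ => .idE (ih₁ hρ)
  | compE _ _ _ _ _ ih₁ ih₂ ih₃ ih₄ ih₅ =>
    exact fun _ _ hρ => .compE (ih₁ hρ) (ih₂ hρ) (ih₃ hρ) (ih₄ hρ) (ih₅ hρ)
  | eq_extn _ _ ih₁ ih₂ => exact fun _ _ hρ => .extn (ih₁ hρ) (ih₂ hρ)
  | eq_idE _ ih₁ => exact fun _ _ hρ => .idE (ih₁ hρ)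
  | eq_compE _ _ _ _ _ ih₁ ih₂ ih₃ ih₄ ih₅ =>
    exact fun _ _ hρ => .compE (ih₁ hρ) (ih₂ hρ) (ih₃ hρ) (ih₄ hρ) (ih₅ hρ)
  | compE_id_left _ _ _ ih₁ ih₂ ih₃ => exact fun _ _ hρ => .compE_id_left (ih₁ hρ) (ih₂ hρ) (ih₃ hρ)
  | compE_id_right _ _ _ ih₁ ih₂ ih₃ =>
    exact fun _ _ hρ => .compE_id_right (ih₁ hρ) (ih₂ hρ) (ih₃ hρ)
  | compE_assoc _ _ _ _ _ _ _ ih₁ ih₂ ih₃ ih₄ ih₅ ih₆ ih₇ =>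
    exact fun _ _ hρ => .compE_assoc (ih₁ hρ) (ih₂ hρ) (ih₃ hρ) (ih₄ hρ) (ih₅ hρ) (ih₆ hρ) (ih₇ hρ)
  | K _ ih₁ => exact fun _ _ hρ => .K (ih₁ hρ)
  | Kinf _ ih₁ => exact fun _ _ hρ => .Kinf (ih₁ hρ)
  | restrict _ _ _ _ ih₁ ih₂ ih₃ ih₄ =>
    exact fun _ _ hρ => .restrict (ih₁ hρ) (ih₂ hρ) (ih₃ hρ) (ih₄ hρ)
  | eq_K _ ih₁ => exact fun _ _ hρ => .K (ih₁ hρ)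
  | eq_Kinf _ ih₁ => exact fun _ _ hρ => .Kinf (ih₁ hρ)
  | eq_restrict _ _ _ _ ih₁ ih₂ ih₃ ih₄ =>
    exact fun _ _ hρ => .restrict (ih₁ hρ) (ih₂ hρ) (ih₃ hρ) (ih₄ hρ)
  | restrict_id _ _ ih₁ ih₂ => exact fun _ _ hρ => .restrict_id (ih₁ hρ) (ih₂ hρ)
  | restrict_comp _ _ _ _ _ _ ih₁ ih₂ ih₃ ih₄ ih₅ ih₆ =>
    exact fun _ _ hρ => .restrict_comp (ih₁ hρ) (ih₂ hρ) (ih₃ hρ) (ih₄ hρ) (ih₅ hρ) (ih₆ hρ)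
  | top => exact fun Δ _ _ => .of_prop (M.top Δ) rfl rfl
  | bot => exact fun Δ _ _ => .of_prop (M.bot Δ) rfl rfl
  | and _ _ ih₁ ih₂ => exact fun _ _ hρ => .and (ih₁ hρ) (ih₂ hρ)
  | or _ _ ih₁ ih₂ => exact fun _ _ hρ => .or (ih₁ hρ) (ih₂ hρ)
  | imp _ _ ih₁ ih₂ => exact fun _ _ hρ => .imp (ih₁ hρ) (ih₂ hρ)
  | all _ _ ih₁ ih₂ => exact fun _ _ hρ => .all (ih₁ hρ) (fun _ _ ha => ih₂ (hρ.bind ha))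
  | ex _ _ ih₁ ih₂ => exact fun _ _ hρ => .ex (ih₁ hρ) (fun _ _ ha => ih₂ (hρ.bind ha))
  | mu _ _ _ _ ih₂ ih₃ => exact fun _ _ hρ => .mu hρ (ih₂ hρ.pvar) ih₃
  | nu _ _ _ _ ih₂ ih₃ => exact fun _ _ hρ => .nu hρ (ih₂ hρ.pvar) ih₃
  | eq_and _ _ ih₁ ih₂ => exact fun _ _ hρ => .and (ih₁ hρ) (ih₂ hρ)
  | eq_or _ _ ih₁ ih₂ => exact fun _ _ hρ => .or (ih₁ hρ) (ih₂ hρ)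
  | eq_imp _ _ ih₁ ih₂ => exact fun _ _ hρ => .imp (ih₁ hρ) (ih₂ hρ)
  | eq_all _ _ ih₁ ih₂ => exact fun _ _ hρ => .all (ih₁ hρ) (fun _ _ ha => ih₂ (hρ.bind ha))
  | eq_ex _ _ ih₁ ih₂ => exact fun _ _ hρ => .ex (ih₁ hρ) (fun _ _ ha => ih₂ (hρ.bind ha))
  | eq_mu _ _ ih₁ ih₂ => exact fun _ _ hρ => .mu hρ (ih₁ hρ.pvar) ih₂
  | eq_nu _ _ ih₁ ih₂ => exact fun _ _ hρ => .nu hρ (ih₁ hρ.pvar) ih₂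
  | irrel _ _ _ ih₁ ih₂ ih₃ => exact fun _ _ hρ => .irrel (ih₁ hρ) (ih₂ hρ) (ih₃ hρ)
  | topI => exact fun _ _ _ => .topI
  | botE _ _ ih₁ ih₂ => exact fun _ _ hρ => .botE (ih₁ hρ) (ih₂ hρ)
  | andI _ _ _ _ ih₁ ih₂ ih₃ ih₄ => exact fun _ _ hρ => .andI (ih₁ hρ) (ih₂ hρ) (ih₃ hρ) (ih₄ hρ)
  | andE₁ _ _ _ ih₁ ih₂ ih₃ => exact fun _ _ hρ => .andE₁ (ih₁ hρ) (ih₂ hρ) (ih₃ hρ)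
  | andE₂ _ _ _ ih₁ ih₂ ih₃ => exact fun _ _ hρ => .andE₂ (ih₁ hρ) (ih₂ hρ) (ih₃ hρ)
  | orI₁ _ _ _ ih₁ ih₂ ih₃ => exact fun _ _ hρ => .orI₁ (ih₁ hρ) (ih₂ hρ) (ih₃ hρ)
  | orI₂ _ _ _ ih₁ ih₂ ih₃ => exact fun _ _ hρ => .orI₂ (ih₁ hρ) (ih₂ hρ) (ih₃ hρ)
  | orE _ _ _ _ _ _ ih₁ ih₂ ih₃ ih₄ ih₅ ih₆ =>
    exact fun _ _ hρ => .orE (ih₁ hρ) (ih₂ hρ) (ih₃ hρ) (ih₄ hρ) (fun _ ha => ih₅ (hρ.hyp ha))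
      (fun _ ha => ih₆ (hρ.hyp ha))
  | impI _ _ _ ih₁ ih₂ ih₃ =>
    exact fun _ _ hρ => .impI (ih₁ hρ) (ih₂ hρ) (fun _ ha => ih₃ (hρ.hyp ha))
  | impE _ _ _ _ ih₁ ih₂ ih₃ ih₄ => exact fun _ _ hρ => .impE (ih₁ hρ) (ih₂ hρ) (ih₃ hρ) (ih₄ hρ)
  | allI _ _ _ ih₁ ih₂ ih₃ =>
    exact fun _ _ hρ => .allI (ih₁ hρ) (fun _ _ ha => ih₂ (hρ.bind ha))
      (fun _ _ ha => ih₃ (hρ.bind ha))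
  | allE _ _ _ _ ih₁ ih₂ ih₃ ih₄ =>
    exact fun _ _ hρ => .allE (ih₁ hρ) (fun _ _ ha => ih₂ (hρ.bind ha)) (ih₃ hρ) (ih₄ hρ)
  | exI _ _ _ _ ih₁ ih₂ ih₃ ih₄ =>
    exact fun _ _ hρ => .exI (ih₁ hρ) (fun _ _ ha => ih₂ (hρ.bind ha)) (ih₃ hρ) (ih₄ hρ)
  | exE _ _ _ _ _ ih₁ ih₂ ih₃ ih₄ ih₅ =>
    exact fun _ _ hρ => .exE (ih₁ hρ) (fun _ _ ha => ih₂ (hρ.bind ha)) (ih₃ hρ) (ih₄ hρ)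
      (fun _ ha _ hb => ih₅ ((hρ.bind ha).hyp hb))
  | fold _ _ _ _ ih₂ ih₃ => exact fun _ _ hρ => .fold hρ (ih₂ hρ.pvar) ih₃
  | unfold _ _ _ _ ih₂ ih₃ => exact fun _ _ hρ => .unfold hρ (ih₂ hρ.pvar) ih₃
  | out _ _ _ _ ih₂ ih₃ => exact fun _ _ hρ => .out hρ (ih₂ hρ.pvar) ih₃
  | into _ _ _ _ ih₂ ih₃ => exact fun _ _ hρ => .into hρ (ih₂ hρ.pvar) ih₃

/-- A closed proof of `⊥` is a global section of `⟦⊥⟧`. -/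
theorem consistent_of_botUninhabited (h : M.BotUninhabited) : Consistent := by
  rintro ⟨r, hr⟩
  obtain ⟨x⟩ := (sound M hr (Δ := M.one) (ρ := []) rfl).holds (X := M.bot M.one) rfl
  exact h.elim x

end Sem

/-! ## A model in sets

Contexts are sets and types are families of sets.  A proposition is a truth value, the knowledge
universes consist of the codes `Know`, and every computational type is a singleton.  Hence
every context of computational variables has a point, also one with hypothetical equations between
types of a universe or between their elements. -/

namespace Sets

/-- Codes of the sets in the knowledge universes. -/
inductive Know : Type
  | unit
  | prop
  | univ
  | prf (P : Prop)

/-- The set with a given code. -/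
def Know.El : Know → Type
  | unit => Unit
  | prop => Prop
  | univ => Know
  | prf P => PLift P

/-- The interpretation of the universes. -/
def srt : Srt → Type
  | .uc _ => Unit
  | .tyL _ => Know
  | .prop => Prop

/-- The set given by an element of a universe. -/
def elS : (s : Srt) → srt s → Type
  | .uc _, _ => Unit
  | .tyL _, k => k.El
  | .prop, P => PLift P

/-- The universes as elements of the next one. -/
def univS : (s : Srt) → srt s.next
  | .uc _ => ()
  | .tyL _ => Know.univ
  | .prop => Know.prop

theorem elS_univS (s : Srt) : elS s.next (univS s) = srt s := by
  cases s <;> rfl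

theorem know_ne_unit : Know ≠ Unit := fun h => by
  have : Subsingleton Know := h ▸ inferInstance
  exact Know.noConfusion (Subsingleton.elim Know.unit Know.prop)

theorem prop_ne_unit : Prop ≠ Unit := fun h => by
  have : Subsingleton Prop := h ▸ inferInstance
  exact true_ne_false (Subsingleton.elim True False)

theorem know_ne_prop : Know ≠ Prop := fun h => by
  have key : ∀ a b c : Know, a = b ∨ b = c ∨ a = c := by
    rw [h]
    intro a b c
    by_cases ha : a <;> by_cases hb : b <;> by_cases hc : c <;> simp [ha, hb, hc]
  rcases key .unit .prop .univ with h | h | h <;> exact Know.noConfusion h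

theorem elS_congr : ∀ {s s' : Srt} {x : srt s} {y : srt s'}, x ≍ y → elS s x = elS s' y
  | .uc _, .uc _, _, _, _ => rfl
  | .tyL _, .tyL _, _, _, h => congrArg Know.El (eq_of_heq h)
  | .prop, .prop, _, _, h => congrArg PLift (eq_of_heq h)
  | .uc _, .tyL _, _, _, h => (know_ne_unit (type_eq_of_heq h).symm).elim
  | .tyL _, .uc _, _, _, h => (know_ne_unit (type_eq_of_heq h)).elim
  | .uc _, .prop, _, _, h => (prop_ne_unit (type_eq_of_heq h).symm).elim
  | .prop, .uc _, _, _, h => (prop_ne_unit (type_eq_of_heq h)).elim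
  | .tyL _, .prop, _, _, h => (know_ne_prop (type_eq_of_heq h)).elim
  | .prop, .tyL _, _, _, h => (know_ne_prop (type_eq_of_heq h).symm).elim

/-- Sets, families of sets and their sections. -/
abbrev cwf : CwF.{1, 0, 1} Type where
  one := Unit
  bang _ := TypeCat.ofHom fun _ => ()
  bang_uniq _ := ConcreteCategory.hom_ext _ _ fun _ => rfl
  Ty Γ := Γ → Type
  Tm Γ := Σ A : Γ → Type, ∀ γ, A γ
  typ t := t.1
  subTy σ A δ := A (σ δ)
  subTm σ t := ⟨fun δ => t.1 (σ δ), fun δ => t.2 (σ δ)⟩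
  subTy_id _ := rfl
  subTy_comp _ _ _ := rfl
  subTm_id _ := rfl
  subTm_comp _ _ _ := rfl
  typ_sub _ _ := rfl
  sort s _ _ := srt s
  sort_sub _ _ := rfl

variable {Γ Δ : Type}

/-- The section of a family given by a term. -/
def sec {A : cwf.Ty Γ} (t : cwf.Elt Γ A) (γ : Γ) : A γ := cast (congrFun t.ty γ) (t.tm.2 γ)

/-- The term given by a section of a family. -/
def ofSec {A : cwf.Ty Γ} (f : ∀ γ, A γ) : cwf.Elt Γ A := ⟨⟨A, f⟩, rfl⟩

/-- Terms are the sections of their types. -/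
def secEquiv (A : cwf.Ty Γ) : cwf.Elt Γ A ≃ ((γ : Γ) → A γ) where
  toFun t := sec t
  invFun f := ofSec f
  left_inv t := by obtain ⟨⟨B, f⟩, rfl⟩ := t; rfl
  right_inv _ := rfl

theorem sec_heq {A : cwf.Ty Γ} (t : cwf.Elt Γ A) (γ : Γ) : sec t γ ≍ t.tm.2 γ := cast_heq _ _

theorem tm_heq {t t' : cwf.Tm Γ} (h : t = t') (γ : Γ) : t.2 γ ≍ t'.2 γ := by
  subst h; rfl

theorem elt_subsingleton {A : cwf.Ty Γ} (h : ∀ γ, Subsingleton (A γ)) :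
    Subsingleton (cwf.Elt Γ A) :=
  (secEquiv A).injective.subsingleton

/-- The sets given by the elements of the universes. -/
abbrev cwfU : CwFU.{1, 0, 1} Type where
  toCwF := cwf
  El {s _} a γ := elS s (sec a γ)
  El_sub _ _ := rfl
  El_congr a b h := funext fun γ =>
    elS_congr ((sec_heq a γ).trans ((tm_heq h γ).trans (sec_heq b γ).symm))
  univ s _ := ofSec fun _ => univS s
  univ_sub := by intros; rfl
  El_univ s _ := funext fun _ => elS_univS s
  incl P := ofSec fun γ => Know.prf (sec P γ)
  incl_sub _ _ := rfl
  El_incl _ := rfl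

/-- Context extension is the total space. -/
abbrev cwfE : CwFE.{1, 0, 1} Type where
  toCwFU := cwfU
  ext Γ e := Σ γ : Γ, e.ty γ
  p _ := TypeCat.ofHom Sigma.fst
  q _ := ofSec Sigma.snd
  pair σ _ t := TypeCat.ofHom fun δ => ⟨σ δ, sec t δ⟩
  pair_p _ _ _ := rfl
  pair_q _ _ t := congrArg CwF.Elt.tm ((secEquiv _).left_inv t)
  pair_uniq _ _ h h' := ConcreteCategory.hom_ext _ _ fun δ =>
    Sigma.ext (ConcreteCategory.congr_hom h δ) (tm_heq h' δ)

/-! Computational types are singletons. -/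

instance {i : ℕ} (a : cwf.Code (.uc i) Γ) : Subsingleton (cwfU.Val a) :=
  elt_subsingleton fun _ => inferInstanceAs (Subsingleton Unit)

/-- The code of the singleton. -/
def one {i : ℕ} : cwf.Code (.uc i) Γ := ofSec fun _ => ()

/-- The element of a computational type. -/
def pt {i : ℕ} (a : cwf.Code (.uc i) Γ) : cwfU.Val a := ofSec fun _ => ()

theorem tm_eq {t t' : cwf.Tm Γ} (h : t.1 = fun _ => Unit) (h' : t'.1 = fun _ => Unit) : t = t' := by
  obtain ⟨A, f⟩ := t
  obtain ⟨B, g⟩ := t'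
  cases h; cases h'
  exact congrArg (Sigma.mk _) (funext fun _ => Subsingleton.elim (α := Unit) _ _)

theorem tm_eq_sub {i j : ℕ} {a : cwf.Code (.uc i) Γ} {b : cwf.Code (.uc j) Δ} (σ : Δ ⟶ Γ)
    (x : cwfU.Val a) (y : cwfU.Val b) : cwf.subTm σ x.tm = y.tm :=
  tm_eq (congrArg (cwf.subTy σ) x.ty) y.ty

abbrev cwfPi : CwFPi.{1, 0, 1} Type where
  toCwFE := cwfE
  pi _ _ := one
  pi_sub _ _ _ := rfl
  lam := ⟨fun _ => pt _, fun _ => pt _, fun _ => Subsingleton.elim _ _, fun _ => Subsingleton.elim _ _⟩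
  lam_sub := by intros; rfl
  sig _ _ := one
  sig_sub _ _ _ := rfl
  pr := ⟨fun _ => pt _, fun _ => ⟨pt _, pt _⟩,
    fun _ => Sigma.ext (Subsingleton.elim _ _) (by
      refine (Subsingleton.helim ?_ _ _); rw [Subsingleton.elim (pt _)]), fun _ => Subsingleton.elim _ _⟩
  pr_sub := by intros; rfl
  idt _ _ := one
  idt_sub := by intros; rfl
  refl _ := pt _
  refl_sub := by intros; rfl

abbrev cwfJ : CwFJ.{1, 0, 1} Type where
  toCwFPi := cwfPi
  J _ _ _ _ _ := pt _
  J_refl _ d _ := (tm_eq_sub _ d (pt _)).symm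
  J_sub := by intros; rfl

abbrev cwfTrace : CwFTrace.{1, 0, 1} Type where
  toCwFJ := cwfJ
  state _ := one
  state_sub _ := rfl
  event _ := one
  event_sub _ := rfl
  nat _ := one
  nat_sub _ := rfl
  trans _ _ _ := one
  trans_sub _ _ _ _ := rfl
  fin _ := one
  fin_sub _ := rfl
  nil _ := pt _
  nil_sub _ _ := rfl
  step _ _ _ := pt _
  step_sub _ _ _ _ := rfl
  inf _ := one
  inf_sub _ := rfl
  head _ := pt _
  head_sub _ _ := rfl
  tail _ := pt _
  tail_sub _ _ := rfl
  corec _ _ _ _ := pt _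
  corec_sub := by intros; rfl
  head_corec _ _ _ _ := Subsingleton.elim _ _
  tail_corec _ _ _ _ := Subsingleton.elim _ _
  extn _ _ := one
  extn_sub _ _ _ := rfl
  idE _ := pt _
  idE_sub _ _ := rfl
  compE _ _ := pt _
  compE_sub := by intros; rfl
  id_compE _ := Subsingleton.elim _ _
  compE_id _ := Subsingleton.elim _ _
  compE_assoc _ _ _ := rfl

/-! The knowledge and propositional layers. -/

instance {P : cwf.Code .prop Γ} : Subsingleton (cwfU.Val P) :=
  elt_subsingleton fun γ => (⟨fun ⟨_⟩ ⟨_⟩ => rfl⟩ : Subsingleton (PLift (sec P γ : Prop)))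

/-- The singleton as a knowledge fibre. -/
def fibre : cwf.Code (.tyL 0) Γ := ofSec fun _ => Know.unit

instance : Subsingleton (cwfU.Val (fibre (Γ := Γ))) :=
  elt_subsingleton fun _ => inferInstanceAs (Subsingleton Unit)

abbrev cwfK : CwFK.{1, 0, 1} Type where
  toCwFTrace := cwfTrace
  K _ := fibre
  K_sub _ _ := rfl
  Kinf _ := fibre
  Kinf_sub _ _ := rfl
  restrict _ _ := ofSec fun _ => ()
  restrict_sub := by intros; rfl
  restrict_id {Γ _} _ := Subsingleton.elim (α := cwfU.Val (fibre (Γ := Γ))) _ _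
  restrict_comp _ _ _ := rfl

theorem holds_iff {P : cwf.Code .prop Γ} : CwFE.Holds (M := cwfE) P ↔ ∀ γ, sec P γ :=
  ⟨fun ⟨x⟩ γ => (sec x γ : PLift _).down, fun h => ⟨ofSec fun γ => PLift.up (h γ)⟩⟩

theorem entails_iff {P Q : cwf.Code .prop Γ} :
    CwFE.Entails (M := cwfE) P Q ↔ ∀ γ, sec P γ → sec Q γ :=
  holds_iff.trans ⟨fun h γ x => h ⟨γ, PLift.up x⟩, fun h z => h z.1 (z.2 : PLift _).down⟩

/-- The proposition given by a family of truth values. -/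
def ofPred (P : Γ → Prop) : cwf.Code .prop Γ := ofSec P

abbrev cwfProp : CwFProp.{1, 0, 1} Type where
  toCwFK := cwfK
  irrel _ _ := Subsingleton.elim _ _
  top _ := ofPred fun _ => True
  top_sub _ := rfl
  bot _ := ofPred fun _ => False
  bot_sub _ := rfl
  and P Q := ofPred fun γ => sec P γ ∧ sec Q γ
  and_sub _ _ _ := rfl
  or P Q := ofPred fun γ => sec P γ ∨ sec Q γ
  or_sub _ _ _ := rfl
  imp P Q := ofPred fun γ => sec P γ → sec Q γ
  imp_sub _ _ _ := rfl
  all a P := ofPred fun γ => ∀ x : cwfU.El a γ, sec P ⟨γ, x⟩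
  all_sub _ _ _ := rfl
  ex a P := ofPred fun γ => ∃ x : cwfU.El a γ, sec P ⟨γ, x⟩
  ex_sub _ _ _ := rfl
  holds_top _ := holds_iff.2 fun _ => trivial
  bot_entails _ := entails_iff.2 fun _ => False.elim
  holds_and _ _ := by
    rw [holds_iff, holds_iff, holds_iff]
    exact forall_and
  or_entails _ _ _ := by
    rw [entails_iff, entails_iff, entails_iff]
    exact ⟨fun h => ⟨fun γ hP => h γ (.inl hP), fun γ hQ => h γ (.inr hQ)⟩,
      fun h γ => Or.rec (h.1 γ) (h.2 γ)⟩
  holds_imp _ _ := holds_iff.trans entails_iff.symm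
  holds_all _ _ := by
    rw [holds_iff, holds_iff]
    exact ⟨fun h z => h z.1 z.2, fun h γ x => h ⟨γ, x⟩⟩
  ex_entails _ _ _ := by
    rw [entails_iff, entails_iff]
    exact ⟨fun h z hz => h z.1 ⟨z.2, hz⟩, fun h γ ⟨x, hx⟩ => h ⟨γ, x⟩ hx⟩

/-- A monotone formula is a monotone map on truth values. -/
theorem monotone_apply {φ : cwf.Code .prop (CwFE.consProp cwfE Γ)}
    (h : CwFProp.Monotone (M := cwfProp) φ) (γ : Γ) {X Y : Prop} (hXY : X → Y)
    (hX : sec φ ⟨γ, X⟩) : sec φ ⟨γ, Y⟩ :=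
  holds_iff.1 (h (Δ := Unit) (TypeCat.ofHom fun _ => γ) (ofPred fun _ => X) (ofPred fun _ => Y)
    (holds_iff.2 fun _ => hXY)) () hX

/-- The model given by sets, families of sets and truth values. -/
abbrev model : Model.{1, 0, 1} Type where
  toCwFProp := cwfProp
  mu φ _ := ofPred fun γ => ∀ X : Prop, (sec φ ⟨γ, X⟩ → X) → X
  mu_sub _ _ _ _ := rfl
  fold φ h := holds_iff.2 fun γ (k : sec φ ⟨γ, _⟩) _ hX =>
    hX (monotone_apply h γ (fun m => m _ hX) k)
  unfold _ h := holds_iff.2 fun γ k => k _ (monotone_apply h γ fun m _ hX =>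
    hX (monotone_apply h γ (fun m => m _ hX) m))
  nu φ _ := ofPred fun γ => ∃ X : Prop, (X → sec φ ⟨γ, X⟩) ∧ X
  nu_sub _ _ _ _ := rfl
  out _ h := holds_iff.2 fun γ ⟨_, hX, x⟩ => monotone_apply h γ (fun x => ⟨_, hX, x⟩) (hX x)
  into _ h := holds_iff.2 fun γ k => ⟨_, monotone_apply h γ fun ⟨_, hX, x⟩ =>
    monotone_apply h γ (fun x => ⟨_, hX, x⟩) (hX x), k⟩

end Sets

namespace Sets

/-- The model `Sets.model` is a model in sets. -/
def setModel : SetModel where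
  model := model
  fam A := A
  fam_sub _ _ _ := rfl
  sec := secEquiv
  sec_sub σ _ t t' h δ := (sec_heq t' δ).trans ((tm_heq h δ).trans (sec_heq t (σ δ)).symm)
  tot _ := Equiv.refl _
  tot_p _ _ := rfl
  tot_q _ _ := HEq.rfl
  omega _ := secEquiv fun _ => Prop
  omega_sub _ _ := rfl
  mem_omega _ _ := ⟨fun h => ⟨PLift.up h⟩, fun ⟨h⟩ => h.down⟩
  omega_bot _ := rfl

theorem model_botUninhabited : model.BotUninhabited :=
  ⟨fun x => (sec x () : PLift False).down⟩

/-- A context of computational variables has a point in the model. -/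
theorem exists_sat {Γ : Ctx} (h : CompCtx Γ) : ∃ ρ : Sem.Env model Unit, Sem.Sat Γ ρ := by
  induction h with
  | nil => exact ⟨[], rfl⟩
  | cons _ hA ih =>
    obtain ⟨ρ, hρ⟩ := ih
    obtain ⟨a, ha⟩ := (Sem.sound model hA hρ).uc
    exact ⟨_, hρ.cons ha.1 (pt a)⟩

/-- There is no proof of `⊥` in a context of computational variables. -/
theorem not_der_bot {Γ : Ctx} {t : Tm} (h : CompCtx Γ) : ¬ Der (.tm Γ t .bot) := fun ht => by
  obtain ⟨ρ, hρ⟩ := exists_sat h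
  obtain ⟨x⟩ := (Sem.sound model ht hρ).holds (X := model.bot Unit) rfl
  exact (sec x () : PLift False).down

end Sets
end NMDEKL

/-- A model whose `⊥` is uninhabited makes the system consistent; in particular so does the
syntactic model. There is such a model in sets. Hence the system is consistent, and if `⊥` has a
proof in a computational context then the system is inconsistent. -/
theorem mainTheorem4 :
    (∀ (C : Type u) [Category.{v} C] (M : NMDEKL.Model.{u, v, w} C),
      M.BotUninhabited → NMDEKL.Consistent) ∧
    (NMDEKL.Syn.model.BotUninhabited → NMDEKL.Consistent) ∧
    (∃ S : NMDEKL.SetModel, S.model.BotUninhabited) ∧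
    NMDEKL.Consistent ∧
    (∀ (Γ : NMDEKL.Ctx) (t : NMDEKL.Tm), NMDEKL.CompCtx Γ → NMDEKL.Der (.tm Γ t .bot) →
      ¬ NMDEKL.Consistent) :=
  ⟨fun _ _ _ h => NMDEKL.Sem.consistent_of_botUninhabited h,
    NMDEKL.Sem.consistent_of_botUninhabited,
    ⟨NMDEKL.Sets.setModel, NMDEKL.Sets.model_botUninhabited⟩,
    NMDEKL.Sem.consistent_of_botUninhabited NMDEKL.Sets.model_botUninhabited,
    fun _ _ h ht => (NMDEKL.Sets.not_der_bot h ht).elim⟩
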